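/- **Machine model.** Algorithms are deterministic unit-cost RAM programs with integer words of $O(\log N)$ bits ($N$ = input length; operations $+,-,\times$, integer division and remainder, bitwise operations, comparison, indirect addressing) and cells holding real numbers (operations $+,-,\times,/$, comparison, conversion of words to reals, indirect addressing; no rounding). Everything below holds for each of two conventions on real arithmetic, the same one being used in the hypotheses and in the conclusions: (i) the unrestricted Real RAM; (ii) the Real RAM without abuse of unlimited precision: whenever all real inputs are fractions with numerator and denominator at most $H$ in absolute value, all computed reals are fractions with numerator and denominator at most $(N+H+2)^{O(1)}$. (On inputs without reals, such as graphs, (ii) is a word RAM.) **Problem.** For non-empty finite sets $A,B\subset\mathbb R^d$ let $\vec\delta(A,B)=\max_{p\in A}\min_{q\in B}\|p-q\|_\infty$ and $\delta_H(A,B)=\max\{\vec\delta(A,B),\vec\delta(B,A)\}$. Undirected Hausdorff distance under translation (uHuT) in $d$-D: given $P,Q\subset\mathbb R^d$ with $|P|=n\ge1$, $|Q|=m\ge1$ and a real $\delta>0$, decide whether some $\tau\in\mathbb R^d$ satisfies $\delta_H(P+\tau,Q)\le\delta$. **Combinatorial algorithms.** As there is no formal definition of "combinatorial algorithm", the result is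 stated for every class $\mathcal C$ of programs that is closed under elementary reductions, in the following sense. An elementary reduction from a decision problem $X$ to a decision problem $Y$ (inputs are lists of polynomially bounded integer words and lists of reals) maps each instance $x$ to finitely many instances $y_0,\dots,y_{r(x)-1}$ of $Y$ that are all equivalent to $x$, where $r(x)$, the two input lengths of each $y_s$ and each single input cell of $y_s$ are given by fixed expressions (arithmetic, comparisons, look-ups of cells of $x$) in $x$, $s$ and the position of the cell. Closedness: if $p\in\mathcal C$ solves $Y$, each $y_s$ has size at most $L(x)$, and for every $x$ the program $p$ decides some $y_s$ within $T(x)$ steps, $T$ polynomially bounded, then some program in $\mathcal C$ solves $X$ in time $O(|x|+r(x)(L(x)+T(x)))$ (write down the instances and run $p$ on them in parallel until the first run halts). **Hypotheses.** Let $\omega$ be the matrix multiplication exponent. * Combinatorial $k$-clique hypothesis for $\mathcal C$: for all $k\ge3$, $\varepsilon'>0$, no program in $\mathcal C$ decides whether a graph on $v$ vertices has a $k$-clique in time $O(v^{k-\varepsilon'})$. * $k$-clique hypothesis: for all $k\ge3$, $\varepsilon'>0$, no program does so in time $O(v^{\omega k/3-\varepsilon'})$. * $k$-hyperclique hypothesis: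 for all $k>3$, $\varepsilon'>0$, no program decides in time $O(v^{k-\varepsilon'})$ whether a 3-uniform hypergraph on $v$ vertices has a set of $k$ vertices all of whose 3-element subsets are hyperedges. **Theorem.** Let $d\ge2$ be an integer, $\varepsilon>0$, $\lambda\in(0,1]$, and let $0<a\le1$, $a<b$ be any constants. Consider algorithms that solve uHuT in $d$-D, and their running time on the instances with $\min(n,m)=\Theta(\max(n,m)^\lambda)$, precisely $a\max(n,m)^\lambda\le\min(n,m)\le b\max(n,m)^\lambda$. 1. For every class $\mathcal C$ closed under elementary reductions: under the combinatorial $k$-clique hypothesis for $\mathcal C$, no algorithm in $\mathcal C$ takes time $O((nm)^{d/2-\varepsilon})$ on these instances. 2. Under the $k$-clique hypothesis, no algorithm takes time $O((nm)^{d\omega/6-\varepsilon})$ on these instances. 3. Under the $k$-hyperclique hypothesis, no algorithm takes time $O\big((nm)^{\lfloor d/2\rfloor\frac{\lambda+3}{3\lambda+3}-\varepsilon}\big)$ on these instances. 4. If $d=3$ and $\lambda\le1/2$, then under the $k$-hyperclique hypothesis no algorithm takes time $O((nm)^{3/2-\varepsilon})$ on these instances. -/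

import Mathlib

namespace FineGrained

noncomputable section

/-! ## The machine: a RAM with integer words and real cells (unit cost) -/

/-- Memory of the machine: directly addressed word and real registers, and indirectly addressed
word and real memories. -/
structure Memory where
  wreg : ℕ → ℤ
  rreg : ℕ → ℝ
  wmem : ℕ → ℤ
  rmem : ℕ → ℝ

/-- Unit-cost operations on words. Division and remainder by zero are the total ones of `ℤ`. -/
inductive WordOp
  | add | sub | mul | div | mod | and | or | xor

def WordOp.eval : WordOp → ℤ → ℤ → ℤ
  | .add, x, y => x + y
  | .sub, x, y => x - y
  | .mul, x, y => x * y
  | .div, x, y => x / y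
  | .mod, x, y => x % y
  | .and, x, y => Int.land x y
  | .or, x, y => Int.lor x y
  | .xor, x, y => Int.xor x y

/-- Unit-cost operations on reals (no rounding to words). -/
inductive RealOp
  | add | sub | mul | div

def RealOp.eval : RealOp → ℝ → ℝ → ℝ
  | .add, x, y => x + y
  | .sub, x, y => x - y
  | .mul, x, y => x * y
  | .div, x, y => x / y

inductive Instr
  /-- `wreg i := z` -/
  | const (i : ℕ) (z : ℤ)
  /-- `wreg i := wreg j ∘ wreg k` -/
  | wop (o : WordOp) (i j k : ℕ)
  /-- `wreg i := wmem[wreg j]` -/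
  | wload (i j : ℕ)
  /-- `wmem[wreg i] := wreg j` -/
  | wstore (i j : ℕ)
  /-- `rreg i := wreg j` -/
  | cast (i j : ℕ)
  /-- `rreg i := rreg j ∘ rreg k` -/
  | rop (o : RealOp) (i j k : ℕ)
  /-- `rreg i := rmem[wreg j]` -/
  | rload (i j : ℕ)
  /-- `rmem[wreg i] := rreg j` -/
  | rstore (i j : ℕ)

/-- The effect of an instruction. -/
def Instr.next : Instr → Memory → Memory
  | .const i z, σ => { σ with wreg := Function.update σ.wreg i z }
  | .wop o i j k, σ => { σ with wreg := Function.update σ.wreg i (o.eval (σ.wreg j) (σ.wreg k)) }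
  | .wload i j, σ => { σ with wreg := Function.update σ.wreg i (σ.wmem (σ.wreg j).toNat) }
  | .wstore i j, σ => { σ with wmem := Function.update σ.wmem (σ.wreg i).toNat (σ.wreg j) }
  | .cast i j, σ => { σ with rreg := Function.update σ.rreg i (σ.wreg j : ℝ) }
  | .rop o i j k, σ => { σ with rreg := Function.update σ.rreg i (o.eval (σ.rreg j) (σ.rreg k)) }
  | .rload i j, σ => { σ with rreg := Function.update σ.rreg i (σ.rmem (σ.wreg j).toNat) }
  | .rstore i j, σ => { σ with rmem := Function.update σ.rmem (σ.wreg i).toNat (σ.rreg j) }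

/-- A newly computed word must have absolute value at most `W` (the word size), and a newly
computed real must lie in `A` (the set of reals the machine can represent). Otherwise the machine
is stuck. -/
def Instr.Ok (W : ℕ) (A : Set ℝ) : Instr → Memory → Prop
  | .const _ z, _ => |z| ≤ W
  | .wop o _ j k, σ => |o.eval (σ.wreg j) (σ.wreg k)| ≤ W
  | .cast _ j, σ => (σ.wreg j : ℝ) ∈ A
  | .rop o _ j k, σ => o.eval (σ.rreg j) (σ.rreg k) ∈ A
  | _, _ => True

/-- Tests: `wreg i ≤ wreg j` and `rreg i ≤ rreg j`. -/
inductive Test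
  | wle (i j : ℕ)
  | rle (i j : ℕ)

def Test.Holds : Test → Memory → Prop
  | .wle i j, σ => σ.wreg i ≤ σ.wreg j
  | .rle i j, σ => σ.rreg i ≤ σ.rreg j

/-- Programs. -/
inductive Prog
  | skip
  | instr (a : Instr)
  | seq (p q : Prog)
  | ite (c : Test) (p q : Prog)
  | while (c : Test) (p : Prog)

/-- `Exec W A p σ t σ'`: started in `σ`, the program `p` halts in `σ'` after exactly `t` steps. -/
inductive Exec (W : ℕ) (A : Set ℝ) : Prog → Memory → ℕ → Memory → Prop
  | skip (σ : Memory) : Exec W A .skip σ 1 σ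
  | instr (a : Instr) (σ : Memory) (h : a.Ok W A σ) : Exec W A (.instr a) σ 1 (a.next σ)
  | seq {p q : Prog} {σ σ₁ σ₂ : Memory} {t₁ t₂ : ℕ} (h₁ : Exec W A p σ t₁ σ₁)
      (h₂ : Exec W A q σ₁ t₂ σ₂) : Exec W A (.seq p q) σ (t₁ + t₂) σ₂
  | ite_true {c : Test} {p q : Prog} {σ σ₁ : Memory} {t : ℕ} (hc : c.Holds σ)
      (h : Exec W A p σ t σ₁) : Exec W A (.ite c p q) σ (1 + t) σ₁
  | ite_false {c : Test} {p q : Prog} {σ σ₁ : Memory} {t : ℕ} (hc : ¬ c.Holds σ)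
      (h : Exec W A q σ t σ₁) : Exec W A (.ite c p q) σ (1 + t) σ₁
  | while_false {c : Test} {p : Prog} {σ : Memory} (hc : ¬ c.Holds σ) :
      Exec W A (.while c p) σ 1 σ
  | while_true {c : Test} {p : Prog} {σ σ₁ σ₂ : Memory} {t₁ t₂ : ℕ} (hc : c.Holds σ)
      (h₁ : Exec W A p σ t₁ σ₁) (h₂ : Exec W A (.while c p) σ₁ t₂ σ₂) :
      Exec W A (.while c p) σ (1 + t₁ + t₂) σ₂

/-! ## Inputs, decision problems, running time -/

/-- An input: a finite list of words and a finite list of reals. -/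
structure Input where
  words : List ℤ
  reals : List ℝ

/-- Input length. -/
def Input.size (x : Input) : ℕ := x.words.length + x.reals.length

/-- The lists are stored in the two memories and their lengths in word registers `0` and `1`;
everything else is `0`. -/
def Input.init (x : Input) : Memory where
  wreg := fun i => if i = 0 then x.words.length else if i = 1 then x.reals.length else 0
  rreg := fun _ => 0
  wmem := fun i => x.words.getD i 0
  rmem := fun i => x.reals.getD i 0

/-- `r` is a fraction with numerator and denominator of absolute value at most `H`. -/
def HasHeight (H : ℕ) (r : ℝ) : Prop :=
  ∃ (p : ℤ) (q : ℕ), 0 < q ∧ q ≤ H ∧ |p| ≤ (H : ℤ) ∧ r = (p : ℝ) / (q : ℝ)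

/-- Two kinds of real arithmetic: `exact` is the unrestricted Real RAM. In `bounded`, the Real RAM
must not abuse unlimited precision: on inputs whose reals are fractions of height at most `H`,
all computed reals are fractions of height polynomial in the input length and `H`, i.e. of
`O(log (size + H))` bits. -/
inductive Arithmetic
  | exact
  | bounded

/-- The reals a machine with precision exponent `c` may compute on the input `x`. -/
def Arithmetic.allowed : Arithmetic → ℕ → Input → Set ℝ
  | .exact, _, _ => Set.univ
  | .bounded, c, x =>
      {v | ∀ H : ℕ, (∀ r ∈ x.reals, HasHeight H r) → HasHeight ((x.size + H + 2) ^ c) v}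

/-- A decision problem: a type of instances with their encodings (whose words fit into `O(log)`
bits) and the set of YES-instances. -/
structure Problem where
  Inst : Type
  input : Inst → Input
  words_bounded : ∃ b : ℕ, ∀ x, ∀ w ∈ (input x).words, |w| ≤ (((input x).size + 2) ^ b : ℕ)
  yes : Inst → Prop

/-- On the instance `x`, the program `p` (with `O(c log size)`-bit words) halts after `t` steps
with the right answer in word register `0`. -/
def Decides (μ : Arithmetic) (c : ℕ) (X : Problem) (p : Prog) (x : X.Inst) (t : ℕ) : Prop :=
  ∃ σ : Memory,
    Exec (((X.input x).size + 2) ^ c) (μ.allowed c (X.input x)) p (X.input x).init t σ ∧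
    (X.yes x → σ.wreg 0 = 1) ∧ (¬ X.yes x → σ.wreg 0 = 0)

/-- Some program of the class `𝒞` solves `X`, in time `O(f)` on the instances in `dom`. -/
def SolvableIn (μ : Arithmetic) (𝒞 : Set Prog) (X : Problem) (dom : Set X.Inst)
    (f : X.Inst → ℝ) : Prop :=
  ∃ p ∈ 𝒞, ∃ c : ℕ, ∃ C : ℝ, ∀ x : X.Inst, ∃ t : ℕ,
    Decides μ c X p x t ∧ (x ∈ dom → (t : ℝ) ≤ C * f x)

/-! ## Elementary reductions and notions of combinatorial algorithm -/

/-- Word-valued expressions of fixed size: constants, a parameter, a position, the input lengths,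
look-up of an input word, arithmetic, and case distinction `if a ≤ b then e₁ else e₂`. -/
inductive WordExpr
  | const (z : ℤ)
  | par
  | pos
  | wlen
  | rlen
  | cell (e : WordExpr)
  | op (o : WordOp) (e₁ e₂ : WordExpr)
  | ite (a b e₁ e₂ : WordExpr)

/-- Value on the input `x`, with parameter `s` and position `j`. -/
def WordExpr.eval (x : Input) (s j : ℤ) : WordExpr → ℤ
  | .const z => z
  | .par => s
  | .pos => j
  | .wlen => x.words.length
  | .rlen => x.reals.length
  | .cell e => x.words.getD (e.eval x s j).toNat 0
  | .op o e₁ e₂ => o.eval (e₁.eval x s j) (e₂.eval x s j)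
  | .ite a b e₁ e₂ => if a.eval x s j ≤ b.eval x s j then e₁.eval x s j else e₂.eval x s j

/-- Real-valued expressions of fixed size. -/
inductive RealExpr
  | ofWord (e : WordExpr)
  | cell (e : WordExpr)
  | op (o : RealOp) (e₁ e₂ : RealExpr)
  | wite (a b : WordExpr) (e₁ e₂ : RealExpr)
  | rite (a b e₁ e₂ : RealExpr)

def RealExpr.eval (x : Input) (s j : ℤ) : RealExpr → ℝ
  | .ofWord e => (e.eval x s j : ℝ)
  | .cell e => x.reals.getD (e.eval x s j).toNat 0
  | .op o e₁ e₂ => o.eval (e₁.eval x s j) (e₂.eval x s j)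
  | .wite a b e₁ e₂ => if a.eval x s j ≤ b.eval x s j then e₁.eval x s j else e₂.eval x s j
  | .rite a b e₁ e₂ =>
      open Classical in if a.eval x s j ≤ b.eval x s j then e₁.eval x s j else e₂.eval x s j

/-- An elementary reduction from `X` to `Y`: an instance `x` of `X` is mapped to `count x`
many equivalent instances `map x 0, map x 1, …` of `Y` (which may for instance differ in size),
such that each single input cell of `map x s` is given by a fixed expression, and hence depends on
a constant number of cells of `x` only. -/
structure ElementaryReduction (X Y : Problem) where
  map : X.Inst → ℕ → Y.Inst
  count : WordExpr
  wlen : WordExpr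
  rlen : WordExpr
  word : WordExpr
  real : RealExpr
  words_eq : ∀ (x : X.Inst) (s : ℕ), (s : ℤ) < count.eval (X.input x) 0 0 →
    (Y.input (map x s)).words = (List.range (wlen.eval (X.input x) s 0).toNat).map
      fun j => word.eval (X.input x) s j
  reals_eq : ∀ (x : X.Inst) (s : ℕ), (s : ℤ) < count.eval (X.input x) 0 0 →
    (Y.input (map x s)).reals = (List.range (rlen.eval (X.input x) s 0).toNat).map
      fun j => real.eval (X.input x) s j
  yes_iff : ∀ (x : X.Inst) (s : ℕ), (s : ℤ) < count.eval (X.input x) 0 0 →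
    (Y.yes (map x s) ↔ X.yes x)

/-- The number of instances produced from `x`. -/
def ElementaryReduction.number {X Y : Problem} (R : ElementaryReduction X Y)
    (x : X.Inst) : ℕ := (R.count.eval (X.input x) 0 0).toNat

/-- The class `𝒞` of programs is closed under elementary reductions: if `p ∈ 𝒞` solves `Y`, and
every `x` is mapped to instances of size at most `L x` at least one of which `p` decides within
`T x` steps (`T` polynomially bounded), then some program in `𝒞` solves `X` as fast as it takes to
write down all the instances produced from `x` and to run `p` on them in parallel until
the first run halts. -/
def ClosedUnderElementaryReductions (μ : Arithmetic) (𝒞 : Set Prog) : Prop :=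
  ∀ (X Y : Problem) (R : ElementaryReduction X Y) (p : Prog) (c : ℕ) (L T : X.Inst → ℕ),
    p ∈ 𝒞 →
    (∀ y : Y.Inst, ∃ t, Decides μ c Y p y t) →
    (∃ a : ℕ, ∀ x, T x ≤ ((X.input x).size + 2) ^ a) →
    (∀ x, ∀ s < R.number x, (Y.input (R.map x s)).size ≤ L x) →
    (∀ x, ∃ s < R.number x, ∃ t ≤ T x, Decides μ c Y p (R.map x s) t) →
    ∃ q ∈ 𝒞, ∃ c' C : ℕ, ∀ x, ∃ t, Decides μ c' X q x t ∧
      t ≤ C * ((X.input x).size + R.number x * (L x + T x))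

/-! ## Clique and hyperclique -/

/-- A graph on a non-empty vertex set. -/
structure GraphInst where
  n : ℕ
  pos : 0 < n
  G : SimpleGraph (Fin n)

/-- The number of vertices followed by the adjacency matrix. -/
def GraphInst.input (x : GraphInst) : Input where
  words := (x.n : ℤ) :: (List.finRange x.n).flatMap fun i =>
    (List.finRange x.n).map fun j => open Classical in if x.G.Adj i j then 1 else 0
  reals := []

/-- A 3-uniform hypergraph on a non-empty vertex set. -/
structure HypergraphInst where
  n : ℕ
  pos : 0 < n
  edges : Set (Finset (Fin n))
  uniform : ∀ e ∈ edges, e.card = 3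

/-- The number of vertices followed by the adjacency tensor. -/
def HypergraphInst.input (x : HypergraphInst) : Input where
  words := (x.n : ℤ) :: (List.finRange x.n).flatMap fun i =>
    (List.finRange x.n).flatMap fun j => (List.finRange x.n).map fun l =>
      open Classical in if ({i, j, l} : Finset (Fin x.n)) ∈ x.edges then 1 else 0
  reals := []

theorem GraphInst.words_bounded : ∃ b : ℕ, ∀ x : GraphInst, ∀ w ∈ x.input.words,
    |w| ≤ ((x.input.size + 2) ^ b : ℕ) := by
  refine ⟨1, fun x w hw => ?_⟩
  have hn : x.n ≤ x.input.size := by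
    have h : x.n * 1 ≤ x.n * x.n := Nat.mul_le_mul_left _ x.pos
    simp [Input.size, GraphInst.input, List.length_flatMap]
    omega
  simp only [GraphInst.input, List.mem_cons, List.mem_flatMap, List.mem_map] at hw
  simp only [pow_one]
  rcases hw with rfl | ⟨i, -, j, -, rfl⟩
  · rw [abs_of_nonneg (by positivity)]
    exact_mod_cast (by omega : x.n ≤ x.input.size + 2)
  · split_ifs <;> simp <;> omega

theorem HypergraphInst.words_bounded : ∃ b : ℕ, ∀ x : HypergraphInst, ∀ w ∈ x.input.words,
    |w| ≤ ((x.input.size + 2) ^ b : ℕ) := by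
  refine ⟨1, fun x w hw => ?_⟩
  have hn : x.n ≤ x.input.size := by
    have h : x.n * 1 ≤ x.n * (x.n * x.n) :=
      Nat.mul_le_mul_left _ (Nat.mul_pos x.pos x.pos)
    simp [Input.size, HypergraphInst.input, List.length_flatMap]
    omega
  simp only [HypergraphInst.input, List.mem_cons, List.mem_flatMap, List.mem_map] at hw
  simp only [pow_one]
  rcases hw with rfl | ⟨i, -, j, -, l, -, rfl⟩
  · rw [abs_of_nonneg (by positivity)]
    exact_mod_cast (by omega : x.n ≤ x.input.size + 2)
  · split_ifs <;> simp <;> omega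

/-- Is there a set of `k` pairwise adjacent vertices? -/
def cliqueProblem (k : ℕ) : Problem where
  Inst := GraphInst
  input := GraphInst.input
  words_bounded := GraphInst.words_bounded
  yes := fun x => ∃ S : Finset (Fin x.n), x.G.IsNClique k S

/-- Is there a set of `k` vertices all of whose 3-element subsets are hyperedges? -/
def hypercliqueProblem (k : ℕ) : Problem where
  Inst := HypergraphInst
  input := HypergraphInst.input
  words_bounded := HypergraphInst.words_bounded
  yes := fun x => ∃ S : Finset (Fin x.n), S.card = k ∧ ∀ e ⊆ S, e.card = 3 → e ∈ x.edges

/-! ## The matrix multiplication exponent -/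

/-- The bilinear map `(A, B) ↦ A * B` of `n × n` matrices over `ℚ` has rank at most `r`. -/
def MatMulRankLE (n r : ℕ) : Prop :=
  ∃ (α β : Fin r → Matrix (Fin n) (Fin n) ℚ →ₗ[ℚ] ℚ) (γ : Fin r → Matrix (Fin n) (Fin n) ℚ),
    ∀ A B : Matrix (Fin n) (Fin n) ℚ, A * B = ∑ t, (α t A * β t B) • γ t

/-- The exponent of matrix multiplication. -/
def matMulExponent : ℝ :=
  sInf {τ : ℝ | ∃ C : ℝ, ∀ n : ℕ, 1 ≤ n → ∃ r : ℕ, MatMulRankLE n r ∧ (r : ℝ) ≤ C * (n : ℝ) ^ τ}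

/-! ## The hypotheses -/

/-- No program in `𝒞` finds `k`-cliques in time `O(n^(k-ε))`. -/
def CombinatorialCliqueHypothesis (μ : Arithmetic) (𝒞 : Set Prog) : Prop :=
  ∀ k : ℕ, 3 ≤ k → ∀ ε : ℝ, 0 < ε →
    ¬ SolvableIn μ 𝒞 (cliqueProblem k) Set.univ (fun x : GraphInst => (x.n : ℝ) ^ ((k : ℝ) - ε))

/-- No program finds `k`-cliques in time `O(n^(ωk/3-ε))`. -/
def CliqueHypothesis (μ : Arithmetic) : Prop :=
  ∀ k : ℕ, 3 ≤ k → ∀ ε : ℝ, 0 < ε →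
    ¬ SolvableIn μ Set.univ (cliqueProblem k) Set.univ
      (fun x : GraphInst => (x.n : ℝ) ^ (matMulExponent * k / 3 - ε))

/-- No program finds `k`-hypercliques in 3-uniform hypergraphs in time `O(n^(k-ε))`. -/
def HypercliqueHypothesis (μ : Arithmetic) : Prop :=
  ∀ k : ℕ, 3 < k → ∀ ε : ℝ, 0 < ε →
    ¬ SolvableIn μ Set.univ (hypercliqueProblem k) Set.univ
      (fun x : HypergraphInst => (x.n : ℝ) ^ ((k : ℝ) - ε))

/-! ## Undirected Hausdorff distance under translation -/

/-- Directed Hausdorff distance of finite point sets for the maximum norm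
(the norm of `Fin d → ℝ`). -/
def directedHausdorff {d n m : ℕ} (P : Fin n → Fin d → ℝ) (Q : Fin m → Fin d → ℝ) : ℝ :=
  ⨆ i, ⨅ j, ‖P i - Q j‖

/-- Undirected Hausdorff distance. -/
def hausdorff {d n m : ℕ} (P : Fin n → Fin d → ℝ) (Q : Fin m → Fin d → ℝ) : ℝ :=
  max (directedHausdorff P Q) (directedHausdorff Q P)

/-- A set of `n ≥ 1` points and a set of `m ≥ 1` points in `ℝ^d`, and a threshold `δ > 0`. -/
structure HuTInst (d : ℕ) where
  n : ℕ
  m : ℕ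
  n_pos : 0 < n
  m_pos : 0 < m
  P : Fin n → Fin d → ℝ
  Q : Fin m → Fin d → ℝ
  P_inj : Function.Injective P
  Q_inj : Function.Injective Q
  δ : ℝ
  δ_pos : 0 < δ

/-- Words: `n`, `m`. Reals: `δ`, the coordinates of the points of `P`, then those of `Q`. -/
def HuTInst.input {d : ℕ} (x : HuTInst d) : Input where
  words := [(x.n : ℤ), (x.m : ℤ)]
  reals := x.δ :: (List.ofFn x.P ++ List.ofFn x.Q).flatMap List.ofFn

theorem HuTInst.words_bounded (d : ℕ) (hd : 0 < d) : ∃ b : ℕ, ∀ x : HuTInst d,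
    ∀ w ∈ x.input.words, |w| ≤ ((x.input.size + 2) ^ b : ℕ) := by
  refine ⟨1, fun x w hw => ?_⟩
  have hsize : x.n + x.m ≤ x.input.size := by
    have h : (x.n + x.m) * 1 ≤ (x.n + x.m) * d := Nat.mul_le_mul_left _ hd
    have h2 : x.input.size = 2 + ((x.n + x.m) * d + 1) := by
      simp [Input.size, HuTInst.input, List.length_flatMap, Function.comp_def]
      ring
    omega
  simp only [HuTInst.input, List.mem_cons, List.not_mem_nil, or_false] at hw
  simp only [pow_one]
  rcases hw with rfl | rfl <;> rw [abs_of_nonneg (by positivity)] <;> norm_cast <;> omega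

/-- Undirected Hausdorff distance under translation in `ℝ^d`, `d ≥ 1`: is there a translation `τ`
with `δ_H(P + τ, Q) ≤ δ`? -/
def undirectedHuT (d : ℕ) (hd : 0 < d) : Problem where
  Inst := HuTInst d
  input := HuTInst.input
  words_bounded := HuTInst.words_bounded d hd
  yes := fun x => ∃ τ : Fin d → ℝ, hausdorff (fun i => x.P i + τ) x.Q ≤ x.δ

/-- The instances with `a · max(n,m)^lam ≤ min(n,m) ≤ b · max(n,m)^lam`. -/
def sizeRegime (d : ℕ) (lam a b : ℝ) : Set (HuTInst d) :=
  {x | a * (max x.n x.m : ℝ) ^ lam ≤ (min x.n x.m : ℝ) ∧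
       (min x.n x.m : ℝ) ≤ b * (max x.n x.m : ℝ) ^ lam}

/-- Some algorithm in `𝒞` for undirected Hausdorff distance under translation in `ℝ^d` takes time
`O((nm)^e)` on the instances with `a · max(n,m)^lam ≤ min(n,m) ≤ b · max(n,m)^lam`. -/
def UndirectedHuTSolvable (μ : Arithmetic) (𝒞 : Set Prog) (d : ℕ) (hd : 0 < d)
    (lam a b e : ℝ) : Prop :=
  SolvableIn μ 𝒞 (undirectedHuT d hd) (sizeRegime d lam a b)
    (fun x : HuTInst d => ((x.n : ℝ) * (x.m : ℝ)) ^ e)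

end

end FineGrained

namespace FineGrained
noncomputable section

/-! ## Running time triples -/

/-- Started in `σ`, the program `p` halts within `T` steps in a state satisfying `Q`. -/
def Runs (W : ℕ) (A : Set ℝ) (p : Prog) (σ : Memory) (T : ℕ) (Q : Memory → Prop) : Prop :=
  ∃ t ≤ T, ∃ σ', Exec W A p σ t σ' ∧ Q σ'

section Runs
variable {W : ℕ} {A : Set ℝ} {p q : Prog} {σ : Memory} {T T₁ T₂ : ℕ} {Q Q₁ : Memory → Prop}

theorem Runs.mono (h : Runs W A p σ T Q) (hT : T ≤ T₁) (hQ : ∀ σ', Q σ' → Q₁ σ') :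
    Runs W A p σ T₁ Q₁ := by
  obtain ⟨t, ht, σ', he, hq⟩ := h
  exact ⟨t, ht.trans hT, σ', he, hQ _ hq⟩

theorem Runs.skip (h : Q σ) : Runs W A .skip σ 1 Q := ⟨1, le_rfl, σ, .skip σ, h⟩

theorem Runs.instr {a : Instr} (ok : a.Ok W A σ) (h : Q (a.next σ)) :
    Runs W A (.instr a) σ 1 Q := ⟨1, le_rfl, _, .instr a σ ok, h⟩

theorem Runs.seq (h₁ : Runs W A p σ T₁ Q₁) (h₂ : ∀ σ', Q₁ σ' → Runs W A q σ' T₂ Q) :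
    Runs W A (.seq p q) σ (T₁ + T₂) Q := by
  obtain ⟨t₁, ht₁, σ₁, he₁, hq₁⟩ := h₁
  obtain ⟨t₂, ht₂, σ₂, he₂, hq₂⟩ := h₂ _ hq₁
  exact ⟨t₁ + t₂, by omega, σ₂, .seq he₁ he₂, hq₂⟩

theorem Runs.ite {c : Test} (h₁ : c.Holds σ → Runs W A p σ T Q)
    (h₂ : ¬ c.Holds σ → Runs W A q σ T Q) : Runs W A (.ite c p q) σ (1 + T) Q := by
  by_cases hc : c.Holds σ
  · obtain ⟨t, ht, σ', he, hq⟩ := h₁ hc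
    exact ⟨1 + t, by omega, σ', .ite_true hc he, hq⟩
  · obtain ⟨t, ht, σ', he, hq⟩ := h₂ hc
    exact ⟨1 + t, by omega, σ', .ite_false hc he, hq⟩

/-- Total correctness with invariant `I` and variant `m`: each round costs its body and one test,
and the leading `1` pays for the last, failing test. -/
theorem Runs.while {c : Test} (I : Memory → Prop) (m : Memory → ℕ)
    (hstep : ∀ σ, I σ → c.Holds σ → Runs W A p σ T (fun σ' => I σ' ∧ m σ' < m σ)) (h : I σ) :
    Runs W A (.while c p) σ (1 + m σ * (T + 1)) (fun σ' => I σ' ∧ ¬ c.Holds σ') := by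
  induction hm : m σ using Nat.strong_induction_on generalizing σ with
  | _ k ih =>
    subst hm
    by_cases hc : c.Holds σ
    · obtain ⟨t, ht, σ', he, hI, hlt⟩ := hstep σ h hc
      obtain ⟨t₂, ht₂, σ₂, he₂, hq₂⟩ := ih (m σ') hlt hI rfl
      refine ⟨1 + t + t₂, ?_, σ₂, .while_true hc he he₂, hq₂⟩
      have : (m σ' + 1) * (T + 1) ≤ m σ * (T + 1) := Nat.mul_le_mul_right _ hlt
      nlinarith
    · exact ⟨1, by omega, σ, .while_false hc, h, hc⟩

end Runs

/-! ## Simulation of a program with a step budget, in one slot of the memory -/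

/-- All registers mentioned by the instruction are below `N`. -/
def Instr.Below (N : ℕ) : Instr → Prop
  | .const i _ => i < N
  | .wop _ i j k => i < N ∧ j < N ∧ k < N
  | .wload i j => i < N ∧ j < N
  | .wstore i j => i < N ∧ j < N
  | .cast i j => i < N ∧ j < N
  | .rop _ i j k => i < N ∧ j < N ∧ k < N
  | .rload i j => i < N ∧ j < N
  | .rstore i j => i < N ∧ j < N

def Test.Below (N : ℕ) : Test → Prop
  | .wle i j => i < N ∧ j < N
  | .rle i j => i < N ∧ j < N

def Prog.Below (N : ℕ) : Prog → Prop
  | .skip => True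
  | .instr a => a.Below N
  | .seq p q => p.Below N ∧ q.Below N
  | .ite c p q => c.Below N ∧ p.Below N ∧ q.Below N
  | .while c p => c.Below N ∧ p.Below N

theorem Instr.Below.mono {N M : ℕ} (h : N ≤ M) {a : Instr} (ha : a.Below N) : a.Below M := by
  cases a <;> simp only [Instr.Below] at * <;> omega

theorem Test.Below.mono {N M : ℕ} (h : N ≤ M) {a : Test} (ha : a.Below N) : a.Below M := by
  cases a <;> simp only [Test.Below] at * <;> omega

theorem Prog.Below.mono {N M : ℕ} (h : N ≤ M) {p : Prog} (hp : p.Below N) : p.Below M := by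
  induction p with
  | skip => trivial
  | instr a => exact Instr.Below.mono h hp
  | seq p q ihp ihq => exact ⟨ihp hp.1, ihq hp.2⟩
  | ite c p q ihp ihq => exact ⟨hp.1.mono h, ihp hp.2.1, ihq hp.2.2⟩
  | _ c p ihp => exact ⟨hp.1.mono h, ihp hp.2⟩

/-- A program mentions finitely many registers, so the host can keep them in a block of fixed
length. At least two are reserved because registers `0` and `1` receive the lengths of the input. -/
theorem Prog.exists_below (p : Prog) : ∃ N, 2 ≤ N ∧ p.Below N := by
  have hi : ∀ a : Instr, ∃ N, a.Below N := fun a => by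
    cases a with
    | const i z => exact ⟨i + 1, by simp [Instr.Below]⟩
    | wop o i j k => exact ⟨i + j + k + 1, by simp only [Instr.Below]; omega⟩
    | rop o i j k => exact ⟨i + j + k + 1, by simp only [Instr.Below]; omega⟩
    | _ i j => exact ⟨i + j + 1, by simp only [Instr.Below]; omega⟩
  have ht : ∀ a : Test, ∃ N, a.Below N := fun a => by
    cases a with
    | _ i j => exact ⟨i + j + 1, by simp only [Test.Below]; omega⟩
  induction p with
  | skip => exact ⟨2, le_rfl, trivial⟩
  | instr a =>
    obtain ⟨N, h⟩ := hi a
    exact ⟨N + 2, by omega, Instr.Below.mono (by omega) h⟩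
  | seq p q ihp ihq =>
    obtain ⟨N, hN, h⟩ := ihp
    obtain ⟨M, hM, h'⟩ := ihq
    exact ⟨N + M, by omega, h.mono (by omega), h'.mono (by omega)⟩
  | ite c p q ihp ihq =>
    obtain ⟨N, hN, h⟩ := ihp
    obtain ⟨M, hM, h'⟩ := ihq
    obtain ⟨K, hc⟩ := ht c
    exact ⟨N + M + K, by omega, hc.mono (by omega), h.mono (by omega), h'.mono (by omega)⟩
  | _ c p ihp =>
    obtain ⟨N, hN, h⟩ := ihp
    obtain ⟨K, hc⟩ := ht c
    exact ⟨N + K, by omega, hc.mono (by omega), h.mono (by omega)⟩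

/-- Assignment to a word register. -/
def Memory.setW (σ : Memory) (i : ℕ) (z : ℤ) : Memory :=
  { σ with wreg := Function.update σ.wreg i z }

/-- Host register `10` receives the host address of the simulated cell whose address is in the
simulated register `j`. -/
def addrCode (j : ℕ) : Prog :=
  .seq (.ite (.wle (16 + j) 2) (.instr (.const 10 0)) (.instr (.wop .add 10 (16 + j) 2)))
    (.seq (.instr (.wop .mul 10 10 5)) (.seq (.instr (.wop .add 10 10 6))
      (.instr (.wop .add 10 10 4))))

def Instr.host : Instr → Prog
  | .const i z => .instr (.const (16 + i) z)
  | .wop o i j k => .instr (.wop o (16 + i) (16 + j) (16 + k))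
  | .wload i j => .seq (addrCode j) (.instr (.wload (16 + i) 10))
  | .wstore i j => .seq (addrCode i) (.instr (.wstore 10 (16 + j)))
  | .cast i j => .instr (.cast (16 + i) (16 + j))
  | .rop o i j k => .instr (.rop o (16 + i) (16 + j) (16 + k))
  | .rload i j => .seq (addrCode j) (.instr (.rload (16 + i) 10))
  | .rstore i j => .seq (addrCode i) (.instr (.rstore 10 (16 + j)))

def Test.host : Test → Test
  | .wle i j => .wle (16 + i) (16 + j)
  | .rle i j => .rle (16 + i) (16 + j)

/-- Decrease the budget. -/
def tick : Prog := .instr (.wop .sub 8 8 3)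

/-- Do nothing if the budget is exhausted. -/
def guarded (p : Prog) : Prog := .ite (.wle 8 2) .skip p

/-- Set the flag to `1` if the budget is not exhausted and the test holds, and to `0` otherwise. -/
def setFlag (c : Test) : Prog :=
  .seq (.instr (.const 9 0)) (guarded (.ite c (.instr (.const 9 1)) .skip))

/-- The translation of a program: every step decreases the budget, and nothing happens any more
when it is exhausted. -/
def Prog.host : Prog → Prog
  | .skip => guarded tick
  | .instr a => guarded (.seq tick a.host)
  | .seq p q => .seq p.host q.host
  | .ite c p q => guarded (.seq tick (.ite c.host p.host q.host))
  | .while c p => .seq (setFlag c.host)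
      (.seq (.while (.wle 3 9) (.seq tick (.seq p.host (setFlag c.host)))) (guarded tick))

def Prog.hostCost : Prog → ℕ
  | .skip => 10
  | .instr _ => 20
  | .seq p q => p.hostCost + q.hostCost
  | .ite _ p q => p.hostCost + q.hostCost + 10
  | .while _ p => 2 * p.hostCost + 20

/-- The constant registers of the host. -/
structure Host (base r s : ℕ) (τ : Memory) : Prop where
  zero : τ.wreg 2 = 0
  one : τ.wreg 3 = 1
  base : τ.wreg 4 = base
  num : τ.wreg 5 = r
  idx : τ.wreg 6 = s

/-- The host state `τ` represents the state `σ` of the simulated program. -/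
structure Sim (N B base r s : ℕ) (σ τ : Memory) : Prop where
  wreg : ∀ i < N, τ.wreg (16 + i) = σ.wreg i
  rreg : ∀ i < N, τ.rreg (16 + i) = σ.rreg i
  wmem : ∀ a, τ.wmem (base + (a * r + s)) = σ.wmem a
  rmem : ∀ a, τ.rmem (base + (a * r + s)) = σ.rmem a
  wreg_le : ∀ i, |σ.wreg i| ≤ B
  wmem_le : ∀ a, |σ.wmem a| ≤ B

/-- Only temporary host registers and slot `s` of the memory differ. -/
structure Frame (base r s : ℕ) (τ τ' : Memory) : Prop where
  wreg : ∀ i < 16, i ≠ 8 → i ≠ 9 → i ≠ 10 → τ'.wreg i = τ.wreg i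
  wmem : ∀ a, (∀ b, a ≠ base + (b * r + s)) → τ'.wmem a = τ.wmem a
  rmem : ∀ a, (∀ b, a ≠ base + (b * r + s)) → τ'.rmem a = τ.rmem a

theorem Frame.refl (base r s : ℕ) (τ : Memory) : Frame base r s τ τ :=
  ⟨fun _ _ _ _ _ => rfl, fun _ _ => rfl, fun _ _ => rfl⟩

theorem Frame.trans {base r s : ℕ} {τ₁ τ₂ τ₃ : Memory} (h : Frame base r s τ₁ τ₂)
    (h' : Frame base r s τ₂ τ₃) : Frame base r s τ₁ τ₃ :=
  ⟨fun i h1 h2 h3 h4 => (h'.wreg i h1 h2 h3 h4).trans (h.wreg i h1 h2 h3 h4),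
   fun a ha => (h'.wmem a ha).trans (h.wmem a ha), fun a ha => (h'.rmem a ha).trans (h.rmem a ha)⟩

theorem Frame.host {base r s : ℕ} {τ τ' : Memory} (h : Frame base r s τ τ')
    (hh : Host base r s τ) : Host base r s τ' :=
  ⟨(h.wreg 2 (by omega) (by omega) (by omega) (by omega)).trans hh.zero,
   (h.wreg 3 (by omega) (by omega) (by omega) (by omega)).trans hh.one,
   (h.wreg 4 (by omega) (by omega) (by omega) (by omega)).trans hh.base,
   (h.wreg 5 (by omega) (by omega) (by omega) (by omega)).trans hh.num,
   (h.wreg 6 (by omega) (by omega) (by omega) (by omega)).trans hh.idx⟩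

/-- The parameters of the two machines fit together. -/
structure Fits (W W' B base r s : ℕ) (A A' : Set ℝ) : Prop where
  sub : A ⊆ A'
  le : W ≤ B
  room : B * r + base + r + 1 ≤ W'
  idx : s < r

theorem Fits.le' {W W' B base r s : ℕ} {A A' : Set ℝ} (h : Fits W W' B base r s A A') : B ≤ W' := by
  have h1 := h.room
  have h2 : B * 1 ≤ B * r := Nat.mul_le_mul_left _ (by have := h.idx; omega)
  omega

section Simulation
variable {N W W' B base r s : ℕ} {A A' : Set ℝ}

/-- Slots are interleaved with stride `r`. They never overlap, whatever the addresses used in them,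
and no slot needs a size fixed in advance. -/
theorem slot_inj (hs : s < r) {a b : ℕ} (h : base + (a * r + s) = base + (b * r + s)) : a = b := by
  have : a * r = b * r := by omega
  exact Nat.eq_of_mul_eq_mul_right (by omega) this

/-- A negative address is replaced by `0`, in accordance with `toNat`. The intermediate results fit
into host words by `Fits.room`. -/
theorem exec_addrCode (fit : Fits W W' B base r s A A') {τ : Memory} (hh : Host base r s τ) {j : ℕ}
    (hj : |τ.wreg (16 + j)| ≤ B) :
    ∃ t ≤ 6, Exec W' A' (addrCode j) τ t
      (τ.setW 10 ((base + ((τ.wreg (16 + j)).toNat * r + s) : ℕ) : ℤ)) := by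
  unfold Memory.setW
  have hroom := fit.room
  have hsr := fit.idx
  have hle := fit.le'
  set z := τ.wreg (16 + j) with hz
  obtain ⟨k, hk⟩ : ∃ k : ℕ, k = z.toNat := ⟨_, rfl⟩
  have hkB : k ≤ B := by
    have := abs_le.1 hj; omega
  have hkr : k * r ≤ B * r := Nat.mul_le_mul_right _ hkB
  rw [← hk]
  have first : Exec W' A' (.ite (.wle (16 + j) 2) (.instr (.const 10 0))
      (.instr (.wop .add 10 (16 + j) 2))) τ 2
      { τ with wreg := Function.update τ.wreg 10 (k : ℤ) } := by
    by_cases hc : z ≤ 0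
    · have hk0 : k = 0 := by omega
      subst hk0
      have := Exec.ite_true (W := W') (A := A') (c := .wle (16 + j) 2)
        (q := .instr (.wop .add 10 (16 + j) 2)) (σ := τ)
        (by simp only [Test.Holds, hh.zero]; exact hc)
        (Exec.instr (.const 10 0) τ (by simp [Instr.Ok]))
      simpa [Instr.next] using this
    · have hkz : (k : ℤ) = z := by omega
      have := Exec.ite_false (W := W') (A := A') (c := .wle (16 + j) 2)
        (p := .instr (.const 10 0)) (σ := τ)
        (by simp only [Test.Holds, hh.zero]; exact hc)
        (Exec.instr (.wop .add 10 (16 + j) 2) τ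
          (by simp only [Instr.Ok, WordOp.eval, hh.zero, ← hz]; rw [add_zero]; omega))
      simpa [Instr.next, WordOp.eval, hh.zero, ← hz, hkz] using this
  have ok1 : |((k * r : ℕ) : ℤ)| ≤ W' := by rw [abs_of_nonneg (by positivity)]; exact_mod_cast by omega
  have ok2 : |((k * r + s : ℕ) : ℤ)| ≤ W' := by
    rw [abs_of_nonneg (by positivity)]; exact_mod_cast by omega
  have ok3 : |((base + (k * r + s) : ℕ) : ℤ)| ≤ W' := by
    rw [abs_of_nonneg (by positivity)]; exact_mod_cast by omega
  have second : Exec W' A' (.instr (.wop .mul 10 10 5))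
      { τ with wreg := Function.update τ.wreg 10 (k : ℤ) } 1
      { τ with wreg := Function.update τ.wreg 10 ((k * r : ℕ) : ℤ) } := by
    have := Exec.instr (W := W') (A := A') (.wop .mul 10 10 5)
      { τ with wreg := Function.update τ.wreg 10 (k : ℤ) }
      (by simpa [Instr.Ok, WordOp.eval, hh.num] using ok1)
    simpa [Instr.next, WordOp.eval, hh.num] using this
  have third : Exec W' A' (.instr (.wop .add 10 10 6))
      { τ with wreg := Function.update τ.wreg 10 ((k * r : ℕ) : ℤ) } 1
      { τ with wreg := Function.update τ.wreg 10 ((k * r + s : ℕ) : ℤ) } := by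
    have := Exec.instr (W := W') (A := A') (.wop .add 10 10 6)
      { τ with wreg := Function.update τ.wreg 10 ((k * r : ℕ) : ℤ) }
      (by simpa [Instr.Ok, WordOp.eval, hh.idx] using ok2)
    simpa [Instr.next, WordOp.eval, hh.idx] using this
  have fourth : Exec W' A' (.instr (.wop .add 10 10 4))
      { τ with wreg := Function.update τ.wreg 10 ((k * r + s : ℕ) : ℤ) } 1
      { τ with wreg := Function.update τ.wreg 10 ((base + (k * r + s) : ℕ) : ℤ) } := by
    have := Exec.instr (W := W') (A := A') (.wop .add 10 10 4)
      { τ with wreg := Function.update τ.wreg 10 ((k * r + s : ℕ) : ℤ) }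
      (by simpa [Instr.Ok, WordOp.eval, hh.base, add_comm] using ok3)
    simpa [Instr.next, WordOp.eval, hh.base, add_comm] using this
  exact ⟨_, by omega, .seq first (.seq second (.seq third fourth))⟩

end Simulation
end
end FineGrained

/-! ### Correctness and cost of the simulation -/

namespace FineGrained
noncomputable section

section Simulation
variable {N W W' B base r s : ℕ} {A A' : Set ℝ}

/-- All words of the state are bounded by `B`. -/
structure Memory.BoundedBy (B : ℕ) (σ : Memory) : Prop where
  wreg : ∀ i, |σ.wreg i| ≤ B
  wmem : ∀ a, |σ.wmem a| ≤ B

/-- Loads and stores only move words around, and every newly computed word is checked by `Instr.Ok`.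
The bound is what keeps the host addresses small. -/
theorem Memory.BoundedBy.next {a : Instr} {σ : Memory} (h : σ.BoundedBy B) (hW : W ≤ B)
    (ok : a.Ok W A σ) : (a.next σ).BoundedBy B := by
  have hWB : (W : ℤ) ≤ B := by exact_mod_cast hW
  have upd : ∀ (f : ℕ → ℤ) (i : ℕ) (z : ℤ), (∀ k, |f k| ≤ B) → |z| ≤ B →
      ∀ k, |Function.update f i z k| ≤ B := fun f i z hf hz k => by
    by_cases hk : k = i
    · subst hk; simpa using hz
    · simpa [Function.update_of_ne hk] using hf k
  cases a with
  | const i z => exact ⟨upd _ _ _ h.wreg (le_trans ok hWB), h.wmem⟩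
  | wop o i j k => exact ⟨upd _ _ _ h.wreg (le_trans ok hWB), h.wmem⟩
  | wload i j => exact ⟨upd _ _ _ h.wreg (h.wmem _), h.wmem⟩
  | wstore i j => exact ⟨h.wreg, upd _ _ _ h.wmem (h.wreg _)⟩
  | cast i j => exact ⟨h.wreg, h.wmem⟩
  | rop o i j k => exact ⟨h.wreg, h.wmem⟩
  | rload i j => exact ⟨h.wreg, h.wmem⟩
  | rstore i j => exact ⟨h.wreg, h.wmem⟩

theorem Sim.boundedBy {σ τ : Memory} (h : Sim N B base r s σ τ) : σ.BoundedBy B :=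
  ⟨h.wreg_le, h.wmem_le⟩

theorem sim_setW {σ τ : Memory} (h : Sim N B base r s σ τ) {i : ℕ} (hi : i < 16) (z : ℤ) :
    Sim N B base r s σ (τ.setW i z) where
  wreg k hk := by
    rw [← h.wreg k hk]
    exact Function.update_of_ne (by omega) _ _
  rreg := h.rreg
  wmem := h.wmem
  rmem := h.rmem
  wreg_le := h.wreg_le
  wmem_le := h.wmem_le

theorem frame_setW {τ : Memory} {i : ℕ} (hi : 16 ≤ i ∨ i = 8 ∨ i = 9 ∨ i = 10) (z : ℤ) :
    Frame base r s τ (τ.setW i z) where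
  wreg k hk h8 h9 h10 := Function.update_of_ne (by omega) _ _
  wmem _ _ := rfl
  rmem _ _ := rfl

theorem update_shift {α : Type*} (f g : ℕ → α) (i : ℕ) (z : α) (h : ∀ k < N, f (16 + k) = g k) :
    ∀ k < N, Function.update f (16 + i) z (16 + k) = Function.update g i z k := fun k hk => by
  by_cases hki : k = i
  · subst hki; simp
  · rw [Function.update_of_ne hki, Function.update_of_ne (by omega), h k hk]

theorem update_slot {α : Type*} (hs : s < r) (f g : ℕ → α) (i : ℕ) (z : α)
    (h : ∀ k, f (base + (k * r + s)) = g k) :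
    ∀ k, Function.update f (base + (i * r + s)) z (base + (k * r + s)) =
      Function.update g i z k := fun k => by
  by_cases hki : k = i
  · subst hki; simp
  · rw [Function.update_of_ne hki, Function.update_of_ne (fun hh => hki (slot_inj hs hh)), h k]

theorem exec_instr_host (fit : Fits W W' B base r s A A') {σ τ : Memory}
    (sim : Sim N B base r s σ τ) (hh : Host base r s τ) {a : Instr} (hN : a.Below N)
    (ok : a.Ok W A σ) :
    ∃ t ≤ 8, ∃ τ', Exec W' A' a.host τ t τ' ∧ Sim N B base r s (a.next σ) τ' ∧
      Frame base r s τ τ' ∧ τ'.wreg 8 = τ.wreg 8 := by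
  have hWW : (W : ℤ) ≤ W' := by exact_mod_cast fit.le.trans fit.le'
  have hs := fit.idx
  have hbd := sim.boundedBy.next fit.le ok
  have addr : ∀ j < N, ∃ t ≤ 6, Exec W' A' (addrCode j) τ t
      (τ.setW 10 ((base + ((σ.wreg j).toNat * r + s) : ℕ) : ℤ)) := fun j hj => by
    have := exec_addrCode fit hh (j := j) (by rw [sim.wreg j hj]; exact sim.wreg_le j)
    rwa [sim.wreg j hj] at this
  cases a with
  | const i z =>
    refine ⟨1, by omega, _, .instr (.const (16 + i) z) τ (le_trans ok hWW), ⟨?_, sim.rreg, sim.wmem,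
      sim.rmem, hbd.1, hbd.2⟩, frame_setW (by omega) z, Function.update_of_ne (by omega) _ _⟩
    exact update_shift _ _ _ _ sim.wreg
  | wop o i j k =>
    obtain ⟨hi, hj, hk⟩ := hN
    refine ⟨1, by omega, _, .instr (.wop o (16 + i) (16 + j) (16 + k)) τ ?_, ⟨?_, sim.rreg, sim.wmem,
      sim.rmem, hbd.1, hbd.2⟩, frame_setW (by omega) _, Function.update_of_ne (by omega) _ _⟩
    · simp only [Instr.Ok, sim.wreg j hj, sim.wreg k hk]
      exact le_trans ok hWW
    · simp only [Instr.next, sim.wreg j hj, sim.wreg k hk]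
      exact update_shift _ _ _ _ sim.wreg
  | wload i j =>
    obtain ⟨t, ht, he⟩ := addr j hN.2
    refine ⟨t + 1, by omega, _, .seq he (.instr (.wload (16 + i) 10) _ trivial), ?_, ?_, ?_⟩
    · have h10 := sim_setW sim (i := 10) (by omega) ((base + ((σ.wreg j).toNat * r + s) : ℕ) : ℤ)
      refine ⟨?_, sim.rreg, sim.wmem, sim.rmem, hbd.1, hbd.2⟩
      have hv : (τ.setW 10 ((base + ((σ.wreg j).toNat * r + s) : ℕ) : ℤ)).wreg 10
        = ((base + ((σ.wreg j).toNat * r + s) : ℕ) : ℤ) := by simp [Memory.setW]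
      simp only [Instr.next, hv, Int.toNat_natCast]
      rw [h10.wmem]
      exact update_shift _ _ _ _ h10.wreg
    · exact (frame_setW (by omega) _).trans (frame_setW (i := 16 + i) (by omega) _)
    · simp [Instr.next, Memory.setW, Function.update_of_ne (show 8 ≠ 16 + i by omega)]
  | wstore i j =>
    obtain ⟨t, ht, he⟩ := addr i hN.1
    have hv : (τ.setW 10 ((base + ((σ.wreg i).toNat * r + s) : ℕ) : ℤ)).wreg 10
        = ((base + ((σ.wreg i).toNat * r + s) : ℕ) : ℤ) := by simp [Memory.setW]
    have h10 := sim_setW sim (i := 10) (by omega) ((base + ((σ.wreg i).toNat * r + s) : ℕ) : ℤ)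
    refine ⟨t + 1, by omega, _, .seq he (.instr (.wstore 10 (16 + j)) _ trivial), ?_, ?_, ?_⟩
    · refine ⟨h10.wreg, sim.rreg, ?_, sim.rmem, hbd.1, hbd.2⟩
      simp only [Instr.next, hv, Int.toNat_natCast]
      rw [h10.wreg j hN.2]
      exact update_slot hs _ _ _ _ h10.wmem
    · refine (frame_setW (i := 10) (by omega) _).trans ⟨fun _ _ _ _ _ => rfl, fun a ha => ?_,
        fun _ _ => rfl⟩
      simp only [Instr.next, hv, Int.toNat_natCast]
      exact Function.update_of_ne (ha _) _ _
    · simp [Instr.next, Memory.setW]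
  | cast i j =>
    refine ⟨1, by omega, _, .instr (.cast (16 + i) (16 + j)) τ ?_, ⟨sim.wreg, ?_, sim.wmem,
      sim.rmem, hbd.1, hbd.2⟩, ⟨fun _ _ _ _ _ => rfl, fun _ _ => rfl, fun _ _ => rfl⟩, rfl⟩
    · simp only [Instr.Ok, sim.wreg j hN.2]
      exact fit.sub ok
    · simp only [Instr.next, sim.wreg j hN.2]
      exact update_shift _ _ _ _ sim.rreg
  | rop o i j k =>
    obtain ⟨hi, hj, hk⟩ := hN
    refine ⟨1, by omega, _, .instr (.rop o (16 + i) (16 + j) (16 + k)) τ ?_, ⟨sim.wreg, ?_, sim.wmem,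
      sim.rmem, hbd.1, hbd.2⟩, ⟨fun _ _ _ _ _ => rfl, fun _ _ => rfl, fun _ _ => rfl⟩, rfl⟩
    · simp only [Instr.Ok, sim.rreg j hj, sim.rreg k hk]
      exact fit.sub ok
    · simp only [Instr.next, sim.rreg j hj, sim.rreg k hk]
      exact update_shift _ _ _ _ sim.rreg
  | rload i j =>
    obtain ⟨t, ht, he⟩ := addr j hN.2
    have hv : (τ.setW 10 ((base + ((σ.wreg j).toNat * r + s) : ℕ) : ℤ)).wreg 10
        = ((base + ((σ.wreg j).toNat * r + s) : ℕ) : ℤ) := by simp [Memory.setW]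
    have h10 := sim_setW sim (i := 10) (by omega) ((base + ((σ.wreg j).toNat * r + s) : ℕ) : ℤ)
    refine ⟨t + 1, by omega, _, .seq he (.instr (.rload (16 + i) 10) _ trivial), ?_, ?_, ?_⟩
    · refine ⟨h10.wreg, ?_, sim.wmem, sim.rmem, hbd.1, hbd.2⟩
      simp only [Instr.next, hv, Int.toNat_natCast]
      rw [h10.rmem]
      exact update_shift _ _ _ _ h10.rreg
    · exact (frame_setW (i := 10) (by omega) _).trans
        ⟨fun _ _ _ _ _ => rfl, fun _ _ => rfl, fun _ _ => rfl⟩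
    · simp [Instr.next, Memory.setW]
  | rstore i j =>
    obtain ⟨t, ht, he⟩ := addr i hN.1
    have hv : (τ.setW 10 ((base + ((σ.wreg i).toNat * r + s) : ℕ) : ℤ)).wreg 10
        = ((base + ((σ.wreg i).toNat * r + s) : ℕ) : ℤ) := by simp [Memory.setW]
    have h10 := sim_setW sim (i := 10) (by omega) ((base + ((σ.wreg i).toNat * r + s) : ℕ) : ℤ)
    refine ⟨t + 1, by omega, _, .seq he (.instr (.rstore 10 (16 + j)) _ trivial), ?_, ?_, ?_⟩
    · refine ⟨h10.wreg, sim.rreg, sim.wmem, ?_, hbd.1, hbd.2⟩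
      simp only [Instr.next, hv, Int.toNat_natCast]
      rw [h10.rreg j hN.2]
      exact update_slot hs _ _ _ _ h10.rmem
    · refine (frame_setW (i := 10) (by omega) _).trans ⟨fun _ _ _ _ _ => rfl, fun _ _ => rfl,
        fun a ha => ?_⟩
      simp only [Instr.next, hv, Int.toNat_natCast]
      exact Function.update_of_ne (ha _) _ _
    · simp [Instr.next, Memory.setW]

theorem Sim.test {σ τ : Memory} (sim : Sim N B base r s σ τ) {c : Test} (hc : c.Below N) :
    c.host.Holds τ ↔ c.Holds σ := by
  cases c with
  | wle i j => simp only [Test.host, Test.Holds, sim.wreg i hc.1, sim.wreg j hc.2]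
  | rle i j => simp only [Test.host, Test.Holds, sim.rreg i hc.1, sim.rreg j hc.2]

theorem exec_tick (_ : Fits W W' B base r s A A') {τ : Memory} (hh : Host base r s τ) {n : ℕ}
    (hn : τ.wreg 8 = (n : ℤ) + 1) (hnW : n ≤ W') :
    Exec W' A' tick τ 1 (τ.setW 8 n) := by
  have := Exec.instr (W := W') (A := A') (.wop .sub 8 8 3) τ (by
    simp only [Instr.Ok, WordOp.eval, hn, hh.one]
    rw [add_sub_cancel_right, abs_of_nonneg (by positivity)]
    exact_mod_cast hnW)
  simpa [tick, Instr.next, WordOp.eval, hn, hh.one, Memory.setW] using this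

theorem exec_guarded_skip {τ : Memory} (hh : Host base r s τ) (hn : τ.wreg 8 = 0) (p : Prog) :
    Exec W' A' (guarded p) τ 2 τ :=
  .ite_true (by simp [Test.Holds, hn, hh.zero]) (.skip τ)

theorem exec_guarded {τ τ' : Memory} (hh : Host base r s τ) {n : ℕ} (hn : τ.wreg 8 = (n : ℤ) + 1)
    {p : Prog} {t : ℕ} (h : Exec W' A' p τ t τ') : Exec W' A' (guarded p) τ (1 + t) τ' :=
  .ite_false (by simp only [Test.Holds, hn, hh.zero]; omega) h

/-- Setting the flag. -/
theorem exec_setFlag (fit : Fits W W' B base r s A A') {τ : Memory} (hh : Host base r s τ)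
    {c : Test} : ∃ t ≤ 5, ∃ z : ℤ, Exec W' A' (setFlag c.host) τ t (τ.setW 9 z) ∧
      (1 ≤ z ↔ (0 < τ.wreg 8 ∧ c.host.Holds τ)) := by
  have hW' : (1 : ℤ) ≤ W' := by exact_mod_cast (by have := fit.room; omega : 1 ≤ W')
  have h0 : Exec W' A' (.instr (.const 9 0)) τ 1 (τ.setW 9 0) :=
    .instr (.const 9 0) τ (by simp [Instr.Ok])
  have hc : c.host.Holds (τ.setW 9 0) ↔ c.host.Holds τ := by
    cases c with
    | wle i j => simp [Test.host, Test.Holds, Memory.setW, Function.update_of_ne (show 16 + i ≠ 9 by omega),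
        Function.update_of_ne (show 16 + j ≠ 9 by omega)]
    | rle i j => simp [Test.host, Test.Holds, Memory.setW]
  have h8 : (τ.setW 9 0).wreg 8 = τ.wreg 8 := by simp [Memory.setW]
  have h2 : (τ.setW 9 0).wreg 2 = 0 := by simp [Memory.setW, hh.zero]
  by_cases hb : τ.wreg 8 ≤ 0
  · refine ⟨_, ?_, 0, .seq h0 (.ite_true ?_ (.skip _)), ?_⟩
    · omega
    · simpa only [Test.Holds, h8, h2] using hb
    · constructor
      · intro h; omega
      · rintro ⟨h, -⟩; omega
  · by_cases ht : c.host.Holds τ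
    · refine ⟨1 + (1 + (1 + 1)), ?_, 1, .seq h0 (.ite_false ?_ (.ite_true (hc.2 ht) ?_)), ?_⟩
      · omega
      · simpa only [Test.Holds, h8, h2] using hb
      · have := Exec.instr (W := W') (A := A') (.const 9 1) (τ.setW 9 0) (by simpa [Instr.Ok] using hW')
        simpa [Instr.next, Memory.setW] using this
      · simp only [le_refl, true_iff]; exact ⟨by omega, ht⟩
    · refine ⟨_, ?_, 0, .seq h0 (.ite_false ?_ (.ite_false (fun h => ht (hc.1 h)) (.skip _))), ?_⟩
      · omega
      · simpa only [Test.Holds, h8, h2] using hb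
      · constructor
        · intro h; omega
        · rintro ⟨-, h⟩; exact absurd h ht

theorem setW_wreg_ne {τ : Memory} {i k : ℕ} {z : ℤ} (h : k ≠ i) : (τ.setW i z).wreg k = τ.wreg k :=
  Function.update_of_ne h _ _

theorem setW_wreg_self {τ : Memory} {i : ℕ} {z : ℤ} : (τ.setW i z).wreg i = z :=
  Function.update_self ..

/-- Without a budget nothing happens. -/
theorem exec_host_exhausted (fit : Fits W W' B base r s A A') (p : Prog) {τ : Memory}
    (hh : Host base r s τ) (hn : τ.wreg 8 = 0) :
    ∃ t ≤ p.hostCost, ∃ τ', Exec W' A' p.host τ t τ' ∧ Frame base r s τ τ' ∧ τ'.wreg 8 = 0 := by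
  induction p generalizing τ with
  | skip => exact ⟨2, by simp [Prog.hostCost], τ, exec_guarded_skip hh hn _, .refl .., hn⟩
  | instr a => exact ⟨2, by simp [Prog.hostCost], τ, exec_guarded_skip hh hn _, .refl .., hn⟩
  | ite c p q => exact ⟨2, by simp only [Prog.hostCost]; omega, τ, exec_guarded_skip hh hn _, .refl .., hn⟩
  | seq p q ihp ihq =>
    obtain ⟨t₁, h₁, τ₁, e₁, f₁, n₁⟩ := ihp hh hn
    obtain ⟨t₂, h₂, τ₂, e₂, f₂, n₂⟩ := ihq (f₁.host hh) n₁
    exact ⟨t₁ + t₂, by simp only [Prog.hostCost]; omega, τ₂, .seq e₁ e₂, f₁.trans f₂, n₂⟩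
  | _ c p ihp =>
    obtain ⟨t, ht, z, he, hz⟩ := exec_setFlag fit hh (c := c)
    have hf : Frame base r s τ (τ.setW 9 z) := frame_setW (by omega) z
    have h8 : (τ.setW 9 z).wreg 8 = 0 := by rw [setW_wreg_ne (by omega), hn]
    refine ⟨_, ?_, _, .seq he (.seq (.while_false ?_) (exec_guarded_skip (hf.host hh) h8 _)), hf, h8⟩
    · simp only [Prog.hostCost]; omega
    · simp only [Test.Holds, (hf.host hh).one, setW_wreg_self, hz, hn]
      omega

/-- Induction on the run: every charged step of the simulated program is matched by one tick of the
budget. As long as the budget suffices the two states correspond; afterwards only the frame and the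
empty budget matter. In the cost, the first term pays for the ticks and the second one for passing
through the code without a budget. -/
theorem exec_host (fit : Fits W W' B base r s A A') {p : Prog} {σ σ' : Memory} {t : ℕ}
    (h : Exec W A p σ t σ') (hN : p.Below N) {τ : Memory} (sim : Sim N B base r s σ τ)
    (hh : Host base r s τ) {n : ℕ} (hn : τ.wreg 8 = n) (hnW : n ≤ W') :
    ∃ t' ≤ p.hostCost * min t n + p.hostCost, ∃ τ', Exec W' A' p.host τ t' τ' ∧
      Frame base r s τ τ' ∧
      (t ≤ n → Sim N B base r s σ' τ' ∧ τ'.wreg 8 = (n : ℤ) - t) ∧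
      (n < t → τ'.wreg 8 = 0) := by
  induction h generalizing τ n with
  | skip σ =>
    rcases Nat.eq_zero_or_pos n with rfl | hpos
    · obtain ⟨t', ht', τ', e, f, h8⟩ := exec_host_exhausted fit .skip hh hn
      exact ⟨t', by omega, τ', e, f, by omega, fun _ => h8⟩
    · obtain ⟨m, rfl⟩ : ∃ m, n = m + 1 := ⟨n - 1, by omega⟩
      refine ⟨_, ?_, _, exec_guarded hh (by exact_mod_cast hn)
        (exec_tick fit hh (n := m) (by exact_mod_cast hn) (by omega)), frame_setW (by omega) _,
        fun _ => ⟨sim_setW sim (by omega) _, ?_⟩, by omega⟩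
      · simp only [Prog.hostCost]; omega
      · rw [setW_wreg_self]; push_cast; ring
  | instr a σ ok =>
    rcases Nat.eq_zero_or_pos n with rfl | hpos
    · obtain ⟨t', ht', τ', e, f, h8⟩ := exec_host_exhausted fit (.instr a) hh hn
      exact ⟨t', by omega, τ', e, f, by omega, fun _ => h8⟩
    · obtain ⟨m, rfl⟩ : ∃ m, n = m + 1 := ⟨n - 1, by omega⟩
      have hf : Frame base r s τ (τ.setW 8 m) := frame_setW (by omega) _
      obtain ⟨t', ht', τ', e, sim', f, h8⟩ := exec_instr_host fit
        (sim_setW sim (i := 8) (by omega) (m : ℤ)) (hf.host hh) hN ok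
      refine ⟨_, ?_, τ', exec_guarded hh (by exact_mod_cast hn)
        (.seq (exec_tick fit hh (n := m) (by exact_mod_cast hn) (by omega)) e), hf.trans f,
        fun _ => ⟨sim', ?_⟩, by omega⟩
      · simp only [Prog.hostCost]; omega
      · rw [h8, setW_wreg_self]; push_cast; ring
  | @seq p q σ σ₁ σ₂ t₁ t₂ h₁ h₂ ih₁ ih₂ =>
    obtain ⟨t₁', b₁, τ₁, e₁, f₁, s₁, x₁⟩ := ih₁ hN.1 sim hh hn hnW
    have hcost : (Prog.seq p q).hostCost = p.hostCost + q.hostCost := rfl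
    by_cases hle : t₁ ≤ n
    · obtain ⟨sim₁, n₁⟩ := s₁ hle
      obtain ⟨t₂', b₂, τ₂, e₂, f₂, s₂, x₂⟩ := ih₂ hN.2 sim₁ (f₁.host hh) (n := n - t₁)
        (by rw [n₁]; omega) (by omega)
      refine ⟨_, ?_, τ₂, .seq e₁ e₂, f₁.trans f₂, fun h => ?_, fun h => x₂ (by omega)⟩
      · have e : min (t₁ + t₂) n = min t₁ n + min t₂ (n - t₁) := by omega
        rw [hcost, e]
        nlinarith [Nat.zero_le (p.hostCost * min t₂ (n - t₁)), Nat.zero_le (q.hostCost * min t₁ n)]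
      · obtain ⟨a, b⟩ := s₂ (by omega)
        exact ⟨a, by rw [b]; push_cast; omega⟩
    · obtain ⟨t₂', b₂, τ₂, e₂, f₂, n₂⟩ := exec_host_exhausted fit q (f₁.host hh) (x₁ (by omega))
      refine ⟨_, ?_, τ₂, .seq e₁ e₂, f₁.trans f₂, fun h => by omega, fun h => n₂⟩
      have e : min (t₁ + t₂) n = min t₁ n := by omega
      rw [hcost, e]
      nlinarith [Nat.zero_le (q.hostCost * min t₁ n)]
  | @ite_true c p q σ σ₁ t hc h ih =>
    rcases Nat.eq_zero_or_pos n with rfl | hpos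
    · obtain ⟨t', ht', τ', e, f, h8⟩ := exec_host_exhausted fit (.ite c p q) hh hn
      exact ⟨t', by omega, τ', e, f, by omega, fun _ => h8⟩
    · obtain ⟨m, rfl⟩ : ∃ m, n = m + 1 := ⟨n - 1, by omega⟩
      have hf : Frame base r s τ (τ.setW 8 m) := frame_setW (by omega) _
      have sim₁ := sim_setW sim (i := 8) (by omega) (m : ℤ)
      obtain ⟨t₂', b₂, τ₂, e₂, f₂, s₂, x₂⟩ := ih hN.2.1 sim₁ (hf.host hh) (n := m)
        setW_wreg_self (by omega)
      refine ⟨_, ?_, τ₂, exec_guarded hh (by exact_mod_cast hn)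
        (.seq (exec_tick fit hh (n := m) (by exact_mod_cast hn) (by omega))
          (.ite_true ((sim₁.test hN.1).2 hc) e₂)), hf.trans f₂, fun h => ?_, fun h => x₂ (by omega)⟩
      · have e : min (1 + t) (m + 1) = min t m + 1 := by omega
        simp only [Prog.hostCost]
        rw [e]
        generalize min t m = K at b₂ ⊢
        nlinarith [Nat.zero_le (q.hostCost * K), Nat.zero_le K, Nat.zero_le p.hostCost,
          Nat.zero_le q.hostCost]
      · obtain ⟨a, b⟩ := s₂ (by omega)
        exact ⟨a, by rw [b]; push_cast; omega⟩
  | @ite_false c p q σ σ₁ t hc h ih =>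
    rcases Nat.eq_zero_or_pos n with rfl | hpos
    · obtain ⟨t', ht', τ', e, f, h8⟩ := exec_host_exhausted fit (.ite c p q) hh hn
      exact ⟨t', by omega, τ', e, f, by omega, fun _ => h8⟩
    · obtain ⟨m, rfl⟩ : ∃ m, n = m + 1 := ⟨n - 1, by omega⟩
      have hf : Frame base r s τ (τ.setW 8 m) := frame_setW (by omega) _
      have sim₁ := sim_setW sim (i := 8) (by omega) (m : ℤ)
      obtain ⟨t₂', b₂, τ₂, e₂, f₂, s₂, x₂⟩ := ih hN.2.2 sim₁ (hf.host hh) (n := m)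
        setW_wreg_self (by omega)
      refine ⟨_, ?_, τ₂, exec_guarded hh (by exact_mod_cast hn)
        (.seq (exec_tick fit hh (n := m) (by exact_mod_cast hn) (by omega))
          (.ite_false (fun hc' => hc ((sim₁.test hN.1).1 hc')) e₂)), hf.trans f₂, fun h => ?_,
          fun h => x₂ (by omega)⟩
      · have e : min (1 + t) (m + 1) = min t m + 1 := by omega
        simp only [Prog.hostCost]
        rw [e]
        generalize min t m = K at b₂ ⊢
        nlinarith [Nat.zero_le (p.hostCost * K), Nat.zero_le K, Nat.zero_le p.hostCost,
          Nat.zero_le q.hostCost]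
      · obtain ⟨a, b⟩ := s₂ (by omega)
        exact ⟨a, by rw [b]; push_cast; omega⟩
  | @while_false c p σ hc =>
    rcases Nat.eq_zero_or_pos n with rfl | hpos
    · obtain ⟨t', ht', τ', e, f, h8⟩ := exec_host_exhausted fit (.while c p) hh hn
      exact ⟨t', by omega, τ', e, f, by omega, fun _ => h8⟩
    · obtain ⟨m, rfl⟩ : ∃ m, n = m + 1 := ⟨n - 1, by omega⟩
      obtain ⟨t, ht, z, he, hz⟩ := exec_setFlag fit hh (c := c)
      have hf : Frame base r s τ (τ.setW 9 z) := frame_setW (by omega) z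
      have h8 : (τ.setW 9 z).wreg 8 = (m : ℤ) + 1 := by
        rw [setW_wreg_ne (by omega), hn]; push_cast; ring
      refine ⟨_, ?_, _, .seq he (.seq (.while_false ?_) (exec_guarded (hf.host hh) h8
        (exec_tick fit (hf.host hh) h8 (by omega)))), hf.trans (frame_setW (by omega) _),
        fun _ => ⟨sim_setW (sim_setW sim (by omega) _) (by omega) _, ?_⟩, by omega⟩
      · simp only [Prog.hostCost]; omega
      · simp only [Test.Holds, (hf.host hh).one, setW_wreg_self]
        exact fun h => hc ((sim.test hN.1).1 (hz.1 h).2)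
      · rw [setW_wreg_self]; push_cast; ring
  | @while_true c p σ σ₁ σ₂ t₁ t₂ hc h₁ h₂ ih₁ ih₂ =>
    rcases Nat.eq_zero_or_pos n with rfl | hpos
    · obtain ⟨t', ht', τ', e, f, h8⟩ := exec_host_exhausted fit (.while c p) hh hn
      exact ⟨t', by omega, τ', e, f, by omega, fun _ => h8⟩
    · obtain ⟨m, rfl⟩ : ∃ m, n = m + 1 := ⟨n - 1, by omega⟩
      obtain ⟨t, ht, z, he, hz⟩ := exec_setFlag fit hh (c := c)
      have hf : Frame base r s τ (τ.setW 9 z) := frame_setW (by omega) z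
      have h8 : (τ.setW 9 z).wreg 8 = (m : ℤ) + 1 := by
        rw [setW_wreg_ne (by omega), hn]; push_cast; ring
      have hz1 : 1 ≤ z := hz.2 ⟨by omega, (sim.test hN.1).2 hc⟩
      have hf' : Frame base r s τ ((τ.setW 9 z).setW 8 m) := hf.trans (frame_setW (by omega) _)
      have sim' : Sim N B base r s σ ((τ.setW 9 z).setW 8 m) :=
        sim_setW (sim_setW sim (by omega) _) (by omega) _
      have tk := exec_tick fit (hf.host hh) h8 (by omega)
      obtain ⟨t₁', b₁, τ₁, e₁, f₁, s₁, x₁⟩ := ih₁ hN.2 sim' (hf'.host hh) (n := m)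
        setW_wreg_self (by omega)
      have hwcost : (Prog.while c p).hostCost = 2 * p.hostCost + 20 := rfl
      have key : ∃ t₂' ≤ (Prog.while c p).hostCost * (min (1 + t₁ + t₂) (m + 1) - (min t₁ m + 1)) +
          (Prog.while c p).hostCost, ∃ τ', Exec W' A' (Prog.while c p).host τ₁ t₂' τ' ∧
          Frame base r s τ₁ τ' ∧ (1 + t₁ + t₂ ≤ m + 1 → Sim N B base r s σ₂ τ' ∧
            τ'.wreg 8 = ((m + 1 : ℕ) : ℤ) - ((1 + t₁ + t₂ : ℕ) : ℤ)) ∧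
            (m + 1 < 1 + t₁ + t₂ → τ'.wreg 8 = 0) := by
        by_cases hle : t₁ ≤ m
        · obtain ⟨sim₁, n₁⟩ := s₁ hle
          obtain ⟨t₂', b₂, τ₂, e₂, f₂, s₂, x₂⟩ := ih₂ hN sim₁ (f₁.host (hf'.host hh)) (n := m - t₁)
            (by rw [n₁]; omega) (by omega)
          refine ⟨t₂', ?_, τ₂, e₂, f₂, fun h => ?_, fun h => x₂ (by omega)⟩
          · rwa [show min (1 + t₁ + t₂) (m + 1) - (min t₁ m + 1) = min t₂ (m - t₁) by omega]
          · obtain ⟨a, b⟩ := s₂ (by omega)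
            exact ⟨a, by rw [b]; push_cast; omega⟩
        · obtain ⟨t₂', b₂, τ₂, e₂, f₂, n₂⟩ := exec_host_exhausted fit (.while c p)
            (f₁.host (hf'.host hh)) (x₁ (by omega))
          exact ⟨t₂', by omega, τ₂, e₂, f₂, fun h => by omega, fun h => n₂⟩
      obtain ⟨t₂', b₂, τ₂, e₂, f₂, s₂, x₂⟩ := key
      -- The run obtained for the remaining iterations starts by setting the flag. That piece
      -- belongs to the end of the loop body of the present iteration, so the run is taken apart and
      -- regrouped.
      cases e₂ with
      | @seq _ _ _ ρ _ u₁ u₂ g₁ g₂ =>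
        cases g₂ with
        | @seq _ _ _ ρ' _ v₁ v₂ k₁ k₂ =>
          refine ⟨_, ?_, τ₂, .seq he (.seq (.while_true ?_ (.seq tk (.seq e₁ g₁)) k₁) k₂),
            hf'.trans (f₁.trans f₂), s₂, x₂⟩
          · have hm : min t₁ m + 1 ≤ min (1 + t₁ + t₂) (m + 1) := by omega
            obtain ⟨D, hD⟩ : ∃ D, min (1 + t₁ + t₂) (m + 1) = D + (min t₁ m + 1) :=
              ⟨_, (Nat.sub_add_cancel hm).symm⟩
            rw [hD] at b₂ ⊢
            rw [Nat.add_sub_cancel] at b₂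
            rw [hwcost] at b₂ ⊢
            generalize min t₁ m = K at b₁ ⊢
            nlinarith [Nat.zero_le (p.hostCost * K), Nat.zero_le K, Nat.zero_le p.hostCost]
          · simpa only [Test.Holds, (hf.host hh).one, setW_wreg_self] using hz1

end Simulation
end
end FineGrained

namespace FineGrained
noncomputable section

/-! ## Evaluation of expressions -/

/-- No bitwise operations. -/
def WordExpr.Arith : WordExpr → Prop
  | .cell e => e.Arith
  | .op o e₁ e₂ => (o = .add ∨ o = .sub ∨ o = .mul ∨ o = .div ∨ o = .mod) ∧ e₁.Arith ∧ e₂.Arith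
  | .ite a b e₁ e₂ => a.Arith ∧ b.Arith ∧ e₁.Arith ∧ e₂.Arith
  | _ => True

/-- All intermediate values have absolute value at most `W`. -/
def WordExpr.Bounded (W : ℕ) (x : Input) (s j : ℤ) : WordExpr → Prop
  | .const z => |z| ≤ W
  | .par => |s| ≤ W
  | .pos => |j| ≤ W
  | .wlen => (x.words.length : ℤ) ≤ W
  | .rlen => (x.reals.length : ℤ) ≤ W
  | .cell e => e.Bounded W x s j ∧ |(WordExpr.cell e).eval x s j| ≤ W
  | .op o e₁ e₂ => e₁.Bounded W x s j ∧ e₂.Bounded W x s j ∧ |(WordExpr.op o e₁ e₂).eval x s j| ≤ W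
  | .ite a b e₁ e₂ =>
    a.Bounded W x s j ∧ b.Bounded W x s j ∧ e₁.Bounded W x s j ∧ e₂.Bounded W x s j

theorem WordExpr.Bounded.abs_le {W : ℕ} {x : Input} {s j : ℤ} {e : WordExpr}
    (h : e.Bounded W x s j) : |e.eval x s j| ≤ W := by
  induction e with
  | const z => exact h
  | par => exact h
  | pos => exact h
  | wlen => rw [WordExpr.eval, abs_of_nonneg (by positivity)]; exact h
  | rlen => rw [WordExpr.eval, abs_of_nonneg (by positivity)]; exact h
  | cell e _ => exact h.2
  | op o e₁ e₂ _ _ => exact h.2.2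
  | ite a b e₁ e₂ _ _ ih₁ ih₂ =>
    simp only [WordExpr.eval]
    split_ifs
    exacts [ih₁ h.2.2.1, ih₂ h.2.2.2]

theorem WordExpr.Bounded.mono {W W' : ℕ} (hW : W ≤ W') {x : Input} {s j : ℤ} {e : WordExpr}
    (h : e.Bounded W x s j) : e.Bounded W' x s j := by
  have hW' : (W : ℤ) ≤ W' := by exact_mod_cast hW
  induction e with
  | const z => exact le_trans (show |z| ≤ (W : ℤ) from h) hW'
  | par => exact le_trans (show |s| ≤ (W : ℤ) from h) hW'
  | pos => exact le_trans (show |j| ≤ (W : ℤ) from h) hW'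
  | wlen => exact le_trans (show (x.words.length : ℤ) ≤ W from h) hW'
  | rlen => exact le_trans (show (x.reals.length : ℤ) ≤ W from h) hW'
  | cell e ih => exact ⟨ih h.1, h.2.trans hW'⟩
  | op o e₁ e₂ ih₁ ih₂ => exact ⟨ih₁ h.1, ih₂ h.2.1, h.2.2.trans hW'⟩
  | ite a b e₁ e₂ iha ihb ih₁ ih₂ => exact ⟨iha h.1, ihb h.2.1, ih₁ h.2.2.1, ih₂ h.2.2.2⟩

/-- Arithmetic operations at most double the exponent and add one. Together with the absence of
bitwise operations this keeps all values of an expression polynomial. -/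
theorem abs_wordOp_le {o : WordOp} (ho : o = .add ∨ o = .sub ∨ o = .mul ∨ o = .div ∨ o = .mod)
    {D k : ℕ} (hD : 2 ≤ D) {a b : ℤ} (ha : |a| ≤ (D ^ k : ℕ)) (hb : |b| ≤ (D ^ k : ℕ)) :
    |o.eval a b| ≤ (D ^ (2 * k + 1) : ℕ) := by
  have hD1 : (1 : ℤ) ≤ (D ^ k : ℕ) := by exact_mod_cast Nat.one_le_pow _ _ (by omega)
  have e : ((D ^ (2 * k + 1) : ℕ) : ℤ) = D * ((D ^ k : ℕ) * (D ^ k : ℕ)) := by push_cast; ring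
  have hD2 : (2 : ℤ) ≤ D := by exact_mod_cast hD
  rw [e]
  generalize ((D ^ k : ℕ) : ℤ) = K at *
  have hKK : K ≤ K * K := by nlinarith
  have h2 : 2 * (K * K) ≤ D * (K * K) := by nlinarith
  have hsum : |a| + |b| ≤ D * (K * K) := by linarith
  rcases ho with rfl | rfl | rfl | rfl | rfl <;> simp only [WordOp.eval]
  · exact (abs_add_le a b).trans hsum
  · exact (abs_sub a b).trans hsum
  · rw [abs_mul]
    nlinarith [mul_le_mul ha hb (abs_nonneg b) (by linarith)]
  · have := Int.abs_ediv_le_abs a b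
    linarith [abs_nonneg b]
  · by_cases hb0 : b = 0
    · subst hb0; simp only [Int.emod_zero]; linarith [abs_nonneg (0 : ℤ)]
    · have h1 := Int.emod_nonneg a hb0
      have h3 := Int.emod_lt_abs a hb0
      rw [abs_of_nonneg h1]
      linarith [abs_nonneg a]

/-- The exponent depends on the expression only, so one word size suffices for its evaluation on all
inputs, parameters and positions. -/
theorem WordExpr.Arith.exists_bounded {e : WordExpr} (he : e.Arith) (b₀ : ℕ) :
    ∃ b, ∀ (x : Input) (s j : ℤ) (D : ℕ), 2 ≤ D → x.size ≤ D → (∀ w ∈ x.words, |w| ≤ (D ^ b₀ : ℕ)) →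
      |s| ≤ (D ^ b₀ : ℕ) → |j| ≤ (D ^ b₀ : ℕ) → e.Bounded (D ^ b) x s j := by
  have mono : ∀ {D m n : ℕ}, 2 ≤ D → m ≤ n → D ^ m ≤ D ^ n := fun hD h =>
    Nat.pow_le_pow_right (by omega) h
  induction e with
  | const z =>
    refine ⟨z.natAbs, fun x s j D hD _ _ _ _ => ?_⟩
    have h1 : z.natAbs < D ^ z.natAbs := Nat.lt_pow_self (by omega)
    show |z| ≤ _
    rw [Int.abs_eq_natAbs]
    exact_mod_cast h1.le
  | par => exact ⟨b₀, fun x s j D hD _ _ hs _ => hs⟩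
  | pos => exact ⟨b₀, fun x s j D hD _ _ _ hj => hj⟩
  | wlen =>
    refine ⟨1, fun x s j D hD hx _ _ _ => ?_⟩
    show (x.words.length : ℤ) ≤ (D ^ 1 : ℕ)
    rw [pow_one]
    exact_mod_cast (by unfold Input.size at hx; omega : x.words.length ≤ D)
  | rlen =>
    refine ⟨1, fun x s j D hD hx _ _ _ => ?_⟩
    show (x.reals.length : ℤ) ≤ (D ^ 1 : ℕ)
    rw [pow_one]
    exact_mod_cast (by unfold Input.size at hx; omega : x.reals.length ≤ D)
  | cell e ih =>
    obtain ⟨b, hb⟩ := ih he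
    refine ⟨b + b₀, fun x s j D hD hx hw hs hj =>
      ⟨(hb x s j D hD hx hw hs hj).mono (mono hD (by omega)), ?_⟩⟩
    simp only [WordExpr.eval]
    have h1 : ((D ^ b₀ : ℕ) : ℤ) ≤ (D ^ (b + b₀) : ℕ) := by exact_mod_cast mono hD (by omega)
    refine le_trans ?_ h1
    by_cases hi : (e.eval x s j).toNat < x.words.length
    · rw [List.getD_eq_getElem _ _ hi]
      exact hw _ (List.getElem_mem hi)
    · rw [List.getD_eq_default _ _ (by omega)]
      simp
  | op o e₁ e₂ ih₁ ih₂ =>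
    obtain ⟨ho, h₁, h₂⟩ := he
    obtain ⟨b₁, hb₁⟩ := ih₁ h₁
    obtain ⟨b₂, hb₂⟩ := ih₂ h₂
    refine ⟨2 * (b₁ + b₂) + 1, fun x s j D hD hx hw hs hj =>
      ⟨(hb₁ x s j D hD hx hw hs hj).mono (mono hD (by omega)),
        (hb₂ x s j D hD hx hw hs hj).mono (mono hD (by omega)), ?_⟩⟩
    exact abs_wordOp_le ho hD
      ((hb₁ x s j D hD hx hw hs hj).mono (mono hD (by omega))).abs_le
      ((hb₂ x s j D hD hx hw hs hj).mono (mono hD (by omega))).abs_le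
  | ite a b e₁ e₂ iha ihb ih₁ ih₂ =>
    obtain ⟨ba, ha⟩ := iha he.1
    obtain ⟨bb, hb⟩ := ihb he.2.1
    obtain ⟨b₁, hb₁⟩ := ih₁ he.2.2.1
    obtain ⟨b₂, hb₂⟩ := ih₂ he.2.2.2
    exact ⟨ba + bb + b₁ + b₂, fun x s j D hD hx hw hs hj =>
      ⟨(ha x s j D hD hx hw hs hj).mono (mono hD (by omega)),
        (hb x s j D hD hx hw hs hj).mono (mono hD (by omega)),
        (hb₁ x s j D hD hx hw hs hj).mono (mono hD (by omega)),
        (hb₂ x s j D hD hx hw hs hj).mono (mono hD (by omega))⟩⟩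

/-- Code that computes the value of an expression into register `d`. -/
def WordExpr.code : WordExpr → ℕ → Prog
  | .const z, d => .instr (.const d z)
  | .par, d => .instr (.wop .add d 6 2)
  | .pos, d => .instr (.wop .add d 7 2)
  | .wlen, d => .instr (.wop .add d 4 2)
  | .rlen, d => .instr (.const d 0)
  | .cell e, d => .seq (e.code d) (.seq (.ite (.wle d 2) (.instr (.const d 0)) .skip)
      (.ite (.wle 4 d) (.instr (.const d 0)) (.instr (.wload d d))))
  | .op o e₁ e₂, d => .seq (e₁.code d) (.seq (e₂.code (d + 1)) (.instr (.wop o d d (d + 1))))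
  | .ite a b e₁ e₂, d => .seq (a.code d) (.seq (b.code (d + 1))
      (.ite (.wle d (d + 1)) (e₁.code d) (e₂.code d)))

def WordExpr.codeCost : WordExpr → ℕ
  | .cell e => e.codeCost + 4
  | .op _ e₁ e₂ => e₁.codeCost + (e₂.codeCost + 1)
  | .ite a b e₁ e₂ => a.codeCost + (b.codeCost + (1 + (e₁.codeCost + e₂.codeCost)))
  | _ => 1

/-- Only word registers from `d` on differ. -/
structure SameBelow (d : ℕ) (τ τ' : Memory) : Prop where
  wreg : ∀ i < d, τ'.wreg i = τ.wreg i
  rreg : τ'.rreg = τ.rreg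
  wmem : τ'.wmem = τ.wmem
  rmem : τ'.rmem = τ.rmem

theorem SameBelow.trans {d d' : ℕ} (hd : d ≤ d') {τ₁ τ₂ τ₃ : Memory} (h : SameBelow d τ₁ τ₂)
    (h' : SameBelow d' τ₂ τ₃) : SameBelow d τ₁ τ₃ :=
  ⟨fun i hi => (h'.wreg i (by omega)).trans (h.wreg i hi), h'.rreg.trans h.rreg,
    h'.wmem.trans h.wmem, h'.rmem.trans h.rmem⟩

theorem sameBelow_setW {d i : ℕ} (hi : d ≤ i) (τ : Memory) (z : ℤ) : SameBelow d τ (τ.setW i z) :=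
  ⟨fun _ hk => setW_wreg_ne (by omega), rfl, rfl, rfl⟩

/-- The host state is ready for the evaluation of expressions. -/
structure EvalReady (x : Input) (s j : ℤ) (τ : Memory) : Prop where
  zero : τ.wreg 2 = 0
  wlen : τ.wreg 4 = x.words.length
  par : τ.wreg 6 = s
  pos : τ.wreg 7 = j
  cells : ∀ a < x.words.length, τ.wmem a = x.words.getD a 0
  reals : x.reals = []

theorem SameBelow.evalReady {d : ℕ} (hd : 16 ≤ d) {x : Input} {s j : ℤ} {τ τ' : Memory}
    (h : SameBelow d τ τ') (hr : EvalReady x s j τ) : EvalReady x s j τ' :=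
  ⟨(h.wreg 2 (by omega)).trans hr.zero, (h.wreg 4 (by omega)).trans hr.wlen,
   (h.wreg 6 (by omega)).trans hr.par, (h.wreg 7 (by omega)).trans hr.pos,
   fun a ha => by rw [h.wmem]; exact hr.cells a ha, hr.reals⟩

theorem runs_const {W : ℕ} {A : Set ℝ} {i : ℕ} {z : ℤ} (hz : |z| ≤ W) {τ : Memory}
    {Q : Memory → Prop} (h : Q (τ.setW i z)) : Runs W A (.instr (.const i z)) τ 1 Q :=
  Runs.instr (a := .const i z) hz h

theorem runs_wop {W : ℕ} {A : Set ℝ} {o : WordOp} {i j k : ℕ} {τ : Memory} {z : ℤ}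
    (hv : o.eval (τ.wreg j) (τ.wreg k) = z) (hz : |z| ≤ W)
    {Q : Memory → Prop} (h : Q (τ.setW i z)) : Runs W A (.instr (.wop o i j k)) τ 1 Q := by
  subst hv
  exact Runs.instr (a := .wop o i j k) hz h

theorem runs_code {W : ℕ} {A : Set ℝ} {x : Input} {s j : ℤ} (e : WordExpr) {d : ℕ} (hd : 16 ≤ d)
    {τ : Memory} (hr : EvalReady x s j τ) (hb : e.Bounded W x s j) :
    Runs W A (e.code d) τ e.codeCost
      (fun τ' => τ'.wreg d = e.eval x s j ∧ SameBelow d τ τ') := by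
  induction e generalizing d τ with
  | const z => exact runs_const hb ⟨setW_wreg_self, sameBelow_setW le_rfl _ _⟩
  | par =>
    refine runs_wop (z := s) ?_ hb ⟨setW_wreg_self, sameBelow_setW le_rfl _ _⟩
    simp [WordOp.eval, hr.par, hr.zero]
  | pos =>
    refine runs_wop (z := j) ?_ hb ⟨setW_wreg_self, sameBelow_setW le_rfl _ _⟩
    simp [WordOp.eval, hr.pos, hr.zero]
  | wlen =>
    refine runs_wop (z := x.words.length) ?_ ?_ ⟨setW_wreg_self, sameBelow_setW le_rfl _ _⟩
    · simp [WordOp.eval, hr.wlen, hr.zero]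
    · rw [abs_of_nonneg (by positivity)]; exact hb
  -- Expressions are only evaluated on inputs without reals, where this length is `0`.
  | rlen => exact runs_const (by simp) ⟨by simp [WordExpr.eval, hr.reals, setW_wreg_self],
      sameBelow_setW le_rfl _ _⟩
  | cell e ih =>
    have hb0 : |(0 : ℤ)| ≤ W := by simp
    refine Runs.mono (T := e.codeCost + ((1 + 1) + (1 + 1))) (Runs.seq (ih hd hr hb.1)
      (Q := fun τ' => τ'.wreg d = (WordExpr.cell e).eval x s j ∧ SameBelow d τ τ')
      fun τ₁ h₁ => Runs.seq
      (Q₁ := fun τ₂ => τ₂.wreg d = ((e.eval x s j).toNat : ℤ) ∧ SameBelow d τ τ₂) ?_ ?_)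
      (by simp only [WordExpr.codeCost]; omega) fun _ h => h
    · have hr₁ := h₁.2.evalReady hd hr
      refine Runs.ite (fun hc => runs_const hb0 ⟨?_, h₁.2.trans le_rfl (sameBelow_setW le_rfl _ _)⟩)
        (fun hc => Runs.skip ⟨?_, h₁.2⟩)
      · simp only [Test.Holds, h₁.1, hr₁.zero] at hc
        rw [setW_wreg_self]; omega
      · simp only [Test.Holds, h₁.1, hr₁.zero] at hc
        rw [h₁.1]; omega
    -- Behind the input the host memory contains the slots, so a look-up out of range has to produce
    -- the default `0` explicitly.
    · intro τ₂ h₂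
      have hr₂ := h₂.2.evalReady hd hr
      refine Runs.ite (fun hc => runs_const hb0 ⟨?_, h₂.2.trans le_rfl (sameBelow_setW le_rfl _ _)⟩)
        (fun hc => Runs.instr trivial ⟨?_, h₂.2.trans le_rfl (sameBelow_setW le_rfl _ _)⟩)
      · simp only [Test.Holds, h₂.1, hr₂.wlen] at hc
        rw [setW_wreg_self]
        simp only [WordExpr.eval]
        rw [List.getD_eq_default _ _ (by omega)]
      · simp only [Test.Holds, h₂.1, hr₂.wlen] at hc
        simp only [Instr.next, Function.update_self, h₂.1, Int.toNat_natCast]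
        rw [hr₂.cells _ (by omega)]
        rfl
  | op o e₁ e₂ ih₁ ih₂ =>
    refine Runs.seq (ih₁ hd hr hb.1) fun τ₁ h₁ => Runs.seq
      (ih₂ (d := d + 1) (by omega) (h₁.2.evalReady hd hr) hb.2.1) fun τ₂ h₂ => ?_
    refine runs_wop ?_ hb.2.2 ⟨setW_wreg_self, ?_⟩
    · rw [h₂.1, h₂.2.wreg d (by omega), h₁.1]; rfl
    · exact (h₁.2.trans (by omega) h₂.2).trans le_rfl (sameBelow_setW le_rfl _ _)
  | ite a b e₁ e₂ iha ihb ih₁ ih₂ =>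
    obtain ⟨h1, h2, h3, h4⟩ := hb
    refine Runs.seq (iha hd hr h1) fun τ₁ k₁ => Runs.seq
      (ihb (d := d + 1) (by omega) (k₁.2.evalReady hd hr) h2) fun τ₂ k₂ => ?_
    have hs : SameBelow d τ τ₂ := k₁.2.trans (by omega) k₂.2
    have va : τ₂.wreg d = a.eval x s j := (k₂.2.wreg d (by omega)).trans k₁.1
    refine Runs.ite (fun hc => ?_) (fun hc => ?_) <;> simp only [Test.Holds, va, k₂.1] at hc
    · refine (ih₁ hd (hs.evalReady hd hr) h3).mono (by omega) fun τ₃ k₃ => ⟨?_, hs.trans le_rfl k₃.2⟩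
      rw [k₃.1]; simp [WordExpr.eval, hc]
    · refine (ih₂ hd (hs.evalReady hd hr) h4).mono (by omega) fun τ₃ k₃ => ⟨?_, hs.trans le_rfl k₃.2⟩
      rw [k₃.1]; simp [WordExpr.eval, hc]

end
end FineGrained

namespace FineGrained
noncomputable section

/-! ## Running a program on all instances produced by a reduction -/

/-- Set the simulated registers to zero. -/
def zeroRegs : ℕ → Prog
  | 0 => .skip
  | n + 1 => .seq (zeroRegs n) (.seq (.instr (.const (16 + n) 0)) (.instr (.cast (16 + n) 2)))

/-- Register `10` receives the host address of cell number `wreg 7` of the current slot. -/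
def slotCode : Prog :=
  .seq (.instr (.wop .mul 10 7 5)) (.seq (.instr (.wop .add 10 10 6)) (.instr (.wop .add 10 10 4)))

def writeWords (e : WordExpr) (E : ℕ) : Prog :=
  .while (.wle 7 13) (.seq (e.code E) (.seq slotCode
    (.seq (.instr (.wstore 10 E)) (.instr (.wop .add 7 7 3)))))

def writeReals (e : WordExpr) (E : ℕ) : Prog :=
  .while (.wle 7 14) (.seq (e.code E) (.seq (.instr (.cast 0 E)) (.seq slotCode
    (.seq (.instr (.rstore 10 0)) (.instr (.wop .add 7 7 3))))))

def clampCode (i k : ℕ) : Prog :=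
  .seq (.ite (.wle i 2) (.instr (.const i 0)) .skip)
    (.seq (.instr (.wop .add k i 2)) (.instr (.wop .sub i i 3)))

def prelude (nw nr : WordExpr) (N : ℕ) : Prog :=
  .seq (.instr (.const 7 0)) (.seq (nw.code (16 + N)) (.seq (.instr (.wop .add 13 (16 + N) 2))
    (.seq (nr.code (16 + N)) (.seq (.instr (.wop .add 14 (16 + N) 2))
      (.seq (zeroRegs N) (.seq (clampCode 13 16) (clampCode 14 17)))))))

/-- Only registers and memory cells that are used during one simulation differ. -/
structure Keep (base r s : ℕ) (τ τ' : Memory) : Prop where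
  wreg : ∀ i < 16, i ≠ 7 → i ≠ 8 → i ≠ 9 → i ≠ 10 → i ≠ 13 → i ≠ 14 → τ'.wreg i = τ.wreg i
  wmem : ∀ a, (∀ b, a ≠ base + (b * r + s)) → τ'.wmem a = τ.wmem a
  rmem : ∀ a, (∀ b, a ≠ base + (b * r + s)) → τ'.rmem a = τ.rmem a

section
variable {base r s : ℕ}

theorem Keep.trans {τ₁ τ₂ τ₃ : Memory} (h : Keep base r s τ₁ τ₂) (h' : Keep base r s τ₂ τ₃) :
    Keep base r s τ₁ τ₃ :=
  ⟨fun i a b c d e f g => (h'.wreg i a b c d e f g).trans (h.wreg i a b c d e f g),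
   fun a ha => (h'.wmem a ha).trans (h.wmem a ha), fun a ha => (h'.rmem a ha).trans (h.rmem a ha)⟩

theorem Frame.keep {τ τ' : Memory} (h : Frame base r s τ τ') : Keep base r s τ τ' :=
  ⟨fun i a _ c d e _ _ => h.wreg i a c d e, h.wmem, h.rmem⟩

theorem keep_of_mem_eq {τ τ' : Memory}
    (h : ∀ i < 16, i ≠ 7 → i ≠ 8 → i ≠ 9 → i ≠ 10 → i ≠ 13 → i ≠ 14 → τ'.wreg i = τ.wreg i)
    (hw : τ'.wmem = τ.wmem) (hr : τ'.rmem = τ.rmem) : Keep base r s τ τ' :=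
  ⟨h, fun _ _ => by rw [hw], fun _ _ => by rw [hr]⟩

theorem Keep.host {τ τ' : Memory} (h : Keep base r s τ τ') (hh : Host base r s τ) :
    Host base r s τ' := by
  have k := fun i (hi : i < 7) => h.wreg i (by omega) (by omega) (by omega) (by omega) (by omega)
    (by omega) (by omega)
  exact ⟨(k 2 (by omega)).trans hh.zero, (k 3 (by omega)).trans hh.one,
    (k 4 (by omega)).trans hh.base, (k 5 (by omega)).trans hh.num, (k 6 (by omega)).trans hh.idx⟩

end

theorem Host.evalReady {x : Input} {r s : ℕ} {τ : Memory} (hh : Host x.words.length r s τ)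
    (hx : x.reals = []) (hc : ∀ a < x.words.length, τ.wmem a = x.words.getD a 0) {j : ℤ}
    (hj : τ.wreg 7 = j) : EvalReady x s j τ :=
  ⟨hh.zero, hh.base, hh.idx, hj, hc, hx⟩

section
variable {W : ℕ} {A : Set ℝ} {base r s : ℕ}

theorem runs_zeroRegs (hA : (0 : ℝ) ∈ A) (n : ℕ) {τ : Memory} (h2 : τ.wreg 2 = 0) :
    Runs W A (zeroRegs n) τ (2 * n + 1) (fun τ' =>
      (∀ i, i < 16 ∨ 16 + n ≤ i → τ'.wreg i = τ.wreg i) ∧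
      (∀ i < n, τ'.wreg (16 + i) = 0 ∧ τ'.rreg (16 + i) = 0) ∧
      τ'.wmem = τ.wmem ∧ τ'.rmem = τ.rmem) := by
  induction n with
  | zero => exact Runs.skip ⟨fun _ _ => rfl, fun i hi => by omega, rfl, rfl⟩
  | succ n ih =>
    refine Runs.mono (Runs.seq ih fun τ₁ h₁ => Runs.seq (Q₁ := fun τ₂ => τ₂ = τ₁.setW (16 + n) 0)
      (runs_const (by simp) rfl) fun τ₂ h₂ => Runs.instr (a := .cast (16 + n) 2) ?_
      (Q := fun τ' => (∀ i, i < 16 ∨ 16 + (n + 1) ≤ i → τ'.wreg i = τ.wreg i) ∧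
      (∀ i < n + 1, τ'.wreg (16 + i) = 0 ∧ τ'.rreg (16 + i) = 0) ∧
      τ'.wmem = τ.wmem ∧ τ'.rmem = τ.rmem) ?_) (by omega) fun _ h => h
    · subst h₂
      show ((τ₁.setW (16 + n) 0).wreg 2 : ℝ) ∈ A
      rw [setW_wreg_ne (by omega), h₁.1 2 (by omega), h2]
      simpa using hA
    · subst h₂
      have v : (τ₁.setW (16 + n) 0).wreg 2 = 0 := by
        rw [setW_wreg_ne (by omega), h₁.1 2 (by omega), h2]
      refine ⟨fun i hi => ?_, fun i hi => ?_, h₁.2.2.1, h₁.2.2.2⟩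
      · exact (setW_wreg_ne (by omega)).trans (h₁.1 i (by omega))
      · by_cases hin : i = n
        · subst hin
          exact ⟨setW_wreg_self, by simp [Instr.next, v]⟩
        · refine ⟨(setW_wreg_ne (by omega)).trans (h₁.2.1 i (by omega)).1, ?_⟩
          exact (Function.update_of_ne (by omega) _ _).trans (h₁.2.1 i (by omega)).2

theorem runs_slotCode {τ : Memory} (hh : Host base r s τ) {k : ℕ} (hk : τ.wreg 7 = k)
    (hW : base + (k * r + s) ≤ W) : Runs W A slotCode τ 3
      (fun τ' => τ' = τ.setW 10 ((base + (k * r + s) : ℕ) : ℤ)) := by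
  have ok : ∀ m : ℕ, m ≤ base + (k * r + s) → |(m : ℤ)| ≤ W := fun m hm => by
    rw [abs_of_nonneg (by positivity)]; exact_mod_cast hm.trans hW
  refine Runs.seq (Q₁ := fun τ' => τ' = τ.setW 10 ((k * r : ℕ) : ℤ))
    (runs_wop (z := ((k * r : ℕ) : ℤ)) ?_ (ok _ (by omega)) rfl) ?_ (T₁ := 1) (T₂ := 2)
  · simp [WordOp.eval, hk, hh.num]
  rintro _ rfl
  refine Runs.seq (Q₁ := fun τ' => τ' = τ.setW 10 ((k * r + s : ℕ) : ℤ))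
    (runs_wop (z := ((k * r + s : ℕ) : ℤ)) ?_ (ok _ (by omega)) ?_) ?_ (T₁ := 1) (T₂ := 1)
  · simp [WordOp.eval, Memory.setW, hh.idx]
  · simp [Memory.setW]
  rintro _ rfl
  refine runs_wop (z := ((base + (k * r + s) : ℕ) : ℤ)) ?_ (ok _ (by omega)) ?_
  · simp [WordOp.eval, Memory.setW, hh.base, add_comm]
  · simp [Memory.setW]

/-- The loop invariant is that the first `k` cells of the slot are written and nothing outside the
slot has changed; in particular the input, which the expression keeps reading, is intact. Register
`13` holds `n - 1` because the loop test is `≤`. -/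
theorem runs_writeWords {x : Input} (hx : x.reals = []) {e : WordExpr} {N n : ℕ} {τ : Memory}
    (hs : s < r) (hh : Host x.words.length r s τ)
    (hc : ∀ a < x.words.length, τ.wmem a = x.words.getD a 0)
    (hb : ∀ j < n, e.Bounded W x s j) (hW : x.words.length + (n * r + s) ≤ W) (hn : n ≤ W)
    (h7 : τ.wreg 7 = 0) (h13 : τ.wreg 13 = (n : ℤ) - 1) :
    Runs W A (writeWords e (16 + N)) τ (1 + n * (e.codeCost + 6)) (fun τ' =>
      Keep x.words.length r s τ τ' ∧ (∀ i < 16 + N, i ≠ 7 → i ≠ 10 → τ'.wreg i = τ.wreg i) ∧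
      (∀ a, τ'.wmem (x.words.length + (a * r + s)) =
        if a < n then e.eval x s a else τ.wmem (x.words.length + (a * r + s))) ∧
      τ'.rmem = τ.rmem ∧ τ'.rreg = τ.rreg) := by
  let I : Memory → Prop := fun σ => ∃ k : ℕ, k ≤ n ∧ σ.wreg 7 = k ∧
    (∀ i < 16 + N, i ≠ 7 → i ≠ 10 → σ.wreg i = τ.wreg i) ∧
    (∀ a, σ.wmem (x.words.length + (a * r + s)) =
        if a < k then e.eval x s a else τ.wmem (x.words.length + (a * r + s))) ∧
    (∀ a, (∀ b, a ≠ x.words.length + (b * r + s)) → σ.wmem a = τ.wmem a) ∧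
    σ.rmem = τ.rmem ∧ σ.rreg = τ.rreg
  have h0 : I τ := ⟨0, by omega, by simpa using h7, fun _ _ _ _ => rfl, fun a => by simp,
    fun _ _ => rfl, rfl, rfl⟩
  have hm : ((n : ℤ) - τ.wreg 7).toNat = n := by rw [h7]; simp
  refine Runs.mono (Runs.while (T := e.codeCost + 5) I (fun σ => ((n : ℤ) - σ.wreg 7).toNat) ?_ h0)
    (by rw [hm]) ?_
  · rintro σ ⟨k, hk, e7, er, em, eo, erm, err⟩ hcond
    have e13 : σ.wreg 13 = (n : ℤ) - 1 := (er 13 (by omega) (by omega) (by omega)).trans h13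
    simp only [Test.Holds, e7, e13] at hcond
    have hkn : k < n := by omega
    have hσ : Host x.words.length r s σ := by
      have k := fun i (hi : i < 7) => er i (by omega) (by omega) (by omega)
      exact ⟨(k 2 (by omega)).trans hh.zero, (k 3 (by omega)).trans hh.one,
        (k 4 (by omega)).trans hh.base, (k 5 (by omega)).trans hh.num, (k 6 (by omega)).trans hh.idx⟩
    have hcσ : ∀ a < x.words.length, σ.wmem a = x.words.getD a 0 := fun a ha =>
      (eo a fun b hb => by omega).trans (hc a ha)
    refine Runs.mono (T := e.codeCost + (3 + (1 + 1))) (Runs.seq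
      (runs_code e (by omega) (hσ.evalReady hx hcσ e7) (hb k hkn)) fun σ₁ h₁ => Runs.seq
      (runs_slotCode (base := x.words.length) (r := r) (s := s) (k := k) ?_ ?_ ?_) ?_) (by omega)
      fun _ h => h
    · exact ⟨(h₁.2.wreg 2 (by omega)).trans hσ.zero, (h₁.2.wreg 3 (by omega)).trans hσ.one,
        (h₁.2.wreg 4 (by omega)).trans hσ.base, (h₁.2.wreg 5 (by omega)).trans hσ.num,
        (h₁.2.wreg 6 (by omega)).trans hσ.idx⟩
    · exact (h₁.2.wreg 7 (by omega)).trans e7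
    · have : k * r ≤ n * r := Nat.mul_le_mul_right _ hk
      omega
    rintro _ rfl
    refine Runs.seq (Q₁ := fun σ₂ => σ₂ = (Instr.wstore 10 (16 + N)).next
      (σ₁.setW 10 ((x.words.length + (k * r + s) : ℕ) : ℤ))) (Runs.instr trivial rfl) ?_
    rintro _ rfl
    have v10 : (σ₁.setW 10 ((x.words.length + (k * r + s) : ℕ) : ℤ)).wreg 10
        = ((x.words.length + (k * r + s) : ℕ) : ℤ) := setW_wreg_self
    have vE : (σ₁.setW 10 ((x.words.length + (k * r + s) : ℕ) : ℤ)).wreg (16 + N) = e.eval x s k :=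
      (setW_wreg_ne (by omega)).trans h₁.1
    have v7 : (σ₁.setW 10 ((x.words.length + (k * r + s) : ℕ) : ℤ)).wreg 7 = k :=
      (setW_wreg_ne (by omega)).trans ((h₁.2.wreg 7 (by omega)).trans e7)
    have v3 : (σ₁.setW 10 ((x.words.length + (k * r + s) : ℕ) : ℤ)).wreg 3 = 1 :=
      (setW_wreg_ne (by omega)).trans ((h₁.2.wreg 3 (by omega)).trans hσ.one)
    refine runs_wop (z := ((k + 1 : ℕ) : ℤ)) ?_ ?_ ⟨⟨k + 1, hkn, setW_wreg_self, ?_, ?_, ?_, ?_, ?_⟩, ?_⟩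
    · simp only [Instr.next, v7, v3, WordOp.eval]; push_cast; rfl
    · rw [abs_of_nonneg (by positivity)]; exact_mod_cast (by omega : k + 1 ≤ W)
    · intro i hi h7 h10
      refine (setW_wreg_ne h7).trans ((setW_wreg_ne h10).trans ((h₁.2.wreg i (by omega)).trans
        (er i hi h7 h10)))
    · intro a
      simp only [Memory.setW, Instr.next] at v10 vE ⊢
      rw [v10, Int.toNat_natCast, vE]
      by_cases hak : a = k
      · subst hak; simp
      · rw [Function.update_of_ne (fun hh => hak (slot_inj hs hh)), h₁.2.wmem, em]
        exact if_congr (by omega) rfl rfl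
    · intro a ha
      simp only [Memory.setW, Instr.next] at v10 vE ⊢
      rw [v10, Int.toNat_natCast, Function.update_of_ne (ha k), h₁.2.wmem, eo a ha]
    · exact h₁.2.rmem.trans erm
    · exact h₁.2.rreg.trans err
    · rw [setW_wreg_self, e7]; omega
  · rintro σ ⟨⟨k, hk, e7, er, em, eo, erm, err⟩, hcond⟩
    have e13 : σ.wreg 13 = (n : ℤ) - 1 := (er 13 (by omega) (by omega) (by omega)).trans h13
    simp only [Test.Holds, e7, e13] at hcond
    obtain rfl : k = n := by omega
    exact ⟨⟨fun i hi h7 _ _ h10 _ _ => er i (by omega) h7 h10, eo, fun _ _ => by rw [erm]⟩, er, em,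
      erm, err⟩

theorem runs_writeReals {x : Input} (hx : x.reals = []) {e : WordExpr} {N n : ℕ} {τ : Memory}
    (hs : s < r) (hh : Host x.words.length r s τ)
    (hc : ∀ a < x.words.length, τ.wmem a = x.words.getD a 0)
    (hb : ∀ j < n, e.Bounded W x s j) (hA : ∀ j < n, ((e.eval x s j : ℤ) : ℝ) ∈ A)
    (hW : x.words.length + (n * r + s) ≤ W) (hn : n ≤ W)
    (h7 : τ.wreg 7 = 0) (h14 : τ.wreg 14 = (n : ℤ) - 1) :
    Runs W A (writeReals e (16 + N)) τ (1 + n * (e.codeCost + 7)) (fun τ' =>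
      Keep x.words.length r s τ τ' ∧ (∀ i < 16 + N, i ≠ 7 → i ≠ 10 → τ'.wreg i = τ.wreg i) ∧
      (∀ a, τ'.rmem (x.words.length + (a * r + s)) =
        if a < n then ((e.eval x s a : ℤ) : ℝ) else τ.rmem (x.words.length + (a * r + s))) ∧
      τ'.wmem = τ.wmem ∧ (∀ i, 0 < i → τ'.rreg i = τ.rreg i)) := by
  let I : Memory → Prop := fun σ => ∃ k : ℕ, k ≤ n ∧ σ.wreg 7 = k ∧
    (∀ i < 16 + N, i ≠ 7 → i ≠ 10 → σ.wreg i = τ.wreg i) ∧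
    (∀ a, σ.rmem (x.words.length + (a * r + s)) =
        if a < k then ((e.eval x s a : ℤ) : ℝ) else τ.rmem (x.words.length + (a * r + s))) ∧
    (∀ a, (∀ b, a ≠ x.words.length + (b * r + s)) → σ.rmem a = τ.rmem a) ∧
    σ.wmem = τ.wmem ∧ (∀ i, 0 < i → σ.rreg i = τ.rreg i)
  have h0 : I τ := ⟨0, by omega, by simpa using h7, fun _ _ _ _ => rfl, fun a => by simp,
    fun _ _ => rfl, rfl, fun _ _ => rfl⟩
  have hm : ((n : ℤ) - τ.wreg 7).toNat = n := by rw [h7]; simp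
  refine Runs.mono (Runs.while (T := e.codeCost + 6) I (fun σ => ((n : ℤ) - σ.wreg 7).toNat) ?_ h0)
    (by rw [hm]) ?_
  · rintro σ ⟨k, hk, e7, er, em, eo, erm, err⟩ hcond
    have e14 : σ.wreg 14 = (n : ℤ) - 1 := (er 14 (by omega) (by omega) (by omega)).trans h14
    simp only [Test.Holds, e7, e14] at hcond
    have hkn : k < n := by omega
    have hσ : Host x.words.length r s σ := by
      have k := fun i (hi : i < 7) => er i (by omega) (by omega) (by omega)
      exact ⟨(k 2 (by omega)).trans hh.zero, (k 3 (by omega)).trans hh.one,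
        (k 4 (by omega)).trans hh.base, (k 5 (by omega)).trans hh.num, (k 6 (by omega)).trans hh.idx⟩
    have hcσ : ∀ a < x.words.length, σ.wmem a = x.words.getD a 0 := fun a ha => by
      rw [erm]; exact hc a ha
    refine Runs.mono (T := e.codeCost + (1 + (3 + (1 + 1)))) (Runs.seq
      (runs_code e (by omega) (hσ.evalReady hx hcσ e7) (hb k hkn)) fun σ₁ h₁ => Runs.seq
      (Q₁ := fun σ₂ => σ₂ = (Instr.cast 0 (16 + N)).next σ₁) (Runs.instr ?_ rfl) ?_)
      (by omega) fun _ h => h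
    · show ((σ₁.wreg (16 + N) : ℤ) : ℝ) ∈ A
      rw [h₁.1]; exact hA k hkn
    rintro _ rfl
    refine Runs.seq (runs_slotCode (base := x.words.length) (r := r) (s := s) (k := k) ?_ ?_ ?_) ?_
    · exact ⟨(h₁.2.wreg 2 (by omega)).trans hσ.zero, (h₁.2.wreg 3 (by omega)).trans hσ.one,
        (h₁.2.wreg 4 (by omega)).trans hσ.base, (h₁.2.wreg 5 (by omega)).trans hσ.num,
        (h₁.2.wreg 6 (by omega)).trans hσ.idx⟩
    · exact (h₁.2.wreg 7 (by omega)).trans e7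
    · have : k * r ≤ n * r := Nat.mul_le_mul_right _ hk
      omega
    rintro _ rfl
    obtain ⟨σ₃, hσ₃⟩ : ∃ σ₃, σ₃ = ((Instr.cast 0 (16 + N)).next σ₁).setW 10
      ((x.words.length + (k * r + s) : ℕ) : ℤ) := ⟨_, rfl⟩
    rw [← hσ₃]
    have v10 : σ₃.wreg 10 = ((x.words.length + (k * r + s) : ℕ) : ℤ) := by
      rw [hσ₃]; exact setW_wreg_self
    have v0 : σ₃.rreg 0 = ((e.eval x s k : ℤ) : ℝ) := by
      rw [hσ₃, ← h₁.1]; simp [Memory.setW, Instr.next]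
    have vr : ∀ i < 16 + N, i ≠ 10 → σ₃.wreg i = σ.wreg i := fun i hi h10 => by
      rw [hσ₃]; exact (setW_wreg_ne h10).trans (h₁.2.wreg i hi)
    have vw : σ₃.wmem = σ.wmem := by rw [hσ₃]; exact h₁.2.wmem
    have vm : σ₃.rmem = σ.rmem := by rw [hσ₃]; exact h₁.2.rmem
    have vrr : ∀ i, 0 < i → σ₃.rreg i = σ.rreg i := fun i hi => by
      rw [hσ₃, ← h₁.2.rreg]; exact Function.update_of_ne (by omega) _ _
    refine Runs.seq (Q₁ := fun σ₂ => σ₂ = (Instr.rstore 10 0).next σ₃) (Runs.instr trivial rfl) ?_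
    rintro _ rfl
    refine runs_wop (z := ((k + 1 : ℕ) : ℤ)) ?_ ?_ ⟨⟨k + 1, hkn, setW_wreg_self, ?_, ?_, ?_, ?_, ?_⟩, ?_⟩
    · simp [Instr.next, vr 7 (by omega) (by omega), vr 3 (by omega) (by omega), e7, hσ.one, WordOp.eval]
    · rw [abs_of_nonneg (by positivity)]; exact_mod_cast (by omega : k + 1 ≤ W)
    · intro i hi h7 h10
      exact (setW_wreg_ne h7).trans ((vr i hi h10).trans (er i hi h7 h10))
    · intro a
      simp only [Memory.setW, Instr.next]
      rw [v10, Int.toNat_natCast, v0]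
      by_cases hak : a = k
      · subst hak; simp
      · rw [Function.update_of_ne (fun hh => hak (slot_inj hs hh)), vm, em]
        exact if_congr (by omega) rfl rfl
    · intro a ha
      simp only [Memory.setW, Instr.next]
      rw [v10, Int.toNat_natCast, Function.update_of_ne (ha k), vm, eo a ha]
    · exact vw.trans erm
    · intro i hi
      exact (vrr i hi).trans (err i hi)
    · rw [setW_wreg_self, e7]; omega
  · rintro σ ⟨⟨k, hk, e7, er, em, eo, erm, err⟩, hcond⟩
    have e14 : σ.wreg 14 = (n : ℤ) - 1 := (er 14 (by omega) (by omega) (by omega)).trans h14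
    simp only [Test.Holds, e7, e14] at hcond
    obtain rfl : k = n := by omega
    exact ⟨⟨fun i hi h7 _ _ h10 _ _ => er i (by omega) h7 h10, fun _ _ => by rw [erm], eo⟩, er, em,
      erm, err⟩

/-- A negative length counts as `0`. The copy in register `k` becomes a length register of the
simulated program, and register `i` becomes the bound of a loop with test `≤`, hence the `- 1`. -/
theorem runs_clampCode {i k : ℕ} {τ : Memory} (hik : i ≠ k) (hi2 : i ≠ 2) (hk3 : k ≠ 3) (hi3 : i ≠ 3)
    (h2 : τ.wreg 2 = 0) (h3 : τ.wreg 3 = 1) {z : ℤ} (hz : τ.wreg i = z)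
    (hW : |z| + 1 ≤ W) :
    Runs W A (clampCode i k) τ 4 (fun τ' => τ'.wreg i = (z.toNat : ℤ) - 1 ∧ τ'.wreg k = z.toNat ∧
      (∀ l, l ≠ i → l ≠ k → τ'.wreg l = τ.wreg l) ∧ τ'.rreg = τ.rreg ∧ τ'.wmem = τ.wmem ∧
      τ'.rmem = τ.rmem) := by
  have hzn : ((z.toNat : ℕ) : ℤ) ≤ W := by
    have := le_abs_self z; have := abs_nonneg z; omega
  refine Runs.seq (T₁ := 2) (T₂ := 2) (Q₁ := fun τ₁ => τ₁.wreg i = z.toNat ∧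
    (∀ l, l ≠ i → τ₁.wreg l = τ.wreg l) ∧ τ₁.rreg = τ.rreg ∧ τ₁.wmem = τ.wmem ∧
      τ₁.rmem = τ.rmem) ?_ ?_
  · refine Runs.ite (T := 1) (fun hc => runs_const (by simp) ?_) (fun hc => Runs.skip ?_) <;>
      simp only [Test.Holds, hz, h2] at hc
    · exact ⟨by rw [setW_wreg_self]; omega, fun l hl => setW_wreg_ne hl, rfl, rfl, rfl⟩
    · exact ⟨by omega, fun _ _ => rfl, rfl, rfl, rfl⟩
  · rintro τ₁ ⟨a1, a2, a3, a4, a5⟩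
    refine Runs.seq (T₁ := 1) (T₂ := 1) (Q₁ := fun τ₂ => τ₂ = τ₁.setW k z.toNat)
      (runs_wop (z := z.toNat) ?_ ?_ rfl) ?_
    · simp [WordOp.eval, a1, a2 2 hi2.symm, h2]
    · rw [abs_of_nonneg (by positivity)]; exact hzn
    rintro _ rfl
    refine runs_wop (z := (z.toNat : ℤ) - 1) ?_ ?_ ⟨setW_wreg_self, ?_, ?_, a3, a4, a5⟩
    · rw [setW_wreg_ne hik, setW_wreg_ne hk3.symm, a1, a2 3 hi3.symm, h3]; rfl
    · rw [abs_le]; have := abs_nonneg z; omega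
    · rw [setW_wreg_ne hik.symm, setW_wreg_self]
    · intro l hl hk
      rw [setW_wreg_ne hl, setW_wreg_ne hk, a2 l hl]

end
end
end FineGrained

/-! ### A single attempt: writing an instance and running the program on it -/

namespace FineGrained
noncomputable section

section
variable {W : ℕ} {A : Set ℝ} {r s : ℕ}

theorem runs_prelude {x : Input} (hx : x.reals = []) {nw nr : WordExpr} {N : ℕ} (hN : 2 ≤ N)
    {τ : Memory} (hA : (0 : ℝ) ∈ A) (hh : Host x.words.length r s τ)
    (hc : ∀ a < x.words.length, τ.wmem a = x.words.getD a 0)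
    {B : ℕ} (hBW : B + 1 ≤ W) (hnw : nw.Bounded B x s 0) (hnr : nr.Bounded B x s 0) :
    Runs W A (prelude nw nr N) τ (nw.codeCost + nr.codeCost + 2 * N + 20) (fun τ' =>
      Keep x.words.length r s τ τ' ∧ τ'.wreg 7 = 0 ∧
      τ'.wreg 13 = ((nw.eval x s 0).toNat : ℤ) - 1 ∧ τ'.wreg 14 = ((nr.eval x s 0).toNat : ℤ) - 1 ∧
      (∀ i < N, τ'.wreg (16 + i) = if i = 0 then ((nw.eval x s 0).toNat : ℤ) else
        if i = 1 then ((nr.eval x s 0).toNat : ℤ) else 0) ∧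
      (∀ i < N, τ'.rreg (16 + i) = 0) ∧ τ'.wmem = τ.wmem ∧ τ'.rmem = τ.rmem) := by
  have hBW' : (B : ℤ) + 1 ≤ W := by exact_mod_cast hBW
  have bw := hnw.abs_le
  have br := hnr.abs_le
  refine Runs.mono (T := 1 + (nw.codeCost + (1 + (nr.codeCost + (1 + ((2 * N + 1) + (4 + 4)))))))
    (Runs.seq (Q₁ := fun τ₁ => τ₁ = τ.setW 7 0) (runs_const (by simp) rfl) ?_) (by omega)
    fun _ h => h
  rintro _ rfl
  have hr₀ : EvalReady x s 0 (τ.setW 7 0) :=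
    ⟨(setW_wreg_ne (by omega)).trans hh.zero, (setW_wreg_ne (by omega)).trans hh.base,
      (setW_wreg_ne (by omega)).trans hh.idx, setW_wreg_self, hc, hx⟩
  refine Runs.seq (runs_code nw (by omega) hr₀ (hnw.mono (by omega))) fun τ₁ h₁ => ?_
  have e₁ := h₁.2.evalReady (by omega) hr₀
  refine Runs.seq (Q₁ := fun τ₂ => τ₂ = τ₁.setW 13 (nw.eval x s 0))
    (runs_wop (z := nw.eval x s 0) ?_ (by omega) rfl) ?_
  · simp [WordOp.eval, h₁.1, e₁.zero]
  rintro _ rfl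
  have e₂ : EvalReady x s 0 (τ₁.setW 13 (nw.eval x s 0)) :=
    ⟨(setW_wreg_ne (by omega)).trans e₁.zero, (setW_wreg_ne (by omega)).trans e₁.wlen,
      (setW_wreg_ne (by omega)).trans e₁.par, (setW_wreg_ne (by omega)).trans e₁.pos, e₁.cells, hx⟩
  refine Runs.seq (runs_code nr (by omega) e₂ (hnr.mono (by omega))) fun τ₃ h₃ => ?_
  have e₃ := h₃.2.evalReady (by omega) e₂
  refine Runs.seq (Q₁ := fun τ₂ => τ₂ = τ₃.setW 14 (nr.eval x s 0))
    (runs_wop (z := nr.eval x s 0) ?_ (by omega) rfl) ?_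
  · simp [WordOp.eval, h₃.1, e₃.zero]
  rintro _ rfl
  refine Runs.seq (runs_zeroRegs hA N ((setW_wreg_ne (by omega)).trans e₃.zero)) ?_
  rintro τ₄ ⟨z1, z2, z3, z4⟩
  have k4 : ∀ i < 16, i ≠ 7 → i ≠ 13 → i ≠ 14 → τ₄.wreg i = τ.wreg i := fun i hi h7 h13 h14 =>
    (z1 i (Or.inl hi)).trans ((setW_wreg_ne h14).trans ((h₃.2.wreg i (by omega)).trans
      ((setW_wreg_ne h13).trans ((h₁.2.wreg i (by omega)).trans (setW_wreg_ne h7)))))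
  have k13 : τ₄.wreg 13 = nw.eval x s 0 := (z1 13 (by omega)).trans
    ((setW_wreg_ne (by omega)).trans ((h₃.2.wreg 13 (by omega)).trans setW_wreg_self))
  have k14 : τ₄.wreg 14 = nr.eval x s 0 := (z1 14 (by omega)).trans setW_wreg_self
  have k7 : τ₄.wreg 7 = 0 := (z1 7 (by omega)).trans
    ((setW_wreg_ne (by omega)).trans e₃.pos)
  have m4 : τ₄.wmem = τ.wmem := z3.trans (h₃.2.wmem.trans h₁.2.wmem)
  have r4 : τ₄.rmem = τ.rmem := z4.trans (h₃.2.rmem.trans h₁.2.rmem)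
  have q2 : τ₄.wreg 2 = 0 := (k4 2 (by omega) (by omega) (by omega) (by omega)).trans hh.zero
  have q3 : τ₄.wreg 3 = 1 := (k4 3 (by omega) (by omega) (by omega) (by omega)).trans hh.one
  -- Host registers `16` and `17` are the simulated registers `0` and `1`, which initially hold the
  -- lengths of the two lists. They are set after the others have been cleared.
  refine Runs.seq (runs_clampCode (i := 13) (k := 16) (by omega) (by omega) (by omega) (by omega)
    q2 q3 k13 (by omega)) ?_
  rintro τ₅ ⟨a1, a2, a3, a4, a5, a6⟩
  refine Runs.mono (runs_clampCode (i := 14) (k := 17) (by omega) (by omega) (by omega) (by omega)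
    ((a3 2 (by omega) (by omega)).trans q2) ((a3 3 (by omega) (by omega)).trans q3)
    ((a3 14 (by omega) (by omega)).trans k14) (by omega)) le_rfl ?_
  rintro τ₆ ⟨b1, b2, b3, b4, b5, b6⟩
  refine ⟨keep_of_mem_eq (fun i hi h7 _ _ _ h13 h14 => ?_) (b5.trans (a5.trans m4))
    (b6.trans (a6.trans r4)), ?_, ?_, b1, fun i hi => ?_, fun i hi => ?_, b5.trans (a5.trans m4),
    b6.trans (a6.trans r4)⟩
  · exact (b3 i h14 (by omega)).trans ((a3 i h13 (by omega)).trans (k4 i hi h7 h13 h14))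
  · exact (b3 7 (by omega) (by omega)).trans ((a3 7 (by omega) (by omega)).trans k7)
  · exact (b3 13 (by omega) (by omega)).trans a1
  · by_cases h0 : i = 0
    · subst h0; rw [if_pos rfl]; exact (b3 16 (by omega) (by omega)).trans a2
    · rw [if_neg h0]
      by_cases h1 : i = 1
      · subst h1; rw [if_pos rfl]; exact b2
      · rw [if_neg h1]
        exact (b3 _ (by omega) (by omega)).trans ((a3 _ (by omega) (by omega)).trans (z2 i hi).1)
  · rw [b4, a4]; exact (z2 i hi).2

/-- One run of the program `p`, on the instance with parameter `wreg 6`; register `11` holds the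
budget. On success `wreg 12 = -1` and the answer is stored in `wreg 15`. -/
def attempt (p : Prog) (nw nr we re : WordExpr) (N : ℕ) : Prog :=
  .seq (prelude nw nr N) (.seq (writeWords we (16 + N)) (.seq (.instr (.const 7 0))
    (.seq (writeReals re (16 + N)) (.seq (.instr (.wop .add 8 11 3)) (.seq p.host
      (.seq (.ite (.wle 3 8) (.seq (.instr (.wop .sub 12 2 3)) (.instr (.wop .add 15 16 2))) .skip)
        (.instr (.wop .add 6 6 3))))))))

/-- No slot has to be erased: each is used by a single attempt, so by `fresh` it still consists of
zeros, as the memory behind the input of the simulated program should. -/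
theorem runs_attempt {x : Input} (hx : x.reals = []) {p : Prog} {nw nr we re : WordExpr} {N : ℕ}
    (hN : 2 ≤ N) (hp : p.Below N) {τ : Memory} (hA : (0 : ℝ) ∈ A)
    (hh : Host x.words.length r s τ) (hc : ∀ a < x.words.length, τ.wmem a = x.words.getD a 0)
    {B Wy : ℕ} {Ay : Set ℝ} (fit : Fits Wy W B x.words.length r s Ay A)
    (hnw : nw.Bounded B x s 0) (hnr : nr.Bounded B x s 0)
    (hwe : ∀ j < (nw.eval x s 0).toNat, we.Bounded B x s j)
    (hre : ∀ j < (nr.eval x s 0).toNat, re.Bounded B x s j)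
    (hreA : ∀ j < (nr.eval x s 0).toNat, ((re.eval x s j : ℤ) : ℝ) ∈ A)
    (fresh : ∀ a, τ.wmem (x.words.length + (a * r + s)) = 0 ∧
      τ.rmem (x.words.length + (a * r + s)) = 0)
    {bud : ℕ} (hbud : τ.wreg 11 = bud) (hbW : bud + 1 ≤ W)
    {y : Input} (hyw : y.words = (List.range (nw.eval x s 0).toNat).map fun j : ℕ => we.eval x s (j : ℤ))
    (hyr : y.reals = (List.range (nr.eval x s 0).toNat).map fun j : ℕ => ((re.eval x s (j : ℤ) : ℤ) : ℝ))
    {t : ℕ} {σ : Memory} (hex : Exec Wy Ay p y.init t σ) :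
    Runs W A (attempt p nw nr we re N) τ
      ((nw.codeCost + nr.codeCost + 2 * N + we.codeCost + re.codeCost + 2 * p.hostCost + 60) *
        (y.size + bud + 1)) (fun τ' =>
      (∀ i < 12, i ≠ 6 → i ≠ 7 → i ≠ 8 → i ≠ 9 → i ≠ 10 → τ'.wreg i = τ.wreg i) ∧
      (∀ a, (∀ b, a ≠ x.words.length + (b * r + s)) →
        τ'.wmem a = τ.wmem a ∧ τ'.rmem a = τ.rmem a) ∧
      τ'.wreg 6 = (s : ℤ) + 1 ∧
      (t ≤ bud → τ'.wreg 12 = -1 ∧ τ'.wreg 15 = σ.wreg 0) ∧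
      (bud < t → τ'.wreg 12 = τ.wreg 12)) := by
  have hroom := fit.room
  have hs := fit.idx
  have hBW := fit.le'
  set n := (nw.eval x s 0).toNat with hn
  set m := (nr.eval x s 0).toNat with hm
  have hnB : n ≤ B := by have := abs_le.1 hnw.abs_le; omega
  have hmB : m ≤ B := by have := abs_le.1 hnr.abs_le; omega
  have hnr' : n * r ≤ B * r := Nat.mul_le_mul_right _ hnB
  have hmr' : m * r ≤ B * r := Nat.mul_le_mul_right _ hmB
  have hBr : B * 1 ≤ B * r := Nat.mul_le_mul_left _ (by omega)
  have hyn : y.words.length = n := by rw [hyw]; simp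
  have hym : y.reals.length = m := by rw [hyr]; simp
  have hsize : y.size = n + m := by rw [Input.size, hyn, hym]
  refine Runs.mono (T := (nw.codeCost + nr.codeCost + 2 * N + 20) + ((1 + n * (we.codeCost + 6)) + (1 +
    ((1 + m * (re.codeCost + 7)) + (1 + ((p.hostCost * (bud + 1) + p.hostCost) + ((1 + 2) + 1)))))))
    (Runs.seq (runs_prelude hx hN hA hh hc (by omega) hnw hnr) ?_) ?_ fun _ h => h
  swap
  · rw [hsize]
    have h1 : ∀ c : ℕ, c ≤ c * (n + m + bud + 1) := fun c => Nat.le_mul_of_pos_right _ (by omega)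
    have h2 : ∀ c, c * n ≤ c * (n + m + bud + 1) := fun c => Nat.mul_le_mul_left _ (by omega)
    have h3 : ∀ c, c * m ≤ c * (n + m + bud + 1) := fun c => Nat.mul_le_mul_left _ (by omega)
    have h4 : p.hostCost * (bud + 1) ≤ p.hostCost * (n + m + bud + 1) :=
      Nat.mul_le_mul_left _ (by omega)
    have := h1 nw.codeCost; have := h1 nr.codeCost; have := h1 (2 * N); have := h1 p.hostCost
    have := h2 we.codeCost; have := h3 re.codeCost
    nlinarith
  rintro τ₁ ⟨K1, j7, j13, j14, jw, jr, jm, jrm⟩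
  have H1 := K1.host hh
  refine Runs.seq (runs_writeWords hx hs H1 (by rw [jm]; exact hc)
    (fun j hj => (hwe j hj).mono (by omega)) (by omega) (by omega) j7 j13) ?_
  rintro τ₂ ⟨K2, i2, w2, rm2, rr2⟩
  have H2 := K2.host H1
  have hc2 : ∀ a < x.words.length, τ₂.wmem a = x.words.getD a 0 := fun a ha => by
    rw [K2.wmem a fun b hb => by omega, jm]; exact hc a ha
  refine Runs.seq (Q₁ := fun τ₃ => τ₃ = τ₂.setW 7 0) (runs_const (by simp) rfl) ?_
  rintro _ rfl
  have K3 : Keep x.words.length r s τ₂ (τ₂.setW 7 0) :=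
    keep_of_mem_eq (fun i _ h _ _ _ _ _ => setW_wreg_ne h) rfl rfl
  refine Runs.seq (runs_writeReals hx hs (K3.host H2) hc2
    (fun j hj => (hre j hj).mono (by omega)) hreA (by omega) (by omega) setW_wreg_self
    ((setW_wreg_ne (by omega)).trans ((i2 14 (by omega) (by omega) (by omega)).trans j14))) ?_
  rintro τ₄ ⟨K4, i4, w4, rm4, rr4⟩
  have H4 := K4.host (K3.host H2)
  have K : Keep x.words.length r s τ τ₄ := K1.trans (K2.trans (K3.trans K4))
  have e11 : τ₄.wreg 11 = bud := (K.wreg 11 (by omega) (by omega) (by omega) (by omega) (by omega)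
    (by omega) (by omega)).trans hbud
  -- One unit more than the allowed number of steps: a run that halts in time leaves a positive
  -- remainder, and this is what the final test detects.
  refine Runs.seq (Q₁ := fun τ₅ => τ₅ = τ₄.setW 8 ((bud + 1 : ℕ) : ℤ))
    (runs_wop (z := ((bud + 1 : ℕ) : ℤ)) ?_ ?_ rfl) ?_
  · simp [WordOp.eval, e11, H4.one]
  · rw [abs_of_nonneg (by positivity)]; exact_mod_cast hbW
  rintro _ rfl
  have K5 : Keep x.words.length r s τ₄ (τ₄.setW 8 ((bud + 1 : ℕ) : ℤ)) :=
    keep_of_mem_eq (fun i _ _ h _ _ _ _ => setW_wreg_ne h) rfl rfl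
  have sim : Sim N B x.words.length r s y.init (τ₄.setW 8 ((bud + 1 : ℕ) : ℤ)) := by
    refine sim_setW ⟨fun i hi => ?_, fun i hi => ?_, fun a => ?_, fun a => ?_, fun i => ?_,
      fun a => ?_⟩ (by omega) _
    · rw [i4 _ (by omega) (by omega) (by omega), setW_wreg_ne (by omega),
        i2 _ (by omega) (by omega) (by omega), jw i hi]
      simp only [Input.init, hyn, hym, hn, hm]
    · rw [rr4 _ (by omega)]
      show τ₂.rreg (16 + i) = 0
      rw [rr2, jr i hi]
    · rw [rm4]
      show τ₂.wmem _ = _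
      rw [w2 a, jm, (fresh a).1]
      simp only [Input.init]
      by_cases ha : a < n
      · rw [if_pos ha, List.getD_eq_getElem _ _ (by omega)]
        simp [hyw]
      · rw [if_neg ha, List.getD_eq_default _ _ (by omega)]
    · rw [w4 a]
      show (if a < m then _ else τ₂.rmem _) = _
      rw [rm2, jrm, (fresh a).2]
      simp only [Input.init]
      by_cases ha : a < m
      · rw [if_pos ha, List.getD_eq_getElem _ _ (by omega)]
        simp [hyr]
      · rw [if_neg ha, List.getD_eq_default _ _ (by omega)]
    · simp only [Input.init, hyn, hym]
      split_ifs
      · rw [abs_of_nonneg (by positivity)]; exact_mod_cast hnB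
      · rw [abs_of_nonneg (by positivity)]; exact_mod_cast hmB
      · simp
    · simp only [Input.init]
      by_cases ha : a < n
      · rw [List.getD_eq_getElem _ _ (by omega)]
        simpa [hyw] using (hwe a ha).abs_le
      · rw [List.getD_eq_default _ _ (by omega)]
        simp
  obtain ⟨t', ht', τ₆, ex6, f6, s6, x6⟩ := exec_host fit hex hp sim (K5.host H4)
    (n := bud + 1) setW_wreg_self hbW
  refine Runs.seq (Q₁ := fun τ' => τ' = τ₆) ⟨t', ?_, τ₆, ex6, rfl⟩ ?_
  · have : p.hostCost * min t (bud + 1) ≤ p.hostCost * (bud + 1) :=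
      Nat.mul_le_mul_left _ (by omega)
    omega
  intro _ hτ₆
  rw [hτ₆]
  clear hτ₆
  have K6 : Keep x.words.length r s τ τ₆ := K.trans (K5.trans f6.keep)
  have H6 := K6.host hh
  have q15 := fun i (hi : i = 11 ∨ i = 12 ∨ i = 15) => K6.wreg i (by omega) (by omega) (by omega)
    (by omega) (by omega) (by omega) (by omega)
  have fin : ∀ τ₇ : Memory, (∀ i < 12, τ₇.wreg i = τ₆.wreg i) → τ₇.wmem = τ₆.wmem →
      τ₇.rmem = τ₆.rmem → (t ≤ bud → τ₇.wreg 12 = -1 ∧ τ₇.wreg 15 = σ.wreg 0) →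
      (bud < t → τ₇.wreg 12 = τ.wreg 12) →
      Runs W A (.instr (.wop .add 6 6 3)) τ₇ 1 (fun τ' =>
      (∀ i < 12, i ≠ 6 → i ≠ 7 → i ≠ 8 → i ≠ 9 → i ≠ 10 → τ'.wreg i = τ.wreg i) ∧
      (∀ a, (∀ b, a ≠ x.words.length + (b * r + s)) →
        τ'.wmem a = τ.wmem a ∧ τ'.rmem a = τ.rmem a) ∧
      τ'.wreg 6 = (s : ℤ) + 1 ∧
      (t ≤ bud → τ'.wreg 12 = -1 ∧ τ'.wreg 15 = σ.wreg 0) ∧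
      (bud < t → τ'.wreg 12 = τ.wreg 12)) := fun τ₇ g1 g2 g3 g4 g5 => by
    refine runs_wop (z := (s : ℤ) + 1) ?_ ?_ ⟨fun i hi h6 h7 h8 h9 h10 => ?_, fun a ha => ⟨?_, ?_⟩,
      setW_wreg_self, fun h => ?_, fun h => ?_⟩
    · simp [WordOp.eval, g1, H6.idx, H6.one]
    · rw [abs_of_nonneg (by positivity)]; exact_mod_cast (by omega : s + 1 ≤ W)
    · exact (setW_wreg_ne h6).trans ((g1 i hi).trans
        (K6.wreg i (by omega) h7 h8 h9 h10 (by omega) (by omega)))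
    · exact (congrFun g2 a).trans (K6.wmem a ha)
    · exact (congrFun g3 a).trans (K6.rmem a ha)
    · exact ⟨(setW_wreg_ne (by omega)).trans (g4 h).1, (setW_wreg_ne (by omega)).trans (g4 h).2⟩
    · exact (setW_wreg_ne (by omega)).trans (g5 h)
  have hone : (1 : ℤ) ≤ W := by exact_mod_cast (by omega : 1 ≤ W)
  refine Runs.seq (Q₁ := fun τ₇ => (∀ i < 12, τ₇.wreg i = τ₆.wreg i) ∧ τ₇.wmem = τ₆.wmem ∧
      τ₇.rmem = τ₆.rmem ∧ (t ≤ bud → τ₇.wreg 12 = -1 ∧ τ₇.wreg 15 = σ.wreg 0) ∧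
      (bud < t → τ₇.wreg 12 = τ.wreg 12)) (Runs.ite (T := 2) (fun hcond => ?_) fun hcond => ?_)
    (fun τ₇ g => fin τ₇ g.1 g.2.1 g.2.2.1 g.2.2.2.1 g.2.2.2.2)
  · simp only [Test.Holds, H6.one] at hcond
    have htb : t ≤ bud := by
      by_contra hlt
      rcases Nat.lt_or_ge (bud + 1) t with h | h
      · rw [x6 h] at hcond; omega
      · rw [(s6 h).2] at hcond; push_cast at hcond; omega
    have sim6 := (s6 (by omega)).1
    have v16 : τ₆.wreg 16 = σ.wreg 0 := sim6.wreg 0 (by omega)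
    refine Runs.seq (T₁ := 1) (T₂ := 1) (Q₁ := fun τ₇ => τ₇ = τ₆.setW 12 (-1))
      (runs_wop (z := -1) ?_ ?_ rfl) ?_
    · simp [WordOp.eval, H6.zero, H6.one]
    · simpa using hone
    rintro _ rfl
    refine runs_wop (z := σ.wreg 0) ?_ ?_ ⟨fun i hi => ?_, rfl, rfl, fun _ => ⟨?_, setW_wreg_self⟩,
      fun h => by omega⟩
    · simp [WordOp.eval, setW_wreg_ne, v16, H6.zero]
    · have := sim6.wreg_le 0
      have h2 : (B : ℤ) ≤ W := by exact_mod_cast hBW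
      omega
    · exact (setW_wreg_ne (by omega)).trans (setW_wreg_ne (by omega))
    · exact (setW_wreg_ne (by omega)).trans setW_wreg_self
  · simp only [Test.Holds, H6.one] at hcond
    refine (Runs.skip ⟨fun _ _ => rfl, rfl, rfl, fun h => ?_, fun h => q15 12 (by omega)⟩).mono
      (by omega) fun _ h => h
    have := (s6 (by omega)).2
    rw [this] at hcond; push_cast at hcond; omega

end
end
end FineGrained

/-! ### Trying all produced instances within the budget -/

namespace FineGrained
noncomputable section

theorem map_range_cast {α : Type*} (f : ℤ → α) (n : ℕ) :
    (List.range n).map f = (List.range n).map (fun j : ℕ => f (j : ℤ)) := by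
  simp only [List.pure_def, List.bind_eq_flatMap, ← List.map_eq_flatMap, List.map_map]
  rfl

/-- Run `p` on the instances with parameters `0, 1, …` until it halts within the budget. -/
def search (p : Prog) (count bud nw nr we re : WordExpr) (N : ℕ) : Prog :=
  .seq (.instr (.const 3 1)) (.seq (.instr (.wop .add 4 0 2)) (.seq (count.code (16 + N))
    (.seq (.instr (.wop .add 5 (16 + N) 2)) (.seq (.instr (.wop .sub 12 5 3))
      (.seq (bud.code (16 + N)) (.seq (.instr (.wop .add 11 (16 + N) 2))
        (.seq (.while (.wle 6 12) (attempt p nw nr we re N)) (.instr (.wop .add 0 15 2)))))))))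

theorem slot_disjoint {base r s s' a b : ℕ} (hs : s < r) (hs' : s' < r) (h : s ≠ s') :
    base + (a * r + s) ≠ base + (b * r + s') := fun e => by
  have e' : s + r * a = s' + r * b := by linarith [mul_comm r a, mul_comm r b]
  have := congrArg (· % r) e'
  simp only [Nat.add_mul_mod_self_left, Nat.mod_eq_of_lt hs, Nat.mod_eq_of_lt hs'] at this
  exact h this

/-- Since all attempts have the same budget, making them one after the other is as good as running
them in parallel. An attempt that exceeds the budget is cut off, and by `hsuc` some attempt
succeeds. -/
theorem runs_search {W : ℕ} {A : Set ℝ} {r : ℕ} {x : Input} (hx : x.reals = []) {p : Prog}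
    {count budE nw nr we re : WordExpr} {N : ℕ} (hN : 2 ≤ N) (hp : p.Below N) (hA : (0 : ℝ) ∈ A)
    {B : ℕ} {Wy : ℕ → ℕ} {Ay : ℕ → Set ℝ} {bud : ℕ} (hr : count.eval x 0 0 = r) (hr0 : 0 < r)
    (hbud : budE.eval x 0 0 = bud) (hcount : count.Bounded B x 0 0) (hbudE : budE.Bounded B x 0 0)
    (hbB : bud ≤ B) (fit : ∀ s < r, Fits (Wy s) W B x.words.length r s (Ay s) A)
    (hnw : ∀ s : ℕ, s < r → nw.Bounded B x s 0) (hnr : ∀ s : ℕ, s < r → nr.Bounded B x s 0)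
    (hwe : ∀ s : ℕ, s < r → ∀ j : ℕ, j < (nw.eval x s 0).toNat → we.Bounded B x s j)
    (hre : ∀ s : ℕ, s < r → ∀ j : ℕ, j < (nr.eval x s 0).toNat → re.Bounded B x s j)
    (hreA : ∀ s : ℕ, s < r → ∀ j : ℕ, j < (nr.eval x s 0).toNat → ((re.eval x s j : ℤ) : ℝ) ∈ A)
    {y : ℕ → Input}
    (hyw : ∀ s : ℕ, s < r →
      (y s).words = (List.range (nw.eval x s 0).toNat).map fun j : ℕ => we.eval x s (j : ℤ))
    (hyr : ∀ s : ℕ, s < r → (y s).reals =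
      (List.range (nr.eval x s 0).toNat).map fun j : ℕ => ((re.eval x s (j : ℤ) : ℤ) : ℝ))
    {t : ℕ → ℕ} {σf : ℕ → Memory} (hex : ∀ s < r, Exec (Wy s) (Ay s) p (y s).init (t s) (σf s))
    (hsuc : ∃ s < r, t s ≤ bud) {L : ℕ} (hL : ∀ s < r, (y s).size ≤ L)
    (hz : ∀ s < r, |(σf s).wreg 0| ≤ W) :
    Runs W A (search p count budE nw nr we re N) x.init
      (count.codeCost + budE.codeCost + 10 + r * ((nw.codeCost + nr.codeCost + 2 * N + we.codeCost +
        re.codeCost + 2 * p.hostCost + 60) * (L + bud + 1) + 1))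
      (fun σ' => ∃ s < r, t s ≤ bud ∧ σ'.wreg 0 = (σf s).wreg 0) := by
  have hroom := (fit 0 hr0).room
  have hBr : B * 1 ≤ B * r := Nat.mul_le_mul_left _ (by omega)
  have hone : |(1 : ℤ)| ≤ W := by simpa using (by exact_mod_cast (by omega : 1 ≤ W) : (1 : ℤ) ≤ W)
  have hokn : ∀ m : ℕ, m ≤ W → |(m : ℤ)| ≤ W := fun m hm => by
    rw [abs_of_nonneg (by positivity)]; exact_mod_cast hm
  set c₀ := nw.codeCost + nr.codeCost + 2 * N + we.codeCost + re.codeCost + 2 * p.hostCost + 60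
    with hc₀
  refine Runs.mono (T := 1 + (1 + (count.codeCost + (1 + (1 + (budE.codeCost + (1 +
    ((1 + r * (c₀ * (L + bud + 1) + 1)) + 1)))))))) (Runs.seq
    (Q₁ := fun τ => τ = x.init.setW 3 1) (runs_const hone rfl) ?_) (by omega) fun _ h => h
  rintro _ rfl
  refine Runs.seq (Q₁ := fun τ => τ = (x.init.setW 3 1).setW 4 x.words.length)
    (runs_wop (z := x.words.length) ?_ (hokn _ (by omega)) rfl) ?_
  · simp [WordOp.eval, Memory.setW, Input.init]
  rintro _ rfl
  have r₀ : EvalReady x 0 0 ((x.init.setW 3 1).setW 4 x.words.length) :=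
    ⟨by simp [Memory.setW, Input.init], by simp [Memory.setW], by simp [Memory.setW, Input.init],
      by simp [Memory.setW, Input.init], fun a _ => rfl, hx⟩
  refine Runs.seq (runs_code count (by omega) r₀ (hcount.mono (by omega))) ?_
  rintro τ₁ ⟨v₁, s₁⟩
  have r₁ := s₁.evalReady (by omega) r₀
  have q₁ : τ₁.wreg 3 = 1 := (s₁.wreg 3 (by omega)).trans (by simp [Memory.setW])
  refine Runs.seq (Q₁ := fun τ => τ = τ₁.setW 5 r) (runs_wop (z := r) ?_ (hokn _ (by omega)) rfl) ?_
  · simp [WordOp.eval, v₁, r₁.zero, hr]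
  rintro _ rfl
  refine Runs.seq (Q₁ := fun τ => τ = (τ₁.setW 5 r).setW 12 ((r - 1 : ℕ) : ℤ))
    (runs_wop (z := ((r - 1 : ℕ) : ℤ)) ?_ (hokn _ (by omega)) rfl) ?_
  · rw [setW_wreg_self, setW_wreg_ne (by omega), q₁]
    simp only [WordOp.eval]; omega
  rintro _ rfl
  have r₂ : EvalReady x 0 0 ((τ₁.setW 5 r).setW 12 ((r - 1 : ℕ) : ℤ)) := by
    refine ⟨?_, ?_, ?_, ?_, r₁.cells, hx⟩ <;> simp only [Memory.setW] <;>
      rw [Function.update_of_ne (by omega), Function.update_of_ne (by omega)]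
    exacts [r₁.zero, r₁.wlen, r₁.par, r₁.pos]
  refine Runs.seq (runs_code budE (by omega) r₂ (hbudE.mono (by omega))) ?_
  rintro τ₃ ⟨v₃, s₃⟩
  have r₃ := s₃.evalReady (by omega) r₂
  refine Runs.seq (Q₁ := fun τ => τ = τ₃.setW 11 bud)
    (runs_wop (z := bud) ?_ (hokn _ (by omega)) rfl) ?_
  · simp [WordOp.eval, v₃, r₃.zero, hbud]
  rintro _ rfl
  have hmem : τ₃.wmem = x.init.wmem := s₃.wmem.trans s₁.wmem
  have hrmem : τ₃.rmem = x.init.rmem := s₃.rmem.trans s₁.rmem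
  -- Either all attempts before `s` have failed and the slots from `s` on are untouched, or some
  -- attempt has succeeded. In the second case register `12` is `-1`, which ends the loop.
  let I : Memory → Prop := fun σ =>
    (∃ s ≤ r, Host x.words.length r s σ ∧ (∀ a < x.words.length, σ.wmem a = x.words.getD a 0) ∧
      σ.wreg 11 = bud ∧ σ.wreg 12 = ((r - 1 : ℕ) : ℤ) ∧
      (∀ s', s ≤ s' → s' < r → ∀ a, σ.wmem (x.words.length + (a * r + s')) = 0 ∧
        σ.rmem (x.words.length + (a * r + s')) = 0) ∧ ∀ s' < s, bud < t s') ∨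
    (σ.wreg 12 = -1 ∧ 0 ≤ σ.wreg 6 ∧ σ.wreg 2 = 0 ∧
      ∃ s < r, t s ≤ bud ∧ σ.wreg 15 = (σf s).wreg 0)
  have hI : I (τ₃.setW 11 bud) := by
    refine Or.inl ⟨0, by omega, ⟨?_, ?_, ?_, ?_, ?_⟩, ?_, setW_wreg_self, ?_, ?_, by omega⟩
    · exact (setW_wreg_ne (by omega)).trans r₃.zero
    · exact (setW_wreg_ne (by omega)).trans ((s₃.wreg 3 (by omega)).trans
        ((setW_wreg_ne (by omega)).trans ((setW_wreg_ne (by omega)).trans q₁)))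
    · exact (setW_wreg_ne (by omega)).trans r₃.wlen
    · exact (setW_wreg_ne (by omega)).trans ((s₃.wreg 5 (by omega)).trans
        ((setW_wreg_ne (by omega)).trans setW_wreg_self))
    · exact (setW_wreg_ne (by omega)).trans r₃.par
    · exact r₃.cells
    · exact (setW_wreg_ne (by omega)).trans ((s₃.wreg 12 (by omega)).trans setW_wreg_self)
    · intro s' _ _ a
      refine ⟨?_, ?_⟩
      · show τ₃.wmem _ = 0
        rw [hmem]
        exact List.getD_eq_default _ _ (by omega)
      · show τ₃.rmem _ = 0
        rw [hrmem]
        simp [Input.init, hx]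
  have hmeas : ((τ₃.setW 11 bud).wreg 12 + 1 - (τ₃.setW 11 bud).wreg 6).toNat = r := by
    have h6 : (τ₃.setW 11 bud).wreg 6 = 0 := (setW_wreg_ne (by omega)).trans r₃.par
    have h12 : (τ₃.setW 11 bud).wreg 12 = ((r - 1 : ℕ) : ℤ) :=
      (setW_wreg_ne (by omega)).trans ((s₃.wreg 12 (by omega)).trans setW_wreg_self)
    rw [h6, h12]; omega
  refine Runs.seq ((Runs.while (T := c₀ * (L + bud + 1)) I
    (fun σ => (σ.wreg 12 + 1 - σ.wreg 6).toNat) ?_ hI).mono (by rw [hmeas]) fun _ h => h) ?_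
  · intro σ hσ hcond
    rcases hσ with ⟨s, hsr, hh, hc, e11, e12, fresh, hfail⟩ | ⟨e12, e6, -⟩
    · simp only [Test.Holds, hh.idx, e12] at hcond
      have hs : s < r := by omega
      refine (runs_attempt hx hN hp hA hh hc (fit s hs) (hnw s hs) (hnr s hs) (hwe s hs) (hre s hs)
        (hreA s hs) (fresh s le_rfl hs) e11 (by omega) (hyw s hs) (hyr s hs) (hex s hs)).mono
        (Nat.mul_le_mul_left _ (by have := hL s hs; omega)) ?_
      rintro σ' ⟨k1, k2, k6, kgood, kbad⟩
      have kk := fun i (hi : i < 6) => k1 i (by omega) (by omega) (by omega) (by omega) (by omega)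
        (by omega)
      rcases Nat.lt_or_ge bud (t s) with hlt | hge
      · have k12 := (kbad hlt).trans e12
        refine ⟨Or.inl ⟨s + 1, hs, ⟨(kk 2 (by omega)).trans hh.zero, (kk 3 (by omega)).trans hh.one,
          (kk 4 (by omega)).trans hh.base, (kk 5 (by omega)).trans hh.num, by rw [k6]; push_cast; rfl⟩,
          fun a ha => ?_, ?_, k12, fun s' h1 h2 a => ?_, fun s' hs' => ?_⟩, ?_⟩
        · exact (k2 a fun b hb => by omega).1.trans (hc a ha)
        · exact (k1 11 (by omega) (by omega) (by omega) (by omega) (by omega) (by omega)).trans e11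
        · obtain ⟨a1, a2⟩ := k2 (x.words.length + (a * r + s'))
            (fun b => slot_disjoint h2 hs (by omega))
          rw [a1, a2]; exact fresh s' (by omega) h2 a
        · rcases Nat.lt_or_ge s' s with h | h
          · exact hfail s' h
          · obtain rfl : s' = s := by omega
            exact hlt
        · rw [k12, k6, e12, hh.idx]; omega
      · refine ⟨Or.inr ⟨(kgood hge).1, by rw [k6]; positivity, (kk 2 (by omega)).trans hh.zero, s, hs, hge, (kgood hge).2⟩, ?_⟩
        rw [(kgood hge).1, k6, e12, hh.idx]; omega
    · simp only [Test.Holds, e12] at hcond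
      omega
  · rintro σ ⟨hσ, hcond⟩
    rcases hσ with ⟨s, hsr, hh, hc, e11, e12, fresh, hfail⟩ | ⟨e12, e6, e2, s, hs, hts, e15⟩
    · simp only [Test.Holds, hh.idx, e12] at hcond
      obtain ⟨s', hs', hts'⟩ := hsuc
      have := hfail s' (by omega)
      omega
    · refine runs_wop (z := (σf s).wreg 0) ?_ (hz s hs) ⟨s, hs, hts, setW_wreg_self⟩
      simp [WordOp.eval, e15, e2]

end
end FineGrained

/-! ### Closedness of the class of all programs, for reductions with an explicit budget -/

namespace FineGrained
noncomputable section

theorem HasHeight.mono {H H' : ℕ} (h : H ≤ H') {r : ℝ} (hr : HasHeight H r) : HasHeight H' r := by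
  obtain ⟨p, q, h0, hq, hp, e⟩ := hr
  exact ⟨p, q, h0, hq.trans h, hp.trans (by exact_mod_cast h), e⟩

theorem hasHeight_intCast {H : ℕ} (hH : 1 ≤ H) {z : ℤ} (hz : |z| ≤ (H : ℤ)) :
    HasHeight H (z : ℝ) := ⟨z, 1, one_pos, hH, hz, by simp⟩

/-- The height of an integer of polynomial size is small regardless of the reals in the input, so
both arithmetics can represent it. -/
theorem intCast_mem_allowed {μ : Arithmetic} {c : ℕ} {x : Input} {z : ℤ}
    (hz : |z| ≤ ((x.size + 2) ^ c : ℕ)) : (z : ℝ) ∈ μ.allowed c x := by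
  cases μ with
  | exact => trivial
  | bounded =>
    intro H _
    refine hasHeight_intCast (Nat.one_le_pow _ _ (by omega)) (hz.trans ?_)
    exact_mod_cast Nat.pow_le_pow_left (by omega) c

/-- A version of `ClosedUnderElementaryReductions` for reductions given by arithmetic expressions
to inputs with integral reals, where the time bound is given by an expression as well. -/
def BudgetClosed (μ : Arithmetic) (𝒞 : Set Prog) : Prop :=
  ∀ (X Y : Problem) (R : ElementaryReduction X Y) (p : Prog) (c : ℕ) (re bud : WordExpr)
    (L : X.Inst → ℕ), R.real = .ofWord re → re.Arith → bud.Arith → R.count.Arith → R.wlen.Arith →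
    R.rlen.Arith → R.word.Arith → (∀ x, (X.input x).reals = []) → (∀ x, 1 ≤ (X.input x).size) →
    p ∈ 𝒞 → (∀ y : Y.Inst, ∃ t, Decides μ c Y p y t) →
    (∀ x, ∀ s < R.number x, (Y.input (R.map x s)).size ≤ L x) →
    (∀ x, 1 ≤ bud.eval (X.input x) 0 0) →
    (∀ x, ∃ s < R.number x, ∃ t : ℕ, (t : ℤ) ≤ bud.eval (X.input x) 0 0 ∧
      Decides μ c Y p (R.map x s) t) →
    ∃ q ∈ 𝒞, ∃ c' C : ℕ, ∀ x, ∃ t, Decides μ c' X q x t ∧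
      t ≤ C * ((X.input x).size + R.number x * (L x + (bud.eval (X.input x) 0 0).toNat))

theorem Problem.exists_bounded (X : Problem) {e : WordExpr} (he : e.Arith) (b₀ : ℕ) :
    ∃ b, ∀ (x : X.Inst) (s j : ℤ), |s| ≤ (((X.input x).size + 2) ^ b₀ : ℕ) →
      |j| ≤ (((X.input x).size + 2) ^ b₀ : ℕ) →
      e.Bounded (((X.input x).size + 2) ^ b) (X.input x) s j := by
  obtain ⟨bx, hbx⟩ := X.words_bounded
  obtain ⟨b, hb⟩ := he.exists_bounded (bx + b₀)
  have mono : ∀ {n a a' : ℕ}, a ≤ a' → ((n + 2) ^ a : ℕ) ≤ (n + 2) ^ a' := fun h =>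
    Nat.pow_le_pow_right (by omega) h
  refine ⟨b, fun x s j hs hj => hb _ s j _ (by omega) (by omega) (fun w hw => ?_) ?_ ?_⟩
  · exact (hbx x w hw).trans (by exact_mod_cast mono (by omega))
  · exact hs.trans (by exact_mod_cast mono (by omega))
  · exact hj.trans (by exact_mod_cast mono (by omega))

/-- A budget given by an arithmetic expression is polynomially bounded, hence an admissible time
bound. -/
theorem ClosedUnderElementaryReductions.budgetClosed {μ : Arithmetic} {𝒞 : Set Prog}
    (h : ClosedUnderElementaryReductions μ 𝒞) : BudgetClosed μ 𝒞 := by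
  intro X Y R p c re bud L _ _ hbud _ _ _ _ _ _ hp hsol hL _ hT
  obtain ⟨b, hb⟩ := X.exists_bounded hbud 0
  refine h X Y R p c L (fun x => (bud.eval (X.input x) 0 0).toNat) hp hsol ⟨b, fun x => ?_⟩ hL
    fun x => ?_
  · have h1 := (hb x 0 0 (by simp) (by simp)).abs_le
    have h2 := le_abs_self (bud.eval (X.input x) 0 0)
    generalize ((X.input x).size + 2) ^ b = B at *
    omega
  · obtain ⟨s, hs, t, ht, hd⟩ := hT x
    exact ⟨s, hs, t, by omega, hd⟩

/-- The program is `search`. All sizes, words and addresses that occur are at most fixed powers of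
`D`, the input length plus `2`; most of the proof collects the exponents. -/
theorem budgetClosed_univ (μ : Arithmetic) : BudgetClosed μ Set.univ := by
  intro X Y R p c re bud L hreal hre hbud hcnt hnw hnr hwe hxr hx1 _ hsol hL hbud1 hT
  obtain ⟨N, hN, hpN⟩ := p.exists_below
  obtain ⟨bb, hbb⟩ := X.exists_bounded hbud 0
  obtain ⟨bc, hbc⟩ := X.exists_bounded hcnt 0
  obtain ⟨bw, hbw⟩ := X.exists_bounded hnw bc
  obtain ⟨br, hbr⟩ := X.exists_bounded hnr bc
  obtain ⟨be, hbe⟩ := X.exists_bounded hwe (bc + bw)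
  obtain ⟨bf, hbf⟩ := X.exists_bounded hre (bc + br)
  -- The product with `c` accounts for the words computed in the simulated runs, whose inputs have
  -- length polynomial in `D`; the other summands account for the values of the expressions.
  set b := bb + bc + bw + br + be + bf + (bw + br + bf + 3) * c with hb
  refine ⟨search p R.count bud R.wlen R.rlen R.word re N, trivial, b + bc + 3,
    R.count.codeCost + bud.codeCost + 10 + 2 * (R.wlen.codeCost + R.rlen.codeCost + 2 * N +
      R.word.codeCost + re.codeCost + 2 * p.hostCost + 60) + 1, fun x => ?_⟩
  set D := (X.input x).size + 2 with hD
  have mono : ∀ {a a' : ℕ}, a ≤ a' → (D ^ a : ℕ) ≤ D ^ a' := fun h =>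
    Nat.pow_le_pow_right (by omega) h
  have monoZ : ∀ {a a' : ℕ}, a ≤ a' → ((D ^ a : ℕ) : ℤ) ≤ (D ^ a' : ℕ) := fun h => by
    exact_mod_cast mono h
  obtain ⟨s₀, hs₀, t₀, ht₀, hd₀⟩ := hT x
  have hcB := (hbc x 0 0 (by simp) (by simp)).abs_le
  have hr : R.count.eval (X.input x) 0 0 = (R.number x : ℕ) := by
    unfold ElementaryReduction.number at hs₀ ⊢; omega
  have hrD : R.number x ≤ D ^ bc := by
    rw [hr] at hcB; rw [abs_of_nonneg (by positivity)] at hcB; exact_mod_cast hcB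
  have hlt : ∀ s : ℕ, s < R.number x → (s : ℤ) < R.count.eval (X.input x) 0 0 := fun s hs => by
    rw [hr]; exact_mod_cast hs
  have hsD : ∀ s : ℕ, s < R.number x → |(s : ℤ)| ≤ (D ^ bc : ℕ) := fun s hs => by
    rw [abs_of_nonneg (by positivity)]; exact_mod_cast hs.le.trans hrD
  have h0D : ∀ a, |(0 : ℤ)| ≤ (D ^ a : ℕ) := fun a => by
    rw [abs_zero]; exact_mod_cast Nat.zero_le _
  have hw : ∀ s : ℕ, s < R.number x → R.wlen.Bounded (D ^ bw) (X.input x) s 0 := fun s hs =>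
    hbw x s 0 (hsD s hs) (h0D _)
  have hrl : ∀ s : ℕ, s < R.number x → R.rlen.Bounded (D ^ br) (X.input x) s 0 := fun s hs =>
    hbr x s 0 (hsD s hs) (h0D _)
  have hjw : ∀ s : ℕ, s < R.number x → (R.wlen.eval (X.input x) s 0).toNat ≤ D ^ bw := fun s hs => by
    have h1 := (hw s hs).abs_le
    have h2 := le_abs_self (R.wlen.eval (X.input x) s 0)
    omega
  have hjr : ∀ s : ℕ, s < R.number x → (R.rlen.eval (X.input x) s 0).toNat ≤ D ^ br := fun s hs => by
    have h1 := (hrl s hs).abs_le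
    have h2 := le_abs_self (R.rlen.eval (X.input x) s 0)
    omega
  have hwe' : ∀ s : ℕ, s < R.number x → ∀ j : ℕ, j < (R.wlen.eval (X.input x) s 0).toNat →
      R.word.Bounded (D ^ be) (X.input x) s j := fun s hs j hj => by
    refine hbe x s j ((hsD s hs).trans (monoZ (by omega))) ?_
    rw [abs_of_nonneg (by positivity)]
    exact_mod_cast (hj.le.trans (hjw s hs)).trans (mono (by omega))
  have hre' : ∀ s : ℕ, s < R.number x → ∀ j : ℕ, j < (R.rlen.eval (X.input x) s 0).toNat →
      re.Bounded (D ^ bf) (X.input x) s j := fun s hs j hj => by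
    refine hbf x s j ((hsD s hs).trans (monoZ (by omega))) ?_
    rw [abs_of_nonneg (by positivity)]
    exact_mod_cast (hj.le.trans (hjr s hs)).trans (mono (by omega))
  have hyw : ∀ s : ℕ, s < R.number x → (Y.input (R.map x s)).words =
      (List.range (R.wlen.eval (X.input x) s 0).toNat).map
        fun j : ℕ => R.word.eval (X.input x) s (j : ℤ) := fun s hs => by
    rw [R.words_eq x s (hlt s hs)]; exact map_range_cast (fun j => R.word.eval (X.input x) s j) _
  have hyr : ∀ s : ℕ, s < R.number x → (Y.input (R.map x s)).reals =
      (List.range (R.rlen.eval (X.input x) s 0).toNat).map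
        fun j : ℕ => ((re.eval (X.input x) s (j : ℤ) : ℤ) : ℝ) := fun s hs => by
    rw [R.reals_eq x s (hlt s hs), hreal]
    exact map_range_cast (fun j => ((re.eval (X.input x) s j : ℤ) : ℝ)) _
  have hsize : ∀ s : ℕ, s < R.number x → (Y.input (R.map x s)).size + 2 ≤ D ^ (bw + br + 2) := by
    intro s hs
    have e : (Y.input (R.map x s)).size = (R.wlen.eval (X.input x) s 0).toNat +
        (R.rlen.eval (X.input x) s 0).toNat := by
      simp [Input.size, hyw s hs, hyr s hs]
    have h1 := hjw s hs
    have h2 := hjr s hs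
    have h3 : D ^ bw ≤ D ^ (bw + br) := mono (by omega)
    have h4 : D ^ br ≤ D ^ (bw + br) := mono (by omega)
    have h5 : 1 ≤ D ^ (bw + br) := Nat.one_le_pow _ _ (by omega)
    have h6 : D ^ (bw + br + 2) = D ^ (bw + br) * (D * D) := by ring
    have h7 : 2 * 2 ≤ D * D := Nat.mul_le_mul (by omega) (by omega)
    have h8 : D ^ (bw + br) * (2 * 2) ≤ D ^ (bw + br) * (D * D) := Nat.mul_le_mul_left _ h7
    omega
  have hA : ∀ s : ℕ, s < R.number x →
      μ.allowed c (Y.input (R.map x s)) ⊆ μ.allowed (b + bc + 3) (X.input x) := by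
    intro s hs
    cases μ with
    | exact => exact fun _ _ => trivial
    | bounded =>
      intro v hv H _
      -- The reals of a produced instance are integers of absolute value at most `D ^ bf`. Inserting
      -- this height bound, instead of `H`, limits all reals of the simulated run independently of
      -- `H`.
      refine (hv (D ^ bf) fun r hr => ?_).mono ?_
      · rw [hyr s hs, List.mem_map] at hr
        obtain ⟨j, hj, rfl⟩ := hr
        exact hasHeight_intCast (Nat.one_le_pow _ _ (by omega))
          (hre' s hs j (List.mem_range.1 hj)).abs_le
      · have h1 := hsize s hs
        have h2 : D ^ bf ≤ D ^ (bw + br + bf + 2) := mono (by omega)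
        have h3 : D ^ (bw + br + 2) ≤ D ^ (bw + br + bf + 2) := mono (by omega)
        have h4 : D ^ (bw + br + bf + 3) = D ^ (bw + br + bf + 2) * D := by ring
        have h5 : D ^ (bw + br + bf + 2) * 2 ≤ D ^ (bw + br + bf + 2) * D :=
          Nat.mul_le_mul_left _ (by omega)
        calc ((Y.input (R.map x s)).size + D ^ bf + 2) ^ c ≤ (D ^ (bw + br + bf + 3)) ^ c :=
              Nat.pow_le_pow_left (by omega) c
          _ = D ^ ((bw + br + bf + 3) * c) := by rw [← pow_mul]
          _ ≤ D ^ (b + bc + 3) := mono (by omega)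
          _ ≤ _ := Nat.pow_le_pow_left (by omega) _
  have hpow : ∀ s : ℕ, s < R.number x → ((Y.input (R.map x s)).size + 2) ^ c ≤ D ^ b := by
    intro s hs
    calc ((Y.input (R.map x s)).size + 2) ^ c ≤ (D ^ (bw + br + bf + 3)) ^ c :=
          Nat.pow_le_pow_left ((hsize s hs).trans (mono (by omega))) c
      _ = D ^ ((bw + br + bf + 3) * c) := by rw [← pow_mul]
      _ ≤ D ^ b := mono (by omega)
  have hroom : D ^ b * R.number x + (X.input x).words.length + R.number x + 1 ≤
      D ^ (b + bc + 3) := by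
    have h1 : D ^ b * R.number x ≤ D ^ b * D ^ bc := Nat.mul_le_mul_left _ hrD
    have h2 : D ^ b * D ^ bc = D ^ (b + bc) := (pow_add D b bc).symm
    have h3 : (X.input x).words.length ≤ D := by rw [hD, Input.size]; omega
    have h4 : D ^ bc ≤ D ^ (b + bc) := mono (by omega)
    have h5 : D ^ (b + bc + 3) = D ^ (b + bc) * D * (D * D) := by ring
    have h6 : 1 ≤ D ^ (b + bc) := Nat.one_le_pow _ _ (by omega)
    have h7 : D ^ (b + bc) * D * (2 * 2) ≤ D ^ (b + bc) * D * (D * D) :=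
      Nat.mul_le_mul_left _ (Nat.mul_le_mul (by omega) (by omega))
    have h8 : D ^ (b + bc) * 2 ≤ D ^ (b + bc) * D := Nat.mul_le_mul_left _ (by omega)
    have h9 : 1 * D ≤ D ^ (b + bc) * D := Nat.mul_le_mul_right _ h6
    omega
  have hbB : (bud.eval (X.input x) 0 0).toNat ≤ D ^ b := by
    have h1 := (hbb x 0 0 (by simp) (by simp)).abs_le
    have h2 := le_abs_self (bud.eval (X.input x) 0 0)
    have h3 : ((D ^ bb : ℕ) : ℤ) ≤ (D ^ b : ℕ) := monoZ (by omega)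
    have h4 := h2.trans (h1.trans h3)
    omega
  -- A halting run is fixed for every instance, and for `s₀` it is the short one. For the other
  -- parameters nothing is known about the time, but if such a run ends within the budget its answer
  -- is right as well, because all instances are equivalent.
  have hex : ∀ s, ∃ t : ℕ, ∃ σ : Memory,
      Exec (((Y.input (R.map x s)).size + 2) ^ c) (μ.allowed c (Y.input (R.map x s))) p
        (Y.input (R.map x s)).init t σ ∧ (Y.yes (R.map x s) → σ.wreg 0 = 1) ∧
        (¬ Y.yes (R.map x s) → σ.wreg 0 = 0) ∧ (s = s₀ → t = t₀) := by
    intro s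
    by_cases hs : s = s₀
    · subst hs
      obtain ⟨σ, h1, h2, h3⟩ := hd₀
      exact ⟨t₀, σ, h1, h2, h3, fun _ => rfl⟩
    · obtain ⟨t, σ, h1, h2, h3⟩ := hsol (R.map x s)
      exact ⟨t, σ, h1, h2, h3, fun h => absurd h hs⟩
  choose t σf hex hyes hno hts using hex
  have hz : ∀ s, |(σf s).wreg 0| ≤ ((D ^ (b + bc + 3) : ℕ) : ℤ) := fun s => by
    have h1 : (1 : ℤ) ≤ (D ^ (b + bc + 3) : ℕ) := by exact_mod_cast Nat.one_le_pow _ _ (by omega)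
    by_cases h : Y.yes (R.map x s)
    · rw [hyes s h, abs_one]; exact h1
    · rw [hno s h, abs_zero]; omega
  have hmono' : ∀ {e : WordExpr} {s j : ℤ} {a : ℕ}, a ≤ b → e.Bounded (D ^ a) (X.input x) s j →
      e.Bounded (D ^ b) (X.input x) s j := fun h he => he.mono (mono h)
  have hb1 := hbud1 x
  obtain ⟨T, hTle, τ, hrun, s, hs, -, hτ⟩ :=
    runs_search (W := D ^ (b + bc + 3)) (A := μ.allowed (b + bc + 3) (X.input x))
      (hxr x) (count := R.count) (budE := bud) (nw := R.wlen) (nr := R.rlen) (we := R.word) (re := re)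
      hN hpN (by exact_mod_cast intCast_mem_allowed (z := 0) (h0D _)) (B := D ^ b)
      (Wy := fun s => ((Y.input (R.map x s)).size + 2) ^ c)
      (Ay := fun s => μ.allowed c (Y.input (R.map x s)))
      (bud := (bud.eval (X.input x) 0 0).toNat) hr (by omega) (by omega)
      (hmono' (by omega) (hbc x 0 0 (by simp) (by simp)))
      (hmono' (by omega) (hbb x 0 0 (by simp) (by simp))) hbB
      (fun s hs => ⟨hA s hs, hpow s hs, hroom, hs⟩)
      (fun s hs => hmono' (by omega) (hw s hs)) (fun s hs => hmono' (by omega) (hrl s hs))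
      (fun s hs j hj => hmono' (by omega) (hwe' s hs j hj))
      (fun s hs j hj => hmono' (by omega) (hre' s hs j hj))
      (fun s hs j hj => intCast_mem_allowed ((hre' s hs j hj).abs_le.trans (monoZ (by omega))))
      (y := fun s => Y.input (R.map x s)) hyw hyr (t := t) (σf := σf) (fun s _ => hex s)
      ⟨s₀, hs₀, by rw [hts s₀ rfl]; omega⟩ (hL x) (fun s _ => hz s)
  have hyx := R.yes_iff x s (hlt s hs)
  refine ⟨T, ⟨τ, hrun, fun h => ?_, fun h => ?_⟩, ?_⟩
  · rw [hτ]; exact hyes s (hyx.2 h)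
  · rw [hτ]; exact hno s (fun h' => h (hyx.1 h'))
  · refine hTle.trans ?_
    have hr0 : 0 < R.number x := by omega
    have hx1' := hx1 x
    have hbud : 1 ≤ (bud.eval (X.input x) 0 0).toNat := by omega
    generalize (bud.eval (X.input x) 0 0).toNat = u at *
    generalize R.wlen.codeCost + R.rlen.codeCost + 2 * N + R.word.codeCost + re.codeCost +
      2 * p.hostCost + 60 = c₀
    generalize R.count.codeCost + bud.codeCost + 10 = c₁
    clear_value b D
    generalize R.number x = r at *
    generalize L x = l at *
    generalize (X.input x).size = z at *
    have h1 : c₀ * (l + u + 1) + 1 ≤ (2 * c₀ + 1) * (l + u) := by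
      have : c₀ * 1 ≤ c₀ * (l + u) := Nat.mul_le_mul_left _ (by omega)
      have e : (2 * c₀ + 1) * (l + u) = c₀ * (l + u) + c₀ * (l + u) + (l + u) := by ring
      have e' : c₀ * (l + u + 1) = c₀ * (l + u) + c₀ := by ring
      omega
    have h2 : r * (c₀ * (l + u + 1) + 1) ≤ r * ((2 * c₀ + 1) * (l + u)) :=
      Nat.mul_le_mul_left _ h1
    have h3 : c₁ * 1 ≤ c₁ * z := Nat.mul_le_mul_left _ hx1'
    have e : (c₁ + 2 * c₀ + 1) * (z + r * (l + u)) = c₁ * z + c₁ * (r * (l + u)) +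
      (2 * c₀ + 1) * z + r * ((2 * c₀ + 1) * (l + u)) := by ring
    rw [e]
    omega

end
end FineGrained

/-! ### Calculus of functions given by arithmetic expressions -/

namespace FineGrained
noncomputable section

/-- A word-valued function of an input, a parameter and a position that is the value of an
arithmetic expression. -/
def Expressible (f : Input → ℤ → ℤ → ℤ) : Prop :=
  ∃ e : WordExpr, e.Arith ∧ ∀ x s j, e.eval x s j = f x s j

/-- A property of an input, a parameter and a position whose indicator is expressible. -/
def ExpressibleProp (P : Input → ℤ → ℤ → Prop) : Prop :=
  Expressible fun x s j => open Classical in if P x s j then 1 else 0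

namespace Expressible
variable {f g h k : Input → ℤ → ℤ → ℤ}

theorem congr (hf : Expressible f) (e : ∀ x s j, f x s j = g x s j) : Expressible g := by
  obtain ⟨a, ha, h⟩ := hf
  exact ⟨a, ha, fun x s j => (h x s j).trans (e x s j)⟩

theorem const (z : ℤ) : Expressible fun _ _ _ => z := ⟨.const z, trivial, fun _ _ _ => rfl⟩
theorem par : Expressible fun _ s _ => s := ⟨.par, trivial, fun _ _ _ => rfl⟩
theorem pos : Expressible fun _ _ j => j := ⟨.pos, trivial, fun _ _ _ => rfl⟩

theorem cell (hf : Expressible f) : Expressible fun x s j => x.words.getD (f x s j).toNat 0 := by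
  obtain ⟨e, he, h⟩ := hf
  exact ⟨.cell e, he, fun x s j => by simp only [WordExpr.eval, h]⟩

theorem add (hf : Expressible f) (hg : Expressible g) :
    Expressible fun x s j => f x s j + g x s j := by
  obtain ⟨e, he, h⟩ := hf
  obtain ⟨e', he', h'⟩ := hg
  exact ⟨.op .add e e', ⟨by simp, he, he'⟩, fun x s j => by simp only [WordExpr.eval, h, h']; rfl⟩

theorem sub (hf : Expressible f) (hg : Expressible g) :
    Expressible fun x s j => f x s j - g x s j := by
  obtain ⟨e, he, h⟩ := hf
  obtain ⟨e', he', h'⟩ := hg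
  exact ⟨.op .sub e e', ⟨by simp, he, he'⟩, fun x s j => by simp only [WordExpr.eval, h, h']; rfl⟩

theorem mul (hf : Expressible f) (hg : Expressible g) :
    Expressible fun x s j => f x s j * g x s j := by
  obtain ⟨e, he, h⟩ := hf
  obtain ⟨e', he', h'⟩ := hg
  exact ⟨.op .mul e e', ⟨by simp, he, he'⟩, fun x s j => by simp only [WordExpr.eval, h, h']; rfl⟩

theorem div (hf : Expressible f) (hg : Expressible g) :
    Expressible fun x s j => f x s j / g x s j := by
  obtain ⟨e, he, h⟩ := hf
  obtain ⟨e', he', h'⟩ := hg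
  exact ⟨.op .div e e', ⟨by simp, he, he'⟩, fun x s j => by simp only [WordExpr.eval, h, h']; rfl⟩

theorem mod (hf : Expressible f) (hg : Expressible g) :
    Expressible fun x s j => f x s j % g x s j := by
  obtain ⟨e, he, h⟩ := hf
  obtain ⟨e', he', h'⟩ := hg
  exact ⟨.op .mod e e', ⟨by simp, he, he'⟩, fun x s j => by simp only [WordExpr.eval, h, h']; rfl⟩

theorem pow (hf : Expressible f) (n : ℕ) : Expressible fun x s j => f x s j ^ n := by
  induction n with
  | zero => simpa only [pow_zero] using const 1
  | succ n ih => simpa only [pow_succ] using ih.mul hf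

theorem ite_le (hf : Expressible f) (hg : Expressible g) (hh : Expressible h)
    (hk : Expressible k) :
    Expressible fun x s j => if f x s j ≤ g x s j then h x s j else k x s j := by
  obtain ⟨a, ha, h₁⟩ := hf
  obtain ⟨b, hb, h₂⟩ := hg
  obtain ⟨e, he, h₃⟩ := hh
  obtain ⟨e', he', h₄⟩ := hk
  exact ⟨.ite a b e e', ⟨ha, hb, he, he'⟩, fun x s j => by simp only [WordExpr.eval, h₁, h₂, h₃, h₄]⟩

theorem ite {P : Input → ℤ → ℤ → Prop} [∀ x s j, Decidable (P x s j)] (hP : ExpressibleProp P)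
    (hf : Expressible f) (hg : Expressible g) :
    Expressible fun x s j => if P x s j then f x s j else g x s j := by
  refine (ite_le (const 1) hP hf hg).congr fun x s j => ?_
  by_cases h : P x s j <;> simp [h]

theorem max (hf : Expressible f) (hg : Expressible g) :
    Expressible fun x s j => max (f x s j) (g x s j) := by
  simpa only [max_def] using ite_le hf hg hg hf

theorem min (hf : Expressible f) (hg : Expressible g) :
    Expressible fun x s j => min (f x s j) (g x s j) := by
  simpa only [min_def] using ite_le hf hg hf hg

/-- Selection from a fixed list of expressible functions. -/
theorem select {ι : Type*} {F : ι → Input → ℤ → ℤ → ℤ} (l : List ι)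
    (hF : ∀ i ∈ l, Expressible (F i)) (hf : Expressible f) :
    Expressible fun x s j => (l.map fun i => F i x s j).getD (f x s j).toNat 0 := by
  induction l generalizing f with
  | nil => simpa using const 0
  | cons a l ih =>
    refine (ite_le hf (const 0) (hF a (by simp))
      (ih (fun i hi => hF i (by simp [hi])) (hf.sub (const 1)))).congr fun x s j => ?_
    split_ifs with h
    · rw [Int.toNat_of_nonpos h]; simp
    · obtain ⟨n, hn⟩ : ∃ n : ℕ, f x s j = n + 1 := ⟨(f x s j - 1).toNat, by omega⟩
      rw [hn, add_sub_cancel_right]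
      simp [show ((n : ℤ) + 1).toNat = n + 1 by omega]

end Expressible

namespace ExpressibleProp
variable {P Q : Input → ℤ → ℤ → Prop} {f g : Input → ℤ → ℤ → ℤ}

theorem const (p : Prop) : ExpressibleProp fun _ _ _ => p := Expressible.const _

theorem le (hf : Expressible f) (hg : Expressible g) :
    ExpressibleProp fun x s j => f x s j ≤ g x s j := by
  refine (Expressible.ite_le hf hg (.const 1) (.const 0)).congr fun x s j => ?_
  split_ifs <;> rfl

theorem and (hP : ExpressibleProp P) (hQ : ExpressibleProp Q) :
    ExpressibleProp fun x s j => P x s j ∧ Q x s j := by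
  refine (Expressible.mul hP hQ).congr fun x s j => ?_
  by_cases h : P x s j <;> by_cases h' : Q x s j <;> simp [h, h']

theorem not (hP : ExpressibleProp P) : ExpressibleProp fun x s j => ¬ P x s j := by
  refine ((Expressible.const 1).sub hP).congr fun x s j => ?_
  by_cases h : P x s j <;> simp [h]

theorem lt (hf : Expressible f) (hg : Expressible g) :
    ExpressibleProp fun x s j => f x s j < g x s j := by
  simpa only [not_le] using (le hg hf).not

theorem eq (hf : Expressible f) (hg : Expressible g) :
    ExpressibleProp fun x s j => f x s j = g x s j := by
  simpa only [← le_antisymm_iff] using (le hf hg).and (le hg hf)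

theorem forall_mem {ι : Type*} {F : ι → Input → ℤ → ℤ → Prop} (l : List ι)
    (hF : ∀ i ∈ l, ExpressibleProp (F i)) : ExpressibleProp fun x s j => ∀ i ∈ l, F i x s j := by
  induction l with
  | nil => simpa using const True
  | cons a l ih =>
    simpa only [List.forall_mem_cons] using
      (hF a (by simp)).and (ih fun i hi => hF i (by simp [hi]))

end ExpressibleProp

end
end FineGrained

/-! ### Integral translations and instances with integral points -/

namespace FineGrained
noncomputable section

theorem directedHausdorff_le_iff {d n m : ℕ} (hn : 0 < n) (hm : 0 < m) {P : Fin n → Fin d → ℝ}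
    {Q : Fin m → Fin d → ℝ} {r : ℝ} :
    directedHausdorff P Q ≤ r ↔ ∀ i, ∃ j, ‖P i - Q j‖ ≤ r := by
  have : Nonempty (Fin n) := ⟨⟨0, hn⟩⟩
  have : Nonempty (Fin m) := ⟨⟨0, hm⟩⟩
  unfold directedHausdorff
  rw [ciSup_le_iff (Set.finite_range _).bddAbove]
  refine forall_congr' fun i => ⟨fun h => ?_, fun ⟨j, hj⟩ => ?_⟩
  · obtain ⟨j, hj⟩ := exists_eq_ciInf_of_finite (f := fun j => ‖P i - Q j‖)
    exact ⟨j, hj.le.trans h⟩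
  · exact (ciInf_le (Set.finite_range _).bddBelow j).trans hj

/-- Some integral translation moves `p` within distance `δ` of `q` and conversely. -/
def IntFeasible {d : ℕ} (n m : ℕ) (p q : ℤ → Fin d → ℤ) (δ : ℤ) : Prop :=
  ∃ τ : Fin d → ℤ, (∀ i : ℕ, i < n → ∃ j : ℕ, j < m ∧ ∀ c, |p i c + τ c - q j c| ≤ δ) ∧
    ∀ j : ℕ, j < m → ∃ i : ℕ, i < n ∧ ∀ c, |p i c + τ c - q j c| ≤ δ

/-- Coordinate `c` of the point with index `i`, scaled and slightly displaced. -/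
def spread {d : ℕ} (σ : ℤ) (p : ℤ → Fin d → ℤ) (i : ℤ) (c : Fin d) : ℤ :=
  5 * σ * p i c + if (c : ℕ) = 0 then i else 0

/-- The difference of the two indices is a multiple of `σ`, but smaller than `σ` in absolute value.
-/
theorem spread_injective {d : ℕ} (hd : 0 < d) {σ : ℤ} {p : ℤ → Fin d → ℤ} {i i' : ℕ}
    (hi : (i : ℤ) < σ) (hi' : (i' : ℤ) < σ) (h : spread σ p i = spread σ p i') : i = i' := by
  have h0 := congrFun h ⟨0, hd⟩
  simp only [spread, if_true] at h0
  have e : (i : ℤ) - i' = σ * (5 * (p i' ⟨0, hd⟩ - p i ⟨0, hd⟩)) := by linarith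
  have : (i : ℤ) - i' = 0 := Int.eq_zero_of_abs_lt_dvd ⟨_, e⟩ (by rw [abs_lt]; constructor <;> omega)
  omega

/-- The instance spanned by integral points, which need not be distinct. -/
def ofInt {d : ℕ} (hd : 0 < d) (n m : ℕ) (hn : 0 < n) (hm : 0 < m) (p q : ℤ → Fin d → ℤ) (δ : ℤ)
    (hδ : 0 ≤ δ) : HuTInst d where
  n := n
  m := m
  n_pos := hn
  m_pos := hm
  P i c := (spread (n + m) p (i : ℕ) c : ℝ)
  Q j c := (spread (n + m) q (j : ℕ) c : ℝ)
  P_inj i i' h := by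
    have := i.2
    have := i'.2
    refine Fin.ext (spread_injective hd (σ := n + m) (p := p) (by omega) (by omega)
      (funext fun c => ?_) : (i : ℕ) = i')
    have h' := congrFun h c
    exact Int.cast_injective h'
  Q_inj i i' h := by
    have := i.2
    have := i'.2
    refine Fin.ext (spread_injective hd (σ := n + m) (p := q) (by omega) (by omega)
      (funext fun c => ?_) : (i : ℕ) = i')
    have h' := congrFun h c
    exact Int.cast_injective h'
  δ := ((5 * (n + m) * δ + (n + m) : ℤ) : ℝ)
  δ_pos := by
    have : 0 ≤ 5 * ((n : ℤ) + m) * δ := by positivity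
    exact_mod_cast (by omega : (0 : ℤ) < 5 * (n + m) * δ + (n + m))

/-- Scaling turns `δ` into `5 * σ * δ`, and the displacements by indices add at most `σ`. -/
theorem spread_near {d : ℕ} {σ δ : ℤ} (hσ : 0 < σ) (hδ₀ : 0 ≤ δ) {p q : ℤ → Fin d → ℤ} {i j : ℕ}
    (hi : (i : ℤ) ≤ σ) (hj : (j : ℤ) ≤ σ) {τ : Fin d → ℤ}
    (h : ∀ c, |p i c + τ c - q j c| ≤ δ) :
    ‖((fun c => (spread σ p i c : ℝ)) + fun c => ((5 * σ * τ c : ℤ) : ℝ)) -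
      fun c => (spread σ q j c : ℝ)‖ ≤ ((5 * σ * δ + σ : ℤ) : ℝ) := by
  have hδ : ∀ c, |spread σ p i c + 5 * σ * τ c - spread σ q j c| ≤ 5 * σ * δ + σ := fun c => by
    have h1 : |5 * σ * (p i c + τ c - q j c)| ≤ 5 * σ * δ := by
      rw [abs_mul, abs_of_pos (by omega : 0 < 5 * σ)]
      exact mul_le_mul_of_nonneg_left (h c) (by omega)
    have h2 : |(if (c : ℕ) = 0 then (i : ℤ) else 0) - if (c : ℕ) = 0 then (j : ℤ) else 0| ≤ σ := by
      split_ifs <;> rw [abs_le] <;> constructor <;> omega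
    calc _ = |5 * σ * (p i c + τ c - q j c) +
          ((if (c : ℕ) = 0 then (i : ℤ) else 0) - if (c : ℕ) = 0 then (j : ℤ) else 0)| := by
          unfold spread; congr 1; ring
      _ ≤ _ := (abs_add_le _ _).trans (add_le_add h1 h2)
  refine (pi_norm_le_iff_of_nonneg ?_).2 fun c => ?_
  · exact_mod_cast (by positivity : 0 ≤ 5 * σ * δ + σ)
  · simp only [Pi.sub_apply, Pi.add_apply, Real.norm_eq_abs]
    exact_mod_cast hδ c

/-- The rounding is the same for all pairs of points. The excess of the threshold and the
displacement contribute at most `σ` each, in both directions. Adding `2 * σ` before the division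
compensates for this from below, and from above leaves an error of at most `4 * σ`, less than the
scale `5 * σ`; hence taking the floor respects both bounds. -/
theorem near_of_spread {d : ℕ} {σ δ : ℤ} (hσ : 0 < σ) {p q : ℤ → Fin d → ℤ} {i j : ℕ}
    (hi : (i : ℤ) ≤ σ) (hj : (j : ℤ) ≤ σ) {τ : Fin d → ℝ}
    (h : ‖((fun c => (spread σ p i c : ℝ)) + τ) - fun c => (spread σ q j c : ℝ)‖ ≤
      ((5 * σ * δ + σ : ℤ) : ℝ)) (c : Fin d) :
    |p i c + ⌊(τ c + 2 * σ) / (5 * σ)⌋ - q j c| ≤ δ := by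
  have h1 := (norm_le_pi_norm _ c).trans h
  simp only [Pi.sub_apply, Pi.add_apply, Real.norm_eq_abs, spread] at h1
  have hσ' : (0 : ℝ) < σ := by exact_mod_cast hσ
  have hi' : (i : ℝ) ≤ σ := by exact_mod_cast hi
  have hj' : (j : ℝ) ≤ σ := by exact_mod_cast hj
  have hi0 : (0 : ℝ) ≤ i := by positivity
  have hj0 : (0 : ℝ) ≤ j := by positivity
  have h2 : |(if (c : ℕ) = 0 then (i : ℝ) else 0) - if (c : ℕ) = 0 then (j : ℝ) else 0| ≤ σ := by
    split_ifs <;> rw [abs_le] <;> constructor <;> linarith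
  push_cast at h1
  rw [abs_le] at h1 h2
  set f := (τ c + 2 * σ) / (5 * σ) with hf
  have hτ : τ c = 5 * σ * f - 2 * σ := by rw [hf]; field_simp; ring
  have hlow : (-δ : ℝ) ≤ p i c - q j c + f := by
    have : 5 * (σ : ℝ) * (-δ) ≤ 5 * σ * (p i c - q j c + f) := by
      nlinarith
    exact le_of_mul_le_mul_left this (by positivity)
  have hup : (p i c - q j c + f : ℝ) < δ + 1 := by
    have : 5 * (σ : ℝ) * (p i c - q j c + f) < 5 * σ * (δ + 1) := by
      nlinarith
    exact lt_of_mul_lt_mul_left this (by positivity)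
  have e : p i c + ⌊f⌋ - q j c = ⌊(p i c - q j c + f : ℝ)⌋ := by
    rw [show (p i c - q j c + f : ℝ) = f + ((p i c - q j c : ℤ) : ℝ) by push_cast; ring,
      Int.floor_add_intCast]
    ring
  rw [e, abs_le]
  constructor
  · exact Int.le_floor.2 (by exact_mod_cast hlow)
  · exact Int.le_of_lt_add_one (Int.floor_lt.2 (by exact_mod_cast hup))

theorem ofInt_yes {d : ℕ} (hd : 0 < d) {n m : ℕ} (hn : 0 < n) (hm : 0 < m) {p q : ℤ → Fin d → ℤ}
    {δ : ℤ} (hδ : 0 ≤ δ) :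
    (undirectedHuT d hd).yes (ofInt hd n m hn hm p q δ hδ) ↔ IntFeasible n m p q δ := by
  have hσ : (0 : ℤ) < n + m := by omega
  set P : Fin n → Fin d → ℝ := fun i c => (spread (n + m) p (i : ℕ) c : ℝ)
  set Q : Fin m → Fin d → ℝ := fun j c => (spread (n + m) q (j : ℕ) c : ℝ)
  show (∃ τ : Fin d → ℝ, hausdorff (fun i => P i + τ) Q ≤ ((5 * (n + m) * δ + (n + m) : ℤ) : ℝ)) ↔ _
  unfold hausdorff
  simp only [max_le_iff, directedHausdorff_le_iff hn hm, directedHausdorff_le_iff hm hn]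
  constructor
  · rintro ⟨τ, h₁, h₂⟩
    refine ⟨fun c => ⌊(τ c + 2 * ((n + m : ℤ) : ℝ)) / (5 * ((n + m : ℤ) : ℝ))⌋, fun i hi => ?_,
      fun j hj => ?_⟩
    · obtain ⟨j, hj⟩ := h₁ ⟨i, hi⟩
      exact ⟨j, j.2, fun c => near_of_spread hσ (by omega) (by omega) hj c⟩
    · obtain ⟨i, hi⟩ := h₂ ⟨j, hj⟩
      rw [norm_sub_rev] at hi
      exact ⟨i, i.2, fun c => near_of_spread hσ (by omega) (by omega) hi c⟩
  · rintro ⟨τ, h₁, h₂⟩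
    refine ⟨fun c => ((5 * (n + m) * τ c : ℤ) : ℝ), fun i => ?_, fun j => ?_⟩
    · obtain ⟨j, hj, h⟩ := h₁ i i.2
      exact ⟨⟨j, hj⟩, spread_near hσ hδ (by omega) (by omega) h⟩
    · obtain ⟨i, hi, h⟩ := h₂ j j.2
      refine ⟨⟨i, hi⟩, ?_⟩
      rw [norm_sub_rev]
      exact spread_near hσ hδ (by omega) (by omega) h

/-- The real with index `j` in the input given by `ofInt`. -/
def cellValue {d : ℕ} (n m : ℤ) (p q : ℤ → Fin d → ℤ) (δ j : ℤ) : ℤ :=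
  if j ≤ 0 then 5 * (n + m) * δ + (n + m) else
    ((List.finRange d).map fun c => if (j - 1) / d < n then spread (n + m) p ((j - 1) / d) c
      else spread (n + m) q ((j - 1) / d - n) c).getD ((j - 1) % d).toNat 0

theorem ofInt_reals {d : ℕ} (hd : 0 < d) {n m : ℕ} (hn : 0 < n) (hm : 0 < m)
    {p q : ℤ → Fin d → ℤ} {δ : ℤ} (hδ : 0 ≤ δ) :
    (ofInt hd n m hn hm p q δ hδ).input.reals =
      (List.range ((n + m) * d + 1)).map fun j : ℕ => (cellValue n m p q δ j : ℝ) := by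
  have hpos : 0 < (d : ℤ) := by exact_mod_cast hd
  rw [List.range_succ_eq_map, List.map_cons, List.map_map]
  show _ :: _ = _
  congr 1
  rw [← List.ofFn_fin_append, List.flatMap_def, List.map_ofFn]
  have := List.ofFn_mul (m := n + m) (n := d) fun k : Fin ((n + m) * d) =>
    (cellValue n m p q δ ((k : ℕ) + 1 : ℕ) : ℝ)
  rw [← List.map_coe_finRange_eq_range, List.map_map, ← List.ofFn_eq_map] 
  refine Eq.trans ?_ this.symm
  congr 1
  refine congrArg List.ofFn (funext fun i => congrArg List.ofFn (funext fun c => ?_))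
  have e1 : (((i : ℕ) * d + (c : ℕ) + 1 : ℕ) : ℤ) - 1 = (c : ℕ) + (d : ℤ) * (i : ℕ) := by
    push_cast; ring
  have hc : ((c : ℕ) : ℤ) < d := by exact_mod_cast c.2
  have e2 : ((c : ℕ) + (d : ℤ) * (i : ℕ)) / d = (i : ℕ) := by
    rw [Int.add_mul_ediv_left _ _ hpos.ne', Int.ediv_eq_zero_of_lt (by omega) hc, zero_add]
  have e3 : ((c : ℕ) + (d : ℤ) * (i : ℕ)) % d = (c : ℕ) := by
    rw [Int.add_mul_emod_self_left, Int.emod_eq_of_lt (by omega) hc]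
  simp only [cellValue, e1, e2, e3]
  rw [if_neg (by omega), Int.toNat_natCast, List.getD_eq_getElem _ _ (by simp)]
  simp only [List.getElem_map, List.getElem_finRange]
  revert i
  refine Fin.addCases (m := n) (n := m) (fun i => ?_) (fun j => ?_)
  · intros
    refine (congrFun (Fin.append_left (n := m) (fun i : Fin n => fun c => (spread (n + m) p (i : ℕ) c : ℝ)) _ i) c).trans ?_
    rw [if_pos (by rw [Fin.val_castAdd]; exact_mod_cast i.2)]
    simp only [Fin.val_castAdd]
    rfl
  · intros
    refine (congrFun (Fin.append_right (m := n) _ (fun j : Fin m => fun c => (spread (n + m) q (j : ℕ) c : ℝ)) j) c).trans ?_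
    rw [if_neg (by rw [Fin.val_natAdd]; push_cast; omega), Fin.val_natAdd,
      show ((n + (j : ℕ) : ℕ) : ℤ) - n = (j : ℕ) by push_cast; ring]
    rfl

end
end FineGrained

/-! ### Orthants and staircases with holes -/

namespace FineGrained
noncomputable section

/-- The coordinatewise largest (or smallest) corner with prescribed coordinates in three, possibly
equal, directions. -/
def upperCorner {d : ℕ} (R : ℤ) (cx cy cz : Fin d) (A B C : ℤ) (c : Fin d) : ℤ :=
  max (max (if c = cx then A else -2 * R) (if c = cy then B else -2 * R))
    (if c = cz then C else -2 * R)

def lowerCorner {d : ℕ} (R : ℤ) (cx cy cz : Fin d) (A B C : ℤ) (c : Fin d) : ℤ :=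
  min (min (if c = cx then A else 2 * R) (if c = cy then B else 2 * R))
    (if c = cz then C else 2 * R)

/-- In the region considered, the coordinate `-2 * R` of a corner is no restriction. Taking maxima
lets the conditions accumulate when directions coincide. -/
theorem upperCorner_le_iff {d : ℕ} {R : ℤ} {cx cy cz : Fin d} {A B C : ℤ} {y : Fin d → ℤ}
    (hy : ∀ c, -2 * R ≤ y c) :
    (∀ c, upperCorner R cx cy cz A B C c ≤ y c) ↔ A ≤ y cx ∧ B ≤ y cy ∧ C ≤ y cz := by
  simp only [upperCorner, max_le_iff]
  constructor
  · intro h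
    exact ⟨by simpa using (h cx).1.1, by simpa using (h cy).1.2, by simpa using (h cz).2⟩
  · rintro ⟨h₁, h₂, h₃⟩ c
    refine ⟨⟨?_, ?_⟩, ?_⟩ <;> split_ifs with h <;> first | exact hy c | (subst h; assumption)

theorem le_lowerCorner_iff {d : ℕ} {R : ℤ} {cx cy cz : Fin d} {A B C : ℤ} {y : Fin d → ℤ}
    (hy : ∀ c, y c ≤ 2 * R) :
    (∀ c, y c ≤ lowerCorner R cx cy cz A B C c) ↔ y cx ≤ A ∧ y cy ≤ B ∧ y cz ≤ C := by
  simp only [lowerCorner, le_min_iff]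
  constructor
  · intro h
    exact ⟨by simpa using (h cx).1.1, by simpa using (h cy).1.2, by simpa using (h cz).2⟩
  · rintro ⟨h₁, h₂, h₃⟩ c
    refine ⟨⟨?_, ?_⟩, ?_⟩ <;> split_ifs with h <;> first | exact hy c | (subst h; assumption)

theorem abs_upperCorner_le {d : ℕ} {R : ℤ} {cx cy cz : Fin d} {A B C : ℤ}
    (hA : |A| ≤ 2 * R) (hB : |B| ≤ 2 * R) (hC : |C| ≤ 2 * R) (c : Fin d) :
    |upperCorner R cx cy cz A B C c| ≤ 2 * R := by
  unfold upperCorner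
  rw [abs_le] at *
  split_ifs <;> omega

theorem abs_lowerCorner_le {d : ℕ} {R : ℤ} {cx cy cz : Fin d} {A B C : ℤ}
    (hA : |A| ≤ 2 * R) (hB : |B| ≤ 2 * R) (hC : |C| ≤ 2 * R) (c : Fin d) :
    |lowerCorner R cx cy cz A B C c| ≤ 2 * R := by
  unfold lowerCorner
  rw [abs_le] at *
  split_ifs <;> omega

/-- A staircase surface over the directions `cx`, `cy`, divided into cells of side lengths
`v ^ ex`, `v ^ ey`; in the cell with index `X, Y` it has a hole in the direction `cz`, of length
`v ^ len` if certain digits of `X` and `Y` have prescribed values `u`, and no hole otherwise. -/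
structure Surface (d : ℕ) where
  (cx cy cz : Fin d)
  (ex ey ez η₁ η₂ len : ℕ)
  base : List (ℤ × ℕ)
  (cu : ℤ) (eu : ℕ)
  (conX conY : List (ℕ × Fin 3))

namespace Surface
variable {d : ℕ} (S : Surface d) (v : ℤ) (u : Fin 3 → ℤ)

def offset : ℤ := (S.base.map fun t => t.1 * v ^ t.2).sum + S.cu * u 2 * v ^ S.eu

def lo (X Y : ℤ) : ℤ := S.offset v u - (X + Y) * v ^ S.ez

def Match (X Y : ℤ) : Prop :=
  (∀ t ∈ S.conX, X / v ^ t.1 % v = u t.2) ∧ ∀ t ∈ S.conY, Y / v ^ t.1 % v = u t.2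

def up (X Y : ℤ) : ℤ := S.lo v u X Y + open Classical in if S.Match v u X Y then v ^ S.len else 0

def Hole (y : Fin d → ℤ) : Prop :=
  0 ≤ y S.cx ∧ y S.cx < v ^ S.ex * v ^ S.η₁ ∧ 0 ≤ y S.cy ∧ y S.cy < v ^ S.ey * v ^ S.η₂ ∧
  S.lo v u (y S.cx / v ^ S.ex) (y S.cy / v ^ S.ey) ≤ y S.cz ∧
  y S.cz < S.up v u (y S.cx / v ^ S.ex) (y S.cy / v ^ S.ey)

/-- The corners of the orthants `{y | corner ≤ y}` that cover the complement of the hole: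
those above the surface, and two half-spaces. -/
def upper (R kind X Y : ℤ) : Fin d → ℤ :=
  upperCorner R S.cx S.cy S.cz
    (if kind = 0 then X * v ^ S.ex else if kind = 1 then v ^ S.ex * v ^ S.η₁ else -2 * R)
    (if kind = 0 then Y * v ^ S.ey else if kind = 1 then -2 * R else v ^ S.ey * v ^ S.η₂)
    (if kind = 0 then S.up v u X Y else -2 * R)

/-- The corners of the orthants `{y | y ≤ corner}` that cover the complement of the hole. -/
def lower (R kind X Y : ℤ) : Fin d → ℤ :=
  lowerCorner R S.cx S.cy S.cz
    (if kind = 0 then (X + 1) * v ^ S.ex - 1 else if kind = 1 then -1 else 2 * R)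
    (if kind = 0 then (Y + 1) * v ^ S.ey - 1 else if kind = 1 then 2 * R else -1)
    (if kind = 0 then S.lo v u X Y - 1 else 2 * R)

/-- The holes of different cells do not interfere. -/
def Monotone : Prop := (S.conX = [] ∧ S.conY = []) ∨ S.len ≤ S.ez

variable {S v u}

theorem lo_anti (hv : 1 ≤ v) {X Y X' Y' : ℤ} (hX : X ≤ X') (hY : Y ≤ Y') :
    S.lo v u X' Y' ≤ S.lo v u X Y := by
  unfold lo
  have : 0 ≤ v ^ S.ez := by positivity
  nlinarith

/-- If the holes are subject to no conditions, the ceiling is a translate of the floor. Otherwise a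
step to a farther cell lowers the floor by at least `v ^ S.ez`, hence by at least the length of a
hole. -/
theorem up_anti (hS : S.Monotone) (hv : 1 ≤ v) {X Y X' Y' : ℤ} (hX : X ≤ X') (hY : Y ≤ Y') :
    S.up v u X' Y' ≤ S.up v u X Y := by
  have hl := lo_anti (S := S) (u := u) hv hX hY
  have h0 : 0 ≤ v ^ S.len := by positivity
  rcases hS with ⟨h₁, h₂⟩ | hS
  · simp only [up, Match, h₁, h₂]
    simpa using hl
  · by_cases he : X = X' ∧ Y = Y'
    · rw [he.1, he.2]
    · have h1 : v ^ S.len ≤ v ^ S.ez := pow_le_pow_right₀ hv hS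
      have h2 : S.lo v u X' Y' + v ^ S.ez ≤ S.lo v u X Y := by
        have h3 : X + Y + 1 ≤ X' + Y' := by omega
        have h4 : 0 ≤ v ^ S.ez := by positivity
        unfold lo
        nlinarith
      unfold up
      split_ifs <;> omega

/-- An orthant that starts at the ceiling of a cell contains what is above the ceiling there; over
farther cells the ceiling is not higher, so the orthant meets no hole. The same holds, upside down,
for orthants below the floor. A point over the grid that is in no such orthant lies between floor
and ceiling of its own cell. -/
theorem hole_iff (hS : S.Monotone) (hv : 1 ≤ v) {R : ℤ} {y : Fin d → ℤ}
    (hy : ∀ c, |y c| ≤ 2 * R) :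
    S.Hole v u y ↔ ∀ k X Y : ℤ, 0 ≤ k → k < 3 → 0 ≤ X → X < v ^ S.η₁ → 0 ≤ Y → Y < v ^ S.η₂ →
      (¬ ∀ c, S.upper v u R k X Y c ≤ y c) ∧ ¬ ∀ c, y c ≤ S.lower v u R k X Y c := by
  have hy₁ : ∀ c, -2 * R ≤ y c := fun c => by linarith [neg_le_of_abs_le (hy c)]
  have hy₂ : ∀ c, y c ≤ 2 * R := fun c => by linarith [le_of_abs_le (hy c)]
  have hx : 0 < v ^ S.ex := by positivity
  have hy' : 0 < v ^ S.ey := by positivity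
  have hη₁ : 0 < v ^ S.η₁ := by positivity
  have hη₂ : 0 < v ^ S.η₂ := by positivity
  simp only [upper, lower, upperCorner_le_iff hy₁, le_lowerCorner_iff hy₂]
  constructor
  · rintro ⟨h₁, h₂, h₃, h₄, h₅, h₆⟩ k X Y hk hk' hX hX' hY hY'
    have hk'' : k = 0 ∨ k = 1 ∨ k = 2 := by omega
    rcases hk'' with rfl | rfl | rfl
    · simp only [if_true]
      constructor
      · rintro ⟨a, b, c⟩
        exact absurd (c.trans_lt h₆) (not_lt.2 (up_anti hS hv ((Int.le_ediv_iff_mul_le hx).2 a)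
          ((Int.le_ediv_iff_mul_le hy').2 b)))
      · rintro ⟨a, b, c⟩
        have a' : y S.cx / v ^ S.ex ≤ X := Int.le_of_lt_add_one
          (Int.ediv_lt_of_lt_mul hx (by linarith))
        have b' : y S.cy / v ^ S.ey ≤ Y := Int.le_of_lt_add_one
          (Int.ediv_lt_of_lt_mul hy' (by linarith))
        have := lo_anti (S := S) (u := u) hv a' b'
        omega
    · simp only [one_ne_zero, if_false, if_true]
      constructor <;> rintro ⟨a, b, c⟩ <;> omega
    · simp only [show (2 : ℤ) ≠ 0 by norm_num, show (2 : ℤ) ≠ 1 by norm_num, if_false]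
      constructor <;> rintro ⟨a, b, c⟩ <;> omega
  · intro h
    -- Kinds `1` and `2` are half-spaces; avoiding them means that the point lies over the grid.
    -- Kind `0` is then applied to its own cell.
    have k1 := h 1 0 0 (by norm_num) (by norm_num) le_rfl hη₁ le_rfl hη₂
    have k2 := h 2 0 0 (by norm_num) (by norm_num) le_rfl hη₁ le_rfl hη₂
    simp only [one_ne_zero, if_false, if_true, hy₁, hy₂, and_true, not_le] at k1
    simp only [show (2 : ℤ) ≠ 0 by norm_num, show (2 : ℤ) ≠ 1 by norm_num, if_false, hy₁, hy₂,
      and_true, true_and, not_le] at k2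
    have k0 := h 0 (y S.cx / v ^ S.ex) (y S.cy / v ^ S.ey) le_rfl (by norm_num)
      (Int.ediv_nonneg (by omega) hx.le) (Int.ediv_lt_of_lt_mul hx (by linarith))
      (Int.ediv_nonneg (by omega) hy'.le) (Int.ediv_lt_of_lt_mul hy' (by linarith))
    simp only [if_true] at k0
    have ex := Int.ediv_mul_le (y S.cx) hx.ne'
    have ey := Int.ediv_mul_le (y S.cy) hy'.ne'
    have ex' := Int.lt_ediv_add_one_mul_self (y S.cx) hx
    have ey' := Int.lt_ediv_add_one_mul_self (y S.cy) hy'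
    refine ⟨by omega, by omega, by omega, by omega, ?_, ?_⟩
    · by_contra hc
      exact k0.2 ⟨by omega, by omega, by omega⟩
    · by_contra hc
      exact k0.1 ⟨ex, ey, by omega⟩

end Surface

end
end FineGrained

/-! ### Placing gadgets in one instance -/

namespace FineGrained
noncomputable section

/-- Gadgets, each consisting of `P` points `pf` and `H` corners `cor` of upper or lower orthants,
placed far apart from each other; followed by two gadgets that restrict the translation. -/
structure Layout (d : ℕ) where
  (G P H R V : ℤ)
  pf : ℤ → ℤ → Fin d → ℤ
  cor : ℤ → ℤ → Fin d → ℤ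

namespace Layout
variable {d : ℕ} (A : Layout d)

def Covered (κ j : ℤ) (y : Fin d → ℤ) : Prop :=
  if j % 2 = 0 then ∀ c, A.cor κ j c ≤ y c else ∀ c, y c ≤ A.cor κ j c

/-- The number of the gadget to which a point belongs. -/
def blockP (i : ℤ) : ℤ :=
  if i < A.G * (A.P + 2) then i / (A.P + 2) else if i = A.G * (A.P + 2) then A.G else A.G + 1

def blockQ (j : ℤ) : ℤ :=
  if j < A.G * A.H then j / A.H else if j = A.G * A.H then A.G else A.G + 1

/-- Coordinates relative to the centre of the gadget. -/
def localP (i : ℤ) (c : Fin d) : ℤ :=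
  if i < A.G * (A.P + 2) then
    if i % (A.P + 2) < A.P then A.pf (i / (A.P + 2)) (i % (A.P + 2)) c
    else if i % (A.P + 2) = A.P then 10 * A.R else -(10 * A.R)
  else 0

def localQ (j : ℤ) (c : Fin d) : ℤ :=
  if j < A.G * A.H then
    A.cor (j / A.H) (j % A.H) c + if j % A.H % 2 = 0 then 10 * A.R else -(10 * A.R)
  else if j = A.G * A.H then 10 * A.R else A.V - 1 - 10 * A.R

def pointP (i : ℤ) (c : Fin d) : ℤ :=
  (if (c : ℕ) = 0 then A.blockP i * (100 * A.R) else 0) + A.localP i c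

def pointQ (j : ℤ) (c : Fin d) : ℤ :=
  (if (c : ℕ) = 0 then A.blockQ j * (100 * A.R) else 0) + A.localQ j c

structure Valid : Prop where
  G : 0 ≤ A.G
  P : 0 ≤ A.P
  H : 2 ≤ A.H
  V : 1 ≤ A.V
  VR : A.V ≤ A.R
  pf : ∀ κ i c, 0 ≤ κ → κ < A.G → 0 ≤ i → i < A.P → |A.pf κ i c| ≤ A.R
  cor : ∀ κ j c, 0 ≤ κ → κ < A.G → 0 ≤ j → j < A.H → |A.cor κ j c| ≤ 2 * A.R

variable {A}

theorem div_mod_lt {a b i : ℤ} (hb : 0 < b) (hi : 0 ≤ i) (h : i < a * b) :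
    0 ≤ i / b ∧ i / b < a ∧ 0 ≤ i % b ∧ i % b < b :=
  ⟨Int.ediv_nonneg hi hb.le, Int.ediv_lt_of_lt_mul hb h, Int.emod_nonneg _ hb.ne',
    Int.emod_lt_of_pos _ hb⟩

theorem index_div {b q r : ℤ} (hr : 0 ≤ r) (hrb : r < b) : (q * b + r) / b = q := by
  rw [add_comm, Int.add_mul_ediv_right _ _ (by omega), Int.ediv_eq_zero_of_lt hr hrb, zero_add]

theorem index_mod {b q r : ℤ} (hr : 0 ≤ r) (hrb : r < b) : (q * b + r) % b = r := by
  rw [add_comm, Int.add_mul_emod_self_right, Int.emod_eq_of_lt hr hrb]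

theorem index_lt {a b q r : ℤ} (hq : q < a) (hr : 0 ≤ r) (hrb : r < b) : q * b + r < a * b := by
  nlinarith

/-- A cube of radius `10 * R` with a corner in the gadget is an orthant for all points that matter.
The points number `P` and `P + 1` of a gadget, at `± 10 * R`, are close to all its points of `Q` of
one orientation. The gadgets `G` and `G + 1` consist of one point of either set, up to repetition,
and say `0 ≤ τ c` and `τ c < V`. All indices beyond the gadgets repeat the point of gadget `G + 1`,
so larger `n` and `m` do no harm. -/
theorem feasible_iff (hd : 0 < d) (hA : A.Valid) {n m : ℕ} (hn : A.G * (A.P + 2) + 2 ≤ n)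
    (hm : A.G * A.H + 2 ≤ m) :
    IntFeasible n m A.pointP A.pointQ (10 * A.R) ↔ ∃ τ : Fin d → ℤ, (∀ c, 0 ≤ τ c ∧ τ c < A.V) ∧
      ∀ κ i, 0 ≤ κ → κ < A.G → 0 ≤ i → i < A.P → ∃ j, 0 ≤ j ∧ j < A.H ∧
        A.Covered κ j fun c => A.pf κ i c + τ c := by
  have hG := hA.G
  have hP := hA.P
  have hH := hA.H
  have hV := hA.V
  have hVR := hA.VR
  have hGP : 0 ≤ A.G * (A.P + 2) := by positivity
  have hGH : 0 ≤ A.G * A.H := mul_nonneg hG (by omega)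
  constructor
  · rintro ⟨τ, h₁, h₂⟩
    have bP : ∀ i : ℕ, 0 ≤ A.blockP i ∧ A.blockP i ≤ A.G + 1 ∧ ∀ c, |A.localP i c| ≤ 10 * A.R := by
      intro i
      unfold blockP localP
      split_ifs with h1 h2 h3 h2
      · obtain ⟨a, b, e, f⟩ := div_mod_lt (by omega) (by omega) h1
        exact ⟨a, by omega, fun c => (hA.pf _ _ c a b e h2).trans (by omega)⟩
      · obtain ⟨a, b, e, f⟩ := div_mod_lt (by omega) (by omega) h1
        exact ⟨a, by omega, fun c => by rw [abs_of_nonneg (by omega)]⟩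
      · obtain ⟨a, b, e, f⟩ := div_mod_lt (by omega) (by omega) h1
        exact ⟨a, by omega, fun c => by rw [abs_neg, abs_of_nonneg (by omega)]⟩
      · exact ⟨by omega, by omega, fun c => by rw [abs_zero]; omega⟩
      · exact ⟨by omega, by omega, fun c => by rw [abs_zero]; omega⟩
    have bQ : ∀ j : ℕ, 0 ≤ A.blockQ j ∧ A.blockQ j ≤ A.G + 1 ∧ ∀ c, |A.localQ j c| ≤ 12 * A.R := by
      intro j
      unfold blockQ localQ
      by_cases h1 : (j : ℤ) < A.G * A.H
      · obtain ⟨a, b, e, f⟩ := div_mod_lt (by omega) (by omega) h1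
        simp only [if_pos h1]
        refine ⟨a, by omega, fun c => ?_⟩
        have := hA.cor _ _ c a b e f
        rw [abs_le] at this ⊢
        split_ifs <;> omega
      · simp only [if_neg h1]
        split_ifs <;> exact ⟨by omega, by omega, fun c => by rw [abs_le]; omega⟩
    -- The points of the last gadget cannot be matched with anything farther out. Using this for
    -- both sets bounds the first coordinate of `τ` before it is known which gadgets are matched.
    have hτ0 : |τ ⟨0, hd⟩| ≤ 30 * A.R := by
      rw [abs_le]
      constructor
      · obtain ⟨i, hi, h⟩ := h₂ (A.G * A.H + 1).toNat (by omega)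
        have h := neg_le_of_abs_le (h ⟨0, hd⟩)
        obtain ⟨b1, b2, b3⟩ := bP i
        have b3 := le_of_abs_le (b3 ⟨0, hd⟩)
        have e1 : A.blockQ (A.G * A.H + 1).toNat = A.G + 1 := by
          rw [blockQ, if_neg (by omega), if_neg (by omega)]
        have e2 : A.localQ (A.G * A.H + 1).toNat ⟨0, hd⟩ = A.V - 1 - 10 * A.R := by
          rw [localQ, if_neg (by omega), if_neg (by omega)]
        simp only [pointP, pointQ, if_true, e1, e2] at h
        nlinarith
      · obtain ⟨j, hj, h⟩ := h₁ (A.G * (A.P + 2) + 1).toNat (by omega)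
        have h := le_of_abs_le (h ⟨0, hd⟩)
        obtain ⟨b1, b2, b3⟩ := bQ j
        have b3 := le_of_abs_le (b3 ⟨0, hd⟩)
        have e1 : A.blockP (A.G * (A.P + 2) + 1).toNat = A.G + 1 := by
          rw [blockP, if_neg (by omega), if_neg (by omega)]
        have e2 : A.localP (A.G * (A.P + 2) + 1).toNat ⟨0, hd⟩ = 0 := by
          rw [localP, if_neg (by omega)]
        simp only [pointP, pointQ, if_true, e1, e2] at h
        nlinarith
    -- Local coordinates, translation and threshold amount to at most `(10 + 12 + 30 + 10) * R`,
    -- which is less than the spacing `100 * R` of the gadgets.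
    have same : ∀ i j : ℕ, (∀ c, |A.pointP i c + τ c - A.pointQ j c| ≤ 10 * A.R) →
        A.blockP i = A.blockQ j ∧ ∀ c, |A.localP i c + τ c - A.localQ j c| ≤ 10 * A.R := by
      intro i j h
      have e : A.blockP i = A.blockQ j := by
        have h0 := h ⟨0, hd⟩
        have b1 := (bP i).2.2 ⟨0, hd⟩
        have b2 := (bQ j).2.2 ⟨0, hd⟩
        simp only [pointP, pointQ, if_true] at h0
        rw [abs_le] at *
        by_contra hne
        rcases lt_or_gt_of_ne hne with hl | hl <;> nlinarith
      refine ⟨e, fun c => ?_⟩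
      have := h c
      simp only [pointP, pointQ, e] at this
      convert this using 2
      ring
    refine ⟨τ, fun c => ⟨?_, ?_⟩, fun κ i hκ hκ' hi hi' => ?_⟩
    · obtain ⟨j, hj, h⟩ := h₁ (A.G * (A.P + 2)).toNat (by omega)
      obtain ⟨e, h⟩ := same _ _ h
      have h := neg_le_of_abs_le (h c)
      have e1 : A.blockP (A.G * (A.P + 2)).toNat = A.G := by
        rw [blockP, if_neg (by omega), if_pos (by omega)]
      have e2 : A.localP (A.G * (A.P + 2)).toNat c = 0 := by
        rw [localP, if_neg (by omega)]
      rw [e1] at e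
      have e3 : A.localQ j c = 10 * A.R := by
        unfold blockQ at e
        split_ifs at e with k1 k2
        · have := (div_mod_lt (by omega) (by omega) k1).2.1
          omega
        · rw [localQ, if_neg (by omega), if_pos k2]
        · omega
      omega
    · obtain ⟨j, hj, h⟩ := h₁ (A.G * (A.P + 2) + 1).toNat (by omega)
      obtain ⟨e, h⟩ := same _ _ h
      have h := le_of_abs_le (h c)
      have e1 : A.blockP (A.G * (A.P + 2) + 1).toNat = A.G + 1 := by
        rw [blockP, if_neg (by omega), if_neg (by omega)]
      have e2 : A.localP (A.G * (A.P + 2) + 1).toNat c = 0 := by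
        rw [localP, if_neg (by omega)]
      rw [e1] at e
      have e3 : A.localQ j c = A.V - 1 - 10 * A.R := by
        unfold blockQ at e
        split_ifs at e with k1 k2
        · have := (div_mod_lt (by omega) (by omega) k1).2.1
          omega
        · omega
        · rw [localQ, if_neg (by omega), if_neg k2]
      omega
    · have hlt : κ * (A.P + 2) + i < A.G * (A.P + 2) := index_lt hκ' hi (by omega)
      have hnn : 0 ≤ κ * (A.P + 2) + i := by positivity
      obtain ⟨j, hj, h⟩ := h₁ (κ * (A.P + 2) + i).toNat (by omega)
      obtain ⟨e, h⟩ := same _ _ h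
      rw [Int.toNat_of_nonneg hnn] at e h
      have e1 : A.blockP (κ * (A.P + 2) + i) = κ := by
        rw [blockP, if_pos hlt, index_div hi (by omega)]
      have e2 : A.localP (κ * (A.P + 2) + i) = A.pf κ i := by
        funext c
        rw [localP, if_pos hlt, index_div hi (by omega), index_mod hi (by omega), if_pos hi']
      rw [e1] at e
      rw [e2] at h
      have k1 : (j : ℤ) < A.G * A.H := by
        by_contra k1
        rw [blockQ, if_neg k1] at e
        split_ifs at e <;> omega
      obtain ⟨b1, b2, b3, b4⟩ := div_mod_lt (by omega) (by omega) k1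
      rw [blockQ, if_pos k1] at e
      refine ⟨j % A.H, b3, b4, ?_⟩
      unfold Covered
      simp only [localQ, if_pos k1, ← e] at h
      split_ifs with k2
      · intro c
        have := neg_le_of_abs_le (h c)
        rw [if_pos k2] at this
        beta_reduce
        omega
      · intro c
        have := le_of_abs_le (h c)
        rw [if_neg k2] at this
        beta_reduce
        omega
  · rintro ⟨τ, hτ, h⟩
    have near : ∀ i j : ℕ, A.blockP i = A.blockQ j →
        (∀ c, |A.localP i c + τ c - A.localQ j c| ≤ 10 * A.R) →
        ∀ c, |A.pointP i c + τ c - A.pointQ j c| ≤ 10 * A.R := by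
      intro i j e h c
      have := h c
      simp only [pointP, pointQ, e]
      convert this using 2
      ring
    have toQ : ∀ κ j : ℤ, 0 ≤ κ → κ < A.G → 0 ≤ j → j < A.H → ∃ k : ℕ, k < m ∧ A.blockQ k = κ ∧
        ∀ c, A.localQ k c = A.cor κ j c + if j % 2 = 0 then 10 * A.R else -(10 * A.R) := by
      intro κ j h1 h2 h3 h4
      have hlt : κ * A.H + j < A.G * A.H := index_lt h2 h3 h4
      have hnn : 0 ≤ κ * A.H + j := by positivity
      refine ⟨(κ * A.H + j).toNat, by omega, ?_, fun c => ?_⟩ <;> rw [Int.toNat_of_nonneg hnn]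
      · rw [blockQ, if_pos hlt, index_div h3 h4]
      · rw [localQ, if_pos hlt, index_div h3 h4, index_mod h3 h4]
    -- The auxiliary points at `± 10 * R`: every point of `Q` in a gadget is served by one of them,
    -- for every `τ` in the box.
    have toP : ∀ κ r : ℤ, 0 ≤ κ → κ < A.G → 0 ≤ r → r < 2 → ∃ k : ℕ, k < n ∧ A.blockP k = κ ∧
        ∀ c, A.localP k c = if r = 0 then 10 * A.R else -(10 * A.R) := by
      intro κ r h1 h2 h3 h4
      have hlt : κ * (A.P + 2) + (A.P + r) < A.G * (A.P + 2) := index_lt h2 (by omega) (by omega)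
      have hnn : 0 ≤ κ * (A.P + 2) + (A.P + r) := by positivity
      refine ⟨(κ * (A.P + 2) + (A.P + r)).toNat, by omega, ?_, fun c => ?_⟩ <;>
        rw [Int.toNat_of_nonneg hnn]
      · rw [blockP, if_pos hlt, index_div (by omega) (by omega)]
      · rw [localP, if_pos hlt, index_mod (by omega) (by omega), if_neg (by omega)]
        congr 1
        simp
    refine ⟨τ, fun i hi => ?_, fun j hj => ?_⟩
    · by_cases h1 : (i : ℤ) < A.G * (A.P + 2)
      · obtain ⟨a, b, e, f⟩ := div_mod_lt (by omega) (by omega) h1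
        have eb : A.blockP i = (i : ℤ) / (A.P + 2) := by rw [blockP, if_pos h1]
        by_cases h2 : (i : ℤ) % (A.P + 2) < A.P
        · obtain ⟨j, hj, hj', hc⟩ := h _ _ a b e h2
          obtain ⟨k, hk, k1, k2⟩ := toQ _ j a b hj hj'
          refine ⟨k, hk, near _ _ (eb.trans k1.symm) fun c => ?_⟩
          rw [k2, localP, if_pos h1, if_pos h2]
          have b1 := hA.pf _ _ c a b e h2
          have b2 := hA.cor _ _ c a b hj hj'
          have b3 := hτ c
          unfold Covered at hc
          rw [abs_le] at *
          split_ifs at hc ⊢ with k3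
          · have := hc c
            beta_reduce at this
            omega
          · have := hc c
            beta_reduce at this
            omega
        · by_cases h3 : (i : ℤ) % (A.P + 2) = A.P
          · obtain ⟨k, hk, k1, k2⟩ := toQ _ 0 a b le_rfl (by omega)
            refine ⟨k, hk, near _ _ (eb.trans k1.symm) fun c => ?_⟩
            rw [k2, localP, if_pos h1, if_neg h2, if_pos h3, if_pos (by norm_num)]
            have b2 := hA.cor _ 0 c a b le_rfl (by omega)
            have b3 := hτ c
            rw [abs_le] at *
            omega
          · obtain ⟨k, hk, k1, k2⟩ := toQ _ 1 a b (by norm_num) (by omega)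
            refine ⟨k, hk, near _ _ (eb.trans k1.symm) fun c => ?_⟩
            rw [k2, localP, if_pos h1, if_neg h2, if_neg h3, if_neg (by norm_num)]
            have b2 := hA.cor _ 1 c a b (by norm_num) (by omega)
            have b3 := hτ c
            rw [abs_le] at *
            omega
      · by_cases h2 : (i : ℤ) = A.G * (A.P + 2)
        · refine ⟨(A.G * A.H).toNat, by omega, near _ _ ?_ fun c => ?_⟩
          · rw [blockP, if_neg h1, if_pos h2, blockQ, if_neg (by omega), if_pos (by omega)]
          · rw [localP, if_neg h1, localQ, if_neg (by omega), if_pos (by omega)]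
            have b3 := hτ c
            rw [abs_le]
            omega
        · refine ⟨(A.G * A.H + 1).toNat, by omega, near _ _ ?_ fun c => ?_⟩
          · rw [blockP, if_neg h1, if_neg h2, blockQ, if_neg (by omega), if_neg (by omega)]
          · rw [localP, if_neg h1, localQ, if_neg (by omega), if_neg (by omega)]
            have b3 := hτ c
            rw [abs_le]
            omega
    · by_cases h1 : (j : ℤ) < A.G * A.H
      · obtain ⟨a, b, e, f⟩ := div_mod_lt (by omega) (by omega) h1
        have eb : A.blockQ j = (j : ℤ) / A.H := by rw [blockQ, if_pos h1]
        obtain ⟨k, hk, k1, k2⟩ := toP _ ((j : ℤ) % A.H % 2) a b (by omega) (by omega)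
        refine ⟨k, hk, near _ _ (k1.trans eb.symm) fun c => ?_⟩
        rw [k2, localQ, if_pos h1]
        have b2 := hA.cor _ _ c a b e f
        have b3 := hτ c
        rw [abs_le] at *
        split_ifs <;> omega
      · by_cases h2 : (j : ℤ) = A.G * A.H
        · refine ⟨(A.G * (A.P + 2)).toNat, by omega, near _ _ ?_ fun c => ?_⟩
          · rw [blockQ, if_neg h1, if_pos h2, blockP, if_neg (by omega), if_pos (by omega)]
          · rw [localQ, if_neg h1, if_pos h2, localP, if_neg (by omega)]
            have b3 := hτ c
            rw [abs_le]
            omega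
        · refine ⟨(A.G * (A.P + 2) + 1).toNat, by omega, near _ _ ?_ fun c => ?_⟩
          · rw [blockQ, if_neg h1, if_neg h2, blockP, if_neg (by omega), if_neg (by omega)]
          · rw [localQ, if_neg h1, if_neg h2, localP, if_neg (by omega)]
            have b3 := hτ c
            rw [abs_le]
            omega

end Layout

end
end FineGrained

/-! ### Families of gadgets indexed by triples of digits -/

namespace FineGrained
noncomputable section

/-- Determines for which triples of digits a gadget has an effect: gadgets that fix the form of the
translation use `always` or `differ`, gadgets that test edges or hyperedges use `bad`. -/
inductive Activation
  | always | differ | bad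

/-- A family of gadgets with the same geometry, parametrized by a triple `u` of digits to the
base `v`: for all `a 0 < v ^ α 0, …` satisfying the constraints `conA`, the translated point
`-∑ k, a k * v ^ om k * e_(oc k)` must not lie in the holes of all three surfaces. -/
structure Shape (d : ℕ) where
  surf : Fin 3 → Surface d
  (α om : Fin 3 → ℕ)
  oc : Fin 3 → Fin d
  conA : List (Fin 3 × ℕ × Fin 3)
  act : Activation

namespace Shape
variable {d : ℕ} (sh : Shape d) (v : ℤ) (bad : (Fin 3 → ℤ) → Prop) (u : Fin 3 → ℤ)

def Active : Prop := match sh.act with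
  | .always => True
  | .differ => u 0 ≠ u 2
  | .bad => bad u

def Enabled (a : Fin 3 → ℤ) : Prop :=
  sh.Active bad u ∧ ∀ t ∈ sh.conA, a t.1 / v ^ t.2.1 % v = u t.2.2

def shift (a : Fin 3 → ℤ) (c : Fin d) : ℤ :=
  (if c = sh.oc 0 then a 0 * v ^ sh.om 0 else 0) + (if c = sh.oc 1 then a 1 * v ^ sh.om 1 else 0) +
    if c = sh.oc 2 then a 2 * v ^ sh.om 2 else 0

def InRange (a : Fin 3 → ℤ) : Prop := ∀ k, 0 ≤ a k ∧ a k < v ^ sh.α k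

def Violated (τ : Fin d → ℤ) : Prop :=
  ∃ a, sh.InRange v a ∧ sh.Enabled v bad u a ∧
    ∀ σ, (sh.surf σ).Hole v u fun c => τ c - sh.shift v a c

def digits (i : ℤ) : Fin 3 → ℤ :=
  ![i % v ^ sh.α 0, i / v ^ sh.α 0 % v ^ sh.α 1, i / (v ^ sh.α 0 * v ^ sh.α 1) % v ^ sh.α 2]

/-- A disabled point is moved to the far corner, where each translation under consideration leaves
it in a half-space that is always covered. -/
def pf (R i : ℤ) (c : Fin d) : ℤ :=
  open Classical in if sh.Enabled v bad u (sh.digits v i) then -sh.shift v (sh.digits v i) c else R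

/-- The index encodes, from the lowest part on, the orientation, the surface, the kind and the cell;
this explains the factor `18 = 2 * 3 * 3`. Surfaces with few cells merely repeat corners. -/
def cor (R j : ℤ) (c : Fin d) : ℤ :=
  (([0, 1, 2] : List (Fin 3)).map fun σ =>
    if j % 2 = 0 then (sh.surf σ).upper v u R (j / 6 % 3) (j / 18 % v ^ (sh.surf σ).η₁)
      (j / 18 / v ^ (sh.surf σ).η₁ % v ^ (sh.surf σ).η₂) c
    else (sh.surf σ).lower v u R (j / 6 % 3) (j / 18 % v ^ (sh.surf σ).η₁)
      (j / 18 / v ^ (sh.surf σ).η₁ % v ^ (sh.surf σ).η₂) c).getD (j / 2 % 3).toNat 0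

structure Valid (pp hh : ℕ) : Prop where
  mono : ∀ σ, (sh.surf σ).Monotone
  α : sh.α 0 + sh.α 1 + sh.α 2 ≤ pp
  η : ∀ σ, (sh.surf σ).η₁ + (sh.surf σ).η₂ ≤ hh

structure BoundedBy (R : ℤ) : Prop where
  shift : ∀ a, sh.InRange v a → ∀ c, |sh.shift v a c| ≤ R
  cell₁ : ∀ σ, v ^ (sh.surf σ).ex * v ^ (sh.surf σ).η₁ ≤ R
  cell₂ : ∀ σ, v ^ (sh.surf σ).ey * v ^ (sh.surf σ).η₂ ≤ R
  len : ∀ σ, v ^ (sh.surf σ).len ≤ R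
  lo : ∀ σ X Y, 0 ≤ X → X < v ^ (sh.surf σ).η₁ → 0 ≤ Y → Y < v ^ (sh.surf σ).η₂ →
    |(sh.surf σ).lo v u X Y| ≤ R

variable {sh v bad u}

theorem digits_inRange (hv : 1 ≤ v) (i : ℤ) : sh.InRange v (sh.digits v i) := by
  have h : ∀ n : ℕ, 0 < v ^ n := fun n => by positivity
  intro k
  fin_cases k <;> exact ⟨Int.emod_nonneg _ (h _).ne', Int.emod_lt_of_pos _ (h _)⟩

theorem exists_digits (hv : 1 ≤ v) {pp hh : ℕ} (hs : sh.Valid pp hh) {a : Fin 3 → ℤ}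
    (ha : sh.InRange v a) : ∃ i, 0 ≤ i ∧ i < v ^ pp ∧ sh.digits v i = a := by
  have h : ∀ n : ℕ, 0 < v ^ n := fun n => by positivity
  obtain ⟨h0, h0'⟩ := ha 0
  obtain ⟨h1, h1'⟩ := ha 1
  obtain ⟨h2, h2'⟩ := ha 2
  have l1 : a 1 + 0 < v ^ sh.α 1 := by omega
  have l2 := Layout.index_lt h2' h1 h1'
  have l3 := Layout.index_lt l2 h0 h0'
  have n2 : 0 ≤ a 2 * v ^ sh.α 1 + a 1 := add_nonneg (mul_nonneg h2 (h _).le) h1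
  refine ⟨(a 2 * v ^ sh.α 1 + a 1) * v ^ sh.α 0 + a 0, add_nonneg (mul_nonneg n2 (h _).le) h0,
    l3.trans_le ?_, ?_⟩
  · rw [← pow_add, ← pow_add]
    exact pow_le_pow_right₀ hv (by have := hs.α; omega)
  · funext k
    fin_cases k
    · exact Layout.index_mod h0 h0'
    · show _ / _ % _ = _
      rw [Layout.index_div h0 h0']
      exact Layout.index_mod h1 h1'
    · show _ / _ % _ = _
      rw [← Int.ediv_ediv_of_nonneg (h _).le, Layout.index_div h0 h0', Layout.index_div h1 h1',
        Int.emod_eq_of_lt h2 h2']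
      rfl

theorem abs_cor_le (hv : 1 ≤ v) {R : ℤ} (hb : sh.BoundedBy v u R) (j : ℤ) (c : Fin d) :
    |sh.cor v u R j c| ≤ 2 * R := by
  have h : ∀ n : ℕ, 0 < v ^ n := fun n => by positivity
  have hj : j / 2 % 3 = 0 ∨ j / 2 % 3 = 1 ∨ j / 2 % 3 = 2 := by omega
  suffices H : ∀ σ : Fin 3, |if j % 2 = 0 then
      (sh.surf σ).upper v u R (j / 6 % 3) (j / 18 % v ^ (sh.surf σ).η₁)
      (j / 18 / v ^ (sh.surf σ).η₁ % v ^ (sh.surf σ).η₂) c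
    else (sh.surf σ).lower v u R (j / 6 % 3) (j / 18 % v ^ (sh.surf σ).η₁)
      (j / 18 / v ^ (sh.surf σ).η₁ % v ^ (sh.surf σ).η₂) c| ≤ 2 * R by
    unfold cor
    rcases hj with e | e | e <;> rw [e]
    exacts [H 0, H 1, H 2]
  intro σ
  have hX := Int.emod_nonneg (j / 18) (h (sh.surf σ).η₁).ne'
  have hX' := Int.emod_lt_of_pos (j / 18) (h (sh.surf σ).η₁)
  have hY := Int.emod_nonneg (j / 18 / v ^ (sh.surf σ).η₁) (h (sh.surf σ).η₂).ne'
  have hY' := Int.emod_lt_of_pos (j / 18 / v ^ (sh.surf σ).η₁) (h (sh.surf σ).η₂)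
  generalize j / 18 % v ^ (sh.surf σ).η₁ = X at *
  generalize j / 18 / v ^ (sh.surf σ).η₁ % v ^ (sh.surf σ).η₂ = Y at *
  have c1 := hb.cell₁ σ
  have c2 := hb.cell₂ σ
  have c3 := hb.len σ
  have c4 := hb.lo σ X Y hX hX' hY hY'
  have e0 := h (sh.surf σ).ex
  have e1 := h (sh.surf σ).ey
  have e2 := h (sh.surf σ).len
  have e3 : (X + 1) * v ^ (sh.surf σ).ex ≤ v ^ (sh.surf σ).ex * v ^ (sh.surf σ).η₁ := by nlinarith
  have e4 : (Y + 1) * v ^ (sh.surf σ).ey ≤ v ^ (sh.surf σ).ey * v ^ (sh.surf σ).η₂ := by nlinarith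
  have e5 : 0 ≤ X * v ^ (sh.surf σ).ex := by positivity
  have e6 : 0 ≤ Y * v ^ (sh.surf σ).ey := by positivity
  rw [add_mul, one_mul] at e3 e4
  rw [abs_le] at c4
  have hR : 1 ≤ R := by omega
  split_ifs
  · refine abs_upperCorner_le ?_ ?_ ?_ c <;> try simp only [Surface.up]
    all_goals rw [abs_le]; split_ifs <;> omega
  · refine abs_lowerCorner_le ?_ ?_ ?_ c <;> rw [abs_le] <;> split_ifs <;>
      first | omega | (rw [add_mul, one_mul]; omega)

theorem exists_covered_iff (hv : 1 ≤ v) {pp hh : ℕ} (hs : sh.Valid pp hh) {R : ℤ} (y : Fin d → ℤ) :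
    (∃ j, 0 ≤ j ∧ j < 18 * v ^ hh ∧
      if j % 2 = 0 then ∀ c, sh.cor v u R j c ≤ y c else ∀ c, y c ≤ sh.cor v u R j c) ↔
    ∃ (σ : Fin 3) (k X Y : ℤ), 0 ≤ k ∧ k < 3 ∧ 0 ≤ X ∧ X < v ^ (sh.surf σ).η₁ ∧ 0 ≤ Y ∧
      Y < v ^ (sh.surf σ).η₂ ∧ ((∀ c, (sh.surf σ).upper v u R k X Y c ≤ y c) ∨
        ∀ c, y c ≤ (sh.surf σ).lower v u R k X Y c) := by
  have h : ∀ n : ℕ, 0 < v ^ n := fun n => by positivity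
  constructor
  · rintro ⟨j, hj, hj', hc⟩
    have hj3 : j / 2 % 3 = 0 ∨ j / 2 % 3 = 1 ∨ j / 2 % 3 = 2 := by omega
    have key : ∀ σ : Fin 3, (∀ c, sh.cor v u R j c = if j % 2 = 0 then
        (sh.surf σ).upper v u R (j / 6 % 3) (j / 18 % v ^ (sh.surf σ).η₁)
        (j / 18 / v ^ (sh.surf σ).η₁ % v ^ (sh.surf σ).η₂) c
      else (sh.surf σ).lower v u R (j / 6 % 3) (j / 18 % v ^ (sh.surf σ).η₁)
        (j / 18 / v ^ (sh.surf σ).η₁ % v ^ (sh.surf σ).η₂) c) → 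
        ∃ (σ : Fin 3) (k X Y : ℤ), 0 ≤ k ∧ k < 3 ∧ 0 ≤ X ∧ X < v ^ (sh.surf σ).η₁ ∧ 0 ≤ Y ∧
          Y < v ^ (sh.surf σ).η₂ ∧ ((∀ c, (sh.surf σ).upper v u R k X Y c ≤ y c) ∨
            ∀ c, y c ≤ (sh.surf σ).lower v u R k X Y c) := by
      intro σ hσ
      refine ⟨σ, j / 6 % 3, j / 18 % v ^ (sh.surf σ).η₁,
        j / 18 / v ^ (sh.surf σ).η₁ % v ^ (sh.surf σ).η₂, by omega, by omega,
        Int.emod_nonneg _ (h _).ne', Int.emod_lt_of_pos _ (h _), Int.emod_nonneg _ (h _).ne',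
        Int.emod_lt_of_pos _ (h _), ?_⟩
      simp only [hσ] at hc
      split_ifs at hc
      · exact Or.inl hc
      · exact Or.inr hc
    rcases hj3 with e | e | e
    · exact key 0 fun c => by rw [cor, e]; rfl
    · exact key 1 fun c => by rw [cor, e]; rfl
    · exact key 2 fun c => by rw [cor, e]; rfl
  · rintro ⟨σ, k, X, Y, hk, hk', hX, hX', hY, hY', hc⟩
    have hσ := σ.2
    have lt : Y * v ^ (sh.surf σ).η₁ + X < v ^ hh := by
      refine (Layout.index_lt hY' hX hX').trans_le ?_
      rw [← pow_add]
      exact pow_le_pow_right₀ hv (by have := hs.η σ; omega)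
    have nn : 0 ≤ Y * v ^ (sh.surf σ).η₁ + X := add_nonneg (mul_nonneg hY (h _).le) hX
    have key : ∀ s : ℤ, 0 ≤ s → s < 2 → ∃ j, 0 ≤ j ∧ j < 18 * v ^ hh ∧ j % 2 = s ∧
        ∀ c, sh.cor v u R j c = if s = 0 then (sh.surf σ).upper v u R k X Y c else
          (sh.surf σ).lower v u R k X Y c := by
      intro s hs hs'
      obtain ⟨w, hw⟩ : ∃ w, w = Y * v ^ (sh.surf σ).η₁ + X := ⟨_, rfl⟩
      rw [← hw] at lt nn
      refine ⟨2 * (σ + 3 * (k + 3 * w)) + s, by omega, by omega, by omega, fun c => ?_⟩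
      have e1 : (2 * ((σ : ℕ) + 3 * (k + 3 * w)) + s) / 2 % 3 = (σ : ℕ) := by omega
      have e2 : (2 * ((σ : ℕ) + 3 * (k + 3 * w)) + s) / 6 % 3 = k := by omega
      have e3 : (2 * ((σ : ℕ) + 3 * (k + 3 * w)) + s) / 18 = w := by omega
      have e4 : (2 * ((σ : ℕ) + 3 * (k + 3 * w)) + s) % 2 = s := by omega
      rw [cor, e1, e2, e3, e4, hw, Int.toNat_natCast]
      have e5 := Layout.index_div (q := Y) hX hX'
      have e6 := Layout.index_mod (q := Y) hX hX'
      have e7 := Int.emod_eq_of_lt hY hY'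
      fin_cases σ <;> simp only [Fin.zero_eta, Fin.mk_one, Fin.reduceFinMk] at e5 e6 e7 <;>
        simp [e5, e6, e7]
    rcases hc with hc | hc
    · obtain ⟨j, h1, h2, h3, h4⟩ := key 0 le_rfl (by norm_num)
      refine ⟨j, h1, h2, ?_⟩
      rw [if_pos h3]
      exact fun c => (h4 c).trans_le (hc c)
    · obtain ⟨j, h1, h2, h3, h4⟩ := key 1 (by norm_num) (by norm_num)
      refine ⟨j, h1, h2, ?_⟩
      rw [if_neg (by omega)]
      exact fun c => (hc c).trans_eq (h4 c).symm

/-- A point is uncovered if it avoids the orthants of all three surfaces, that is, lies in a hole of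
each. Conditions on up to three coordinates are thus combined while the numbers of corners only add
up. -/
theorem covered_iff_not_violated (hv : 1 ≤ v) {pp hh : ℕ} (hs : sh.Valid pp hh) {R : ℤ}
    (hb : sh.BoundedBy v u R) {τ : Fin d → ℤ} (hτ : ∀ c, 0 ≤ τ c ∧ τ c ≤ R) :
    (∀ i, 0 ≤ i → i < v ^ pp → ∃ j, 0 ≤ j ∧ j < 18 * v ^ hh ∧
      if j % 2 = 0 then ∀ c, sh.cor v u R j c ≤ sh.pf v bad u R i c + τ c
      else ∀ c, sh.pf v bad u R i c + τ c ≤ sh.cor v u R j c) ↔ ¬ sh.Violated v bad u τ := by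
  have h : ∀ n : ℕ, 0 < v ^ n := fun n => by positivity
  have hole : ∀ a, sh.InRange v a → ∀ σ, ((sh.surf σ).Hole v u fun c => τ c - sh.shift v a c) ↔ _ :=
    fun a ha σ => Surface.hole_iff (R := R) (hs.mono σ) hv fun c => by
      have h1 := hb.shift a ha c
      have h2 := hτ c
      rw [abs_le] at h1 ⊢
      omega
  simp only [exists_covered_iff hv hs (R := R) fun c => sh.pf v bad u R _ c + τ c]
  constructor
  · rintro H ⟨a, ha, hen, hh⟩
    obtain ⟨i, hi, hi', rfl⟩ := exists_digits hv hs ha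
    obtain ⟨σ, k, X, Y, hk, hk', hX, hX', hY, hY', hc⟩ := H i hi hi'
    simp only [pf, if_pos hen, neg_add_eq_sub] at hc
    have := (hole _ ha σ).1 (hh σ) k X Y hk hk' hX hX' hY hY'
    tauto
  · intro H i hi hi'
    by_contra hno
    push Not at hno
    have ha := digits_inRange (sh := sh) hv i
    by_cases hen : sh.Enabled v bad u (sh.digits v i)
    · refine H ⟨_, ha, hen, fun σ => (hole _ ha σ).2 fun k X Y hk hk' hX hX' hY hY' => ?_⟩
      have := hno σ k X Y hk hk' hX hX' hY hY'
      simp only [pf, if_pos hen, neg_add_eq_sub] at this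
      simpa only [not_forall, not_le] using this
    -- A disabled point lies in the half-space of kind `1` of the first surface.
    · obtain ⟨⟨c, hc⟩, -⟩ := hno 0 1 0 0 (by norm_num) (by norm_num) le_rfl (h _) le_rfl (h _)
      simp only [pf, if_neg hen] at hc
      refine absurd hc (not_lt.2 ?_)
      have hR := hb.cell₁ 0
      have hpos := mul_pos (h (sh.surf 0).ex) (h (sh.surf 0).η₁)
      have h1 := hτ c
      simp only [Surface.upper, upperCorner, one_ne_zero, if_false, if_true]
      split_ifs <;> omega

end Shape

end
end FineGrained

/-! ### A common polynomial bound on the coordinates inside the gadgets -/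

namespace FineGrained
noncomputable section

/-- A function on a type of parameters is bounded by a polynomial in `v`. -/
def PolyBounded {ι : Type*} (v f : ι → ℤ) : Prop := ∃ C e : ℕ, ∀ i, |f i| ≤ C * v i ^ e

namespace PolyBounded
variable {ι : Type*} {v f g : ι → ℤ}

theorem const (z : ℤ) : PolyBounded v fun _ => z :=
  ⟨z.natAbs, 0, fun i => by simp⟩

theorem pow (hv : ∀ i, 1 ≤ v i) (e : ℕ) : PolyBounded v fun i => v i ^ e :=
  ⟨1, e, fun i => by
    have := hv i
    rw [abs_of_nonneg (by positivity)]; simp⟩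

theorem mono (hf : PolyBounded v f) (h : ∀ i, |g i| ≤ |f i|) : PolyBounded v g := by
  obtain ⟨C, e, H⟩ := hf
  exact ⟨C, e, fun i => (h i).trans (H i)⟩

theorem add (hv : ∀ i, 1 ≤ v i) (hf : PolyBounded v f) (hg : PolyBounded v g) :
    PolyBounded v fun i => f i + g i := by
  obtain ⟨C, e, H⟩ := hf
  obtain ⟨C', e', H'⟩ := hg
  refine ⟨C + C', e + e', fun i => (abs_add_le _ _).trans ?_⟩
  have h1 : v i ^ e ≤ v i ^ (e + e') := pow_le_pow_right₀ (hv i) (by omega)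
  have h2 : v i ^ e' ≤ v i ^ (e + e') := pow_le_pow_right₀ (hv i) (by omega)
  have h3 := mul_le_mul_of_nonneg_left h1 (by positivity : (0 : ℤ) ≤ C)
  have h4 := mul_le_mul_of_nonneg_left h2 (by positivity : (0 : ℤ) ≤ C')
  have := H i
  have := H' i
  push_cast
  linarith

theorem neg (hf : PolyBounded v f) : PolyBounded v fun i => -f i :=
  hf.mono fun i => by rw [abs_neg]

theorem sub (hv : ∀ i, 1 ≤ v i) (hf : PolyBounded v f) (hg : PolyBounded v g) :
    PolyBounded v fun i => f i - g i := by
  simpa only [sub_eq_add_neg] using hf.add hv hg.neg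

theorem mul (hf : PolyBounded v f) (hg : PolyBounded v g) : PolyBounded v fun i => f i * g i := by
  obtain ⟨C, e, H⟩ := hf
  obtain ⟨C', e', H'⟩ := hg
  refine ⟨C * C', e + e', fun i => ?_⟩
  rw [abs_mul, pow_add]
  calc |f i| * |g i| ≤ (C * v i ^ e) * (C' * v i ^ e') :=
        mul_le_mul (H i) (H' i) (abs_nonneg _) ((abs_nonneg _).trans (H i))
    _ = _ := by push_cast; ring

theorem le_pow (hv : ∀ i, 1 ≤ v i) (hf : PolyBounded v f) :
    ∃ K₀ : ℕ, ∀ K : ℕ, K₀ ≤ K → ∀ i, |f i| ≤ K * v i ^ K := by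
  obtain ⟨C, e, H⟩ := hf
  refine ⟨C + e, fun K hK i => (H i).trans ?_⟩
  have h1 : v i ^ e ≤ v i ^ K := pow_le_pow_right₀ (hv i) (by omega)
  have h0 : 0 ≤ v i ^ e := by have := hv i; positivity
  exact mul_le_mul (by exact_mod_cast (by omega : C ≤ K)) h1 h0 (by positivity)

end PolyBounded

namespace Shape
variable {d : ℕ}

/-- Each coordinate is built from powers of `v`, digits and cell indices by sums and products.
Taking all admissible parameters as one index type makes the polynomial bound uniform in them. -/
theorem exists_boundedBy (sh : Shape d) : ∃ K₀ : ℕ, ∀ K : ℕ, K₀ ≤ K → ∀ (v : ℤ) (u : Fin 3 → ℤ),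
    1 ≤ v → (∀ r, 0 ≤ u r ∧ u r < v) → sh.BoundedBy v u (K * v ^ K) := by
  have hsurf : ∀ σ, ∃ K₀ : ℕ, ∀ K : ℕ, K₀ ≤ K → ∀ (v : ℤ) (u : Fin 3 → ℤ),
      1 ≤ v → (∀ r, 0 ≤ u r ∧ u r < v) →
      v ^ (sh.surf σ).ex * v ^ (sh.surf σ).η₁ ≤ K * v ^ K ∧
      v ^ (sh.surf σ).ey * v ^ (sh.surf σ).η₂ ≤ K * v ^ K ∧ v ^ (sh.surf σ).len ≤ K * v ^ K ∧
      ∀ X Y, 0 ≤ X → X < v ^ (sh.surf σ).η₁ → 0 ≤ Y → Y < v ^ (sh.surf σ).η₂ →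
        |(sh.surf σ).lo v u X Y| ≤ K * v ^ K := by
    intro σ
    generalize sh.surf σ = S
    let ι := {t : ℤ × (Fin 3 → ℤ) × ℤ × ℤ // 1 ≤ t.1 ∧ (∀ r, 0 ≤ t.2.1 r ∧ t.2.1 r < t.1) ∧
      0 ≤ t.2.2.1 ∧ t.2.2.1 < t.1 ^ S.η₁ ∧ 0 ≤ t.2.2.2 ∧ t.2.2.2 < t.1 ^ S.η₂}
    let v : ι → ℤ := fun t => t.1.1
    have hv : ∀ t, 1 ≤ v t := fun t => t.2.1
    have p : ∀ e, PolyBounded v fun t => v t ^ e := PolyBounded.pow hv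
    have hX : PolyBounded v fun t : ι => t.1.2.2.1 := (p S.η₁).mono fun t => by
      rw [abs_of_nonneg t.2.2.2.1, abs_of_nonneg (by have := hv t; positivity)]
      exact t.2.2.2.2.1.le
    have hY : PolyBounded v fun t : ι => t.1.2.2.2 := (p S.η₂).mono fun t => by
      rw [abs_of_nonneg t.2.2.2.2.2.1, abs_of_nonneg (by have := hv t; positivity)]
      exact t.2.2.2.2.2.2.le
    have hu : PolyBounded v fun t : ι => t.1.2.1 2 := (p 1).mono fun t => by
      rw [abs_of_nonneg (t.2.2.1 2).1, abs_of_nonneg (by have := hv t; positivity), pow_one]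
      exact (t.2.2.1 2).2.le
    have hbase : PolyBounded v fun t => (S.base.map fun b => b.1 * v t ^ b.2).sum := by
      induction S.base with
      | nil => simpa using PolyBounded.const 0
      | cons b l ih =>
        simpa using (((PolyBounded.const b.1).mul (p b.2)).add hv ih)
    have hlo : PolyBounded v fun t : ι => S.lo t.1.1 t.1.2.1 t.1.2.2.1 t.1.2.2.2 :=
      (hbase.add hv (((PolyBounded.const S.cu).mul hu).mul (p S.eu))).sub hv
        ((hX.add hv hY).mul (p S.ez))
    obtain ⟨K₁, h₁⟩ := ((p S.ex).mul (p S.η₁)).le_pow hv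
    obtain ⟨K₂, h₂⟩ := ((p S.ey).mul (p S.η₂)).le_pow hv
    obtain ⟨K₃, h₃⟩ := (p S.len).le_pow hv
    obtain ⟨K₄, h₄⟩ := hlo.le_pow hv
    refine ⟨K₁ + K₂ + K₃ + K₄, fun K hK v u hv hu => ?_⟩
    have pos : ∀ e : ℕ, 0 < v ^ e := fun e => by positivity
    let t₀ : ι := ⟨(v, u, 0, 0), hv, hu, le_rfl, pos _, le_rfl, pos _⟩
    exact ⟨(le_abs_self _).trans (h₁ K (by omega) t₀), (le_abs_self _).trans (h₂ K (by omega) t₀),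
      (le_abs_self _).trans (h₃ K (by omega) t₀), fun X Y a b c e =>
        h₄ K (by omega) ⟨(v, u, X, Y), hv, hu, a, b, c, e⟩⟩
  have hshift : ∃ K₀ : ℕ, ∀ K : ℕ, K₀ ≤ K → ∀ (v : ℤ), 1 ≤ v → ∀ a, sh.InRange v a →
      ∀ c, |sh.shift v a c| ≤ K * v ^ K := by
    let ι := {t : ℤ × (Fin 3 → ℤ) × Fin d // 1 ≤ t.1 ∧ sh.InRange t.1 t.2.1}
    let v : ι → ℤ := fun t => t.1.1
    have hv : ∀ t, 1 ≤ v t := fun t => t.2.1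
    have p : ∀ e, PolyBounded v fun t => v t ^ e := PolyBounded.pow hv
    have ha : ∀ k, PolyBounded v fun t : ι =>
        if t.1.2.2 = sh.oc k then t.1.2.1 k * t.1.1 ^ sh.om k else 0 := fun k => by
      have : PolyBounded v fun t : ι => t.1.2.1 k := (p (sh.α k)).mono fun t => by
        rw [abs_of_nonneg (t.2.2 k).1, abs_of_nonneg (by have := hv t; positivity)]
        exact (t.2.2 k).2.le
      refine (this.mul (p (sh.om k))).mono fun t => ?_
      split_ifs
      · exact le_rfl
      · rw [abs_zero]; exact abs_nonneg _
    obtain ⟨K₀, h⟩ := (((ha 0).add hv (ha 1)).add hv (ha 2)).le_pow hv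
    exact ⟨K₀, fun K hK v hv a ha c => h K hK ⟨(v, a, c), hv, ha⟩⟩
  choose Ks hKs using hsurf
  obtain ⟨Kt, hKt⟩ := hshift
  refine ⟨Kt + ∑ σ, Ks σ, fun K hK v u hv hu => ?_⟩
  have hle : ∀ σ, Ks σ ≤ K := fun σ =>
    (Finset.single_le_sum (fun _ _ => Nat.zero_le _) (Finset.mem_univ σ)).trans (by omega)
  exact ⟨hKt K (by omega) v hv, fun σ => (hKs σ K (hle σ) v u hv hu).1,
    fun σ => (hKs σ K (hle σ) v u hv hu).2.1, fun σ => (hKs σ K (hle σ) v u hv hu).2.2.1,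
    fun σ => (hKs σ K (hle σ) v u hv hu).2.2.2⟩

theorem exists_forall_boundedBy (l : List (Shape d)) : ∃ K₀ : ℕ, ∀ K : ℕ, K₀ ≤ K → ∀ sh ∈ l,
    ∀ (v : ℤ) (u : Fin 3 → ℤ), 1 ≤ v → (∀ r, 0 ≤ u r ∧ u r < v) →
      sh.BoundedBy v u (K * v ^ K) := by
  induction l with
  | nil => exact ⟨0, by simp⟩
  | cons sh l ih =>
    obtain ⟨K₁, h₁⟩ := ih
    obtain ⟨K₂, h₂⟩ := sh.exists_boundedBy
    refine ⟨K₁ + K₂, fun K hK s hs => ?_⟩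
    rcases List.mem_cons.1 hs with rfl | hs
    · exact h₂ K (by omega)
    · exact h₁ K (by omega) s hs

end Shape

/-! ### The instance assembled from a list of shapes -/

/-- The layout with one gadget for each shape in a list and each triple of digits. -/
def shapeLayout {d : ℕ} (l : List (Shape d)) (v : ℤ) (bad : (Fin 3 → ℤ) → Prop) (pp hh g K : ℕ) :
    Layout d where
  G := l.length * v ^ 3
  P := v ^ pp
  H := 18 * v ^ hh
  R := K * v ^ K
  V := v ^ g
  pf κ i c := (l.map fun sh => sh.pf v bad ![κ % v, κ / v % v, κ / v ^ 2 % v] (K * v ^ K) i c).getD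
    (κ / v ^ 3).toNat 0
  cor κ j c := (l.map fun sh => sh.cor v ![κ % v, κ / v % v, κ / v ^ 2 % v] (K * v ^ K) j c).getD
    (κ / v ^ 3).toNat 0

theorem exists_gadget {S : ℕ} {v : ℤ} (hv : 1 ≤ v) {s : ℕ} (hs : s < S) {u : Fin 3 → ℤ}
    (hu : ∀ r, 0 ≤ u r ∧ u r < v) : ∃ κ : ℤ, 0 ≤ κ ∧ κ < S * v ^ 3 ∧ κ / v ^ 3 = s ∧
      ![κ % v, κ / v % v, κ / v ^ 2 % v] = u := by
  obtain ⟨h0, h0'⟩ := hu 0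
  obtain ⟨h1, h1'⟩ := hu 1
  obtain ⟨h2, h2'⟩ := hu 2
  have l1 := Layout.index_lt h1' h0 h0'
  have l2 := Layout.index_lt h2' (add_nonneg (mul_nonneg h1 (by omega)) h0) l1
  have n2 := add_nonneg (mul_nonneg h2 (by positivity : 0 ≤ v * v)) (add_nonneg (mul_nonneg h1 (by omega : 0 ≤ v)) h0)
  have e3 : v ^ 3 = v * (v * v) := by ring
  refine ⟨s * v ^ 3 + (u 2 * (v * v) + (u 1 * v + u 0)), by positivity, ?_, ?_, ?_⟩
  · refine Layout.index_lt (by exact_mod_cast hs) n2 (by rw [e3]; exact l2)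
  · exact Layout.index_div n2 (by rw [e3]; exact l2)
  · have e : (s * v ^ 3 + (u 2 * (v * v) + (u 1 * v + u 0)) : ℤ) =
        ((s * v + u 2) * v + u 1) * v + u 0 := by ring
    rw [e, pow_two, ← Int.ediv_ediv_of_nonneg (by omega : 0 ≤ v), Layout.index_div h0 h0',
      Layout.index_div h1 h1', Layout.index_mod h0 h0', Layout.index_mod h1 h1',
      Layout.index_mod h2 h2']
    funext r
    fin_cases r <;> rfl

section
variable {d : ℕ} {l : List (Shape d)} {v : ℤ} {bad : (Fin 3 → ℤ) → Prop} {pp hh g K : ℕ}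

theorem gadget_digits (hv : 1 ≤ v) (κ : ℤ) (r : Fin 3) :
    0 ≤ (![κ % v, κ / v % v, κ / v ^ 2 % v] : Fin 3 → ℤ) r ∧
      (![κ % v, κ / v % v, κ / v ^ 2 % v] : Fin 3 → ℤ) r < v := by
  fin_cases r <;> exact ⟨Int.emod_nonneg _ (by omega), Int.emod_lt_of_pos _ (by omega)⟩

/-- The number of a gadget encodes a shape and a triple of digits, so the general criterion for
layouts turns into one condition for each shape and each triple. -/
theorem shapeLayout_feasible_iff (hd : 0 < d) (hv : 1 ≤ v) (hl : ∀ sh ∈ l, sh.Valid pp hh)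
    (hK : ∀ sh ∈ l, ∀ (u : Fin 3 → ℤ), (∀ r, 0 ≤ u r ∧ u r < v) → sh.BoundedBy v u (K * v ^ K))
    (hgK : g ≤ K) (hK1 : 1 ≤ K) {n m : ℕ} (hn : l.length * v ^ 3 * (v ^ pp + 2) + 2 ≤ n)
    (hm : l.length * v ^ 3 * (18 * v ^ hh) + 2 ≤ m) :
    IntFeasible n m (shapeLayout l v bad pp hh g K).pointP (shapeLayout l v bad pp hh g K).pointQ
      (10 * (K * v ^ K)) ↔ ∃ τ : Fin d → ℤ, (∀ c, 0 ≤ τ c ∧ τ c < v ^ g) ∧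
        ∀ sh ∈ l, ∀ u : Fin 3 → ℤ, (∀ r, 0 ≤ u r ∧ u r < v) → ¬ sh.Violated v bad u τ := by
  set A := shapeLayout l v bad pp hh g K with hAdef
  have hpos : ∀ e : ℕ, 0 < v ^ e := fun e => by positivity
  have hVR : v ^ g ≤ K * v ^ K := by
    have h1 : v ^ g ≤ v ^ K := pow_le_pow_right₀ hv hgK
    have h2 : (1 : ℤ) ≤ K := by exact_mod_cast hK1
    have := hpos K
    nlinarith
  have idx : ∀ κ : ℤ, 0 ≤ κ → κ < A.G → ∃ s : ℕ, ∃ hs : s < l.length, κ / v ^ 3 = s ∧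
      (∀ i c, A.pf κ i c =
        l[s].pf v bad ![κ % v, κ / v % v, κ / v ^ 2 % v] (K * v ^ K) i c) ∧
      ∀ j c, A.cor κ j c = l[s].cor v ![κ % v, κ / v % v, κ / v ^ 2 % v] (K * v ^ K) j c := by
    intro κ h1 h2
    obtain ⟨a, b, -, -⟩ := Layout.div_mod_lt (hpos 3) h1 h2
    have hs : (κ / v ^ 3).toNat < l.length := by omega
    refine ⟨(κ / v ^ 3).toNat, hs, by omega, fun i c => ?_, fun j c => ?_⟩
    · show List.getD _ _ _ = _
      rw [List.getD_eq_getElem _ _ (by simpa using hs), List.getElem_map]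
    · show List.getD _ _ _ = _
      rw [List.getD_eq_getElem _ _ (by simpa using hs), List.getElem_map]
  have hA : A.Valid := by
    refine ⟨mul_nonneg (by positivity) (hpos 3).le, (hpos pp).le, ?_, ?_, hVR, ?_, ?_⟩
    · show 2 ≤ 18 * v ^ hh
      have := hpos hh
      omega
    · exact hpos g
    · intro κ i c h1 h2 _ _
      obtain ⟨s, hs, -, h3, -⟩ := idx κ h1 h2
      have hb := hK l[s] (List.getElem_mem hs) _ (gadget_digits hv κ)
      rw [h3]
      unfold Shape.pf
      split_ifs
      · rw [abs_neg]
        exact hb.shift _ (Shape.digits_inRange hv i) c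
      · rw [abs_of_nonneg (by positivity)]
        exact le_rfl
    · intro κ j c h1 h2 _ _
      obtain ⟨s, hs, -, -, h3⟩ := idx κ h1 h2
      rw [h3]
      exact Shape.abs_cor_le hv (hK l[s] (List.getElem_mem hs) _ (gadget_digits hv κ)) j c
  refine (Layout.feasible_iff hd hA hn hm).trans (exists_congr fun τ => and_congr_right fun hτ => ?_)
  have hτ' : ∀ c, 0 ≤ τ c ∧ τ c ≤ K * v ^ K := fun c => ⟨(hτ c).1, (hτ c).2.le.trans hVR⟩
  have key : ∀ (κ : ℤ) (s : ℕ) (hs : s < l.length), (∀ i c, A.pf κ i c =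
        l[s].pf v bad ![κ % v, κ / v % v, κ / v ^ 2 % v] (K * v ^ K) i c) →
      (∀ j c, A.cor κ j c = l[s].cor v ![κ % v, κ / v % v, κ / v ^ 2 % v] (K * v ^ K) j c) →
      ((∀ i, 0 ≤ i → i < A.P → ∃ j, 0 ≤ j ∧ j < A.H ∧
        A.Covered κ j fun c => A.pf κ i c + τ c) ↔
      ¬ l[s].Violated v bad ![κ % v, κ / v % v, κ / v ^ 2 % v] τ) := by
    intro κ s hs h1 h2
    rw [← Shape.covered_iff_not_violated hv (hl _ (List.getElem_mem hs))
      (hK l[s] (List.getElem_mem hs) _ (gadget_digits hv κ)) hτ']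
    simp only [Layout.Covered, h1, h2]
    rfl
  constructor
  · intro H sh hsh u hu
    obtain ⟨s, hs, rfl⟩ := List.getElem_of_mem hsh
    obtain ⟨κ, h1, h2, h3, h4⟩ := exists_gadget hv hs hu
    obtain ⟨s', hs', h5, h6, h7⟩ := idx κ h1 h2
    have : s' = s := by omega
    subst this
    have := (key κ s' hs' h6 h7).1 fun i => H κ i h1 h2
    rwa [h4] at this
  · intro H κ i h1 h2
    obtain ⟨s, hs, h5, h6, h7⟩ := idx κ h1 h2
    exact (key κ s hs h6 h7).2 (H _ (List.getElem_mem hs) _ (gadget_digits hv κ)) i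

end

end
end FineGrained

/-! ### The coordinates of the gadgets as expressions -/

namespace FineGrained
noncomputable section

section
variable {d : ℕ} {v X Y R k : Input → ℤ → ℤ → ℤ} {u a : Input → ℤ → ℤ → Fin 3 → ℤ}

theorem Expressible.sum_list {ι : Type*} {F : ι → Input → ℤ → ℤ → ℤ} (l : List ι)
    (hF : ∀ i, Expressible (F i)) : Expressible fun x s j => (l.map fun i => F i x s j).sum := by
  induction l with
  | nil => simpa using const 0
  | cons i l ih => simpa using (hF i).add ih

theorem Expressible.digit (hv : Expressible v) (hX : Expressible X) (e : ℕ) :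
    Expressible fun x s j => X x s j / v x s j ^ e % v x s j := (hX.div (hv.pow e)).mod hv

theorem Surface.expressible_lo (S : Surface d) (hv : Expressible v)
    (hu : ∀ r, Expressible fun x s j => u x s j r) (hX : Expressible X) (hY : Expressible Y) :
    Expressible fun x s j => S.lo (v x s j) (u x s j) (X x s j) (Y x s j) :=
  ((Expressible.sum_list S.base fun t => (Expressible.const t.1).mul (hv.pow t.2)).add
    (((Expressible.const S.cu).mul (hu 2)).mul (hv.pow S.eu))).sub ((hX.add hY).mul (hv.pow S.ez))

theorem Surface.expressible_up (S : Surface d) (hv : Expressible v)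
    (hu : ∀ r, Expressible fun x s j => u x s j r) (hX : Expressible X) (hY : Expressible Y) :
    Expressible fun x s j => S.up (v x s j) (u x s j) (X x s j) (Y x s j) := by
  classical
  refine (S.expressible_lo hv hu hX hY).add (Expressible.ite ?_ (hv.pow _) (.const 0))
  exact (ExpressibleProp.forall_mem _ fun t _ => .eq (hv.digit hX _) (hu _)).and
    (ExpressibleProp.forall_mem _ fun t _ => .eq (hv.digit hY _) (hu _))

theorem Surface.expressible_upper (S : Surface d) (c : Fin d) (hv : Expressible v)
    (hu : ∀ r, Expressible fun x s j => u x s j r) (hR : Expressible R) (hk : Expressible k)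
    (hX : Expressible X) (hY : Expressible Y) :
    Expressible fun x s j =>
      S.upper (v x s j) (u x s j) (R x s j) (k x s j) (X x s j) (Y x s j) c := by
  have h2R := (Expressible.const (-2)).mul hR
  have k0 := ExpressibleProp.eq hk (.const 0)
  have k1 := ExpressibleProp.eq hk (.const 1)
  refine ((Expressible.ite (.const _) (.ite k0 (hX.mul (hv.pow _))
    (.ite k1 ((hv.pow _).mul (hv.pow _)) h2R)) h2R).max (.ite (.const _)
    (.ite k0 (hY.mul (hv.pow _)) (.ite k1 h2R ((hv.pow _).mul (hv.pow _)))) h2R)).max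
    (.ite (.const _) (.ite k0 (S.expressible_up hv hu hX hY) h2R) h2R)

theorem Surface.expressible_lower (S : Surface d) (c : Fin d) (hv : Expressible v)
    (hu : ∀ r, Expressible fun x s j => u x s j r) (hR : Expressible R) (hk : Expressible k)
    (hX : Expressible X) (hY : Expressible Y) :
    Expressible fun x s j =>
      S.lower (v x s j) (u x s j) (R x s j) (k x s j) (X x s j) (Y x s j) c := by
  have h2R := (Expressible.const 2).mul hR
  have k0 := ExpressibleProp.eq hk (.const 0)
  have k1 := ExpressibleProp.eq hk (.const 1)
  refine ((Expressible.ite (.const _) (.ite k0 (((hX.add (.const 1)).mul (hv.pow _)).sub (.const 1))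
    (.ite k1 (.const (-1)) h2R)) h2R).min (.ite (.const _)
    (.ite k0 (((hY.add (.const 1)).mul (hv.pow _)).sub (.const 1))
      (.ite k1 h2R (.const (-1)))) h2R)).min
    (.ite (.const _) (.ite k0 ((S.expressible_lo hv hu hX hY).sub (.const 1)) h2R) h2R)

namespace Shape
variable {bad : Input → (Fin 3 → ℤ) → Prop}

/-- Forbidden triples can be recognized by an expression. -/
def ExpressibleBad (bad : Input → (Fin 3 → ℤ) → Prop) : Prop :=
  ∀ u : Input → ℤ → ℤ → Fin 3 → ℤ, (∀ r, Expressible fun x s j => u x s j r) →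
    ExpressibleProp fun x s j => bad x (u x s j)

theorem expressible_pf (sh : Shape d) (c : Fin d) (hbad : ExpressibleBad bad) (hv : Expressible v)
    (hu : ∀ r, Expressible fun x s j => u x s j r) (hR : Expressible R) (hX : Expressible X) :
    Expressible fun x s j => sh.pf (v x s j) (bad x) (u x s j) (R x s j) (X x s j) c := by
  have hd : ∀ r, Expressible fun x s j => sh.digits (v x s j) (X x s j) r := by
    intro r
    fin_cases r
    exacts [hX.mod (hv.pow _), (hX.div (hv.pow _)).mod (hv.pow _),
      (hX.div ((hv.pow _).mul (hv.pow _))).mod (hv.pow _)]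
  have hact : ExpressibleProp fun x s j => sh.Active (bad x) (u x s j) := by
    unfold Active
    cases sh.act with
    | always => exact .const _
    | differ => exact (ExpressibleProp.eq (hu 0) (hu 2)).not
    | bad => exact hbad u hu
  classical
  refine Expressible.ite (hact.and (.forall_mem _ fun t _ => .eq (hv.digit (hd _) _) (hu _))) ?_ hR
  refine ((Expressible.const 0).sub (((Expressible.ite (.const _) ((hd 0).mul (hv.pow (sh.om 0)))
    (.const 0)).add (.ite (.const _) ((hd 1).mul (hv.pow (sh.om 1))) (.const 0))).add (.ite
    (.const _) ((hd 2).mul (hv.pow (sh.om 2))) (.const 0)))).congr fun x s j => zero_sub _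

theorem expressible_cor (sh : Shape d) (c : Fin d) (hv : Expressible v)
    (hu : ∀ r, Expressible fun x s j => u x s j r) (hR : Expressible R) (hX : Expressible X) :
    Expressible fun x s j => sh.cor (v x s j) (u x s j) (R x s j) (X x s j) c := by
  have c2 := Expressible.const 2
  have c6 := Expressible.const 6
  have c18 := Expressible.const 18
  refine Expressible.select [0, 1, 2] (fun σ _ => ?_) ((hX.div c2).mod (.const 3))
  have hX' := (hX.div c18).mod (hv.pow (sh.surf σ).η₁)
  have hY' := ((hX.div c18).div (hv.pow (sh.surf σ).η₁)).mod (hv.pow (sh.surf σ).η₂)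
  exact Expressible.ite (.eq (hX.mod c2) (.const 0))
    ((sh.surf σ).expressible_upper c hv hu hR ((hX.div c6).mod (.const 3)) hX' hY')
    ((sh.surf σ).expressible_lower c hv hu hR ((hX.div c6).mod (.const 3)) hX' hY')

end Shape

variable {l : List (Shape d)} {bad : Input → (Fin 3 → ℤ) → Prop} {pp hh g K : ℕ}
  {n m δ : Input → ℤ → ℤ → ℤ}

theorem expressible_gadget (hv : Expressible v) (hX : Expressible X) (r : Fin 3) :
    Expressible fun x s j => (![X x s j % v x s j, X x s j / v x s j % v x s j,
      X x s j / v x s j ^ 2 % v x s j] : Fin 3 → ℤ) r := by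
  fin_cases r
  exacts [hX.mod hv, (hX.div hv).mod hv, (hX.div (hv.pow 2)).mod hv]

theorem expressible_pointP (c : Fin d) (hbad : Shape.ExpressibleBad bad) (hv : Expressible v)
    (hX : Expressible X) :
    Expressible fun x s j => (shapeLayout l (v x s j) (bad x) pp hh g K).pointP (X x s j) c := by
  have hG := (Expressible.const (l.length : ℤ)).mul (hv.pow 3)
  have hP2 := (hv.pow pp).add (.const 2)
  have hGP := hG.mul hP2
  have hR := (Expressible.const (K : ℤ)).mul (hv.pow K)
  have hR10 := (Expressible.const 10).mul hR
  have hdiv := hX.div hP2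
  have hmod := hX.mod hP2
  refine (Expressible.ite (.const _) ((Expressible.ite (.lt hX hGP) hdiv (.ite (.eq hX hGP) hG
    (hG.add (.const 1)))).mul ((Expressible.const 100).mul hR)) (.const 0)).add
    (.ite (.lt hX hGP) (.ite (.lt hmod (hv.pow pp)) ?_ (.ite (.eq hmod (hv.pow pp)) hR10
      (((Expressible.const 0).sub hR10).congr fun x s j => zero_sub _))) (.const 0))
  exact Expressible.select l (fun sh _ => sh.expressible_pf c hbad hv
    (expressible_gadget hv hdiv) hR hmod) (hdiv.div (hv.pow 3))

theorem expressible_pointQ (c : Fin d) (hv : Expressible v) (hX : Expressible X) :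
    Expressible fun x s j => (shapeLayout l (v x s j) (bad x) pp hh g K).pointQ (X x s j) c := by
  have hG := (Expressible.const (l.length : ℤ)).mul (hv.pow 3)
  have hH := (Expressible.const 18).mul (hv.pow hh)
  have hGH := hG.mul hH
  have hR := (Expressible.const (K : ℤ)).mul (hv.pow K)
  have hR10 := (Expressible.const 10).mul hR
  have hdiv := hX.div hH
  have hmod := hX.mod hH
  refine (Expressible.ite (.const _) ((Expressible.ite (.lt hX hGH) hdiv (.ite (.eq hX hGH) hG
    (hG.add (.const 1)))).mul ((Expressible.const 100).mul hR)) (.const 0)).add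
    (.ite (.lt hX hGH) (Expressible.add ?_ (.ite (.eq (hmod.mod (.const 2)) (.const 0)) hR10
      (((Expressible.const 0).sub hR10).congr fun x s j => zero_sub _)))
      (.ite (.eq hX hGH) hR10 (((hv.pow g).sub (.const 1)).sub hR10)))
  exact Expressible.select l (fun sh _ => sh.expressible_cor c hv
    (expressible_gadget hv hdiv) hR hmod) (hdiv.div (hv.pow 3))

theorem expressible_cellValue (hbad : Shape.ExpressibleBad bad) (hv : Expressible v)
    (hn : Expressible n) (hm : Expressible m) (hδ : Expressible δ) :
    Expressible fun x s j => cellValue (n x s j) (m x s j)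
      (shapeLayout l (v x s j) (bad x) pp hh g K).pointP
      (shapeLayout l (v x s j) (bad x) pp hh g K).pointQ (δ x s j) j := by
  have hσ := hn.add hm
  have h5 := (Expressible.const 5).mul hσ
  have hj := Expressible.pos.sub (.const 1)
  have hi := hj.div (.const (d : ℤ))
  have hi' := hi.sub hn
  refine .ite (.le .pos (.const 0)) ((h5.mul hδ).add hσ) (Expressible.select (List.finRange d)
    (fun c _ => .ite (.lt hi hn) ((h5.mul (expressible_pointP c hbad hv hi)).add
      (.ite (.const _) hi (.const 0))) ((h5.mul (expressible_pointQ c hv hi')).add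
      (.ite (.const _) hi' (.const 0)))) (hj.mod (.const (d : ℤ))))

end

end
end FineGrained

/-! ### The elementary reduction -/

namespace FineGrained
noncomputable section

/-- A problem on structures with `vert` vertices, the number of which is the first cell of the
input, and for which a set of forbidden triples of vertices is given by an expression. -/
structure VertexProblem where
  X : Problem
  vert : X.Inst → ℕ
  one_le_vert : ∀ x, 1 ≤ vert x
  cell_zero : ∀ x, (X.input x).words.getD 0 0 = vert x
  reals_nil : ∀ x, (X.input x).reals = []
  one_le_size : ∀ x, 1 ≤ (X.input x).size
  size_le : ∀ x, (X.input x).size ≤ 2 * vert x ^ 3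
  finite : ∀ N, {x | vert x < N}.Finite
  bad : Input → (Fin 3 → ℤ) → Prop
  expressible_bad : Shape.ExpressibleBad bad

/-- The gadgets of a list of shapes admit a common translation if and only if the instance is a
YES-instance. -/
def VertexProblem.EncodedBy (S : VertexProblem) {d : ℕ} (l : List (Shape d)) (g : ℕ) : Prop :=
  ∀ x, (∃ τ : Fin d → ℤ, (∀ c, 0 ≤ τ c ∧ τ c < (S.vert x : ℤ) ^ g) ∧ ∀ sh ∈ l, ∀ u : Fin 3 → ℤ,
    (∀ r, 0 ≤ u r ∧ u r < S.vert x) → ¬ sh.Violated (S.vert x) (S.bad (S.X.input x)) u τ) ↔ S.X.yes x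

/-- The sizes of the two sets: `C * v ^ p` and `C * v ^ q * (s + 1)`, in this order or swapped. -/
def setSize (swap : Bool) (C p q v s : ℕ) : ℕ :=
  if swap then C * v ^ q * (s + 1) else C * v ^ p

/-- The gadgets depend on the instance alone, and `s` only affects how often the last point is
repeated and, through the total size, the scale of the points. Therefore all produced instances are
equivalent, whereas their sizes vary. -/
theorem exists_reduction (S : VertexProblem) {d : ℕ} (hd : 0 < d) {l : List (Shape d)}
    {pp hh g p q C κ : ℕ} (swap : Bool) (hl : ∀ sh ∈ l, sh.Valid pp hh) (henc : S.EncodedBy l g)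
    (hC : 18 * l.length + 2 ≤ C)
    (hp : if swap then hh + 3 ≤ p ∧ pp + 3 ≤ q else pp + 3 ≤ p ∧ hh + 3 ≤ q) :
    ∃ R : ElementaryReduction S.X (undirectedHuT d hd), (∃ re : WordExpr, R.real = .ofWord re ∧
      re.Arith) ∧ R.count.Arith ∧ R.wlen.Arith ∧ R.rlen.Arith ∧ R.word.Arith ∧
      (∀ x, R.number x = S.vert x ^ κ) ∧ ∀ x s,
        HuTInst.n (R.map x s) = setSize swap C p q (S.vert x) s ∧
        HuTInst.m (R.map x s) = setSize (!swap) C p q (S.vert x) s := by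
  obtain ⟨K₀, hK₀⟩ := Shape.exists_forall_boundedBy l
  set K := K₀ + g + 1 with hK
  have hv := S.one_le_vert
  have hvZ : ∀ x, (1 : ℤ) ≤ S.vert x := fun x => by exact_mod_cast hv x
  have hpos : ∀ (b : Bool) x s, 0 < setSize b C p q (S.vert x) s := fun b x s => by
    have := hv x
    have : 0 < C := by omega
    unfold setSize
    split_ifs <;> positivity
  let δ : S.X.Inst → ℤ := fun x => 10 * (K * (S.vert x : ℤ) ^ K)
  have hδ : ∀ x, 0 ≤ δ x := fun x => by positivity
  let A : S.X.Inst → Layout d := fun x =>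
    shapeLayout l (S.vert x) (S.bad (S.X.input x)) pp hh g K
  let mp : S.X.Inst → ℕ → HuTInst d := fun x s =>
    ofInt hd (setSize swap C p q (S.vert x) s) (setSize (!swap) C p q (S.vert x) s) (hpos _ x s)
      (hpos _ x s) (A x).pointP (A x).pointQ (δ x) (hδ x)
  have e_v : Expressible fun x _ _ => x.words.getD 0 0 := (Expressible.const 0).cell
  have e_size : ∀ b : Bool, Expressible fun x s _ => if b then
      (C : ℤ) * x.words.getD 0 0 ^ q * (s + 1) else (C : ℤ) * x.words.getD 0 0 ^ p := fun b => by
    cases b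
    · exact (Expressible.const _).mul (e_v.pow p)
    · exact ((Expressible.const _).mul (e_v.pow q)).mul (Expressible.par.add (.const 1))
  have size_eq : ∀ (b : Bool) x (s : ℕ), (if b then
      (C : ℤ) * (S.X.input x).words.getD 0 0 ^ q * ((s : ℤ) + 1) else
      (C : ℤ) * (S.X.input x).words.getD 0 0 ^ p) = (setSize b C p q (S.vert x) s : ℕ) := by
    intro b x s
    rw [S.cell_zero, setSize]
    split_ifs <;> push_cast <;> rfl
  obtain ⟨ec, hec, hec'⟩ := e_v.pow κ
  obtain ⟨ew, hew, hew'⟩ := Expressible.const 2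
  obtain ⟨er, her, her'⟩ := (((e_size swap).add (e_size (!swap))).mul (.const (d : ℤ))).add (.const 1)
  obtain ⟨eo, heo, heo'⟩ := Expressible.ite_le .pos (.const 0) (e_size swap) (e_size (!swap))
  obtain ⟨ev, hev, hev'⟩ := expressible_cellValue (d := d) (l := l) (pp := pp) (hh := hh) (g := g)
    (K := K) S.expressible_bad e_v (e_size swap) (e_size (!swap))
    ((Expressible.const 10).mul ((Expressible.const (K : ℤ)).mul (e_v.pow K)))
  refine ⟨⟨mp, ec, ew, er, eo, .ofWord ev, ?_, ?_, ?_⟩, ⟨ev, rfl, hev⟩, hec, hew, her, heo, ?_, ?_⟩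
  · intro x s _
    refine Eq.trans ?_ (map_range_cast (fun j => eo.eval (S.X.input x) s j) _).symm
    rw [hew']
    simp only [heo', size_eq]
    rfl
  · intro x s _
    refine Eq.trans ?_ (map_range_cast (fun j => ((ev.eval (S.X.input x) s j : ℤ) : ℝ)) _).symm
    refine (ofInt_reals hd (hpos _ x s) (hpos _ x s) (hδ x)).trans ?_
    simp only [her', hev', size_eq]
    simp only [S.cell_zero]
    congr 2
  · intro x s _
    refine (ofInt_yes hd (hpos _ x s) (hpos _ x s) (hδ x)).trans (Iff.trans ?_ (henc x))
    have h1 : ∀ e, (1 : ℤ) ≤ (S.vert x : ℤ) ^ e := fun e => one_le_pow₀ (hvZ x)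
    have hCZ : (18 * l.length + 2 : ℤ) ≤ C := by exact_mod_cast hC
    -- The `3` in the exponent comes from the `v ^ 3` triples of digits per shape; the constant `C`
    -- absorbs the number of shapes, the factor `18` and the auxiliary points.
    have hbig : ∀ (e e' : ℕ), e + 3 ≤ e' →
        (l.length : ℤ) * (S.vert x : ℤ) ^ 3 * ((S.vert x : ℤ) ^ e + 2) + 2 ≤
          C * (S.vert x : ℤ) ^ e' ∧
        (l.length : ℤ) * (S.vert x : ℤ) ^ 3 * (18 * (S.vert x : ℤ) ^ e) + 2 ≤
          C * (S.vert x : ℤ) ^ e' := by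
      intro e e' he
      have h2 : (S.vert x : ℤ) ^ 3 * (S.vert x : ℤ) ^ e ≤ (S.vert x : ℤ) ^ e' := by
        rw [← pow_add]; exact pow_le_pow_right₀ (hvZ x) (by omega)
      have h3 : (S.vert x : ℤ) ^ 3 ≤ (S.vert x : ℤ) ^ e' := pow_le_pow_right₀ (hvZ x) (by omega)
      have h4 := h1 e'
      have h5 : (18 * l.length + 2 : ℤ) * (S.vert x : ℤ) ^ e' ≤ C * (S.vert x : ℤ) ^ e' :=
        mul_le_mul_of_nonneg_right hCZ (by omega)
      have h6 := mul_le_mul_of_nonneg_left h2 (by positivity : (0 : ℤ) ≤ l.length)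
      have h7 := mul_le_mul_of_nonneg_left h3 (by positivity : (0 : ℤ) ≤ l.length)
      have h8 : 0 ≤ (l.length : ℤ) * (S.vert x : ℤ) ^ e' := by positivity
      constructor <;> nlinarith
    have hsmall : ∀ e' : ℕ, (C : ℤ) * (S.vert x : ℤ) ^ e' ≤
        C * (S.vert x : ℤ) ^ e' * ((s : ℤ) + 1) := fun e' =>
      le_mul_of_one_le_right (by positivity) (by omega)
    refine shapeLayout_feasible_iff hd (hvZ x) hl (fun sh hsh u hu => hK₀ K (by omega) sh hsh _ u
      (hvZ x) hu) (by omega) (by omega) ?_ ?_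
    · unfold setSize
      cases swap
      · simpa using (hbig pp p hp.1).1
      · simpa using (hbig pp q hp.2).1.trans (hsmall q)
    · unfold setSize
      cases swap
      · simpa using (hbig hh q hp.2).2.trans (hsmall q)
      · simpa using (hbig hh p hp.1).2
  · intro x
    unfold ElementaryReduction.number
    rw [hec']
    beta_reduce
    rw [S.cell_zero]
    norm_cast
  · exact fun x s => ⟨rfl, rfl⟩

end
end FineGrained

/-! ### Meeting the size regime, and the transfer of running times -/

namespace FineGrained
noncomputable section

/-- For large `v` one of the sizes `C * v ^ q * (s + 1)` is in the prescribed relation to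
`C * v ^ p`. -/
theorem exists_size_in_regime {lam a b : ℝ} (hlam0 : 0 < lam) (hlam1 : lam ≤ 1) (ha0 : 0 < a)
    (ha1 : a ≤ 1) (hab : a < b) {C p q : ℕ} (hC : 1 ≤ C) (hqp : q ≤ p)
    (hq : (q : ℝ) + 1 ≤ lam * p) (hq' : lam * p ≤ q + 2) :
    ∃ v₀ : ℕ, ∀ v : ℕ, v₀ ≤ v → ∃ s : ℕ, s < v ^ min 4 (p - q) ∧
      a * ((C * v ^ p : ℕ) : ℝ) ^ lam ≤ ((C * v ^ q * (s + 1) : ℕ) : ℝ) ∧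
      ((C * v ^ q * (s + 1) : ℕ) : ℝ) ≤ b * ((C * v ^ p : ℕ) : ℝ) ^ lam ∧
      C * v ^ q * (s + 1) ≤ C * v ^ p := by
  have hb : 0 < b := ha0.trans hab
  -- For such `v` the step `C * v ^ q` between consecutive sizes is at most the length `(b - a) * n
  -- ^ lam` of the target interval, so it cannot be jumped over. Moreover `b ≤ v` keeps the number
  -- of candidates polynomial.
  refine ⟨⌈b⌉₊ + ⌈C / (b - a)⌉₊ + 1, fun v hv => ?_⟩
  have hvb : b ≤ v := (Nat.le_ceil b).trans (by exact_mod_cast (by omega))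
  have hvC : (C : ℝ) / (b - a) ≤ v := (Nat.le_ceil _).trans (by exact_mod_cast (by omega))
  have hv1 : (1 : ℝ) ≤ v := by exact_mod_cast (by omega : 1 ≤ v)
  have hv0 : (0 : ℝ) < v := by linarith
  have hC1 : (1 : ℝ) ≤ C := by exact_mod_cast hC
  set n : ℝ := ((C * v ^ p : ℕ) : ℝ) with hn
  have hn' : n = C * (v : ℝ) ^ p := by rw [hn]; push_cast; rfl
  have hn1 : 1 ≤ n := by
    rw [hn']
    exact one_le_mul_of_one_le_of_one_le hC1 (one_le_pow₀ hv1)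
  have hnl : n ^ lam = (C : ℝ) ^ lam * (v : ℝ) ^ (lam * p) := by
    rw [hn', Real.mul_rpow (by positivity) (by positivity), ← Real.rpow_natCast,
      ← Real.rpow_mul hv0.le, mul_comm lam]
  have hlow : (v : ℝ) ^ (q + 1) ≤ n ^ lam := by
    rw [hnl]
    calc (v : ℝ) ^ (q + 1) = (v : ℝ) ^ ((q : ℝ) + 1) := by
          rw [← Real.rpow_natCast]; push_cast; rfl
      _ ≤ (v : ℝ) ^ (lam * p) := Real.rpow_le_rpow_of_exponent_le hv1 hq
      _ ≤ _ := le_mul_of_one_le_left (by positivity) (Real.one_le_rpow hC1 hlam0.le)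
  have hup : n ^ lam ≤ C * (v : ℝ) ^ (q + 2) := by
    rw [hnl]
    refine mul_le_mul ((Real.rpow_le_rpow_of_exponent_le hC1 hlam1).trans_eq (Real.rpow_one _)) ?_
      (by positivity) (by positivity)
    calc (v : ℝ) ^ (lam * p) ≤ (v : ℝ) ^ ((q : ℝ) + 2) := Real.rpow_le_rpow_of_exponent_le hv1 hq'
      _ = _ := by rw [← Real.rpow_natCast]; push_cast; rfl
  have hstep : (0 : ℝ) < C * (v : ℝ) ^ q := by positivity
  have bound : ∀ s : ℕ, ((C * v ^ q * (s + 1) : ℕ) : ℝ) ≤ b * n ^ lam →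
      C * v ^ q * (s + 1) ≤ C * v ^ p → s < v ^ min 4 (p - q) := by
    intro s h1 h2
    have h3 : s + 1 ≤ v ^ 4 := by
      have : ((s : ℝ) + 1) * (C * (v : ℝ) ^ q) ≤ (v : ℝ) ^ 4 * (C * (v : ℝ) ^ q) := by
        push_cast at h1
        calc ((s : ℝ) + 1) * (C * (v : ℝ) ^ q) = C * (v : ℝ) ^ q * (s + 1) := by ring
          _ ≤ b * n ^ lam := h1
          _ ≤ v * (C * (v : ℝ) ^ (q + 2)) := mul_le_mul hvb hup (by positivity) hv0.le
          _ = (v : ℝ) ^ 3 * (C * (v : ℝ) ^ q) := by ring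
          _ ≤ (v : ℝ) ^ 4 * (C * (v : ℝ) ^ q) :=
            mul_le_mul_of_nonneg_right (pow_le_pow_right₀ hv1 (by norm_num)) hstep.le
      have := le_of_mul_le_mul_right this hstep
      exact_mod_cast this
    have h4 : s + 1 ≤ v ^ (p - q) := by
      have e : C * v ^ p = C * v ^ q * v ^ (p - q) := by
        rw [mul_assoc, ← pow_add, Nat.add_sub_cancel' hqp]
      rw [e] at h2
      refine Nat.le_of_mul_le_mul_left h2 ?_
      have : 0 < v := by omega
      positivity
    rcases min_choice 4 (p - q) with h | h <;> rw [h] <;> omega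
  -- If the interval reaches up to `n`, two sets of equal size are admissible because of `a ≤ 1`.
  -- Otherwise the largest multiple below the upper end is chosen, and it is automatically smaller
  -- than `n`.
  by_cases hcase : n ≤ b * n ^ lam
  · have hvpos : 0 < v := by omega
    have hpow : 0 < v ^ (p - q) := by positivity
    have e : C * v ^ q * (v ^ (p - q) - 1 + 1) = C * v ^ p := by
      rw [Nat.sub_add_cancel hpow, mul_assoc, ← pow_add, Nat.add_sub_cancel' hqp]
    refine ⟨v ^ (p - q) - 1, bound _ ?_ e.le, ?_, ?_, e.le⟩ <;> rw [e]
    · exact hcase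
    · calc a * n ^ lam ≤ 1 * n ^ (1 : ℝ) := mul_le_mul ha1
            (Real.rpow_le_rpow_of_exponent_le hn1 hlam1) (by positivity) zero_le_one
        _ = n := by rw [one_mul, Real.rpow_one]
    · exact hcase
  · push Not at hcase
    have hgap : C * (v : ℝ) ^ q ≤ (b - a) * n ^ lam := by
      have h1 : (C : ℝ) ≤ (b - a) * v := by
        rw [div_le_iff₀ (by linarith)] at hvC
        linarith
      calc C * (v : ℝ) ^ q ≤ (b - a) * v * (v : ℝ) ^ q :=
            mul_le_mul_of_nonneg_right h1 (by positivity)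
        _ = (b - a) * (v : ℝ) ^ (q + 1) := by ring
        _ ≤ _ := mul_le_mul_of_nonneg_left hlow (by linarith)
    have hnlam : 0 < n ^ lam := by positivity
    set w := b * n ^ lam / (C * (v : ℝ) ^ q) with hw
    have hw1 : 1 ≤ w := by
      rw [hw, le_div_iff₀ hstep]
      nlinarith
    have hf1 : 1 ≤ ⌊w⌋₊ := Nat.le_floor (by exact_mod_cast hw1)
    have e : ((C * v ^ q * (⌊w⌋₊ - 1 + 1) : ℕ) : ℝ) = C * (v : ℝ) ^ q * ⌊w⌋₊ := by
      rw [Nat.sub_add_cancel hf1]; push_cast; rfl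
    have ew : C * (v : ℝ) ^ q * w = b * n ^ lam := by
      rw [hw]; field_simp
    have hle : ((C * v ^ q * (⌊w⌋₊ - 1 + 1) : ℕ) : ℝ) ≤ b * n ^ lam := by
      rw [e, ← ew]
      exact mul_le_mul_of_nonneg_left (Nat.floor_le (by linarith)) hstep.le
    have hle' : C * v ^ q * (⌊w⌋₊ - 1 + 1) ≤ C * v ^ p := by
      exact Nat.cast_le.1 (hle.trans hcase.le)
    refine ⟨⌊w⌋₊ - 1, bound _ hle hle', ?_, hle, hle'⟩
    rw [e]
    have : C * (v : ℝ) ^ q * w ≤ C * (v : ℝ) ^ q * (⌊w⌋₊ + 1) :=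
      mul_le_mul_of_nonneg_left (Nat.lt_floor_add_one w).le hstep.le
    rw [ew] at this
    linarith

/-- At most `v ^ 4` instances of size `O(v ^ p)` are written down, and on one of the admissible size
the algorithm takes `O(v ^ (p * (1 + lam) * e))` steps. The two conditions on `T` compare `v ^ T`
with these costs. The suitable `s` is never computed. -/
theorem solvable_of_encoded {μ : Arithmetic} {𝒞 : Set Prog} (hclosed : BudgetClosed μ 𝒞)
    (S : VertexProblem) {d : ℕ} (hd : 0 < d) {l : List (Shape d)} {pp hh g p q : ℕ} (swap : Bool)
    (hl : ∀ sh ∈ l, sh.Valid pp hh) (henc : S.EncodedBy l g)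
    (hp : if swap then hh + 3 ≤ p ∧ pp + 3 ≤ q else pp + 3 ≤ p ∧ hh + 3 ≤ q)
    {lam a b e T : ℝ} (hlam0 : 0 < lam) (hlam1 : lam ≤ 1) (ha0 : 0 < a) (ha1 : a ≤ 1) (hab : a < b)
    (he : 0 ≤ e) (hq : (q : ℝ) + 1 ≤ lam * p) (hq' : lam * p ≤ q + 2)
    (hT : (p : ℝ) + 4 ≤ T) (hT' : p * (1 + lam) * e + 5 ≤ T)
    (hsol : UndirectedHuTSolvable μ 𝒞 d hd lam a b e) :
    SolvableIn μ 𝒞 S.X Set.univ fun x => (S.vert x : ℝ) ^ T := by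
  have hb : 0 < b := ha0.trans hab
  have hqp : q ≤ p := by
    have : (q : ℝ) ≤ p := by nlinarith [(by positivity : (0 : ℝ) ≤ p)]
    exact_mod_cast this
  set C := 18 * l.length + 2 with hC
  obtain ⟨R, ⟨re, hre, hreA⟩, hcA, hwA, hrA, hoA, hnum, hsize⟩ :=
    exists_reduction S hd (κ := min 4 (p - q)) swap hl henc hC.ge hp
  obtain ⟨v₀, hv₀⟩ := exists_size_in_regime hlam0 hlam1 ha0 ha1 hab (C := C) (by omega) hqp hq hq'
  obtain ⟨prog, hprog, c, C₁, hrun⟩ := hsol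
  choose t ht using hrun
  -- Below `v₀` there may be no suitable size, but this concerns finitely many instances, whose
  -- running times are absorbed in a constant.
  obtain ⟨T₀, hT₀⟩ : ∃ T₀ : ℕ, ∀ x, S.vert x < v₀ → t (R.map x 0) ≤ T₀ := by
    obtain ⟨T₀, h⟩ := ((S.finite v₀).image fun x => t (R.map x 0)).bddAbove
    exact ⟨T₀, fun x hx => h ⟨x, hx, rfl⟩⟩
  -- The budget has to be an arithmetic expression, so its exponent is rounded up; of the `5` in
  -- `hT'` one unit is spent on that and four on the number of instances.
  set K := ⌈p * (1 + lam) * e⌉₊ with hK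
  set C₂ := ⌈|C₁| * (b * (C : ℝ) ^ (1 + lam)) ^ e⌉₊ + T₀ + 1 with hC₂
  have e_v : Expressible fun x _ _ => x.words.getD 0 0 := (Expressible.const 0).cell
  obtain ⟨bud, hbud, hbud'⟩ := (Expressible.const (C₂ : ℤ)).mul (e_v.pow K)
  have hbv : ∀ x, bud.eval (S.X.input x) 0 0 = (C₂ * S.vert x ^ K : ℕ) := fun x => by
    rw [hbud']
    beta_reduce
    rw [S.cell_zero]; push_cast; rfl
  have hvpow : ∀ x k, 1 ≤ S.vert x ^ k := fun x k => Nat.one_le_pow _ _ (S.one_le_vert x)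
  have hC₂v : ∀ x, C₂ ≤ C₂ * S.vert x ^ K := fun x => Nat.le_mul_of_pos_right _ (hvpow x K)
  refine (hclosed S.X _ R prog c re bud
    (fun x => 3 + 2 * C * S.vert x ^ p * d) hre hreA hbud hcA hwA hrA hoA S.reals_nil S.one_le_size
    hprog (fun y => ⟨t y, (ht y).1⟩) ?_ ?_ ?_).elim fun prog' ⟨hprog', c', C₃, hrun'⟩ => ?_
  rotate_left 3
  · refine ⟨prog', hprog', c', C₃ * (5 + 2 * C * d + C₂), fun x => ?_⟩
    obtain ⟨t', h1, h2⟩ := hrun' x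
    refine ⟨t', h1, fun _ => ?_⟩
    have hv1 : (1 : ℝ) ≤ S.vert x := by exact_mod_cast S.one_le_vert x
    have pow_le : ∀ k : ℕ, (k : ℝ) ≤ T → (S.vert x : ℝ) ^ k ≤ (S.vert x : ℝ) ^ T := fun k hk => by
      rw [← Real.rpow_natCast]
      exact Real.rpow_le_rpow_of_exponent_le hv1 hk
    have hKT : (K : ℝ) + 4 ≤ T := by
      have := Nat.ceil_lt_add_one (by positivity : 0 ≤ p * (1 + lam) * e)
      rw [← hK] at this
      linarith
    have g1 := pow_le 3 (by push_cast; linarith [(by positivity : (0 : ℝ) ≤ p)])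
    have g2 := pow_le (4 + p) (by push_cast; linarith)
    have g3 := pow_le (4 + K) (by push_cast; linarith)
    have g4 := pow_le 4 (by push_cast; linarith [(by positivity : (0 : ℝ) ≤ p)])
    have h3 : t' ≤ C₃ * (2 * S.vert x ^ 3 + S.vert x ^ 4 * (3 + 2 * C * S.vert x ^ p * d +
        C₂ * S.vert x ^ K)) := by
      refine h2.trans (Nat.mul_le_mul_left _ (Nat.add_le_add (S.size_le x) ?_))
      rw [hnum, hbv, Int.toNat_natCast]
      exact Nat.mul_le_mul_right _ (Nat.pow_le_pow_right (S.one_le_vert x) (min_le_left _ _))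
    have h4 : (t' : ℝ) ≤ C₃ * (2 * (S.vert x : ℝ) ^ 3 + (S.vert x : ℝ) ^ 4 *
        (3 + 2 * C * (S.vert x : ℝ) ^ p * d + C₂ * (S.vert x : ℝ) ^ K)) := by exact_mod_cast h3
    refine h4.trans ?_
    push_cast
    rw [mul_assoc (C₃ : ℝ)]
    refine mul_le_mul_of_nonneg_left ?_ (by positivity : (0 : ℝ) ≤ C₃)
    rw [pow_add] at g2 g3
    have g2' := mul_le_mul_of_nonneg_left g2 (by positivity : (0 : ℝ) ≤ 2 * C * d)
    have g3' := mul_le_mul_of_nonneg_left g3 (by positivity : (0 : ℝ) ≤ C₂)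
    generalize (S.vert x : ℝ) ^ T = Z at *
    generalize (S.vert x : ℝ) ^ 3 = Z₃ at *
    generalize (S.vert x : ℝ) ^ 4 = Z₄ at *
    generalize (S.vert x : ℝ) ^ p = Z₅ at *
    generalize (S.vert x : ℝ) ^ K = Z₆ at *
    calc 2 * Z₃ + Z₄ * (3 + 2 * C * Z₅ * d + C₂ * Z₆) =
          2 * Z₃ + 3 * Z₄ + 2 * C * d * (Z₄ * Z₅) + C₂ * (Z₄ * Z₆) := by ring
      _ ≤ 2 * Z + 3 * Z + 2 * C * d * Z + C₂ * Z := by linarith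
      _ = _ := by ring
  · intro x s hs
    rw [hnum] at hs
    have hs' : s + 1 ≤ S.vert x ^ (p - q) :=
      (show s + 1 ≤ _ from hs).trans (Nat.pow_le_pow_right (S.one_le_vert x) (min_le_right _ _))
    have hle : ∀ b : Bool, setSize b C p q (S.vert x) s ≤ C * S.vert x ^ p := fun b => by
      unfold setSize
      split_ifs
      · calc _ ≤ C * S.vert x ^ q * S.vert x ^ (p - q) := Nat.mul_le_mul_left _ hs'
          _ = _ := by rw [mul_assoc, ← pow_add, Nat.add_sub_cancel' hqp]
      · exact le_rfl
    have e : ∀ y : HuTInst d, y.input.size = (y.n + y.m) * d + 3 := fun y => by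
      simp [Input.size, HuTInst.input, List.length_flatMap, Function.comp_def]
      ring
    refine (e _).trans_le ?_
    rw [(hsize x s).1, (hsize x s).2]
    have := Nat.mul_le_mul_right d (Nat.add_le_add (hle swap) (hle (!swap)))
    calc _ ≤ (C * S.vert x ^ p + C * S.vert x ^ p) * d + 3 := by omega
      _ = _ := by ring
  · intro x
    rw [hbv]
    have := hC₂v x
    exact_mod_cast (by omega : 1 ≤ C₂ * S.vert x ^ K)
  · intro x
    simp only [hnum, hbv, Nat.cast_le]
    by_cases hx : S.vert x < v₀
    · exact ⟨0, hvpow x _, t (R.map x 0), (hT₀ x hx).trans (by have := hC₂v x; omega),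
        (ht (R.map x 0)).1⟩
    obtain ⟨s, hs, r1, r2, r3⟩ := hv₀ (S.vert x) (by omega)
    refine ⟨s, hs, t (R.map x s), ?_, (ht _).1⟩
    obtain ⟨hn, hm⟩ := hsize x s
    set n := C * S.vert x ^ p with hndef
    set m := C * S.vert x ^ q * (s + 1) with hmdef
    have hnm : max (HuTInst.n (R.map x s) : ℝ) (HuTInst.m (R.map x s)) = n ∧
        min (HuTInst.n (R.map x s) : ℝ) (HuTInst.m (R.map x s)) = m ∧
        (HuTInst.n (R.map x s) : ℝ) * (HuTInst.m (R.map x s)) = n * m := by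
      have h : (m : ℝ) ≤ n := by exact_mod_cast r3
      rw [hn, hm]
      unfold setSize
      cases swap
      · simp only [Bool.not_false, if_true, Bool.false_eq_true, if_false, ← hndef, ← hmdef]
        exact ⟨max_eq_left h, min_eq_right h, trivial⟩
      · simp only [Bool.not_true, if_true, Bool.false_eq_true, if_false, ← hndef, ← hmdef]
        exact ⟨max_eq_right h, min_eq_left h, mul_comm _ _⟩
    have hreg := (ht (R.map x s)).2 (by
      show _ ∧ _
      rw [hnm.1, hnm.2.1]
      exact ⟨r1, r2⟩)
    beta_reduce at hreg
    rw [hnm.2.2] at hreg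
    have hv1 : (1 : ℝ) ≤ S.vert x := by exact_mod_cast S.one_le_vert x
    have hn0 : (0 : ℝ) < n := by
      rw [hndef]; exact_mod_cast Nat.mul_pos (by omega) (hvpow x p)
    have key : ((n : ℝ) * m) ^ e ≤ (b * (C : ℝ) ^ (1 + lam)) ^ e * (S.vert x : ℝ) ^ K := by
      have h1 : (n : ℝ) * m ≤ b * (C : ℝ) ^ (1 + lam) * (S.vert x : ℝ) ^ (p * (1 + lam)) := by
        calc (n : ℝ) * m ≤ n * (b * (n : ℝ) ^ lam) := mul_le_mul_of_nonneg_left r2 hn0.le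
          _ = b * (n : ℝ) ^ (1 + lam) := by rw [Real.rpow_add hn0, Real.rpow_one]; ring
          _ = _ := by
            rw [hndef]
            push_cast
            rw [Real.mul_rpow (by positivity) (by positivity), ← Real.rpow_natCast,
              ← Real.rpow_mul (by positivity)]
            ring
      refine (Real.rpow_le_rpow (by positivity) h1 he).trans ?_
      rw [Real.mul_rpow (by positivity) (by positivity), ← Real.rpow_mul (by positivity),
        ← Real.rpow_natCast]
      exact mul_le_mul_of_nonneg_left (Real.rpow_le_rpow_of_exponent_le hv1 (Nat.le_ceil _))
        (by positivity)
    have h2 : (t (R.map x s) : ℝ) ≤ C₂ * (S.vert x : ℝ) ^ K := by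
      have h3 : |C₁| * (b * (C : ℝ) ^ (1 + lam)) ^ e ≤ C₂ := by
        refine (Nat.le_ceil _).trans ?_
        rw [hC₂]
        exact_mod_cast (by omega)
      calc (t (R.map x s) : ℝ) ≤ C₁ * ((n : ℝ) * m) ^ e := hreg
        _ ≤ |C₁| * ((n : ℝ) * m) ^ e :=
          mul_le_mul_of_nonneg_right (le_abs_self _) (by positivity)
        _ ≤ |C₁| * ((b * (C : ℝ) ^ (1 + lam)) ^ e * (S.vert x : ℝ) ^ K) :=
          mul_le_mul_of_nonneg_left key (abs_nonneg _)
        _ = |C₁| * (b * (C : ℝ) ^ (1 + lam)) ^ e * (S.vert x : ℝ) ^ K := by ring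
        _ ≤ _ := mul_le_mul_of_nonneg_right h3 (by positivity)
    exact_mod_cast h2

end
end FineGrained

/-! ### Graphs and hypergraphs as inputs -/

namespace FineGrained
noncomputable section

theorem getElem?_flatMap {α β : Type*} {f : α → List β} {b : ℕ} (l : List α)
    (hf : ∀ a, (f a).length = b) {i j : ℕ} (hi : i < l.length) (hj : j < b) :
    (l.flatMap f)[i * b + j]? = (f l[i])[j]? := by
  induction l generalizing i with
  | nil => simp at hi
  | cons a l ih =>
    rw [List.flatMap_cons]
    cases i with
    | zero => rw [List.getElem?_append_left (by rw [hf]; omega)]; simp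
    | succ i =>
      rw [List.getElem?_append_right (by rw [hf]; nlinarith), hf,
        show (i + 1) * b + j - b = i * b + j by rw [add_mul]; omega,
        ih (by simpa using hi)]
      simp

theorem GraphInst.input_cell (x : GraphInst) (i j : Fin x.n) :
    x.input.words.getD (1 + (i * x.n + j)) 0 = open Classical in if x.G.Adj i j then 1 else 0 := by
  rw [List.getD_eq_getElem?_getD, GraphInst.input, add_comm, List.getElem?_cons_succ,
    getElem?_flatMap (b := x.n) _ (by simp) (by simp) j.2]
  simp
  congr! <;> exact Fin.ext (by simp)

theorem HypergraphInst.input_cell (x : HypergraphInst) (i j k : Fin x.n) :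
    x.input.words.getD (1 + ((i * x.n + j) * x.n + k)) 0 =
      open Classical in if ({i, j, k} : Finset (Fin x.n)) ∈ x.edges then 1 else 0 := by
  have e : ((i * x.n + j) * x.n + k : ℕ) = i * (x.n * x.n) + (j * x.n + k) := by ring
  have hj : (j * x.n + k : ℕ) < x.n * x.n := by nlinarith [j.2, k.2]
  rw [List.getD_eq_getElem?_getD, HypergraphInst.input, add_comm, List.getElem?_cons_succ, e,
    getElem?_flatMap (b := x.n * x.n) _ (by simp [List.length_flatMap]) (by simp) hj,
    getElem?_flatMap (b := x.n) _ (by simp) (by simp) k.2]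
  simp
  congr! <;> exact Fin.ext (by simp)

theorem GraphInst.finite (N : ℕ) : {x : GraphInst | x.n < N}.Finite := by
  let f : (Σ n : Fin N, {_G : SimpleGraph (Fin n) // 0 < (n : ℕ)}) → GraphInst := fun t =>
    ⟨t.1, t.2.2, t.2.1⟩
  refine (Set.finite_range f).subset fun x hx => ?_
  exact ⟨⟨⟨x.n, hx⟩, ⟨x.G, x.pos⟩⟩, rfl⟩

theorem HypergraphInst.finite (N : ℕ) : {x : HypergraphInst | x.n < N}.Finite := by
  let f : (Σ n : Fin N, {E : Set (Finset (Fin n)) // 0 < (n : ℕ) ∧ ∀ e ∈ E, e.card = 3}) →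
      HypergraphInst := fun t => ⟨t.1, t.2.2.1, t.2.1, t.2.2.2⟩
  refine (Set.finite_range f).subset fun x hx => ?_
  exact ⟨⟨⟨x.n, hx⟩, ⟨x.edges, x.pos, x.uniform⟩⟩, rfl⟩

/-- Finding cliques; a triple is forbidden if its outer members are not adjacent. -/
def cliqueVertexProblem (k : ℕ) : VertexProblem where
  X := cliqueProblem k
  vert := GraphInst.n
  one_le_vert := GraphInst.pos
  cell_zero _ := rfl
  reals_nil _ := rfl
  one_le_size _ := by simp [cliqueProblem, GraphInst.input, Input.size]
  size_le x := by
    have h : x.n * x.n * 1 ≤ x.n * x.n * x.n := Nat.mul_le_mul_left _ x.pos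
    have h1 : 1 ≤ x.n * x.n * x.n := Nat.mul_pos (Nat.mul_pos x.pos x.pos) x.pos
    have e : x.n ^ 3 = x.n * x.n * x.n := by ring
    simp [cliqueProblem, GraphInst.input, Input.size, List.length_flatMap]
    omega
  finite := GraphInst.finite
  bad x u := x.words.getD (1 + (u 0 * x.words.getD 0 0 + u 2)).toNat 0 ≠ 1
  expressible_bad u hu := by
    have hv : Expressible fun x _ _ => x.words.getD 0 0 := (Expressible.const 0).cell
    exact (ExpressibleProp.eq
      ((Expressible.const 1).add (((hu 0).mul hv).add (hu 2))).cell (.const 1)).not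

/-- Finding hypercliques; a triple is forbidden if it is not a hyperedge. -/
def hypercliqueVertexProblem (k : ℕ) : VertexProblem where
  X := hypercliqueProblem k
  vert := HypergraphInst.n
  one_le_vert := HypergraphInst.pos
  cell_zero _ := rfl
  reals_nil _ := rfl
  one_le_size _ := by simp [hypercliqueProblem, HypergraphInst.input, Input.size]
  size_le x := by
    have h1 : 1 ≤ x.n * x.n * x.n := Nat.mul_pos (Nat.mul_pos x.pos x.pos) x.pos
    have e : x.n ^ 3 = x.n * x.n * x.n := by ring
    have e' : x.n * (x.n * x.n) = x.n * x.n * x.n := by ring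
    simp [hypercliqueProblem, HypergraphInst.input, Input.size, List.length_flatMap]
    omega
  finite := HypergraphInst.finite
  bad x u := x.words.getD
    (1 + ((u 0 * x.words.getD 0 0 + u 1) * x.words.getD 0 0 + u 2)).toNat 0 ≠ 1
  expressible_bad u hu := by
    have hv : Expressible fun x _ _ => x.words.getD 0 0 := (Expressible.const 0).cell
    exact (ExpressibleProp.eq ((Expressible.const 1).add
      (((((hu 0).mul hv).add (hu 1)).mul hv).add (hu 2))).cell (.const 1)).not

theorem clique_bad_iff {k : ℕ} (x : GraphInst) {u : Fin 3 → ℤ} {i j : Fin x.n}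
    (hi : u 0 = (i : ℕ)) (hj : u 2 = (j : ℕ)) :
    (cliqueVertexProblem k).bad x.input u ↔ ¬ x.G.Adj i j := by
  show x.input.words.getD (1 + (u 0 * (x.n : ℤ) + u 2)).toNat 0 ≠ 1 ↔ _
  rw [hi, hj, show (1 + ((i : ℕ) * (x.n : ℤ) + (j : ℕ))).toNat = 1 + (i * x.n + j) by
    have : 1 + ((i : ℕ) * (x.n : ℤ) + (j : ℕ)) = ((1 + (i * x.n + j) : ℕ) : ℤ) := by push_cast; rfl
    rw [this, Int.toNat_natCast], x.input_cell]
  split_ifs with h <;> simp [h]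

theorem hyperclique_bad_iff {k : ℕ} (x : HypergraphInst) {u : Fin 3 → ℤ} {i j l : Fin x.n}
    (hi : u 0 = (i : ℕ)) (hj : u 1 = (j : ℕ)) (hl : u 2 = (l : ℕ)) :
    (hypercliqueVertexProblem k).bad x.input u ↔ ({i, j, l} : Finset (Fin x.n)) ∉ x.edges := by
  show x.input.words.getD (1 + ((u 0 * (x.n : ℤ) + u 1) * (x.n : ℤ) + u 2)).toNat 0 ≠ 1 ↔ _
  rw [hi, hj, hl, show (1 + (((i : ℕ) * (x.n : ℤ) + (j : ℕ)) * (x.n : ℤ) + (l : ℕ))).toNat =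
    1 + ((i * x.n + j) * x.n + l) by
      have : (1 + (((i : ℕ) * (x.n : ℤ) + (j : ℕ)) * (x.n : ℤ) + (l : ℕ))) =
        ((1 + ((i * x.n + j) * x.n + l) : ℕ) : ℤ) := by push_cast; rfl
      rw [this, Int.toNat_natCast], x.input_cell]
  split_ifs with h <;> simp [h]

end
end FineGrained

/-! ### Digits, and gadgets that read them -/

namespace FineGrained
noncomputable section

section Digits
variable {v : ℤ}

theorem digit_high {a X : ℤ} {η t : ℕ} (hv : 1 ≤ v) (hX : 0 ≤ X) (hX' : X < v ^ η) (ht : η ≤ t) :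
    (a * v ^ η + X) / v ^ t = a / v ^ (t - η) := by
  rw [← Nat.add_sub_cancel' ht, pow_add, ← Int.ediv_ediv_of_nonneg (by positivity),
    Layout.index_div hX hX', Nat.add_sub_cancel_left]

theorem digit_low {a X : ℤ} {η t : ℕ} (hv : 1 ≤ v) (ht : t < η) :
    (a * v ^ η + X) / v ^ t % v = X / v ^ t % v := by
  obtain ⟨k, rfl⟩ : ∃ k, η = t + (k + 1) := ⟨η - t - 1, by omega⟩
  rw [show a * v ^ (t + (k + 1)) + X = X + v ^ t * (v * (a * v ^ k)) by ring,
    Int.add_mul_ediv_left _ _ (by positivity), Int.add_mul_emod_self_left]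

theorem split_at (hv : 1 ≤ v) (τ : ℤ) (e η : ℕ) :
    τ / v ^ e = τ / v ^ (e + η) * v ^ η + τ % v ^ (e + η) / v ^ e := by
  have h : τ = τ % v ^ (e + η) + v ^ e * (τ / v ^ (e + η) * v ^ η) := by
    have := Int.emod_add_mul_ediv τ (v ^ (e + η))
    rw [pow_add] at *
    linarith
  conv_lhs => rw [h, Int.add_mul_ediv_left _ _ (by positivity)]
  ring

theorem eq_div_of_sub_mem {τ a b : ℤ} (h : 0 ≤ τ - a * b) (h' : τ - a * b < b) :
    a = τ / b ∧ τ - a * b = τ % b := by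
  have e : τ = a * b + (τ - a * b) := by ring
  constructor
  · conv_rhs => rw [e, Layout.index_div h h']
  · conv_rhs => rw [e, Layout.index_mod h h']

/-- Shifting by multiples of `M * v` does not alter the digit at `M`. It can bring `z` into the
window that belongs to `u` only if this digit is `u`, and then by the shift that cancels the
quotient. In the gadgets, `M` is `v ^ ez` and `W` is made up of the cell and the guess `a 2`. -/
theorem window_iff {M z W u : ℤ} (hM : 0 < M) (hu : 0 ≤ u) (hu' : u < v) :
    u * M ≤ z + W * (M * v) ∧ z + W * (M * v) < u * M + M ↔ W = -(z / (M * v)) ∧ z / M % v = u := by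
  have e1 : u * M ≤ z + W * (M * v) ∧ z + W * (M * v) < u * M + M ↔ (z + W * (M * v)) / M = u := by
    constructor
    · rintro ⟨h1, h2⟩
      have : z + W * (M * v) = u * M + (z + W * (M * v) - u * M) := by ring
      rw [this, Layout.index_div (by omega) (by omega)]
    · rintro rfl
      have h1 := Int.ediv_mul_le (z + W * (M * v)) hM.ne'
      have h2 := Int.lt_ediv_add_one_mul_self (z + W * (M * v)) hM
      rw [add_mul, one_mul] at h2
      exact ⟨h1, h2⟩
  rw [e1, show z + W * (M * v) = z + M * (W * v) by ring, Int.add_mul_ediv_left _ _ hM.ne',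
    ← Int.ediv_ediv_of_nonneg hM.le]
  have h3 := Int.emod_add_mul_ediv (z / M) v
  constructor
  · intro h
    have h4 : z / M = (-W) * v + u := by linarith
    rw [h4, Layout.index_div hu hu', Layout.index_mod hu hu']
    simp
  · rintro ⟨h1, h2⟩
    rw [h1]
    linarith

/-- For `v = 1` all three numbers are at most `0`, and otherwise three is less than `v ^ 2`. -/
theorem add_add_lt_pow {x y z : ℤ} {b : ℕ} (hv : 1 ≤ v) (hx : x < v ^ b) (hy : y < v ^ b)
    (hz : z < v ^ b) : x + y + z < v ^ (b + 2) := by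
  have hb : 0 < v ^ b := by positivity
  rcases hv.lt_or_eq with h | h
  · have h4 : 2 * 2 ≤ v * v := mul_le_mul h h (by norm_num) (by omega)
    have h5 : v ^ b * (2 * 2) ≤ v ^ (b + 2) := by
      rw [pow_add, pow_two]; exact mul_le_mul_of_nonneg_left h4 hb.le
    omega
  · subst h
    simp only [one_pow] at *
    omega

/-- Digits with positions and prescribed values, split at position `η`. -/
theorem forall_digits_iff {u : Fin 3 → ℤ} (hv : 1 ≤ v) (r : List (ℕ × Fin 3)) {a X : ℤ} {η : ℕ}
    (hX : 0 ≤ X) (hX' : X < v ^ η) :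
    (∀ t ∈ r, (a * v ^ η + X) / v ^ t.1 % v = u t.2) ↔
      (∀ t ∈ r.filter (·.1 < η), X / v ^ t.1 % v = u t.2) ∧
      ∀ t ∈ r.filter (η ≤ ·.1), a / v ^ (t.1 - η) % v = u t.2 := by
  simp only [List.mem_filter, decide_eq_true_eq]
  constructor
  · intro h
    refine ⟨fun t ⟨ht, hl⟩ => ?_, fun t ⟨ht, hl⟩ => ?_⟩
    · rw [← h t ht, digit_low hv hl]
    · rw [← h t ht, digit_high hv hX hX' hl]
  · rintro ⟨h1, h2⟩ t ht
    by_cases hl : t.1 < η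
    · rw [digit_low hv hl, h1 t ⟨ht, hl⟩]
    · rw [digit_high hv hX hX' (by omega), h2 t ⟨ht, by omega⟩]

end Digits

namespace Shape
variable {d : ℕ}

/-- Reads digits `rx` of the number `τ cx / v ^ ex` and digits `ry` of `τ cy / v ^ ey`, and the
digit with position `ez` of `τ cz`. -/
def reading (cx cy cz : Fin d) (ex η₁ α₁ ey η₂ α₂ ez β : ℕ) (rx ry : List (ℕ × Fin 3))
    (act : Activation) : Shape d where
  surf _ := ⟨cx, cy, cz, ex, ey, ez + 1, η₁, η₂, ez, [], 1, ez, rx.filter (·.1 < η₁),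
    ry.filter (·.1 < η₂)⟩
  α := ![α₁, α₂, β]
  om := ![ex + η₁, ey + η₂, ez + 1]
  oc := ![cx, cy, cz]
  conA := (rx.filter (η₁ ≤ ·.1)).map (fun t => (0, t.1 - η₁, t.2)) ++
    (ry.filter (η₂ ≤ ·.1)).map (fun t => (1, t.1 - η₂, t.2))
  act := act

theorem reading_valid {cx cy cz : Fin d} {ex η₁ α₁ ey η₂ α₂ ez β : ℕ} {rx ry : List (ℕ × Fin 3)}
    {act : Activation} {pp hh : ℕ} (hα : α₁ + α₂ + β ≤ pp) (hη : η₁ + η₂ ≤ hh) :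
    (reading cx cy cz ex η₁ α₁ ey η₂ α₂ ez β rx ry act).Valid pp hh :=
  ⟨fun _ => Or.inr (Nat.le_succ ez), hα, fun _ => hη⟩

variable {v : ℤ} {bad : (Fin 3 → ℤ) → Prop} {u : Fin 3 → ℤ} {τ : Fin d → ℤ}

-- A point can only be in a hole if `a 0` and `a 1` are the quotients of the first two coordinates;
-- the residues then fall into the cell `X`, `Y`. From cell to cell the staircase descends by
-- multiples of `v ^ (ez + 1)`, which makes it monotone without affecting the digit at `ez` of the
-- third coordinate, since `a 2` can compensate for the descent. Digits below the splitting position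
-- are compared by the holes and digits above it by enabling points, so `η₁` and `η₂` distribute the
-- work between the two sets. The conditions on `β` ensure that the required value of `a 2` is in
-- range.
set_option maxHeartbeats 400000 in
theorem reading_violated_iff (hv : 1 ≤ v) (hu : ∀ r, 0 ≤ u r ∧ u r < v)
    {cx cy cz : Fin d} {ex η₁ α₁ ey η₂ α₂ ez β g : ℕ} {rx ry : List (ℕ × Fin 3)}
    {act : Activation} (hτ : ∀ c, 0 ≤ τ c ∧ τ c < v ^ g) (hzx : cz ≠ cx) (hzy : cz ≠ cy)
    (hy : cy ≠ cx ∨ cy = cx ∧ α₂ = 0 ∧ η₂ = 0 ∧ ex + η₁ ≤ ey ∧ ry = [])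
    (hgx : g ≤ ex + η₁ + α₁) (hgy : g ≤ ey + η₂ + α₂) (hgz : g + 1 ≤ ez + β) (hβ₁ : η₁ + 2 ≤ β)
    (hβ₂ : η₂ + 2 ≤ β) :
    (reading cx cy cz ex η₁ α₁ ey η₂ α₂ ez β rx ry act).Violated v bad u τ ↔
      (reading cx cy cz ex η₁ α₁ ey η₂ α₂ ez β rx ry act).Active bad u ∧
      (∀ t ∈ rx, τ cx / v ^ ex / v ^ t.1 % v = u t.2) ∧
      (∀ t ∈ ry, τ cy / v ^ ey / v ^ t.1 % v = u t.2) ∧ τ cz / v ^ ez % v = u 2 := by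
  have hpos : ∀ e : ℕ, 0 < v ^ e := fun e => by positivity
  set sh := reading cx cy cz ex η₁ α₁ ey η₂ α₂ ez β rx ry act with hsh
  set X := τ cx % v ^ (ex + η₁) / v ^ ex with hX
  set Y := τ cy % v ^ (ey + η₂) / v ^ ey with hY
  have mod_lt : ∀ (t : ℤ) (e η : ℕ), 0 ≤ t % v ^ (e + η) ∧ t % v ^ (e + η) < v ^ e * v ^ η :=
    fun t e η => ⟨Int.emod_nonneg _ (hpos _).ne', by
      rw [← pow_add]; exact Int.emod_lt_of_pos _ (hpos _)⟩
  have cell_lt : ∀ (t : ℤ) (e η : ℕ), 0 ≤ t % v ^ (e + η) / v ^ e ∧ t % v ^ (e + η) / v ^ e < v ^ η :=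
    fun t e η => ⟨Int.ediv_nonneg (mod_lt t e η).1 (hpos _).le,
      Int.ediv_lt_of_lt_mul (hpos _) (by rw [mul_comm]; exact (mod_lt t e η).2)⟩
  have hX0 := cell_lt (τ cx) ex η₁
  have hY0 := cell_lt (τ cy) ey η₂
  rw [← hX] at hX0
  rw [← hY] at hY0
  have ex_split := split_at hv (τ cx) ex η₁
  have ey_split := split_at hv (τ cy) ey η₂
  rw [← hX] at ex_split
  rw [← hY] at ey_split
  rw [ex_split, ey_split, forall_digits_iff hv rx hX0.1 hX0.2, forall_digits_iff hv ry hY0.1 hY0.2]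
  have hA2 : cy = cx → sh.InRange v = fun a => sh.InRange v a ∧ a 1 = 0 := fun e => by
    rcases hy with h | ⟨-, h, -⟩
    · exact absurd e h
    · funext a
      refine propext ⟨fun ha => ⟨ha, ?_⟩, And.left⟩
      have := ha 1
      have e : sh.α 1 = 0 := h
      rw [e, pow_zero] at this
      omega
  have shift_x : ∀ a, sh.InRange v a → sh.shift v a cx = a 0 * v ^ (ex + η₁) := fun a ha => by
    have e3 : sh.oc 2 = cz := rfl
    have e1 : sh.oc 0 = cx := rfl
    have e2 : sh.oc 1 = cy := rfl
    rw [shift, e1, e2, e3, if_pos rfl, if_neg hzx.symm, add_zero]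
    by_cases h : cx = cy
    · rw [hA2 h.symm] at ha
      rw [if_pos h, ha.2]
      simp [hsh, reading]
    · rw [if_neg h]
      simp [hsh, reading]
  have shift_y : ∀ a, cy ≠ cx → sh.shift v a cy = a 1 * v ^ (ey + η₂) := fun a h => by
    have e3 : sh.oc 2 = cz := rfl
    have e1 : sh.oc 0 = cx := rfl
    have e2 : sh.oc 1 = cy := rfl
    rw [shift, e1, e2, e3, if_neg h, if_neg hzy.symm, if_pos rfl]
    simp [hsh, reading]
  have shift_z : ∀ a, sh.shift v a cz = a 2 * v ^ (ez + 1) := fun a => by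
    have e3 : sh.oc 2 = cz := rfl
    have e1 : sh.oc 0 = cx := rfl
    have e2 : sh.oc 1 = cy := rfl
    rw [shift, e1, e2, e3, if_neg hzx, if_neg hzy, if_pos rfl]
    simp [hsh, reading]
  have small : ex + η₁ ≤ ey → τ cx % v ^ (ex + η₁) < v ^ ey := fun h =>
    (Int.emod_lt_of_pos _ (hpos _)).trans_le (pow_le_pow_right₀ hv h)
  -- The degenerate case, with only one coordinate besides `cz`: the second direction consists of a
  -- single cell that contains the whole residue.
  have Y_zero : cy = cx → Y = 0 := fun h => by
    rcases hy with h' | ⟨-, h1, h2, h3, h4⟩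
    · exact absurd h h'
    · have := hY0
      rw [h2, pow_zero] at this
      omega
  have enabled : ∀ a, sh.Enabled v bad u a ↔ sh.Active bad u ∧
      (∀ t ∈ rx.filter (η₁ ≤ ·.1), a 0 / v ^ (t.1 - η₁) % v = u t.2) ∧
      ∀ t ∈ ry.filter (η₂ ≤ ·.1), a 1 / v ^ (t.1 - η₂) % v = u t.2 := fun a => by
    unfold Enabled
    refine and_congr_right fun _ => ?_
    show (∀ t ∈ _ ++ _, _) ↔ _
    simp only [List.forall_mem_append, List.forall_mem_map]
  have hole : ∀ a, sh.InRange v a → a 0 = τ cx / v ^ (ex + η₁) →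
      (cy ≠ cx → a 1 = τ cy / v ^ (ey + η₂)) →
      ((∀ σ, (sh.surf σ).Hole v u fun c => τ c - sh.shift v a c) ↔
        ((∀ t ∈ rx.filter (·.1 < η₁), X / v ^ t.1 % v = u t.2) ∧
          ∀ t ∈ ry.filter (·.1 < η₂), Y / v ^ t.1 % v = u t.2) ∧
        X + Y - a 2 = -(τ cz / v ^ (ez + 1)) ∧ τ cz / v ^ ez % v = u 2) := by
    intro a ha h0 h1
    have hx : τ cx - sh.shift v a cx = τ cx % v ^ (ex + η₁) := by
      rw [shift_x a ha, h0, Int.emod_def]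
      ring
    have hyy : 0 ≤ τ cy - sh.shift v a cy ∧ τ cy - sh.shift v a cy < v ^ ey * v ^ η₂ ∧
        (τ cy - sh.shift v a cy) / v ^ ey = Y := by
      by_cases h : cy = cx
      · rcases hy with h' | ⟨-, k1, k2, k3, k4⟩
        · exact absurd h h'
        · rw [Y_zero h, h, hx, k2, pow_zero, mul_one]
          have := mod_lt (τ cx) ex η₁
          exact ⟨this.1, small k3, Int.ediv_eq_zero_of_lt this.1 (small k3)⟩
      · have e : τ cy - sh.shift v a cy = τ cy % v ^ (ey + η₂) := by
          rw [shift_y a h, h1 h, Int.emod_def]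
          ring
        rw [e]
        exact ⟨(mod_lt _ _ _).1, (mod_lt _ _ _).2, rfl⟩
    -- This shape has three identical surfaces.
    have all : (∀ σ, (sh.surf σ).Hole v u fun c => τ c - sh.shift v a c) ↔
        (sh.surf 0).Hole v u fun c => τ c - sh.shift v a c := ⟨fun h => h 0, fun h _ => h⟩
    rw [all]
    have hlo : ∀ X Y : ℤ, (sh.surf 0).lo v u X Y = u 2 * v ^ ez - (X + Y) * v ^ (ez + 1) := fun X Y => by
      simp [Surface.lo, Surface.offset, hsh, reading]
    show (0 ≤ τ cx - sh.shift v a cx ∧ τ cx - sh.shift v a cx < v ^ ex * v ^ η₁ ∧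
      0 ≤ τ cy - sh.shift v a cy ∧ τ cy - sh.shift v a cy < v ^ ey * v ^ η₂ ∧
      (sh.surf 0).lo v u ((τ cx - sh.shift v a cx) / v ^ ex) ((τ cy - sh.shift v a cy) / v ^ ey) ≤
        τ cz - sh.shift v a cz ∧ τ cz - sh.shift v a cz <
      (sh.surf 0).up v u ((τ cx - sh.shift v a cx) / v ^ ex) ((τ cy - sh.shift v a cy) / v ^ ey)) ↔ _
    rw [hyy.2.2, hx, ← hX, shift_z, Surface.up, hlo]
    have hmatch : (sh.surf 0).Match v u X Y ↔ ((∀ t ∈ rx.filter (·.1 < η₁), X / v ^ t.1 % v = u t.2) ∧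
          ∀ t ∈ ry.filter (·.1 < η₂), Y / v ^ t.1 % v = u t.2) := Iff.rfl
    rw [← hmatch]
    have hlen : (sh.surf 0).len = ez := rfl
    have hwin := window_iff (z := τ cz) (W := X + Y - a 2) (hpos ez) (hu 2).1 (hu 2).2
    rw [← pow_succ] at hwin
    have m1 := mod_lt (τ cx) ex η₁
    by_cases hm : (sh.surf 0).Match v u X Y
    · rw [if_pos hm, hlen]
      simp only [m1, hyy.1, hyy.2.1, true_and, hm, ← hwin]
      constructor <;> rintro ⟨k1, k2⟩ <;> constructor <;> nlinarith
    · rw [if_neg hm]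
      simp only [hm, false_and, iff_false]
      rintro ⟨-, -, -, -, k1, k2⟩
      omega
  constructor
  · rintro ⟨a, ha, hen, hh⟩
    have h0 : a 0 = τ cx / v ^ (ex + η₁) := by
      have h := hh 0
      have h1 : 0 ≤ τ cx - sh.shift v a cx := h.1
      have h2 : τ cx - sh.shift v a cx < v ^ ex * v ^ η₁ := h.2.1
      rw [shift_x a ha] at h1 h2
      exact (eq_div_of_sub_mem h1 (by rw [pow_add]; rwa [pow_add] at h2)).1
    have h1 : cy ≠ cx → a 1 = τ cy / v ^ (ey + η₂) := fun hne => by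
      have h := hh 0
      have h1 : 0 ≤ τ cy - sh.shift v a cy := h.2.2.1
      have h2 : τ cy - sh.shift v a cy < v ^ ey * v ^ η₂ := h.2.2.2.1
      rw [shift_y a hne] at h1 h2
      exact (eq_div_of_sub_mem h1 (by rw [pow_add]; rwa [pow_add] at h2)).1
    obtain ⟨⟨m1, m2⟩, -, m3⟩ := (hole a ha h0 h1).1 hh
    obtain ⟨e1, e2, e3⟩ := (enabled a).1 hen
    refine ⟨e1, ⟨m1, by rwa [h0] at e2⟩, ⟨m2, ?_⟩, m3⟩
    by_cases h : cy = cx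
    · rcases hy with h' | ⟨-, -, -, -, h'⟩
      · exact absurd h h'
      · simp [h']
    · rwa [h1 h] at e3
  · rintro ⟨hact, ⟨m1, e2⟩, ⟨m2, e3⟩, hz⟩
    -- The last entry is the quotient of the third coordinate, corrected by the descent `X + Y` of
    -- the staircase.
    let a : Fin 3 → ℤ := ![τ cx / v ^ (ex + η₁), if cy = cx then 0 else τ cy / v ^ (ey + η₂),
      X + Y + τ cz / v ^ (ez + 1)]
    have div_lt : ∀ (c : Fin d) (e α : ℕ), g ≤ e + α → 0 ≤ τ c / v ^ e ∧ τ c / v ^ e < v ^ α :=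
      fun c e α h => ⟨Int.ediv_nonneg (hτ c).1 (hpos _).le, Int.ediv_lt_of_lt_mul (hpos _)
        ((hτ c).2.trans_le (by rw [← pow_add]; exact pow_le_pow_right₀ hv (by omega)))⟩
    have ha : sh.InRange v a := by
      intro k
      fin_cases k
      · exact div_lt cx _ _ hgx
      · show 0 ≤ (if cy = cx then 0 else τ cy / v ^ (ey + η₂)) ∧
          (if cy = cx then 0 else τ cy / v ^ (ey + η₂)) < v ^ α₂
        split_ifs
        · exact ⟨le_rfl, hpos _⟩
        · exact div_lt cy _ _ hgy
      · show 0 ≤ X + Y + τ cz / v ^ (ez + 1) ∧ X + Y + τ cz / v ^ (ez + 1) < v ^ β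
        obtain ⟨b, rfl⟩ : ∃ b, β = b + 2 := ⟨β - 2, by omega⟩
        have z1 := div_lt cz (ez + 1) b (by omega)
        have x1 : X < v ^ b := hX0.2.trans_le (pow_le_pow_right₀ hv (by omega))
        have y1 : Y < v ^ b := hY0.2.trans_le (pow_le_pow_right₀ hv (by omega))
        refine ⟨by omega, ?_⟩
        exact add_add_lt_pow hv x1 y1 z1.2
    have h0 : a 0 = τ cx / v ^ (ex + η₁) := rfl
    have h1 : cy ≠ cx → a 1 = τ cy / v ^ (ey + η₂) := fun h => if_neg h
    refine ⟨a, ha, (enabled a).2 ⟨hact, e2, ?_⟩, (hole a ha h0 h1).2 ⟨⟨m1, m2⟩, ?_, hz⟩⟩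
    · by_cases h : cy = cx
      · rcases hy with h' | ⟨-, -, -, -, h'⟩
        · exact absurd h h'
        · simp [h']
      · rwa [h1 h]
    · show X + Y - (X + Y + τ cz / v ^ (ez + 1)) = _
      ring

/-- Reads digits `rx` of the number `τ c / v ^ e`. -/
def readingOne (c : Fin d) (e α g : ℕ) (rx : List (ℕ × Fin 3)) (act : Activation) : Shape d where
  surf _ := ⟨c, c, c, e, g, 0, 0, 0, g, [], 0, 0, [], []⟩
  α := ![α, 0, 0]
  om := ![e, 0, 0]
  oc := ![c, c, c]
  conA := rx.map fun t => (0, t.1, t.2)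
  act := act

theorem readingOne_valid {c : Fin d} {e α g : ℕ} {rx : List (ℕ × Fin 3)} {act : Activation}
    {pp hh : ℕ} (hα : α ≤ pp) : (readingOne c e α g rx act).Valid pp hh :=
  ⟨fun _ => Or.inl ⟨rfl, rfl⟩, hα, fun _ => Nat.zero_le _⟩

/-- All digits are guessed by points of `P`: the only cell has a hole for residues in `[0, v ^ e)`,
which forces `a 0` to be the quotient. -/
theorem readingOne_violated_iff (hv : 1 ≤ v) {c : Fin d} {e α g : ℕ} {rx : List (ℕ × Fin 3)}
    {act : Activation} (hτ : ∀ c, 0 ≤ τ c ∧ τ c < v ^ g) (he : e ≤ g) (hg : g ≤ e + α) :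
    (readingOne c e α g rx act).Violated v bad u τ ↔ (readingOne c e α g rx act).Active bad u ∧
      ∀ t ∈ rx, τ c / v ^ e / v ^ t.1 % v = u t.2 := by
  have hpos : ∀ e : ℕ, 0 < v ^ e := fun e => by positivity
  set sh := readingOne c e α g rx act with hsh
  have hshift : ∀ a, sh.InRange v a → sh.shift v a c = a 0 * v ^ e := fun a ha => by
    have h1 := ha 1
    have h2 := ha 2
    have e1 : sh.α 1 = 0 := rfl
    have e2 : sh.α 2 = 0 := rfl
    rw [e1, pow_zero] at h1
    rw [e2, pow_zero] at h2
    have h1' : a 1 = 0 := by omega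
    have h2' : a 2 = 0 := by omega
    simp [shift, hsh, readingOne, h1', h2']
  have enabled : ∀ a, sh.Enabled v bad u a ↔ sh.Active bad u ∧
      ∀ t ∈ rx, a 0 / v ^ t.1 % v = u t.2 := fun a => by
    unfold Enabled
    refine and_congr_right fun _ => ?_
    show (∀ t ∈ List.map _ _, _) ↔ _
    simp only [List.forall_mem_map]
  constructor
  · rintro ⟨a, ha, hen, hh⟩
    have h1 : 0 ≤ τ c - sh.shift v a c := (hh 0).1
    have h2 : τ c - sh.shift v a c < v ^ e * v ^ 0 := (hh 0).2.1
    rw [hshift a ha] at h1 h2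
    rw [pow_zero, mul_one] at h2
    have h0 := (eq_div_of_sub_mem h1 h2).1
    rw [← h0]
    exact (enabled a).1 hen
  · rintro ⟨hact, hr⟩
    let a : Fin 3 → ℤ := ![τ c / v ^ e, 0, 0]
    have ha : sh.InRange v a := by
      intro k
      fin_cases k
      · show 0 ≤ τ c / v ^ e ∧ τ c / v ^ e < v ^ α
        exact ⟨Int.ediv_nonneg (hτ c).1 (hpos _).le, Int.ediv_lt_of_lt_mul (hpos _)
          ((hτ c).2.trans_le (by rw [← pow_add]; exact pow_le_pow_right₀ hv (by omega)))⟩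
      · exact ⟨le_rfl, hpos _⟩
      · exact ⟨le_rfl, hpos _⟩
    refine ⟨a, ha, (enabled a).2 ⟨hact, hr⟩, fun σ => ?_⟩
    have e0 : τ c - sh.shift v a c = τ c % v ^ e := by
      rw [hshift a ha, Int.emod_def, mul_comm]
      rfl
    have m1 := Int.emod_nonneg (τ c) (hpos e).ne'
    have m2 := Int.emod_lt_of_pos (τ c) (hpos e)
    have m3 : τ c % v ^ e < v ^ g := m2.trans_le (pow_le_pow_right₀ hv he)
    show 0 ≤ τ c - sh.shift v a c ∧ τ c - sh.shift v a c < v ^ e * v ^ 0 ∧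
      0 ≤ τ c - sh.shift v a c ∧ τ c - sh.shift v a c < v ^ g * v ^ 0 ∧
      (sh.surf σ).lo v u ((τ c - sh.shift v a c) / v ^ e) ((τ c - sh.shift v a c) / v ^ g) ≤
        τ c - sh.shift v a c ∧ τ c - sh.shift v a c <
      (sh.surf σ).up v u ((τ c - sh.shift v a c) / v ^ e) ((τ c - sh.shift v a c) / v ^ g)
    rw [e0, Int.ediv_eq_zero_of_lt m1 m2, Int.ediv_eq_zero_of_lt m1 m3]
    have hlo : (sh.surf σ).lo v u 0 0 = 0 := by
      unfold Surface.lo Surface.offset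
      simp [hsh, readingOne]
    have hup : (sh.surf σ).up v u 0 0 = v ^ g := by
      rw [Surface.up, hlo]
      simp [Surface.Match, hsh, readingOne]
    rw [hlo, hup]
    simp only [pow_zero, mul_one]
    exact ⟨m1, m2, m1, m3, m1, m3⟩

end Shape

end
end FineGrained

/-! ### Cliques as digits of a translation -/

namespace FineGrained
noncomputable section

theorem exists_digits_eq {v : ℤ} (hv : 1 ≤ v) (g : ℕ) (f : ℕ → ℤ) (hf : ∀ t, 0 ≤ f t ∧ f t < v) :
    ∃ τ : ℤ, (0 ≤ τ ∧ τ < v ^ g) ∧ ∀ t < g, τ / v ^ t % v = f t := by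
  induction g with
  | zero => exact ⟨0, by simp, by simp⟩
  | succ g ih =>
    obtain ⟨τ, ⟨h0, h1⟩, h2⟩ := ih
    refine ⟨f g * v ^ g + τ, ⟨add_nonneg (mul_nonneg (hf g).1 (by positivity)) h0, ?_⟩,
      fun t ht => ?_⟩
    · rw [pow_succ']
      exact Layout.index_lt (hf g).2 h0 h1
    · rcases Nat.lt_succ_iff_lt_or_eq.1 ht with h | rfl
      · rw [digit_low hv h, h2 t h]
      · rw [Layout.index_div h0 h1, Int.emod_eq_of_lt (hf t).1 (hf t).2]

theorem digit_add {v : ℤ} (hv : 1 ≤ v) (τ : ℤ) {s t : ℕ} (h : s ≤ t) :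
    τ / v ^ s / v ^ (t - s) = τ / v ^ t := by
  rw [Int.ediv_ediv_of_nonneg (by positivity), ← pow_add, Nat.add_sub_cancel' h]

/-- The last digit of a number to the base `n`. -/
def lastDigit (n : ℕ) (hn : 0 < n) (z : ℤ) : Fin n :=
  ⟨(z % n).toNat, by
    have := Int.emod_lt_of_pos z (by exact_mod_cast hn : (0 : ℤ) < n)
    have := Int.emod_nonneg z (by exact_mod_cast hn.ne' : (n : ℤ) ≠ 0)
    omega⟩

theorem coe_lastDigit {n : ℕ} (hn : 0 < n) (z : ℤ) : ((lastDigit n hn z : ℕ) : ℤ) = z % n :=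
  Int.toNat_of_nonneg (Int.emod_nonneg z (by exact_mod_cast hn.ne'))

theorem exists_coordinates {n : ℕ} (hn : 0 < n) {d g : ℕ} (w : Fin d → ℕ → Fin n) :
    ∃ τ : Fin d → ℤ, (∀ c, 0 ≤ τ c ∧ τ c < (n : ℤ) ^ g) ∧
      ∀ c, ∀ t < g, lastDigit n hn (τ c / (n : ℤ) ^ t) = w c t := by
  have hnZ : (1 : ℤ) ≤ n := by exact_mod_cast hn
  choose τ h1 h2 using fun c => exists_digits_eq hnZ g (fun t => ((w c t : ℕ) : ℤ))
    fun t => ⟨by positivity, by exact_mod_cast (w c t).2⟩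
  refine ⟨τ, h1, fun c t ht => Fin.ext ?_⟩
  have := h2 c t ht
  rw [← coe_lastDigit hn] at this
  exact_mod_cast this

/-- The gadgets that forbid non-adjacent vertices encoded by two digits of the coordinates. -/
def pairShape {d : ℕ} (g M : ℕ) (A B : Fin d × Fin g) : Shape d :=
  if A.1 = B.1 then .readingOne A.1 A.2 g g [(0, 0), ((B.2 : ℕ) - A.2, 2)] .bad
  else .reading A.1 A.1 B.1 A.2 M (g - M) (A.2 + M + g) 0 0 B.2 (g + 1) [(0, 0)] [] .bad

def pairShapes (d g M : ℕ) : List (Shape d) :=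
  (Finset.univ.filter fun p : (Fin d × Fin g) × (Fin d × Fin g) =>
    p.1.1 ≠ p.2.1 ∨ p.1.2 < p.2.2).toList.map fun p => pairShape g M p.1 p.2

theorem forall_pairShapes {d g M : ℕ} {P : Shape d → Prop} : (∀ sh ∈ pairShapes d g M, P sh) ↔
    ∀ A B : Fin d × Fin g, A.1 ≠ B.1 ∨ A.2 < B.2 → P (pairShape g M A B) := by
  simp only [pairShapes, List.mem_map, Finset.mem_toList, Finset.mem_filter, Finset.mem_univ,
    true_and]
  constructor
  · exact fun H A B h => H _ ⟨(A, B), h, rfl⟩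
  · rintro H _ ⟨p, h, rfl⟩
    exact H _ _ h

/-- Reading one digit in each of two coordinates takes `g - M` and `g + 1` guessed digits in `P`,
and `M` in `Q`. The sum is `2 * g + 1` for every `M`, so the product of the sizes does not depend on
how they are balanced. -/
theorem pairShapes_valid {d g M : ℕ} (hM : M + 1 ≤ g) :
    ∀ sh ∈ pairShapes d g M, sh.Valid (2 * g + 1 - M) M := by
  refine forall_pairShapes.2 fun A B _ => ?_
  unfold pairShape
  split_ifs
  · exact Shape.readingOne_valid (by omega)
  · exact Shape.reading_valid (by omega) (by omega)

theorem pairShape_violated_iff {d g M : ℕ} (hM : M + 1 ≤ g) {v : ℤ} (hv : 1 ≤ v)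
    {bad : (Fin 3 → ℤ) → Prop} {u : Fin 3 → ℤ} (hu : ∀ r, 0 ≤ u r ∧ u r < v) {τ : Fin d → ℤ}
    (hτ : ∀ c, 0 ≤ τ c ∧ τ c < v ^ g) {A B : Fin d × Fin g} (h : A.1 ≠ B.1 ∨ A.2 < B.2) :
    (pairShape g M A B).Violated v bad u τ ↔ bad u ∧
      τ A.1 / v ^ (A.2 : ℕ) % v = u 0 ∧ τ B.1 / v ^ (B.2 : ℕ) % v = u 2 := by
  unfold pairShape
  split_ifs with hc
  · have hlt : A.2 < B.2 := h.resolve_left (not_not.2 hc)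
    rw [Shape.readingOne_violated_iff hv hτ A.2.2.le (by omega)]
    refine and_congr Iff.rfl ?_
    simp only [List.mem_cons, List.not_mem_nil, or_false, forall_eq_or_imp, forall_eq, pow_zero,
      Int.ediv_one, digit_add hv _ (show (A.2 : ℕ) ≤ B.2 from hlt.le), hc]
  · rw [Shape.reading_violated_iff hv hu hτ (Ne.symm hc) (Ne.symm hc)
      (Or.inr ⟨rfl, rfl, rfl, by omega, rfl⟩) (by omega) (by omega) (by omega) (by omega)
      (by omega)]
    refine and_congr Iff.rfl ?_
    simp

/-- Digits at different positions have to be adjacent and are therefore different, so the `d * g`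
positions name a clique of that size. Conversely, the members of a clique are distributed over the
positions arbitrarily. -/
theorem clique_encodedBy {d g M : ℕ} (hM : M + 1 ≤ g) :
    (cliqueVertexProblem (d * g)).EncodedBy (pairShapes d g M) g := by
  intro x
  change (∃ τ : Fin d → ℤ, (∀ c, 0 ≤ τ c ∧ τ c < (x.n : ℤ) ^ g) ∧ ∀ sh ∈ pairShapes d g M,
    ∀ u : Fin 3 → ℤ, (∀ r, 0 ≤ u r ∧ u r < (x.n : ℤ)) →
      ¬ sh.Violated x.n ((cliqueVertexProblem (d * g)).bad x.input) u τ) ↔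
    ∃ S : Finset (Fin x.n), x.G.IsNClique (d * g) S
  have hv : (1 : ℤ) ≤ x.n := by exact_mod_cast x.pos
  have key : ∀ τ : Fin d → ℤ, (∀ c, 0 ≤ τ c ∧ τ c < (x.n : ℤ) ^ g) →
      ((∀ sh ∈ pairShapes d g M, ∀ u : Fin 3 → ℤ, (∀ r, 0 ≤ u r ∧ u r < (x.n : ℤ)) →
        ¬ sh.Violated x.n ((cliqueVertexProblem (d * g)).bad x.input) u τ) ↔
      ∀ A B : Fin d × Fin g, A ≠ B → x.G.Adj (lastDigit x.n x.pos (τ A.1 / (x.n : ℤ) ^ (A.2 : ℕ)))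
        (lastDigit x.n x.pos (τ B.1 / (x.n : ℤ) ^ (B.2 : ℕ)))) := by
    intro τ hτ
    have one : ∀ A B : Fin d × Fin g, A.1 ≠ B.1 ∨ A.2 < B.2 → ((∀ u : Fin 3 → ℤ,
        (∀ r, 0 ≤ u r ∧ u r < (x.n : ℤ)) → ¬ (pairShape g M A B).Violated x.n
          ((cliqueVertexProblem (d * g)).bad x.input) u τ) ↔
        x.G.Adj (lastDigit x.n x.pos (τ A.1 / (x.n : ℤ) ^ (A.2 : ℕ)))
          (lastDigit x.n x.pos (τ B.1 / (x.n : ℤ) ^ (B.2 : ℕ)))) := by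
      intro A B h
      constructor
      · intro H
        by_contra hadj
        have hr : ∀ i : Fin x.n, 0 ≤ ((i : ℕ) : ℤ) ∧ ((i : ℕ) : ℤ) < x.n := fun i =>
          ⟨by positivity, by exact_mod_cast i.2⟩
        have hu : ∀ r, 0 ≤ (![((lastDigit x.n x.pos (τ A.1 / (x.n : ℤ) ^ (A.2 : ℕ)) : ℕ) : ℤ), 0,
            ((lastDigit x.n x.pos (τ B.1 / (x.n : ℤ) ^ (B.2 : ℕ)) : ℕ) : ℤ)] : Fin 3 → ℤ) r ∧
            (![((lastDigit x.n x.pos (τ A.1 / (x.n : ℤ) ^ (A.2 : ℕ)) : ℕ) : ℤ), 0,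
            ((lastDigit x.n x.pos (τ B.1 / (x.n : ℤ) ^ (B.2 : ℕ)) : ℕ) : ℤ)] : Fin 3 → ℤ) r <
              x.n := by
          intro r
          fin_cases r
          exacts [hr _, ⟨le_rfl, by show (0 : ℤ) < x.n; omega⟩, hr _]
        refine H _ hu ((pairShape_violated_iff hM hv hu hτ h).2
          ⟨(clique_bad_iff x rfl rfl).2 hadj, ?_, ?_⟩)
        · exact (coe_lastDigit x.pos _).symm
        · exact (coe_lastDigit x.pos _).symm
      · intro hadj u hu hviol
        obtain ⟨hb, h0, h2⟩ := (pairShape_violated_iff hM hv hu hτ h).1 hviol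
        rw [← coe_lastDigit x.pos] at h0 h2
        exact (clique_bad_iff x h0.symm h2.symm).1 hb hadj
    rw [forall_pairShapes]
    constructor
    · intro H A B hAB
      by_cases h : A.1 ≠ B.1 ∨ A.2 < B.2
      · exact (one A B h).1 (H A B h)
      · push Not at h
        have h' : B.2 < A.2 := lt_of_le_of_ne h.2 fun e => hAB (Prod.ext h.1 e.symm)
        exact ((one B A (Or.inr h')).1 (H B A (Or.inr h'))).symm
    · intro H A B h
      refine (one A B h).2 (H A B ?_)
      rintro rfl
      rcases h with h | h
      · exact h rfl
      · exact h.ne rfl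
  constructor
  · rintro ⟨τ, hτ, H⟩
    have H' := (key τ hτ).1 H
    let f : Fin d × Fin g → Fin x.n := fun A => lastDigit x.n x.pos (τ A.1 / (x.n : ℤ) ^ (A.2 : ℕ))
    have hf : Function.Injective f := fun A B e => by
      by_contra hne
      exact (H' A B hne).ne e
    refine ⟨Finset.univ.map ⟨f, hf⟩, ?_, by simp⟩
    intro a ha b hb hab
    simp only [Finset.coe_map, Finset.coe_univ, Set.image_univ, Set.mem_range,
      Function.Embedding.coeFn_mk] at ha hb
    obtain ⟨A, rfl⟩ := ha
    obtain ⟨B, rfl⟩ := hb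
    exact H' A B fun e => hab (by rw [e])
  · rintro ⟨S, hS⟩
    obtain ⟨e⟩ : Nonempty (Fin d × Fin g ≃ S) := by
      rw [← Fintype.card_eq]
      simp [hS.card_eq]
    obtain ⟨τ, hτ, hw⟩ := exists_coordinates x.pos (g := g) fun (c : Fin d) t =>
      if ht : t < g then ((e (c, ⟨t, ht⟩) : S) : Fin x.n) else ⟨0, x.pos⟩
    refine ⟨τ, hτ, (key τ hτ).2 fun A B hAB => ?_⟩
    rw [hw A.1 _ A.2.2, hw B.1 _ B.2.2, dif_pos A.2.2, dif_pos B.2.2]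
    refine hS.isClique (e A).2 (e B).2 fun h => hAB ?_
    exact e.injective (Subtype.ext h)

end
end FineGrained

/-! ### The exponent obtained from cliques -/

namespace FineGrained
noncomputable section

theorem UndirectedHuTSolvable.mono {μ : Arithmetic} {𝒞 : Set Prog} {d : ℕ} {hd : 0 < d}
    {lam a b e e' : ℝ} (h : UndirectedHuTSolvable μ 𝒞 d hd lam a b e) (he : e ≤ e') :
    UndirectedHuTSolvable μ 𝒞 d hd lam a b e' := by
  obtain ⟨p, hp, c, C, hrun⟩ := h
  refine ⟨p, hp, c, |C|, fun x => ?_⟩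
  obtain ⟨t, ht, ht'⟩ := hrun x
  refine ⟨t, ht, fun hx => (ht' hx).trans ?_⟩
  have h1 : (1 : ℝ) ≤ (x.n : ℝ) * x.m := by
    exact_mod_cast Nat.mul_pos x.n_pos x.m_pos
  exact mul_le_mul (le_abs_self C) (Real.rpow_le_rpow_of_exponent_le h1 he) (by positivity)
    (abs_nonneg C)

theorem exists_floor_exponent {lam : ℝ} (hlam0 : 0 < lam) {p r : ℕ} (h : (r : ℝ) + 1 ≤ lam * p) :
    ∃ q : ℕ, r ≤ q ∧ (q : ℝ) + 1 ≤ lam * p ∧ lam * p ≤ q + 2 := by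
  have h0 : 0 ≤ lam * p := by positivity
  have h1 : r + 1 ≤ ⌊lam * p⌋₊ := Nat.le_floor (by exact_mod_cast h)
  have h2 := Nat.floor_le h0
  have h3 := Nat.lt_floor_add_one (lam * p)
  obtain ⟨q, hq⟩ : ∃ q, ⌊lam * p⌋₊ = q + 1 := ⟨⌊lam * p⌋₊ - 1, by omega⟩
  rw [hq] at h1 h2 h3
  push_cast at h2 h3
  exact ⟨q, by omega, h2, by linarith⟩

theorem exists_nat_ge_mul {c₁ c₂ c₃ x₁ x₂ x₃ : ℝ} (h₁ : 0 < c₁) (h₂ : 0 < c₂) (h₃ : 0 < c₃) :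
    ∃ p : ℕ, x₁ ≤ c₁ * p ∧ x₂ ≤ c₂ * p ∧ x₃ ≤ c₃ * p := by
  obtain ⟨p, hp⟩ := exists_nat_ge (max (x₁ / c₁) (max (x₂ / c₂) (x₃ / c₃)))
  simp only [max_le_iff, div_le_iff₀ h₁, div_le_iff₀ h₂, div_le_iff₀ h₃] at hp
  exact ⟨p, by linarith, by linarith, by linarith⟩

/-- A fast algorithm for the Hausdorff distance under translation yields a fast algorithm for
`k`-clique, for some `k = d * g`. -/
theorem exists_clique_solvable {μ : Arithmetic} {𝒞 : Set Prog} (hclosed : BudgetClosed μ 𝒞)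
    {d : ℕ} (hd : 2 ≤ d) (hd' : 0 < d) {lam a b y ε : ℝ} (hlam0 : 0 < lam) (hlam1 : lam ≤ 1)
    (ha0 : 0 < a) (ha1 : a ≤ 1) (hab : a < b) (hε : 0 < ε) (hy : 1 < (1 + lam) * y)
    (h : UndirectedHuTSolvable μ 𝒞 d hd' lam a b (y - ε)) :
    ∃ g : ℕ, 3 ≤ d * g ∧ SolvableIn μ 𝒞 (cliqueProblem (d * g)) Set.univ
      fun x : GraphInst => (x.n : ℝ) ^ (2 * y * g - 1) := by
  have hy0 : 0 < y := by
    by_contra hc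
    nlinarith
  set e := max (y - ε) 0 with he
  have hey : e < y := max_lt (by linarith) hy0
  -- The first condition makes room for `M`. The second one makes writing down the instances cheap
  -- enough, which is where `hy` is needed. By the third one the gain from `e < y` outweighs all
  -- rounding.
  obtain ⟨p, hp₁, hp₂, hp₃⟩ := exists_nat_ge_mul (x₁ := 40) (x₂ := 5 + 15 * y) (x₃ := 6 + 15 * y)
    hlam0 (by linarith : 0 < (1 + lam) * y - 1) (by nlinarith : 0 < (1 + lam) * (y - e))
  obtain ⟨q, hq₀, hq, hq'⟩ := exists_floor_exponent hlam0 (r := 30) (p := p) (by norm_num; linarith)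
  have hqp : q + 1 ≤ p := by
    have : (q : ℝ) + 1 ≤ p := by nlinarith [(by positivity : (0 : ℝ) ≤ p)]
    exact_mod_cast this
  obtain ⟨M, rfl⟩ : ∃ M, q = M + 8 := ⟨q - 8, by omega⟩
  -- The largest value with `(2 * g + 1 - M) + 3 ≤ p`. As `M` is about `lam * p`, `2 * g` is `p * (1
  -- + lam)` up to a constant.
  set g := (p + M - 4) / 2 with hg
  have hg2 : p + M ≤ 2 * g + 5 := by omega
  have hgR : p * (1 + lam) - 15 ≤ 2 * (g : ℝ) := by
    have : (p : ℝ) + M ≤ 2 * g + 5 := by exact_mod_cast hg2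
    push_cast at hq'
    linarith
  have hyg : y * (p * (1 + lam) - 15) ≤ 2 * y * g := by nlinarith
  refine ⟨g, by nlinarith [(by omega : 3 ≤ g)], ?_⟩
  refine solvable_of_encoded hclosed (cliqueVertexProblem (d * g)) hd' (l := pairShapes d g M)
    (pp := 2 * g + 1 - M) (hh := M) (g := g) (p := p) (q := M + 8) false
    (pairShapes_valid (by omega)) (clique_encodedBy (by omega)) ?_ hlam0 hlam1 ha0 ha1 hab
    (le_max_right _ _) hq hq' ?_ ?_ (h.mono (le_max_left _ _))
  · simp only [Bool.false_eq_true, if_false]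
    omega
  · linarith
  · linarith

end
end FineGrained

/-! ### Impossibility of sublinear algorithms -/

namespace FineGrained
noncomputable section

theorem Exec.mono {W : ℕ} {A A' : Set ℝ} (hA : A ⊆ A') {p : Prog} {σ σ' : Memory} {t : ℕ}
    (h : Exec W A p σ t σ') : Exec W A' p σ t σ' := by
  induction h with
  | skip σ => exact .skip σ
  | instr a σ h =>
    refine .instr a σ ?_
    cases a with
    | cast i j => exact hA h
    | rop o i j k => exact hA h
    | _ => exact h
  | seq _ _ ih₁ ih₂ => exact .seq ih₁ ih₂
  | ite_true hc _ ih => exact .ite_true hc ih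
  | ite_false hc _ ih => exact .ite_false hc ih
  | while_false hc => exact .while_false hc
  | while_true hc _ _ ih₁ ih₂ => exact .while_true hc ih₁ ih₂

theorem Exec.deterministic {W : ℕ} {A : Set ℝ} {p : Prog} {σ σ₁ σ₂ : Memory} {t₁ t₂ : ℕ}
    (h₁ : Exec W A p σ t₁ σ₁) (h₂ : Exec W A p σ t₂ σ₂) : σ₁ = σ₂ := by
  induction h₁ generalizing t₂ σ₂ with
  | skip σ => cases h₂; rfl
  | instr a σ h => cases h₂; rfl
  | seq _ _ ih₁ ih₂ =>
    cases h₂ with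
    | seq k₁ k₂ => obtain rfl := ih₁ k₁; exact ih₂ k₂
  | ite_true hc _ ih =>
    cases h₂ with
    | ite_true _ k => exact ih k
    | ite_false hc' _ => exact absurd hc hc'
  | ite_false hc _ ih =>
    cases h₂ with
    | ite_true hc' _ => exact absurd hc' hc
    | ite_false _ k => exact ih k
  | while_false hc =>
    cases h₂ with
    | while_false _ => rfl
    | while_true hc' _ _ => exact absurd hc' hc
  | while_true hc _ _ ih₁ ih₂ =>
    cases h₂ with
    | while_false hc' => exact absurd hc hc'
    | while_true _ k₁ k₂ => obtain rfl := ih₁ k₁; exact ih₂ k₂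

/-- Two memories agree on everything but the real memory, and there on `S`. -/
structure AgreeOn (S : Set ℕ) (σ τ : Memory) : Prop where
  wreg : τ.wreg = σ.wreg
  rreg : τ.rreg = σ.rreg
  wmem : τ.wmem = σ.wmem
  rmem : ∀ a ∈ S, τ.rmem a = σ.rmem a

theorem AgreeOn.holds {S : Set ℕ} {σ τ : Memory} (h : AgreeOn S σ τ) (c : Test) :
    c.Holds τ ↔ c.Holds σ := by
  cases c <;> simp only [Test.Holds, h.wreg, h.rreg]

/-- A computation of `t` steps depends on at most `t` cells of the real memory. -/
theorem Exec.exists_cells {W : ℕ} {A : Set ℝ} {p : Prog} {σ σ' : Memory} {t : ℕ}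
    (h : Exec W A p σ t σ') : ∃ S : Finset ℕ, S.card ≤ t ∧ ∀ (S' : Set ℕ) (τ : Memory), ↑S ⊆ S' →
      AgreeOn S' σ τ → ∃ τ', Exec W A p τ t τ' ∧ AgreeOn S' σ' τ' := by
  induction h with
  | skip σ => exact ⟨∅, by simp, fun S' τ _ hτ => ⟨τ, .skip τ, hτ⟩⟩
  | instr a σ h =>
    cases a with
    | rload i j =>
      refine ⟨{(σ.wreg j).toNat}, by simp, fun S' τ hS hτ => ⟨_, .instr _ τ trivial, ?_⟩⟩
      refine ⟨hτ.wreg, ?_, hτ.wmem, hτ.rmem⟩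
      simp only [Instr.next, hτ.wreg, hτ.rreg]
      rw [hτ.rmem _ (hS (by simp))]
    | rstore i j =>
      refine ⟨∅, by simp, fun S' τ hS hτ => ⟨_, .instr _ τ trivial, ?_⟩⟩
      refine ⟨hτ.wreg, hτ.rreg, hτ.wmem, fun a ha => ?_⟩
      simp only [Instr.next, hτ.wreg, hτ.rreg]
      by_cases e : a = (σ.wreg i).toNat
      · rw [e, Function.update_self, Function.update_self]
      · rw [Function.update_of_ne e, Function.update_of_ne e, hτ.rmem a ha]
    | _ =>
      refine ⟨∅, by simp, fun S' τ hS hτ => ⟨_, .instr _ τ ?_, ?_⟩⟩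
      · first | exact trivial | simpa only [Instr.Ok, hτ.wreg, hτ.rreg] using h
      · constructor <;> simp only [Instr.next, hτ.wreg, hτ.rreg, hτ.wmem]
        exact hτ.rmem
  | seq _ _ ih₁ ih₂ =>
    obtain ⟨S₁, c₁, k₁⟩ := ih₁
    obtain ⟨S₂, c₂, k₂⟩ := ih₂
    refine ⟨S₁ ∪ S₂, (Finset.card_union_le _ _).trans (by omega), fun S' τ hS hτ => ?_⟩
    rw [Finset.coe_union, Set.union_subset_iff] at hS
    obtain ⟨τ₁, e₁, a₁⟩ := k₁ S' τ hS.1 hτ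
    obtain ⟨τ₂, e₂, a₂⟩ := k₂ S' τ₁ hS.2 a₁
    exact ⟨τ₂, .seq e₁ e₂, a₂⟩
  | ite_true hc _ ih =>
    obtain ⟨S, c, k⟩ := ih
    refine ⟨S, by omega, fun S' τ hS hτ => ?_⟩
    obtain ⟨τ', e, a⟩ := k S' τ hS hτ
    exact ⟨τ', .ite_true ((hτ.holds _).2 hc) e, a⟩
  | ite_false hc _ ih =>
    obtain ⟨S, c, k⟩ := ih
    refine ⟨S, by omega, fun S' τ hS hτ => ?_⟩
    obtain ⟨τ', e, a⟩ := k S' τ hS hτ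
    exact ⟨τ', .ite_false (fun h => hc ((hτ.holds _).1 h)) e, a⟩
  | while_false hc =>
    exact ⟨∅, by simp, fun S' τ _ hτ => ⟨τ, .while_false fun h => hc ((hτ.holds _).1 h), hτ⟩⟩
  | while_true hc _ _ ih₁ ih₂ =>
    obtain ⟨S₁, c₁, k₁⟩ := ih₁
    obtain ⟨S₂, c₂, k₂⟩ := ih₂
    refine ⟨S₁ ∪ S₂, (Finset.card_union_le _ _).trans (by omega), fun S' τ hS hτ => ?_⟩
    rw [Finset.coe_union, Set.union_subset_iff] at hS
    obtain ⟨τ₁, e₁, a₁⟩ := k₁ S' τ hS.1 hτ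
    obtain ⟨τ₂, e₂, a₂⟩ := k₂ S' τ₁ hS.2 a₁
    exact ⟨τ₂, .while_true ((hτ.holds _).2 hc) e₁ e₂, a₂⟩

/-- An algorithm has to look at all points of the first set. -/
theorem le_time {μ : Arithmetic} {c d : ℕ} {hd : 0 < d} {prog : Prog}
    (hsol : ∀ y : HuTInst d, ∃ t, Decides μ c (undirectedHuT d hd) prog y t) {n m : ℕ} (hn : 2 ≤ n)
    (hm : 0 < m) {t : ℕ} (ht : Decides μ c (undirectedHuT d hd) prog
      (ofInt hd n m (by omega) hm (fun _ _ => 0) (fun _ _ => 0) 0 le_rfl) t) : n ≤ t := by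
  by_contra hlt
  push Not at hlt
  set x := ofInt hd n m (by omega) hm (fun _ _ => 0) (fun _ _ => 0) 0 le_rfl with hx
  obtain ⟨σ, hex, hyes, -⟩ := ht
  -- The sets of representable reals may differ for the two inputs to be compared; both runs are
  -- viewed in the unrestricted arithmetic.
  obtain ⟨S, hS, hcells⟩ := (hex.mono (Set.subset_univ _)).exists_cells
  obtain ⟨i, hi, hiS⟩ : ∃ i < n, 1 + i * d ∉ S := by
    by_contra hall
    push Not at hall
    have h1 : ((Finset.range n).image fun i => 1 + i * d) ⊆ S := by
      intro k hk
      obtain ⟨i, hi, rfl⟩ := Finset.mem_image.1 hk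
      exact hall i (Finset.mem_range.1 hi)
    have h2 := Finset.card_le_card h1
    rw [Finset.card_image_of_injective, Finset.card_range] at h2
    · omega
    · intro i j hij
      exact Nat.eq_of_mul_eq_mul_right hd (by simpa using hij)
  -- Moving one of at least two points by a unit turns the answer into NO, and alters only the cell
  -- `1 + i * d`, which the short run does not read.
  let p : ℤ → Fin d → ℤ := fun k c => if k = i ∧ (c : ℕ) = 0 then 1 else 0
  set y := ofInt hd n m (by omega) hm p (fun _ _ => 0) 0 le_rfl with hy
  have hxyes : (undirectedHuT d hd).yes x := (ofInt_yes hd _ hm le_rfl).2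
    ⟨0, fun i _ => ⟨0, hm, fun c => by simp⟩, fun j _ => ⟨0, by omega, fun c => by simp⟩⟩
  have hyno : ¬ (undirectedHuT d hd).yes y := by
    rw [hy, ofInt_yes hd _ hm le_rfl]
    rintro ⟨τ, h, -⟩
    obtain ⟨k, hk, hki⟩ : ∃ k : ℕ, k < n ∧ k ≠ i := by
      by_cases h0 : i = 0
      · exact ⟨1, by omega, by omega⟩
      · exact ⟨0, by omega, by omega⟩
    obtain ⟨j, -, h1⟩ := h i hi
    obtain ⟨j', -, h2⟩ := h k hk
    have h1 := h1 ⟨0, hd⟩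
    have h2 := h2 ⟨0, hd⟩
    simp only [p, Nat.cast_inj, hki, true_and, false_and, if_true, if_false] at h1 h2
    rw [abs_le] at h1 h2
    omega
  have hagree : AgreeOn {a | a ≠ 1 + i * d} x.input.init y.input.init := by
    have hw : y.input.words = x.input.words := rfl
    have hl : y.input.reals.length = x.input.reals.length := by
      rw [hx, hy, ofInt_reals, ofInt_reals, List.length_map, List.length_map]
    refine ⟨?_, rfl, ?_, fun a ha => ?_⟩
    · simp only [Input.init, hw, hl]
    · simp only [Input.init, hw]
    · show y.input.reals.getD a 0 = x.input.reals.getD a 0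
      rw [hx, hy, ofInt_reals, ofInt_reals]
      simp only [List.getD_eq_getElem?_getD, List.getElem?_map]
      by_cases hlen : a < (n + m) * d + 1
      · rw [List.getElem?_range hlen]
        simp only [Option.map_some, Option.getD_some]
        congr 1
        have hdZ : (0 : ℤ) < d := by exact_mod_cast hd
        have hmod := Int.emod_lt_of_pos ((a : ℤ) - 1) hdZ
        have hmod' := Int.emod_nonneg ((a : ℤ) - 1) hdZ.ne'
        have hlt' : (((a : ℤ) - 1) % d).toNat < d := by omega
        have hget : ∀ f : Fin d → ℤ, ((List.finRange d).map f).getD (((a : ℤ) - 1) % d).toNat 0 =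
            f ⟨(((a : ℤ) - 1) % d).toNat, hlt'⟩ := fun f => by
          rw [List.getD_eq_getElem _ _ (by simpa using hlt'), List.getElem_map,
            List.getElem_finRange]
          rfl
        unfold cellValue
        split_ifs with h1 h2
        · rfl
        · rw [hget, hget]
          have hp0 : p (((a : ℤ) - 1) / d) ⟨(((a : ℤ) - 1) % d).toNat, hlt'⟩ = 0 := by
            refine if_neg ?_
            rintro ⟨h3, h4⟩
            have h5 : (((a : ℤ) - 1) % d) = 0 := by
              simp at h4
              omega
            have h6 := Int.emod_add_mul_ediv ((a : ℤ) - 1) d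
            rw [h3, h5] at h6
            refine ha ?_
            have : (a : ℤ) = ((1 + i * d : ℕ) : ℤ) := by push_cast; linarith
            exact_mod_cast this
          rw [spread, spread, hp0]
        · rfl
      · rw [List.getElem?_eq_none (by simpa using hlen)]
        rfl
  have hWx : ((undirectedHuT d hd).input y).size = ((undirectedHuT d hd).input x).size := by
    show y.input.words.length + y.input.reals.length = x.input.words.length + x.input.reals.length
    rw [hx, hy, ofInt_reals, ofInt_reals, List.length_map, List.length_map]
    rfl
  obtain ⟨τ', hex', hagree'⟩ := hcells _ _ (fun a ha => by rintro rfl; exact hiS ha) hagree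
  obtain ⟨t', τ, hex₂, -, hno⟩ := hsol y
  rw [hWx] at hex₂
  have := hex'.deterministic (hex₂.mono (Set.subset_univ _))
  have h1 := hyes hxyes
  have h0 := hno hyno
  rw [← this, hagree'.wreg, h1] at h0
  exact one_ne_zero h0

/-- There is no sublinear algorithm. -/
theorem not_solvable_of_sublinear {μ : Arithmetic} {𝒞 : Set Prog} {d : ℕ} {hd : 0 < d}
    {lam a b e : ℝ} (hlam0 : 0 < lam) (hlam1 : lam ≤ 1) (ha0 : 0 < a) (ha1 : a ≤ 1) (hab : a < b)
    (he0 : 0 ≤ e) (he : (1 + lam) * e < 1) : ¬ UndirectedHuTSolvable μ 𝒞 d hd lam a b e := by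
  rintro ⟨prog, -, c, C, hrun⟩
  have hb : 0 < b := ha0.trans hab
  have t1 := (tendsto_rpow_atTop (by linarith : 0 < 1 - (1 + lam) * e)).comp
    tendsto_natCast_atTop_atTop
  have t2 := (tendsto_rpow_atTop hlam0).comp tendsto_natCast_atTop_atTop
  obtain ⟨n, hn1, hn2, hn⟩ := ((t1.eventually_gt_atTop (|C| * b ^ e)).and
    ((t2.eventually_ge_atTop (1 / (b - a))).and (Filter.eventually_ge_atTop 2))).exists
  simp only [Function.comp_apply] at hn1 hn2
  have hn0 : (0 : ℝ) < n := by exact_mod_cast (by omega : 0 < n)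
  have hnl : (n : ℝ) ^ lam ≤ n := by
    simpa using Real.rpow_le_rpow_of_exponent_le (by exact_mod_cast (by omega) : (1 : ℝ) ≤ n) hlam1
  have hnl0 : 0 < (n : ℝ) ^ lam := by positivity
  -- Rounding up adds less than `1`, and `n` is so large that `(b - a) * n ^ lam` is at least `1`.
  set m := ⌈a * (n : ℝ) ^ lam⌉₊ with hm
  have hm1 : a * (n : ℝ) ^ lam ≤ m := Nat.le_ceil _
  have hm0 : 0 < m := Nat.ceil_pos.2 (by positivity)
  have hm2 : (m : ℝ) ≤ b * (n : ℝ) ^ lam := by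
    have := Nat.ceil_lt_add_one (by positivity : 0 ≤ a * (n : ℝ) ^ lam)
    rw [div_le_iff₀ (by linarith)] at hn2
    linarith
  have hmn : m ≤ n := Nat.ceil_le.2 (by nlinarith)
  have hmn' : (m : ℝ) ≤ n := by exact_mod_cast hmn
  obtain ⟨t, ht, hle⟩ := hrun (ofInt hd n m (by omega) hm0 (fun _ _ => 0) (fun _ _ => 0) 0 le_rfl)
  have hnt := le_time (fun y => (hrun y).imp fun t h => h.1) hn hm0 ht
  have hle := hle (by
    show a * (max (n : ℝ) m) ^ lam ≤ min (n : ℝ) m ∧ min (n : ℝ) m ≤ b * (max (n : ℝ) m) ^ lam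
    rw [max_eq_left hmn', min_eq_right hmn']
    exact ⟨hm1, hm2⟩)
  have hle : (t : ℝ) ≤ C * ((n : ℝ) * m) ^ e := hle
  have h1 : ((n : ℝ) * m) ^ e ≤ b ^ e * (n : ℝ) ^ ((1 + lam) * e) := by
    rw [Real.rpow_mul hn0.le, ← Real.mul_rpow hb.le (by positivity)]
    refine Real.rpow_le_rpow (by positivity) ?_ he0
    rw [Real.rpow_add hn0, Real.rpow_one]
    nlinarith
  have h2 : (n : ℝ) ≤ |C| * b ^ e * (n : ℝ) ^ ((1 + lam) * e) := by
    calc (n : ℝ) ≤ t := by exact_mod_cast hnt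
      _ ≤ C * ((n : ℝ) * m) ^ e := hle
      _ ≤ |C| * (b ^ e * (n : ℝ) ^ ((1 + lam) * e)) :=
        mul_le_mul (le_abs_self C) h1 (by positivity) (abs_nonneg C)
      _ = _ := by ring
  have h3 : (n : ℝ) ^ (1 - (1 + lam) * e) * (n : ℝ) ^ ((1 + lam) * e) = n := by
    rw [← Real.rpow_add hn0]
    simp
  have h4 : 0 < (n : ℝ) ^ ((1 + lam) * e) := by positivity
  nlinarith

end
end FineGrained

/-! ### A general scheme for encoding hypercliques -/

namespace FineGrained
noncomputable section

/-- The triples that violate a gadget are determined by three digits, so that it is violated if and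
only if these are not a hyperedge. -/
theorem forall_not_violated_iff {d k : ℕ} {sh : Shape d} (x : HypergraphInst) {τ : Fin d → ℤ}
    (z : Fin 3 → ℤ) (h : ∀ u : Fin 3 → ℤ, (∀ r, 0 ≤ u r ∧ u r < (x.n : ℤ)) →
      (sh.Violated x.n ((hypercliqueVertexProblem k).bad x.input) u τ ↔
        (hypercliqueVertexProblem k).bad x.input u ∧ ∀ r, z r % x.n = u r)) :
    (∀ u : Fin 3 → ℤ, (∀ r, 0 ≤ u r ∧ u r < (x.n : ℤ)) →
      ¬ sh.Violated x.n ((hypercliqueVertexProblem k).bad x.input) u τ) ↔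
    ({lastDigit x.n x.pos (z 0), lastDigit x.n x.pos (z 1), lastDigit x.n x.pos (z 2)} :
      Finset (Fin x.n)) ∈ x.edges := by
  constructor
  · intro H
    by_contra he
    have hu : ∀ r, 0 ≤ ((lastDigit x.n x.pos (z r) : ℕ) : ℤ) ∧
        ((lastDigit x.n x.pos (z r) : ℕ) : ℤ) < x.n := fun r =>
      ⟨by positivity, by exact_mod_cast (lastDigit x.n x.pos (z r)).2⟩
    exact H _ hu ((h _ hu).2 ⟨(hyperclique_bad_iff x rfl rfl rfl).2 he, fun r =>
      (coe_lastDigit x.pos _).symm⟩)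
  · intro he u hu hviol
    obtain ⟨hb, hz⟩ := (h u hu).1 hviol
    simp only [← coe_lastDigit x.pos] at hz
    exact (hyperclique_bad_iff x (hz 0).symm (hz 1).symm (hz 2).symm).1 hb he

/-- All triples of distinct positions carry hyperedges. -/
def AllEdges {V : Type} (x : HypergraphInst) (w : V → Fin x.n) : Prop :=
  ∀ A B C : V, A ≠ B → A ≠ C → B ≠ C → ({w A, w B, w C} : Finset (Fin x.n)) ∈ x.edges

/-- The vertices are automatically distinct: if two positions carried the same vertex, any third
position would complete them to a hyperedge with at most two elements. -/
theorem hyperclique_yes_iff {V : Type} [Fintype V] (hV : 3 ≤ Fintype.card V) (x : HypergraphInst) :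
    (hypercliqueProblem (Fintype.card V)).yes x ↔ ∃ w : V → Fin x.n, AllEdges x w := by
  classical
  show (∃ S : Finset (Fin x.n), S.card = _ ∧ ∀ e ⊆ S, e.card = 3 → e ∈ x.edges) ↔ _
  constructor
  · rintro ⟨S, hS, h⟩
    obtain ⟨e⟩ : Nonempty (V ≃ S) := by
      rw [← Fintype.card_eq]
      simp [hS]
    have hne : ∀ A B, A ≠ B → (e A : Fin x.n) ≠ e B := fun A B hAB hc =>
      hAB (e.injective (Subtype.ext hc))
    refine ⟨fun A => e A, fun A B C hAB hAC hBC => h _ ?_ ?_⟩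
    · intro i hi
      simp only [Finset.mem_insert, Finset.mem_singleton] at hi
      rcases hi with rfl | rfl | rfl <;> exact (e _).2
    · exact Finset.card_eq_three.2 ⟨_, _, _, hne _ _ hAB, hne _ _ hAC, hne _ _ hBC, rfl⟩
  · rintro ⟨w, hw⟩
    have hinj : Function.Injective w := fun A B he => by
      by_contra hne
      obtain ⟨C, hC⟩ : ∃ C, C ∉ ({A, B} : Finset V) := by
        by_contra! hall
        have h1 := Finset.card_le_card fun C (_ : C ∈ Finset.univ) => hall C
        have h2 := Finset.card_le_two (a := A) (b := B)
        rw [Finset.card_univ] at h1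
        omega
      simp only [Finset.mem_insert, Finset.mem_singleton, not_or] at hC
      have h3 := x.uniform _ (hw A B C hne (Ne.symm hC.1) (Ne.symm hC.2))
      rw [he, Finset.insert_eq_of_mem (Finset.mem_insert_self _ _)] at h3
      have := Finset.card_le_two (a := w B) (b := w C)
      omega
    refine ⟨Finset.univ.map ⟨w, hinj⟩, by simp, fun e he hc => ?_⟩
    obtain ⟨i, j, l, hij, hil, hjl, rfl⟩ := Finset.card_eq_three.1 hc
    have hm : ∀ a ∈ ({i, j, l} : Finset (Fin x.n)), ∃ A, w A = a := fun a ha => by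
      simpa using he ha
    obtain ⟨A, rfl⟩ := hm i (by simp)
    obtain ⟨B, rfl⟩ := hm j (by simp)
    obtain ⟨C, rfl⟩ := hm l (by simp)
    exact hw A B C (fun h => hij (congrArg w h)) (fun h => hil (congrArg w h))
      fun h => hjl (congrArg w h)

/-- The gadget `sh` is not violated by `τ`. -/
def Respects {d : ℕ} (k : ℕ) (x : HypergraphInst) (τ : Fin d → ℤ) (sh : Shape d) : Prop :=
  ∀ u : Fin 3 → ℤ, (∀ r, 0 ≤ u r ∧ u r < (x.n : ℤ)) →
    ¬ sh.Violated x.n ((hypercliqueVertexProblem k).bad x.input) u τ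

/-- An encoding of tuples of vertices by vectors `τ` is given by gadgets `cons` that single out the
vectors used for the encoding, and gadgets that test triples of vertices. -/
theorem exists_hyperclique_encodedBy {V : Type} [Fintype V] (hV : 3 ≤ Fintype.card V)
    {d g pp hh : ℕ} (cons : List (Shape d)) (hcons : ∀ sh ∈ cons, sh.Valid pp hh)
    (val : ∀ x : HypergraphInst, (Fin d → ℤ) → V → Fin x.n)
    (hsurj : ∀ (x : HypergraphInst) (w : V → Fin x.n), ∃ τ : Fin d → ℤ,
      (∀ c, 0 ≤ τ c ∧ τ c < (x.n : ℤ) ^ g) ∧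
      (∀ sh ∈ cons, Respects (Fintype.card V) x τ sh) ∧ val x τ = w)
    (htest : ∀ A B C : V, A ≠ B → A ≠ C → B ≠ C → ∃ sh : Shape d, sh.Valid pp hh ∧
      ∀ (x : HypergraphInst) (τ : Fin d → ℤ), (∀ c, 0 ≤ τ c ∧ τ c < (x.n : ℤ) ^ g) →
        (∀ sh ∈ cons, Respects (Fintype.card V) x τ sh) →
        (Respects (Fintype.card V) x τ sh ↔
          ({val x τ A, val x τ B, val x τ C} : Finset (Fin x.n)) ∈ x.edges)) :
    ∃ l : List (Shape d), (∀ sh ∈ l, sh.Valid pp hh) ∧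
      (hypercliqueVertexProblem (Fintype.card V)).EncodedBy l g := by
  classical
  choose test hvalid htest using htest
  let l' : List (Shape d) := (Finset.univ : Finset {t : V × V × V //
    t.1 ≠ t.2.1 ∧ t.1 ≠ t.2.2 ∧ t.2.1 ≠ t.2.2}).toList.map fun t =>
      test t.1.1 t.1.2.1 t.1.2.2 t.2.1 t.2.2.1 t.2.2.2
  have hl' : ∀ P : Shape d → Prop, (∀ sh ∈ l', P sh) ↔
      ∀ A B C (h₁ : A ≠ B) (h₂ : A ≠ C) (h₃ : B ≠ C), P (test A B C h₁ h₂ h₃) := by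
    intro P
    simp only [l', List.mem_map, Finset.mem_toList, Finset.mem_univ, true_and]
    constructor
    · exact fun H A B C h₁ h₂ h₃ => H _ ⟨⟨(A, B, C), h₁, h₂, h₃⟩, rfl⟩
    · rintro H _ ⟨t, rfl⟩
      exact H _ _ _ _ _ _
  refine ⟨cons ++ l', ?_, fun (x : HypergraphInst) => ?_⟩
  · rw [List.forall_mem_append]
    exact ⟨hcons, (hl' _).2 hvalid⟩
  show (∃ τ : Fin d → ℤ, (∀ c, 0 ≤ τ c ∧ τ c < (x.n : ℤ) ^ g) ∧
    ∀ sh ∈ cons ++ l', Respects (Fintype.card V) x τ sh) ↔ (hypercliqueProblem _).yes x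
  rw [hyperclique_yes_iff hV]
  simp only [List.forall_mem_append, hl']
  constructor
  · rintro ⟨τ, hτ, hc, ht⟩
    exact ⟨val x τ, fun A B C h₁ h₂ h₃ =>
      (htest A B C h₁ h₂ h₃ x τ hτ hc).1 (ht A B C h₁ h₂ h₃)⟩
  · rintro ⟨w, hw⟩
    obtain ⟨τ, hτ, hc, rfl⟩ := hsurj x w
    exact ⟨τ, hτ, hc, fun A B C h₁ h₂ h₃ =>
      (htest A B C h₁ h₂ h₃ x τ hτ hc).2 (hw A B C h₁ h₂ h₃)⟩

end
end FineGrained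

/-! ### Hypercliques in three dimensions, with linked digits -/

namespace FineGrained
noncomputable section

namespace Shape
variable {d : ℕ} {v : ℤ} {bad : (Fin 3 → ℤ) → Prop} {u : Fin 3 → ℤ} {τ : Fin d → ℤ}

/-- Reads digits `rx` of `τ c / v ^ (g - 1 - s)`, and the digit with position `g - 1 - s'`
of `τ c'`. -/
def readingTwo (g M : ℕ) (c : Fin d) (s : ℕ) (rx : List (ℕ × Fin 3)) (c' : Fin d) (s' : ℕ)
    (act : Activation) : Shape d :=
  .reading c c c' (g - 1 - s) (min M s) (s + 1 - min M s) g 0 0 (g - 1 - s') (max s' (min M s) + 2)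
    rx [] act

/-- Depths `s`, `s'` are counted from the highest digit. Reading down to depth `s` means guessing `s
+ 1` digits, of which up to `M` are left to `Q`. -/
theorem readingTwo_valid {g M : ℕ} {c : Fin d} {s : ℕ} {rx : List (ℕ × Fin 3)} {c' : Fin d}
    {s' : ℕ} {act : Activation} {pp : ℕ} (h : s + s' + 3 ≤ pp + M) (h' : s + 3 ≤ pp)
    (h'' : s' + 3 ≤ pp) : (readingTwo g M c s rx c' s' act).Valid pp M :=
  reading_valid (by omega) (by omega)

theorem readingTwo_violated_iff (hv : 1 ≤ v) (hu : ∀ r, 0 ≤ u r ∧ u r < v) {g M : ℕ}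
    (hτ : ∀ c, 0 ≤ τ c ∧ τ c < v ^ g) {c : Fin d} {s : ℕ} {rx : List (ℕ × Fin 3)} {c' : Fin d}
    {s' : ℕ} {act : Activation} (hc : c' ≠ c) (hs : s < g) (hs' : s' < g) :
    (readingTwo g M c s rx c' s' act).Violated v bad u τ ↔
      (readingTwo g M c s rx c' s' act).Active bad u ∧
      (∀ t ∈ rx, τ c / v ^ (g - 1 - s) / v ^ t.1 % v = u t.2) ∧
      τ c' / v ^ (g - 1 - s') % v = u 2 := by
  unfold readingTwo
  rw [reading_violated_iff hv hu hτ hc hc (Or.inr ⟨rfl, rfl, rfl, by omega, rfl⟩) (by omega)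
    (by omega) (by omega) (by omega) (by omega)]
  simp

/-- Reads a digit in each of three coordinates. -/
def readingThree (g M : ℕ) (c : Fin d) (s : ℕ) (c' : Fin d) (s' : ℕ) (c'' : Fin d) (s'' : ℕ)
    (act : Activation) : Shape d :=
  .reading c c' c'' (g - 1 - s) (min M s) (s + 1 - min M s)
    (g - 1 - s') (min (M - s) s') (s' + 1 - min (M - s) s') (g - 1 - s'') (s'' + 2)
    [(0, 0)] [(0, 1)] act

/-- The cost is essentially the sum of the three depths, so only triples that are not too deep can
be read in this way. -/
theorem readingThree_valid {g M : ℕ} {c : Fin d} {s : ℕ} {c' : Fin d} {s' : ℕ} {c'' : Fin d}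
    {s'' : ℕ} {act : Activation} {pp : ℕ} (h : s + s' + s'' + 4 ≤ pp + M) (h' : s'' + 4 ≤ pp) :
    (readingThree g M c s c' s' c'' s'' act).Valid pp M :=
  reading_valid (by omega) (by omega)

theorem readingThree_violated_iff (hv : 1 ≤ v) (hu : ∀ r, 0 ≤ u r ∧ u r < v) {g M : ℕ}
    (hτ : ∀ c, 0 ≤ τ c ∧ τ c < v ^ g) {c : Fin d} {s : ℕ} {c' : Fin d} {s' : ℕ} {c'' : Fin d}
    {s'' : ℕ} {act : Activation} (hc : c'' ≠ c) (hc' : c'' ≠ c') (hcc : c' ≠ c) (hs : s ≤ s'')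
    (hs' : s' ≤ s'') (hs'' : s'' < g) :
    (readingThree g M c s c' s' c'' s'' act).Violated v bad u τ ↔
      (readingThree g M c s c' s' c'' s'' act).Active bad u ∧
      τ c / v ^ (g - 1 - s) % v = u 0 ∧ τ c' / v ^ (g - 1 - s') % v = u 1 ∧
      τ c'' / v ^ (g - 1 - s'') % v = u 2 := by
  unfold readingThree
  rw [reading_violated_iff hv hu hτ hc hc' (Or.inl hcc) (by omega) (by omega) (by omega) (by omega)
    (by omega)]
  simp

end Shape

/-- The vertex encoded at position `A`. -/
def topVertex (f : ℕ) (x : HypergraphInst) (τ : Fin 3 → ℤ) (A : Fin 3 × Fin (3 * f)) : Fin x.n :=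
  lastDigit x.n x.pos (τ A.1 / (x.n : ℤ) ^ (4 * f - 1 - (A.2 : ℕ)))

/-- The gadgets that force the lowest digits of each coordinate to be copies of digits of the next
coordinate. -/
def linkShapes (f M : ℕ) : List (Shape 3) :=
  (Finset.univ : Finset (Fin 3 × Fin f)).toList.map fun t =>
    .readingTwo (4 * f) M t.1 (4 * f - 1 - t.2) [(0, 0)] (t.1 + 1) (2 * f + t.2) .differ

theorem linkShapes_valid {f M : ℕ} (hM : M ≤ 2 * f) :
    ∀ sh ∈ linkShapes f M, sh.Valid (6 * f + 4 - M) M := by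
  simp only [linkShapes, List.mem_map, forall_exists_index, and_imp]
  rintro _ t - rfl
  have := t.2.2
  exact Shape.readingTwo_valid (by omega) (by omega) (by omega)

theorem Fin.three_add_one_ne (c : Fin 3) : c + 1 ≠ c := by
  revert c
  decide

theorem respects_linkShapes_iff {f M k : ℕ} (x : HypergraphInst) {τ : Fin 3 → ℤ}
    (hτ : ∀ c, 0 ≤ τ c ∧ τ c < (x.n : ℤ) ^ (4 * f)) :
    (∀ sh ∈ linkShapes f M, Respects k x τ sh) ↔ ∀ c, ∀ i < f,
      lastDigit x.n x.pos (τ c / (x.n : ℤ) ^ i) =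
        lastDigit x.n x.pos (τ (c + 1) / (x.n : ℤ) ^ (2 * f - 1 - i)) := by
  have hv : (1 : ℤ) ≤ x.n := by exact_mod_cast x.pos
  have key : ∀ c, ∀ i < f, Respects k x τ (.readingTwo (4 * f) M c (4 * f - 1 - i) [(0, 0)] (c + 1)
      (2 * f + i) .differ) ↔ lastDigit x.n x.pos (τ c / (x.n : ℤ) ^ i) =
        lastDigit x.n x.pos (τ (c + 1) / (x.n : ℤ) ^ (2 * f - 1 - i)) := by
    intro c i hi
    have hr : ∀ i : Fin x.n, 0 ≤ ((i : ℕ) : ℤ) ∧ ((i : ℕ) : ℤ) < x.n := fun i =>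
      ⟨by positivity, by exact_mod_cast i.2⟩
    have hiff : ∀ u : Fin 3 → ℤ, (∀ r, 0 ≤ u r ∧ u r < (x.n : ℤ)) →
        ((Shape.readingTwo (4 * f) M c (4 * f - 1 - i) [(0, 0)] (c + 1) (2 * f + i) .differ).Violated
          x.n ((hypercliqueVertexProblem k).bad x.input) u τ ↔ u 0 ≠ u 2 ∧
          τ c / (x.n : ℤ) ^ i % x.n = u 0 ∧ τ (c + 1) / (x.n : ℤ) ^ (2 * f - 1 - i) % x.n = u 2) := by
      intro u hu
      rw [Shape.readingTwo_violated_iff hv hu hτ (Fin.three_add_one_ne c) (by omega) (by omega),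
        show 4 * f - 1 - (4 * f - 1 - i) = i by omega,
        show 4 * f - 1 - (2 * f + i) = 2 * f - 1 - i by omega]
      refine and_congr Iff.rfl ?_
      simp
    constructor
    · intro H
      by_contra hne
      have hu : ∀ r, 0 ≤ (![((lastDigit x.n x.pos (τ c / (x.n : ℤ) ^ i) : ℕ) : ℤ), 0,
          ((lastDigit x.n x.pos (τ (c + 1) / (x.n : ℤ) ^ (2 * f - 1 - i)) : ℕ) : ℤ)] :
          Fin 3 → ℤ) r ∧ (![((lastDigit x.n x.pos (τ c / (x.n : ℤ) ^ i) : ℕ) : ℤ), 0,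
          ((lastDigit x.n x.pos (τ (c + 1) / (x.n : ℤ) ^ (2 * f - 1 - i)) : ℕ) : ℤ)] :
          Fin 3 → ℤ) r < x.n := by
        intro r
        fin_cases r
        exacts [hr _, ⟨le_rfl, by show (0 : ℤ) < x.n; omega⟩, hr _]
      refine H _ hu ((hiff _ hu).2 ⟨fun h => hne (Fin.ext (Nat.cast_injective (R := ℤ) h)),
        (coe_lastDigit x.pos _).symm, (coe_lastDigit x.pos _).symm⟩)
    · intro h u hu hviol
      obtain ⟨hne, h0, h2⟩ := (hiff u hu).1 hviol
      rw [← coe_lastDigit x.pos] at h0 h2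
      rw [← h0, ← h2, h] at hne
      exact hne rfl
  simp only [linkShapes, List.mem_map, forall_exists_index, and_imp]
  constructor
  · intro H c i hi
    exact (key c i hi).1 (H _ (c, ⟨i, hi⟩) (by simp) rfl)
  · rintro H _ t - rfl
    exact (key _ _ t.2.2).2 (H _ _ t.2.2)

theorem exists_linked {f M k : ℕ} (x : HypergraphInst) (w : Fin 3 × Fin (3 * f) → Fin x.n) :
    ∃ τ : Fin 3 → ℤ, (∀ c, 0 ≤ τ c ∧ τ c < (x.n : ℤ) ^ (4 * f)) ∧
      (∀ sh ∈ linkShapes f M, Respects k x τ sh) ∧ topVertex f x τ = w := by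
  let w' : Fin 3 → ℕ → Fin x.n := fun c s => if h : s < 3 * f then w (c, ⟨s, h⟩) else ⟨0, x.pos⟩
  obtain ⟨τ, hτ, h⟩ := exists_coordinates x.pos (g := 4 * f) fun (c : Fin 3) s =>
    if f ≤ s then w' c (4 * f - 1 - s) else w' (c + 1) (2 * f + s)
  refine ⟨τ, hτ, (respects_linkShapes_iff x hτ).2 fun c i hi => ?_, funext fun A => ?_⟩
  · rw [h c i (by omega), h (c + 1) _ (by omega), if_neg (by omega), if_pos (by omega)]
    congr 1
    omega
  · have hA := A.2.2
    rw [topVertex, h _ _ (by omega), if_pos (by omega),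
      show 4 * f - 1 - (4 * f - 1 - (A.2 : ℕ)) = A.2 by omega]
    exact dif_pos hA

/-- Some gadget tests if three positions carry a hyperedge. -/
def Testable (f M k : ℕ) (A B C : Fin 3 × Fin (3 * f)) : Prop :=
  ∃ sh : Shape 3, sh.Valid (6 * f + 4 - M) M ∧ ∀ (x : HypergraphInst) (τ : Fin 3 → ℤ),
    (∀ c, 0 ≤ τ c ∧ τ c < (x.n : ℤ) ^ (4 * f)) → (∀ sh ∈ linkShapes f M, Respects k x τ sh) →
      (Respects k x τ sh ↔ ({topVertex f x τ A, topVertex f x τ B, topVertex f x τ C} :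
        Finset (Fin x.n)) ∈ x.edges)

namespace Testable
variable {f M k : ℕ} {A B C : Fin 3 × Fin (3 * f)}

theorem swap (h : Testable f M k A B C) : Testable f M k B A C := by
  obtain ⟨sh, hsh, h⟩ := h
  exact ⟨sh, hsh, fun x τ hτ hc => by rw [h x τ hτ hc, Finset.insert_comm]⟩

theorem rotate (h : Testable f M k A B C) : Testable f M k B C A := by
  obtain ⟨sh, hsh, h⟩ := h
  exact ⟨sh, hsh, fun x τ hτ hc => by
    rw [h x τ hτ hc, Finset.insert_comm, Finset.pair_comm]⟩

theorem of_coord_eq (hM : M ≤ 2 * f) (h₁ : B.1 = A.1) (h₂ : C.1 = A.1) (h₃ : B.2 ≤ A.2)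
    (h₄ : C.2 ≤ A.2) : Testable f M k A B C := by
  have hA := A.2.2
  refine ⟨.readingOne A.1 (4 * f - 1 - A.2) (A.2 + 1) (4 * f)
    [(0, 0), ((4 * f - 1 - B.2) - (4 * f - 1 - A.2), 1),
      ((4 * f - 1 - C.2) - (4 * f - 1 - A.2), 2)] .bad, Shape.readingOne_valid (by omega),
    fun x τ hτ _ => ?_⟩
  have hv : (1 : ℤ) ≤ x.n := by exact_mod_cast x.pos
  refine forall_not_violated_iff x ![τ A.1 / (x.n : ℤ) ^ (4 * f - 1 - (A.2 : ℕ)),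
    τ B.1 / (x.n : ℤ) ^ (4 * f - 1 - (B.2 : ℕ)), τ C.1 / (x.n : ℤ) ^ (4 * f - 1 - (C.2 : ℕ))]
    fun u hu => ?_
  rw [Shape.readingOne_violated_iff hv hτ (by omega) (by omega)]
  refine and_congr Iff.rfl ?_
  simp only [List.mem_cons, List.not_mem_nil, or_false, forall_eq_or_imp, forall_eq, pow_zero,
    Int.ediv_one, digit_add hv _ (show 4 * f - 1 - (A.2 : ℕ) ≤ 4 * f - 1 - (B.2 : ℕ) by omega),
    digit_add hv _ (show 4 * f - 1 - (A.2 : ℕ) ≤ 4 * f - 1 - (C.2 : ℕ) by omega), h₁, h₂,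
    Fin.forall_fin_succ]
  simp

theorem of_two_coord (hM : M ≤ 2 * f) (h₁ : B.1 = A.1) (h₂ : C.1 ≠ A.1) (h₃ : B.2 ≤ A.2) :
    Testable f M k A B C := by
  have hA := A.2.2
  have hC := C.2.2
  refine ⟨.readingTwo (4 * f) M A.1 A.2 [(0, 0), ((4 * f - 1 - B.2) - (4 * f - 1 - A.2), 1)]
    C.1 C.2 .bad, Shape.readingTwo_valid (by omega) (by omega) (by omega), fun x τ hτ _ => ?_⟩
  have hv : (1 : ℤ) ≤ x.n := by exact_mod_cast x.pos
  refine forall_not_violated_iff x ![τ A.1 / (x.n : ℤ) ^ (4 * f - 1 - (A.2 : ℕ)),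
    τ B.1 / (x.n : ℤ) ^ (4 * f - 1 - (B.2 : ℕ)), τ C.1 / (x.n : ℤ) ^ (4 * f - 1 - (C.2 : ℕ))]
    fun u hu => ?_
  rw [Shape.readingTwo_violated_iff hv hu hτ h₂ (by omega) (by omega)]
  refine and_congr Iff.rfl ?_
  simp only [List.mem_cons, List.not_mem_nil, or_false, forall_eq_or_imp, forall_eq, pow_zero,
    Int.ediv_one, digit_add hv _ (show 4 * f - 1 - (A.2 : ℕ) ≤ 4 * f - 1 - (B.2 : ℕ) by omega), h₁,
    Fin.forall_fin_succ]
  simp [and_assoc]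

/-- Depths with sum at most `6 * f` allow reading all three coordinates directly. -/
theorem of_le (h₁ : B.1 ≠ A.1) (h₂ : C.1 ≠ A.1) (h₃ : C.1 ≠ B.1)
    (hA : A.2 ≤ C.2) (hB : B.2 ≤ C.2) (h : (A.2 : ℕ) + B.2 + C.2 ≤ 6 * f) (hM : M ≤ 2 * f) :
    Testable f M k A B C := by
  have hC := C.2.2
  refine ⟨.readingThree (4 * f) M A.1 A.2 B.1 B.2 C.1 C.2 .bad,
    Shape.readingThree_valid (by omega) (by omega), fun x τ hτ _ => ?_⟩
  have hv : (1 : ℤ) ≤ x.n := by exact_mod_cast x.pos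
  refine forall_not_violated_iff x ![τ A.1 / (x.n : ℤ) ^ (4 * f - 1 - (A.2 : ℕ)),
    τ B.1 / (x.n : ℤ) ^ (4 * f - 1 - (B.2 : ℕ)), τ C.1 / (x.n : ℤ) ^ (4 * f - 1 - (C.2 : ℕ))]
    fun u hu => ?_
  rw [Shape.readingThree_violated_iff hv hu hτ h₂ h₃ h₁ hA hB (by omega)]
  refine and_congr Iff.rfl ?_
  simp only [Fin.forall_fin_succ]
  simp

/-- The position `C` is read from its copy in the coordinate of `A`. -/
theorem of_link (hM : M ≤ 2 * f) (h₁ : C.1 = A.1 + 1) (h₂ : B.1 ≠ A.1) (h₃ : B.2 ≤ C.2)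
    (hC : 2 * f ≤ C.2) : Testable f M k A C B := by
  have hC' := C.2.2
  have hA := A.2.2
  -- Copies are stored in reverse order, so the copy of `C` has depth `6 * f - 1 - C.2`: the deeper
  -- the original, the shallower the copy. As `B.2 ≤ C.2`, the two depths sum to less than `6 * f`.
  -- The digit of `A` comes for free, being higher than the copy in the same coordinate.
  refine ⟨.readingTwo (4 * f) M A.1 (4 * f - 1 - (C.2 - 2 * f))
    [(0, 1), ((4 * f - 1 - A.2) - (C.2 - 2 * f), 0)] B.1 B.2 .bad,
    Shape.readingTwo_valid (by omega) (by omega) (by omega), fun x τ hτ hc => ?_⟩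
  have hv : (1 : ℤ) ≤ x.n := by exact_mod_cast x.pos
  have hcopy : topVertex f x τ C =
      lastDigit x.n x.pos (τ A.1 / (x.n : ℤ) ^ ((C.2 : ℕ) - 2 * f)) := by
    rw [(respects_linkShapes_iff x hτ).1 hc A.1 _ (by omega), ← h₁,
      show 2 * f - 1 - ((C.2 : ℕ) - 2 * f) = 4 * f - 1 - C.2 by omega]
    rfl
  rw [hcopy]
  refine forall_not_violated_iff x ![τ A.1 / (x.n : ℤ) ^ (4 * f - 1 - (A.2 : ℕ)),
    τ A.1 / (x.n : ℤ) ^ ((C.2 : ℕ) - 2 * f), τ B.1 / (x.n : ℤ) ^ (4 * f - 1 - (B.2 : ℕ))]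
    fun u hu => ?_
  rw [Shape.readingTwo_violated_iff hv hu hτ h₂ (by omega) (by omega),
    show 4 * f - 1 - (4 * f - 1 - ((C.2 : ℕ) - 2 * f)) = C.2 - 2 * f by omega]
  refine and_congr Iff.rfl ?_
  simp only [List.mem_cons, List.not_mem_nil, or_false, forall_eq_or_imp, forall_eq, pow_zero,
    Int.ediv_one, digit_add hv _ (show (C.2 : ℕ) - 2 * f ≤ 4 * f - 1 - (A.2 : ℕ) by omega),
    Fin.forall_fin_succ]
  simp
  tauto

/-- If the depths sum to more than `6 * f`, the largest one exceeds `2 * f`, so `C` has a copy in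
the cyclically preceding coordinate. That is the coordinate of `A` or of `B`. -/
theorem of_coord_ne (hM : M ≤ 2 * f) (h₁ : B.1 ≠ A.1) (h₂ : C.1 ≠ A.1) (h₃ : C.1 ≠ B.1)
    (hA : A.2 ≤ C.2) (hB : B.2 ≤ C.2) : Testable f M k A B C := by
  by_cases h : (A.2 : ℕ) + B.2 + C.2 ≤ 6 * f
  · exact of_le h₁ h₂ h₃ hA hB h hM
  · have hcyc : ∀ a b c : Fin 3, b ≠ a → c ≠ a → c ≠ b → c = a + 1 ∨ c = b + 1 := by decide
    rcases hcyc _ _ _ h₁ h₂ h₃ with e | e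
    · exact (of_link hM e h₁ hB (by omega)).rotate.rotate.swap
    · exact (of_link hM e h₁.symm hA (by omega)).rotate.rotate

theorem of_coord_eq_pair (hM : M ≤ 2 * f) (h₁ : B.1 = A.1) (h₂ : C.1 ≠ A.1) :
    Testable f M k A B C := by
  rcases le_total B.2 A.2 with h | h
  · exact of_two_coord hM h₁ h₂ h
  · exact (of_two_coord hM h₁.symm (h₁ ▸ h₂) h).swap

theorem all (hM : M ≤ 2 * f) (A B C : Fin 3 × Fin (3 * f)) : Testable f M k A B C := by
  by_cases h₁ : B.1 = A.1
  · by_cases h₂ : C.1 = A.1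
    · rcases le_total B.2 A.2 with h | h
      · rcases le_total C.2 A.2 with h' | h'
        · exact of_coord_eq hM h₁ h₂ h h'
        · exact (of_coord_eq hM h₂.symm (h₁.trans h₂.symm) h' (h.trans h')).rotate
      · rcases le_total C.2 B.2 with h' | h'
        · exact (of_coord_eq hM h₁.symm (h₂.trans h₁.symm) h h').swap
        · exact (of_coord_eq hM h₂.symm (h₁.trans h₂.symm) (h.trans h') h').rotate
    · exact of_coord_eq_pair hM h₁ h₂
  · by_cases h₂ : C.1 = A.1
    · exact (of_coord_eq_pair hM h₂.symm (h₂ ▸ h₁) : Testable f M k C A B).rotate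
    · by_cases h₃ : C.1 = B.1
      · exact (of_coord_eq_pair hM h₃ (Ne.symm h₁) : Testable f M k B C A).rotate.rotate
      · rcases le_total A.2 C.2 with h | h <;> rcases le_total B.2 C.2 with h' | h'
        · exact of_coord_ne hM h₁ h₂ h₃ h h'
        · exact (of_coord_ne hM h₂ h₁ (Ne.symm h₃) (h.trans h') h' :
            Testable f M k A C B).rotate.rotate.swap
        · exact (of_coord_ne hM h₃ (Ne.symm h₁) (Ne.symm h₂) (h'.trans h) h :
            Testable f M k B C A).rotate.rotate
        · rcases le_total A.2 B.2 with h'' | h''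
          · exact (of_coord_ne hM h₂ h₁ (Ne.symm h₃) h'' h' :
              Testable f M k A C B).rotate.rotate.swap
          · exact (of_coord_ne hM h₃ (Ne.symm h₁) (Ne.symm h₂) h'' h :
              Testable f M k B C A).rotate.rotate

end Testable

/-- There are three coordinates with `3 * f` free digits each, whereas the sizes multiply to `v ^ (6
* f)` up to a fixed power; the quotient of `9 * f` and `6 * f` is the exponent. -/
theorem exists_encodedBy_three {f M : ℕ} (hf : 1 ≤ f) (hM : M ≤ 2 * f) : ∃ l : List (Shape 3),
    (∀ sh ∈ l, sh.Valid (6 * f + 4 - M) M) ∧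
      (hypercliqueVertexProblem (9 * f)).EncodedBy l (4 * f) := by
  have hcard : Fintype.card (Fin 3 × Fin (3 * f)) = 9 * f := by
    rw [Fintype.card_prod, Fintype.card_fin, Fintype.card_fin]
    ring
  rw [← hcard]
  exact exists_hyperclique_encodedBy (by omega) (linkShapes f M) (linkShapes_valid hM)
    (topVertex f) exists_linked fun A B C _ _ _ => Testable.all hM A B C

end
end FineGrained

/-! ### The exponent obtained in three dimensions -/

namespace FineGrained
noncomputable section

/-- A fast algorithm for the Hausdorff distance under translation in three dimensions yields a fast
algorithm for hypercliques. -/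
theorem exists_hyperclique_solvable_three {μ : Arithmetic} {𝒞 : Set Prog}
    (hclosed : BudgetClosed μ 𝒞) (hd : 0 < 3) {lam a b ε : ℝ} (hlam0 : 0 < lam)
    (hlam1 : lam ≤ 1 / 2) (ha0 : 0 < a) (ha1 : a ≤ 1) (hab : a < b) (hε : 0 < ε)
    (h : UndirectedHuTSolvable μ 𝒞 3 hd lam a b (3 / 2 - ε)) :
    ∃ k : ℕ, 3 < k ∧ SolvableIn μ 𝒞 (hypercliqueProblem k) Set.univ
      fun x : HypergraphInst => (x.n : ℝ) ^ ((k : ℝ) - 1) := by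
  set e := max (3 / 2 - ε) 0 with he
  have hey : e < 3 / 2 := max_lt (by linarith) (by norm_num)
  obtain ⟨p, hp₁, hp₂, hp₃⟩ := exists_nat_ge_mul (x₁ := 40) (x₂ := 76) (x₃ := 39)
    hlam0 one_pos (by nlinarith : 0 < (1 + lam) * (3 / 2 - e))
  have hp0 : (0 : ℝ) ≤ p := by positivity
  obtain ⟨q, hq₀, hq, hq'⟩ := exists_floor_exponent hlam0 (r := 30) (p := p) (by norm_num; linarith)
  have hqp : 2 * (q + 1) ≤ p := by
    have : 2 * ((q : ℝ) + 1) ≤ p := by nlinarith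
    exact_mod_cast this
  obtain ⟨M, rfl⟩ : ∃ M, q = M + 8 := ⟨q - 8, by omega⟩
  -- The largest value with `(6 * f + 4 - M) + 3 ≤ p`. Then `M ≤ 2 * f` means that `M` is at most
  -- about `p / 2`, which is where `hlam1` is needed.
  set f := (p + M - 7) / 6 with hf
  have hfR : (p : ℝ) + M ≤ 6 * f + 12 := by
    exact_mod_cast (by omega : p + M ≤ 6 * f + 12)
  have hMf : M ≤ 2 * f := by omega
  push_cast at hq'
  obtain ⟨l, hl, henc⟩ := exists_encodedBy_three (f := f) (by omega) hMf
  refine ⟨9 * f, by omega, ?_⟩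
  refine solvable_of_encoded hclosed (hypercliqueVertexProblem (9 * f)) hd (p := p) (q := M + 8)
    false hl henc ?_ hlam0 (by linarith) ha0 ha1 hab (le_max_right _ _) hq (by push_cast; linarith)
    ?_ ?_ (h.mono (le_max_left _ _))
  · simp only [Bool.false_eq_true, if_false]
    omega
  · push_cast
    nlinarith
  · push_cast
    nlinarith

end
end FineGrained

/-! ### Testing three coordinates by three separate staircases -/

namespace FineGrained
noncomputable section

/-- The first index with a given value. -/
def firstIndex {α : Type*} [DecidableEq α] (f : Fin 3 → α) (c : α) : Fin 3 :=
  if f 0 = c then 0 else if f 1 = c then 1 else 2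

theorem apply_firstIndex {α : Type*} [DecidableEq α] (f : Fin 3 → α) (r : Fin 3) :
    f (firstIndex f (f r)) = f r := by
  unfold firstIndex
  split_ifs with h0 h1
  · exact h0
  · exact h1
  · fin_cases r
    · exact absurd rfl h0
    · exact absurd rfl h1
    · rfl

namespace Shape
variable {d : ℕ} {v : ℤ} {bad : (Fin 3 → ℤ) → Prop} {u : Fin 3 → ℤ} {τ : Fin d → ℤ}

/-- Reads digits `rd r` of `τ (cx r)`, and tests if `τ (cz r)` lies in an interval whose position
depends on the `N` lowest digits of `τ (cx r)`. -/
def paired (N e : ℕ) (cx cz : Fin 3 → Fin d) (base : List (ℤ × ℕ)) (len : ℕ)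
    (rd : Fin 3 → List (ℕ × Fin 3)) (act : Activation) : Shape d where
  surf r := ⟨cx r, cx r, cz r, 0, N, 0, N, 0, len, base, 0, 0, (rd r).filter (·.1 < N), []⟩
  α k := if firstIndex cx (cx k) = k then e else 0
  om _ := N
  oc := cx
  conA := (List.finRange 3).flatMap fun r => ((rd r).filter (N ≤ ·.1)).map fun t =>
    (firstIndex cx (cx r), t.1 - N, t.2)
  act := act

/-- The staircase descends by one per cell. Holes of unit length may therefore be opened in an
arbitrary set of cells, longer ones only in all cells at once. -/
theorem paired_valid {N e : ℕ} {cx cz : Fin 3 → Fin d} {base : List (ℤ × ℕ)} {len : ℕ}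
    {rd : Fin 3 → List (ℕ × Fin 3)} {act : Activation} (h : len = 0 ∨ ∀ r, rd r = []) :
    (paired N e cx cz base len rd act).Valid (3 * e) N := by
  refine ⟨fun r => ?_, ?_, fun _ => le_rfl⟩
  · rcases h with h | h
    · exact Or.inr h.le
    · refine Or.inl ⟨?_, rfl⟩
      show (rd r).filter _ = []
      rw [h, List.filter_nil]
  · have h : ∀ k, (paired N e cx cz base len rd act).α k ≤ e := fun k => by
      show (if _ then e else 0) ≤ e
      split_ifs <;> omega
    have h0 := h 0
    have h1 := h 1
    have h2 := h 2
    omega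

/-- Several of the three readings may concern the same coordinate. Only the first of them has a
guess; the others have range `v ^ 0` and contribute nothing. -/
theorem paired_shift {N e : ℕ} {cx cz : Fin 3 → Fin d} {base : List (ℤ × ℕ)} {len : ℕ}
    {rd : Fin 3 → List (ℕ × Fin 3)} {act : Activation} {a : Fin 3 → ℤ}
    (ha : (paired N e cx cz base len rd act).InRange v a) (r : Fin 3) :
    (paired N e cx cz base len rd act).shift v a (cx r) = a (firstIndex cx (cx r)) * v ^ N := by
  have hk : ∀ k : Fin 3, (if cx r = cx k then a k * v ^ N else 0) =
      if firstIndex cx (cx r) = k then a k * v ^ N else 0 := fun k => by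
    by_cases h : firstIndex cx (cx r) = k
    · rw [if_pos h, if_pos (by rw [← h, apply_firstIndex cx])]
    · rw [if_neg h]
      split_ifs with h'
      · have h1 := ha k
        have e1 : (paired N e cx cz base len rd act).α k = 0 := if_neg (by rwa [← h'])
        rw [e1, pow_zero] at h1
        rw [show a k = 0 by omega, zero_mul]
      · rfl
  show (if cx r = cx 0 then a 0 * v ^ N else 0) + (if cx r = cx 1 then a 1 * v ^ N else 0) +
    (if cx r = cx 2 then a 2 * v ^ N else 0) = _
  rw [hk, hk, hk, ← Fin.sum_univ_three fun k => if firstIndex cx (cx r) = k then a k * v ^ N else 0,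
    Finset.sum_ite_eq, if_pos (Finset.mem_univ _)]

/-- Each surface forces the guess for its coordinate to be the quotient by `v ^ N`, and its cells
are the possible residues. The set `Q` thus needs `O(v ^ N)` points instead of `v ^ (3 * N)`, at the
price of a condition that ties `cz r` to the residue of `cx r`. -/
theorem paired_violated_iff (hv : 1 ≤ v) {N e : ℕ} (hτ : ∀ c, 0 ≤ τ c ∧ τ c < v ^ (N + e))
    {cx cz : Fin 3 → Fin d} (hc : ∀ r k, cz r ≠ cx k) {base : List (ℤ × ℕ)} {len : ℕ}
    {rd : Fin 3 → List (ℕ × Fin 3)} {act : Activation} :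
    (paired N e cx cz base len rd act).Violated v bad u τ ↔
      (paired N e cx cz base len rd act).Active bad u ∧
      (∀ r, ∀ t ∈ rd r, τ (cx r) / v ^ t.1 % v = u t.2) ∧
      ∀ r, (base.map fun t => t.1 * v ^ t.2).sum - τ (cx r) % v ^ N ≤ τ (cz r) ∧
        τ (cz r) < (base.map fun t => t.1 * v ^ t.2).sum - τ (cx r) % v ^ N + v ^ len := by
  have hpos : ∀ e : ℕ, 0 < v ^ e := fun e => by positivity
  set sh := paired N e cx cz base len rd act with hsh
  set w := (base.map fun t => t.1 * v ^ t.2).sum with hw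
  have hX : ∀ r, 0 ≤ τ (cx r) % v ^ N ∧ τ (cx r) % v ^ N < v ^ N := fun r =>
    ⟨Int.emod_nonneg _ (hpos _).ne', Int.emod_lt_of_pos _ (hpos _)⟩
  have split : ∀ r, τ (cx r) = τ (cx r) / v ^ N * v ^ N + τ (cx r) % v ^ N := fun r =>
    (Int.ediv_mul_add_emod _ _).symm
  have shift_z : ∀ a r, sh.shift v a (cz r) = 0 := fun a r => by
    have : ∀ k, cz r ≠ sh.oc k := hc r
    simp only [shift, if_neg (this _), add_zero]
  have enabled : ∀ a, sh.Enabled v bad u a ↔ sh.Active bad u ∧ ∀ r,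
      ∀ t ∈ (rd r).filter (N ≤ ·.1), a (firstIndex cx (cx r)) / v ^ (t.1 - N) % v = u t.2 :=
    fun a => by
      unfold Enabled
      refine and_congr_right fun _ => ?_
      have hcon : sh.conA = (List.finRange 3).flatMap fun r => ((rd r).filter (N ≤ ·.1)).map fun t =>
        (firstIndex cx (cx r), t.1 - N, t.2) := rfl
      simp only [hcon, List.mem_flatMap, List.mem_finRange, true_and, List.mem_map]
      constructor
      · exact fun H r t ht => H _ ⟨r, t, ht, rfl⟩
      · rintro H _ ⟨r, t, ht, rfl⟩
        exact H r t ht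
  have hole : ∀ a r, sh.InRange v a → a (firstIndex cx (cx r)) = τ (cx r) / v ^ N →
      ((sh.surf r).Hole v u (fun c => τ c - sh.shift v a c) ↔
        (∀ t ∈ (rd r).filter (·.1 < N), τ (cx r) % v ^ N / v ^ t.1 % v = u t.2) ∧
        w - τ (cx r) % v ^ N ≤ τ (cz r) ∧ τ (cz r) < w - τ (cx r) % v ^ N + v ^ len) := by
    intro a r ha h0
    have hx : τ (cx r) - sh.shift v a (cx r) = τ (cx r) % v ^ N := by
      rw [hsh, paired_shift ha, h0]
      have := split r
      linarith
    have hlo : ∀ X, (sh.surf r).lo v u X 0 = w - X := fun X => by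
      simp [Surface.lo, Surface.offset, hsh, paired, hw]
    show (0 ≤ τ (cx r) - sh.shift v a (cx r) ∧ τ (cx r) - sh.shift v a (cx r) < v ^ 0 * v ^ N ∧
      0 ≤ τ (cx r) - sh.shift v a (cx r) ∧ τ (cx r) - sh.shift v a (cx r) < v ^ N * v ^ 0 ∧
      (sh.surf r).lo v u ((τ (cx r) - sh.shift v a (cx r)) / v ^ 0)
        ((τ (cx r) - sh.shift v a (cx r)) / v ^ N) ≤ τ (cz r) - sh.shift v a (cz r) ∧
      τ (cz r) - sh.shift v a (cz r) < (sh.surf r).up v u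
        ((τ (cx r) - sh.shift v a (cx r)) / v ^ 0) ((τ (cx r) - sh.shift v a (cx r)) / v ^ N)) ↔ _
    have hmatch : (sh.surf r).Match v u (τ (cx r) % v ^ N) 0 ↔
        ∀ t ∈ (rd r).filter (·.1 < N), τ (cx r) % v ^ N / v ^ t.1 % v = u t.2 :=
      and_iff_left (by rintro t ⟨⟩)
    rw [hx, shift_z, sub_zero, Int.ediv_eq_zero_of_lt (hX r).1 (hX r).2, pow_zero, one_mul, mul_one,
      Int.ediv_one, Surface.up, hlo, ← hmatch]
    have hlen : (sh.surf r).len = len := rfl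
    rw [hlen]
    have hX := hX r
    split_ifs with hm
    · simp only [hX, hm, true_and]
    · simp only [hm, false_and, iff_false]
      omega
  have read : ∀ r, (∀ t ∈ rd r, τ (cx r) / v ^ t.1 % v = u t.2) ↔
      (∀ t ∈ (rd r).filter (·.1 < N), τ (cx r) % v ^ N / v ^ t.1 % v = u t.2) ∧
      ∀ t ∈ (rd r).filter (N ≤ ·.1), τ (cx r) / v ^ N / v ^ (t.1 - N) % v = u t.2 := fun r => by
    rw [← forall_digits_iff hv (rd r) (hX r).1 (hX r).2, ← split r]
  constructor
  · rintro ⟨a, ha, hen, hh⟩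
    have h0 : ∀ r, a (firstIndex cx (cx r)) = τ (cx r) / v ^ N := fun r => by
      have h1 : 0 ≤ τ (cx r) - sh.shift v a (cx r) := (hh r).1
      have h2 : τ (cx r) - sh.shift v a (cx r) < v ^ 0 * v ^ N := (hh r).2.1
      rw [hsh, paired_shift ha] at h1 h2
      rw [pow_zero, one_mul] at h2
      exact (eq_div_of_sub_mem h1 h2).1
    have hh' := fun r => (hole a r ha (h0 r)).1 (hh r)
    obtain ⟨hact, hhigh⟩ := (enabled a).1 hen
    exact ⟨hact, fun r => (read r).2 ⟨(hh' r).1, fun t ht => by rw [← h0 r, hhigh r t ht]⟩,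
      fun r => (hh' r).2⟩
  · rintro ⟨hact, hr, hz⟩
    let a : Fin 3 → ℤ := fun k => if firstIndex cx (cx k) = k then τ (cx k) / v ^ N else 0
    have ha : sh.InRange v a := fun k => by
      show 0 ≤ (if firstIndex cx (cx k) = k then τ (cx k) / v ^ N else 0) ∧
        (if firstIndex cx (cx k) = k then τ (cx k) / v ^ N else 0) <
          v ^ (if firstIndex cx (cx k) = k then e else 0)
      split_ifs
      · exact ⟨Int.ediv_nonneg (hτ _).1 (hpos _).le, Int.ediv_lt_of_lt_mul (hpos _)
          (by rw [← pow_add, add_comm]; exact (hτ _).2)⟩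
      · exact ⟨le_rfl, hpos _⟩
    have h0 : ∀ r, a (firstIndex cx (cx r)) = τ (cx r) / v ^ N := fun r => by
      simp only [a, apply_firstIndex cx, if_true]
    refine ⟨a, ha, (enabled a).2 ⟨hact, fun r t ht => ?_⟩, fun r =>
      (hole a r ha (h0 r)).2 ⟨((read r).1 (hr r)).1, hz r⟩⟩
    rw [h0]
    exact ((read r).1 (hr r)).2 t ht

end Shape

/-! ### Hypercliques encoded in pairs of coordinates -/

section Pairs
variable {d : ℕ}

/-- If `d` is odd, the last coordinate belongs to no pair and carries no information. -/
def pairFst (D : Fin (d / 2)) : Fin d := ⟨2 * D, by omega⟩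

def pairSnd (D : Fin (d / 2)) : Fin d := ⟨2 * D + 1, by omega⟩

theorem pairSnd_ne (D E : Fin (d / 2)) : pairSnd D ≠ pairFst E := fun h => by
  have := congrArg Fin.val h
  simp only [pairSnd, pairFst] at this
  omega

/-- The gadgets that force the second coordinate of a pair to be the complement of the `N` lowest
digits of the first one. -/
def complementShapes (d N e : ℕ) : List (Shape d) :=
  ((Finset.univ : Finset (Fin (d / 2))).toList.map fun D =>
    .paired N e (fun _ => pairFst D) (fun _ => pairSnd D) [(1, N)] (N + e) (fun _ => []) .always) ++
  (Finset.univ : Finset (Fin (d / 2))).toList.map fun D =>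
    .paired N e (fun _ => pairFst D) (fun _ => pairSnd D) [(1, N), (-1, 0), (-1, N + e)] (N + e)
      (fun _ => []) .always

theorem complementShapes_valid {N e : ℕ} :
    ∀ sh ∈ complementShapes d N e, sh.Valid (3 * e) N := by
  simp only [complementShapes, List.forall_mem_append, List.forall_mem_map]
  exact ⟨fun _ _ => Shape.paired_valid (Or.inr fun _ => rfl),
    fun _ _ => Shape.paired_valid (Or.inr fun _ => rfl)⟩

/-- One family of gadgets excludes larger values of the second coordinate and the other one smaller
values. Their holes have length `v ^ (N + e)`, the full range of a coordinate, so nothing but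
equality remains. -/
theorem respects_complementShapes_iff {N e k : ℕ} (x : HypergraphInst) {τ : Fin d → ℤ}
    (hτ : ∀ c, 0 ≤ τ c ∧ τ c < (x.n : ℤ) ^ (N + e)) :
    (∀ sh ∈ complementShapes d N e, Respects k x τ sh) ↔
      ∀ D : Fin (d / 2), τ (pairSnd D) = (x.n : ℤ) ^ N - 1 - τ (pairFst D) % (x.n : ℤ) ^ N := by
  have hv : (1 : ℤ) ≤ x.n := by exact_mod_cast x.pos
  have key : ∀ (D : Fin (d / 2)) (base : List (ℤ × ℕ)), Respects k x τ (.paired N e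
      (fun _ => pairFst D) (fun _ => pairSnd D) base (N + e) (fun _ => []) .always) ↔
      ¬ ((base.map fun t => t.1 * (x.n : ℤ) ^ t.2).sum - τ (pairFst D) % (x.n : ℤ) ^ N ≤
          τ (pairSnd D) ∧ τ (pairSnd D) < (base.map fun t => t.1 * (x.n : ℤ) ^ t.2).sum -
            τ (pairFst D) % (x.n : ℤ) ^ N + (x.n : ℤ) ^ (N + e)) := fun D base => by
    have hiff : ∀ u : Fin 3 → ℤ, _ := fun u => Shape.paired_violated_iff
      (bad := (hypercliqueVertexProblem k).bad x.input) (u := u) hv hτ (base := base)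
      (len := N + e) (rd := fun _ => []) (act := .always) fun _ _ => pairSnd_ne D D
    constructor
    · exact fun H hc => H 0 (fun _ => ⟨le_rfl, by show (0 : ℤ) < x.n; omega⟩)
        ((hiff 0).2 ⟨trivial, by simp, fun _ => hc⟩)
    · exact fun H u _ hc => H (((hiff u).1 hc).2.2 0)
  have e1 : ((([(1, N)] : List (ℤ × ℕ))).map fun t => t.1 * (x.n : ℤ) ^ t.2).sum = (x.n : ℤ) ^ N := by
    simp
  have e2 : ((([(1, N), (-1, 0), (-1, N + e)] : List (ℤ × ℕ))).map fun t =>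
      t.1 * (x.n : ℤ) ^ t.2).sum = (x.n : ℤ) ^ N - 1 - (x.n : ℤ) ^ (N + e) := by
    simp
    ring
  simp only [complementShapes, List.forall_mem_append, List.forall_mem_map, Finset.mem_toList,
    Finset.mem_univ, forall_true_left, key, e1, e2, ← forall_and]
  refine forall_congr' fun D => ?_
  have hX := Int.emod_nonneg (τ (pairFst D)) (by positivity : (x.n : ℤ) ^ N ≠ 0)
  have hX' := Int.emod_lt_of_pos (τ (pairFst D)) (by positivity : 0 < (x.n : ℤ) ^ N)
  have hle : (x.n : ℤ) ^ N ≤ (x.n : ℤ) ^ (N + e) := pow_le_pow_right₀ hv (by omega)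
  have := hτ (pairSnd D)
  omega

/-- The vertex encoded at position `A`. -/
def pairVertex (N e : ℕ) (x : HypergraphInst) (τ : Fin d → ℤ) (A : Fin (d / 2) × Fin (N + e)) :
    Fin x.n :=
  lastDigit x.n x.pos (τ (pairFst A.1) / (x.n : ℤ) ^ (A.2 : ℕ))

theorem exists_complementary {N e k : ℕ} (x : HypergraphInst)
    (w : Fin (d / 2) × Fin (N + e) → Fin x.n) :
    ∃ τ : Fin d → ℤ, (∀ c, 0 ≤ τ c ∧ τ c < (x.n : ℤ) ^ (N + e)) ∧
      (∀ sh ∈ complementShapes d N e, Respects k x τ sh) ∧ pairVertex N e x τ = w := by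
  have hv : (1 : ℤ) ≤ x.n := by exact_mod_cast x.pos
  obtain ⟨σ, hσ, h⟩ := exists_coordinates x.pos (g := N + e) fun (D : Fin (d / 2)) s =>
    if h : s < N + e then w (D, ⟨s, h⟩) else ⟨0, x.pos⟩
  let τ : Fin d → ℤ := fun c => if h : (c : ℕ) / 2 < d / 2 then
    if (c : ℕ) % 2 = 0 then σ ⟨c / 2, h⟩ else (x.n : ℤ) ^ N - 1 - σ ⟨c / 2, h⟩ % (x.n : ℤ) ^ N
    else 0
  have hfst : ∀ D, τ (pairFst D) = σ D := fun D => by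
    have e1 : 2 * (D : ℕ) / 2 = D := by omega
    simp [τ, pairFst]
  have hsnd : ∀ D, τ (pairSnd D) = (x.n : ℤ) ^ N - 1 - σ D % (x.n : ℤ) ^ N := fun D => by
    have e1 : (2 * (D : ℕ) + 1) / 2 = D := by omega
    have e2 : (2 * (D : ℕ) + 1) % 2 = 1 := by omega
    simp [τ, pairSnd, e1, e2]
  have hτ : ∀ c, 0 ≤ τ c ∧ τ c < (x.n : ℤ) ^ (N + e) := fun c => by
    have hle : (x.n : ℤ) ^ N ≤ (x.n : ℤ) ^ (N + e) := pow_le_pow_right₀ hv (by omega)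
    simp only [τ]
    split_ifs with h1 h2
    · exact hσ _
    · have hX := Int.emod_nonneg (σ ⟨c / 2, h1⟩) (by positivity : (x.n : ℤ) ^ N ≠ 0)
      have hX' := Int.emod_lt_of_pos (σ ⟨c / 2, h1⟩) (by positivity : 0 < (x.n : ℤ) ^ N)
      omega
    · exact ⟨le_rfl, by positivity⟩
  refine ⟨τ, hτ, (respects_complementShapes_iff x hτ).2 fun D => by rw [hfst, hsnd],
    funext fun A => ?_⟩
  rw [pairVertex, hfst, h _ _ A.2.2]
  exact dif_pos A.2.2

/-- Complementary coordinates put the residue and the second coordinate on an antidiagonal, exactly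
where the unit holes are. The condition on the second coordinate is thus automatic, and a test
gadget only depends on the three digits. It needs `v ^ (3 * e)` guesses in `P` and `v ^ N` cells per
surface in `Q`. -/
theorem exists_encodedBy_pairs {N e : ℕ} (h : 3 ≤ d / 2 * (N + e)) : ∃ l : List (Shape d),
    (∀ sh ∈ l, sh.Valid (3 * e) N) ∧
      (hypercliqueVertexProblem (d / 2 * (N + e))).EncodedBy l (N + e) := by
  have hcard : Fintype.card (Fin (d / 2) × Fin (N + e)) = d / 2 * (N + e) := by
    rw [Fintype.card_prod, Fintype.card_fin, Fintype.card_fin]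
  rw [← hcard] at h ⊢
  refine exists_hyperclique_encodedBy h (complementShapes d N e) complementShapes_valid
    (pairVertex N e) exists_complementary fun A B C _ _ _ => ?_
  let t : Fin 3 → Fin (d / 2) × Fin (N + e) := ![A, B, C]
  refine ⟨.paired N e (fun r => pairFst (t r).1) (fun r => pairSnd (t r).1) [(1, N), (-1, 0)] 0
    (fun r => [((t r).2, r)]) .bad, Shape.paired_valid (Or.inl rfl), fun x τ hτ hc => ?_⟩
  have hv : (1 : ℤ) ≤ x.n := by exact_mod_cast x.pos
  refine forall_not_violated_iff x (fun r => τ (pairFst (t r).1) / (x.n : ℤ) ^ ((t r).2 : ℕ))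
    fun u _ => ?_
  rw [Shape.paired_violated_iff hv hτ fun _ _ => pairSnd_ne _ _]
  refine and_congr Iff.rfl ((and_iff_left fun r => ?_).trans ?_)
  · have := (respects_complementShapes_iff x hτ).1 hc (t r).1
    rw [this]
    simp only [List.map_cons, List.map_nil, List.sum_cons, List.sum_nil, pow_zero]
    omega
  · simp

end Pairs

/-- A fast algorithm for the Hausdorff distance under translation yields a fast algorithm for
hypercliques. -/
theorem exists_hyperclique_solvable {μ : Arithmetic} {𝒞 : Set Prog}
    (hclosed : BudgetClosed μ 𝒞) {d : ℕ} (hd : 2 ≤ d) (hd' : 0 < d) {lam a b ε : ℝ}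
    (hlam0 : 0 < lam) (hlam1 : lam ≤ 1) (ha0 : 0 < a) (ha1 : a ≤ 1) (hab : a < b) (hε : 0 < ε)
    (h : UndirectedHuTSolvable μ 𝒞 d hd' lam a b
      (((d / 2 : ℕ) : ℝ) * ((lam + 3) / (3 * lam + 3)) - ε)) :
    ∃ k : ℕ, 3 < k ∧ SolvableIn μ 𝒞 (hypercliqueProblem k) Set.univ
      fun x : HypergraphInst => (x.n : ℝ) ^ ((k : ℝ) - 1) := by
  have hD : 1 ≤ d / 2 := by omega
  set D := d / 2 with hDdef
  have hDR : (1 : ℝ) ≤ D := by exact_mod_cast hD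
  set y := (D : ℝ) * ((lam + 3) / (3 * lam + 3)) with hy
  have hy0 : 0 < y := by positivity
  have hyl : (1 + lam) * y = D * (1 + lam / 3) := by
    rw [hy]
    field_simp
    ring
  set e := max (y - ε) 0 with he
  have hey : e < y := max_lt (by linarith) hy0
  obtain ⟨p, hp₁, -, hp₃⟩ := exists_nat_ge_mul (x₁ := 80) (x₂ := 0) (x₃ := 20 * D + 6)
    hlam0 one_pos (by nlinarith : 0 < (1 + lam) * (y - e))
  have hp0 : (0 : ℝ) ≤ p := by positivity
  obtain ⟨q, hq₀, hq, hq'⟩ := exists_floor_exponent hlam0 (r := 60) (p := p) (by norm_num; linarith)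
  have hqp : q + 1 ≤ p := by
    have : (q : ℝ) + 1 ≤ p := by nlinarith
    exact_mod_cast this
  obtain ⟨N, rfl⟩ : ∃ N, p = N + 3 := ⟨p - 3, by omega⟩
  -- The roles are exchanged: `P` is the smaller set and guesses `j` digits in three coordinates, so
  -- `3 * j + 3 ≤ q` and `j` is about `lam * p / 3`. The number of vertices is then about `D * p *
  -- (1 + lam / 3)`, to be compared with `n * m`, which is about `v ^ (p * (1 + lam))`.
  set j := (q - 3) / 3 with hj
  have hjR : (q : ℝ) ≤ 3 * j + 5 := by exact_mod_cast (by omega : q ≤ 3 * j + 5)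
  have hj15 : (15 : ℝ) ≤ j := by exact_mod_cast (by omega : 15 ≤ j)
  obtain ⟨l, hl, henc⟩ := exists_encodedBy_pairs (d := d) (N := N) (e := j) (by nlinarith)
  refine ⟨D * (N + j), by nlinarith, ?_⟩
  have hN0 : (0 : ℝ) ≤ N := by positivity
  push_cast at hp₁ hp₃ hq hq'
  refine solvable_of_encoded hclosed (hypercliqueVertexProblem (D * (N + j))) hd' (p := N + 3)
    (q := q) true hl henc ?_ hlam0 hlam1 ha0 ha1 hab (le_max_right _ _) (by push_cast; linarith)
    (by push_cast; linarith) ?_ ?_ (h.mono (le_max_left _ _))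
  · simp only [if_true]
    omega
  · push_cast
    nlinarith
  · push_cast
    have h1 : ((N : ℝ) + 3) * (1 + lam) * y ≤ D * (N + j) + 20 * D - 5 * D := by
      have : ((N : ℝ) + 3) * (1 + lam) * y = D * (((N : ℝ) + 3) + (lam * (N + 3)) / 3) := by
        rw [mul_assoc, hyl]
        ring
      rw [this]
      nlinarith
    nlinarith

end
end FineGrained

/-! ### Conclusion -/

namespace FineGrained

/-- A lower bound for exponents follows if it holds for those that are not sublinear. -/
theorem not_solvable_sub {μ : Arithmetic} {𝒞 : Set Prog} {d : ℕ} {hd : 0 < d} {lam a b y ε : ℝ}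
    (hlam0 : 0 < lam) (hlam1 : lam ≤ 1) (ha0 : 0 < a) (ha1 : a ≤ 1) (hab : a < b) (hε : 0 < ε)
    (h : 1 < (1 + lam) * y → ¬ UndirectedHuTSolvable μ 𝒞 d hd lam a b (y - ε)) :
    ¬ UndirectedHuTSolvable μ 𝒞 d hd lam a b (y - ε) := by
  by_cases hy : 1 < (1 + lam) * y
  · exact h hy
  · intro hsol
    refine not_solvable_of_sublinear hlam0 hlam1 ha0 ha1 hab (le_max_right (y - ε) 0) ?_
      (hsol.mono (le_max_left _ _))
    rcases max_choice (y - ε) 0 with e | e <;> rw [e] <;> nlinarith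

end FineGrained

theorem mainTheorem12 (μ : FineGrained.Arithmetic) (d : ℕ) (hd : 2 ≤ d)
    (ε : ℝ) (hε : 0 < ε) (lam : ℝ) (hlam0 : 0 < lam) (hlam1 : lam ≤ 1)
    (a b : ℝ) (ha0 : 0 < a) (ha1 : a ≤ 1) (hab : a < b) :
    (∀ 𝒞 : Set FineGrained.Prog, FineGrained.ClosedUnderElementaryReductions μ 𝒞 →
      FineGrained.CombinatorialCliqueHypothesis μ 𝒞 →
      ¬ FineGrained.UndirectedHuTSolvable μ 𝒞 d (by omega) lam a b ((d : ℝ) / 2 - ε)) ∧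
    (FineGrained.CliqueHypothesis μ →
      ¬ FineGrained.UndirectedHuTSolvable μ Set.univ d (by omega) lam a b
        ((d : ℝ) * FineGrained.matMulExponent / 6 - ε)) ∧
    (FineGrained.HypercliqueHypothesis μ →
      ¬ FineGrained.UndirectedHuTSolvable μ Set.univ d (by omega) lam a b
        (((d / 2 : ℕ) : ℝ) * ((lam + 3) / (3 * lam + 3)) - ε)) ∧
    (d = 3 → lam ≤ 1 / 2 → FineGrained.HypercliqueHypothesis μ →
      ¬ FineGrained.UndirectedHuTSolvable μ Set.univ d (by omega) lam a b (3 / 2 - ε)) := by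
  have hdR : (2 : ℝ) ≤ d := by exact_mod_cast hd
  refine ⟨fun 𝒞 h𝒞 hyp hsol => ?_, fun hyp => ?_, fun hyp hsol => ?_, ?_⟩
  -- With `y = d / 2` the exponent `2 * y * g` is the clique size `d * g`, and `(1 + lam) * y > 1`
  -- holds because of `d ≥ 2` and `lam > 0`.
  · obtain ⟨g, hg, hsolv⟩ := FineGrained.exists_clique_solvable h𝒞.budgetClosed hd _ hlam0 hlam1
      ha0 ha1 hab hε (by nlinarith) hsol
    refine hyp _ hg 1 one_pos ?_
    convert hsolv using 2
    push_cast
    ring_nf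
  -- Here `(1 + lam) * y` need not exceed `1`, for instance when `d = 2` and `lam` is small, so the
  -- sublinear case is treated separately.
  · refine FineGrained.not_solvable_sub hlam0 hlam1 ha0 ha1 hab hε fun hy hsol => ?_
    obtain ⟨g, hg, hsolv⟩ := FineGrained.exists_clique_solvable (FineGrained.budgetClosed_univ μ)
      hd _ hlam0 hlam1 ha0 ha1 hab hε hy hsol
    refine hyp _ hg 1 one_pos ?_
    convert hsolv using 2
    push_cast
    ring_nf
  · obtain ⟨k, hk, hsolv⟩ := FineGrained.exists_hyperclique_solvable
      (FineGrained.budgetClosed_univ μ) hd _ hlam0 hlam1 ha0 ha1 hab hε hsol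
    exact hyp k hk 1 one_pos hsolv
  · rintro rfl hlam hyp hsol
    obtain ⟨k, hk, hsolv⟩ := FineGrained.exists_hyperclique_solvable_three
      (FineGrained.budgetClosed_univ μ) _ hlam0 hlam ha0 ha1 hab hε hsol
    exact hyp k hk 1 one_pos hsolv
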